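/- Let $k$ be a field of characteristic $0$. DG Lie algebras and DG algebras over $k$ are $\mathbb Z$-graded with differential of degree $-1$, and $U(\mathfrak a)$ denotes the universal enveloping (DG) algebra of a DG Lie algebra $\mathfrak a$. For a DG algebra $A$, let $\overline{\mathrm{HC}}_\bullet(A)$ be its reduced cyclic homology, that is, the homology of the reduced Connes complex $\bigoplus_{n\ge 0}(A/k)^{\otimes (n+1)}/(1-t)$ (total degree, with $a_0\otimes\cdots\otimes a_n$ in degree $|a_0|+\cdots+|a_n|+n$), and let $A_\natural := A/(k+[A,A])$. For $d\ge 1$ let $$\lambda^{(d)}(\mathfrak a)=\mathrm{Sym}^d(\mathfrak a)/[\mathfrak a,\mathrm{Sym}^d(\mathfrak a)] .$$ A cofibrant resolution of $\mathfrak a$ is a quasi-isomorphism $q:\mathfrak L\to\mathfrak a$ of DG Lie algebras such that every morphism from $\mathfrak L$ lifts through every surjective quasi-isomorphism of DG Lie algebras. Every $\mathfrak a$ has one, and the Drinfeld homology $\mathrm{HC}^{(d)}_\bullet(\mathrm{Lie},\mathfrak a)$ is the homology of the left derived functor of $\lambda^{(d)}$, that is, $\mathrm H_\bullet[\lambda^{(d)}(\mathfrak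 L)]$ (independent of the resolution). For every cofibrant resolution $q:\mathfrak L\to\mathfrak a$ the maps $\overline{\mathrm{HC}}_\bullet(U(\mathfrak a))\leftarrow\overline{\mathrm{HC}}_\bullet(U(\mathfrak L))\to \mathrm H_\bullet[U(\mathfrak L)_\natural]$, induced by $q$ and by the projection of the reduced Connes complex to its quotient $U(\mathfrak L)_\natural$, are isomorphisms. For every DG Lie algebra $\mathfrak L$ and every $p\ge 0$, the Adams operation $\psi^p=m_p\circ\Delta^p$ (the $p$-fold convolution power of the identity map of the Hopf algebra $U(\mathfrak L)$) descends to a chain map of $U(\mathfrak L)_\natural$. Through the isomorphisms above it induces an operation $\psi^p$ on $\overline{\mathrm{HC}}_\bullet(U(\mathfrak a))$ that does not depend on the resolution. **Theorem.** For any DG Lie algebra $\mathfrak a$ over $k$ there is an isomorphism $$\overline{\mathrm{HC}}_\bullet(U(\mathfrak a))\;\cong\;\bigoplus_{d\ge 1}\mathrm{HC}^{(d)}_\bullet(\mathrm{Lie},\mathfrak a),$$ natural in $\mathfrak a$ (compatible with morphisms of DG Lie algebras and of their cofibrant resolutions). For every $p\ge 2$ and $d\ge1$, the image of the summand $\mathrm{HC}^{(d)}_\bullet(\mathrm{Lie},\mathfrak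 a)$ is exactly the eigenspace of $\psi^p$ on $\overline{\mathrm{HC}}_\bullet(U(\mathfrak a))$ with eigenvalue $p^d$. -/

import Mathlib

open scoped TensorProduct DirectSum

universe u

noncomputable section

namespace DrinfeldHodge

/-! ### Signs and parity on graded modules -/

section Graded

variable {k : Type u} [Field k] {M : Type u} [AddCommGroup M] [Module k M]

/-- The endomorphism of a graded module acting on the `i`-th component by the scalar `c i`. -/
def degreewise (gr : ℤ → Submodule k M) [DirectSum.Decomposition gr] (c : ℤ → k) : M →ₗ[k] M :=
  (DirectSum.toModule k ℤ M fun i => c i • (gr i).subtype) ∘ₗ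
    (DirectSum.decomposeLinearEquiv gr).toLinearMap

theorem degreewise_of_mem (gr : ℤ → Submodule k M) [DirectSum.Decomposition gr] (c : ℤ → k)
    {i : ℤ} {x : M} (hx : x ∈ gr i) : degreewise gr c x = c i • x := by
  simp only [degreewise, LinearMap.comp_apply, LinearEquiv.coe_coe,
    DirectSum.decomposeLinearEquiv_apply, DirectSum.decompose_of_mem gr hx]
  rw [← DirectSum.lof_eq_of k, DirectSum.toModule_lof]
  rfl

/-- Two linear maps that agree on homogeneous elements are equal. -/
theorem hom_ext_of_homogeneous (gr : ℤ → Submodule k M) [DirectSum.Decomposition gr]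
    {N : Type u} [AddCommGroup N] [Module k N] {f g : M →ₗ[k] N}
    (h : ∀ i, ∀ x ∈ gr i, f x = g x) : f = g :=
  DirectSum.decompose_lhom_ext gr fun i => LinearMap.ext fun x => h i x x.2

theorem degreewise_comm {gr : ℤ → Submodule k M} [DirectSum.Decomposition gr]
    {N : Type u} [AddCommGroup N] [Module k N] {gr' : ℤ → Submodule k N}
    [DirectSum.Decomposition gr'] (c : ℤ → k) (f : M →ₗ[k] N)
    (hf : ∀ {i x}, x ∈ gr i → f x ∈ gr' i) :
    f ∘ₗ degreewise gr c = degreewise gr' c ∘ₗ f :=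
  hom_ext_of_homogeneous gr fun i x hx => by
    simp [degreewise_of_mem gr c hx, degreewise_of_mem gr' c (hf hx)]

end Graded

/-! ### Complexes and homology -/

/-- A presentation of a chain complex of `k`-vector spaces (differential of degree `-1`): an
ambient module `M` with a family of graded pieces `gr n`, a differential `d` on `M`, and a
submodule `rel` of relations. It presents the complex `M / rel`. -/
structure PresentedComplex (k : Type u) [Field k] where
  M : Type u
  [addCommGroup : AddCommGroup M]
  [module : Module k M]
  gr : ℤ → Submodule k M
  rel : Submodule k M
  d : M →ₗ[k] M

attribute [instance] PresentedComplex.addCommGroup PresentedComplex.module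

namespace PresentedComplex

variable {k : Type u} [Field k]

/-- Elements of `M` of degree `n` that represent `n`-cycles of `M / rel`. -/
def cycles (C : PresentedComplex k) (n : ℤ) : Submodule k C.M := C.gr n ⊓ C.rel.comap C.d

/-- Elements of `M` that represent `n`-boundaries of `M / rel`. -/
def boundaries (C : PresentedComplex k) (n : ℤ) : Submodule k C.M :=
  (C.gr (n + 1)).map C.d ⊔ C.rel

/-- The `n`-th homology of the complex `M / rel`. -/
abbrev H (C : PresentedComplex k) (n : ℤ) : Type u :=
  ↥(C.cycles n) ⧸ (C.boundaries n).submoduleOf (C.cycles n)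

theorem sub_mem_rel (C : PresentedComplex k) {x y : C.M} (h : x = y) : x - y ∈ C.rel := by
  rw [h, sub_self]
  exact C.rel.zero_mem

/-- Chain maps (of degree `0`) `M / rel → M' / rel'`, represented by linear maps `M → M'`. -/
structure Hom (C D : PresentedComplex k) where
  toLin : C.M →ₗ[k] D.M
  map_gr : ∀ {n x}, x ∈ C.gr n → toLin x ∈ D.gr n
  map_rel : ∀ {x}, x ∈ C.rel → toLin x ∈ D.rel
  map_d : ∀ x, toLin (C.d x) - D.d (toLin x) ∈ D.rel

/-- The map induced on homology by a chain map. -/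
def Hom.mapH {C D : PresentedComplex k} (f : Hom C D) (n : ℤ) : C.H n →ₗ[k] D.H n :=
  Submodule.mapQ _ _
    (f.toLin.restrict (p := C.cycles n) (q := D.cycles n) fun x hx => by
      refine ⟨f.map_gr hx.1, ?_⟩
      have h := D.rel.sub_mem (f.map_rel hx.2) (f.map_d x)
      simpa using h)
    (by
      rintro ⟨x, hx⟩ h
      simp only [Submodule.submoduleOf, Submodule.mem_comap, Submodule.subtype_apply,
        boundaries, Submodule.mem_sup, Submodule.mem_map] at h ⊢
      obtain ⟨_, ⟨y, hy, rfl⟩, r, hr, hyr⟩ := h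
      refine ⟨_, ⟨f.toLin y, f.map_gr hy, rfl⟩,
        (f.toLin (C.d y) - D.d (f.toLin y)) + f.toLin r,
        D.rel.add_mem (f.map_d y) (f.map_rel hr), ?_⟩
      change _ = f.toLin x
      rw [← hyr, map_add]
      abel)

end PresentedComplex

/-! ### Differential graded Lie algebras -/

/-- A differential graded Lie algebra over `k`, with `ℤ`-grading and differential of
degree `-1`. -/
structure DGLA (k : Type u) [Field k] where
  carrier : Type u
  [addCommGroup : AddCommGroup carrier]
  [module : Module k carrier]
  gr : ℤ → Submodule k carrier
  [dec : DirectSum.Decomposition gr]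
  d : carrier →ₗ[k] carrier
  bracket : carrier →ₗ[k] carrier →ₗ[k] carrier
  d_mem : ∀ {i x}, x ∈ gr i → d x ∈ gr (i - 1)
  d_d : ∀ x, d (d x) = 0
  bracket_mem : ∀ {i j x y}, x ∈ gr i → y ∈ gr j → bracket x y ∈ gr (i + j)
  skew : ∀ {i j x y}, x ∈ gr i → y ∈ gr j →
    bracket x y = -((-1 : k) ^ (i * j) • bracket y x)
  jacobi : ∀ {i j x y}, x ∈ gr i → y ∈ gr j → ∀ z,
    bracket x (bracket y z) =
      bracket (bracket x y) z + (-1 : k) ^ (i * j) • bracket y (bracket x z)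
  leibniz : ∀ {i x}, x ∈ gr i → ∀ y,
    d (bracket x y) = bracket (d x) y + (-1 : k) ^ i • bracket x (d y)

attribute [instance] DGLA.addCommGroup DGLA.module DGLA.dec

namespace DGLA

variable {k : Type u} [Field k]

/-- Morphisms of DG Lie algebras. -/
structure Hom (L L' : DGLA k) where
  toLin : L.carrier →ₗ[k] L'.carrier
  map_gr : ∀ {i x}, x ∈ L.gr i → toLin x ∈ L'.gr i
  map_d : ∀ x, toLin (L.d x) = L'.d (toLin x)
  map_bracket : ∀ x y, toLin (L.bracket x y) = L'.bracket (toLin x) (toLin y)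

/-- The underlying complex of a DG Lie algebra. -/
abbrev cx (L : DGLA k) : PresentedComplex k where
  M := L.carrier
  gr := L.gr
  rel := ⊥
  d := L.d

/-- The chain map underlying a morphism of DG Lie algebras. -/
def Hom.cx {L L' : DGLA k} (f : Hom L L') : PresentedComplex.Hom L.cx L'.cx where
  toLin := f.toLin
  map_gr := f.map_gr
  map_rel := by rintro x rfl; exact (map_zero f.toLin)
  map_d x := L'.cx.sub_mem_rel (f.map_d x)

/-- Quasi-isomorphisms of DG Lie algebras. -/
def Hom.IsQuasiIso {L L' : DGLA k} (f : Hom L L') : Prop :=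
  ∀ n, Function.Bijective (f.cx.mapH n)

/-- `L` is cofibrant: every morphism `L → Y` lifts through every surjective quasi-isomorphism
`X → Y` (that is, `0 → L` has the left lifting property with respect to the acyclic
fibrations). -/
def IsCofibrant (L : DGLA k) : Prop :=
  ∀ (X Y : DGLA k) (p : Hom X Y), Function.Surjective p.toLin → p.IsQuasiIso →
    ∀ g : Hom L Y, ∃ h : Hom L X, p.toLin ∘ₗ h.toLin = g.toLin

/-- A cofibrant resolution of a DG Lie algebra. -/
structure CofibrantResolution (a : DGLA k) where
  L : DGLA k
  cofibrant : L.IsCofibrant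
  q : Hom L a
  quasiIso : q.IsQuasiIso

/-- The complex underlying `L`, regarded as a DG Lie algebra with zero bracket. -/
abbrev abelian (L : DGLA k) : DGLA k where
  carrier := L.carrier
  gr := L.gr
  d := L.d
  bracket := 0
  d_mem := L.d_mem
  d_d := L.d_d
  bracket_mem _ _ := by simp
  skew _ _ := by simp
  jacobi _ _ _ := by simp
  leibniz _ _ := by simp

/-- A morphism of DG Lie algebras, regarded as a morphism of the underlying complexes. -/
def Hom.abelian {L L' : DGLA k} (f : Hom L L') : Hom L.abelian L'.abelian where
  toLin := f.toLin
  map_gr := f.map_gr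
  map_d := f.map_d
  map_bracket _ _ := map_zero f.toLin

end DGLA

/-! ### Differential graded algebras -/

/-- A unital associative differential graded algebra over `k`. -/
structure DGA (k : Type u) [Field k] where
  carrier : Type u
  [ring : Ring carrier]
  [algebra : Algebra k carrier]
  gr : ℤ → Submodule k carrier
  [graded : GradedAlgebra gr]
  d : carrier →ₗ[k] carrier
  d_mem : ∀ {i x}, x ∈ gr i → d x ∈ gr (i - 1)
  d_d : ∀ x, d (d x) = 0
  leibniz : ∀ {i x}, x ∈ gr i → ∀ y, d (x * y) = d x * y + (-1 : k) ^ i • (x * d y)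

attribute [instance] DGA.ring DGA.algebra DGA.graded

namespace DGA

variable {k : Type u} [Field k]

/-- Morphisms of DG algebras. -/
structure Hom (A B : DGA k) where
  toAlgHom : A.carrier →ₐ[k] B.carrier
  map_gr : ∀ {i x}, x ∈ A.gr i → toAlgHom x ∈ B.gr i
  map_d : ∀ x, toAlgHom (A.d x) = B.d (toAlgHom x)

/-- The subspace spanned by `1` and by the graded commutators. -/
def commutators (A : DGA k) : Submodule k A.carrier :=
  Submodule.span k ({1} ∪ {z | ∃ i j, ∃ x ∈ A.gr i, ∃ y ∈ A.gr j,
    z = x * y - (-1 : k) ^ (i * j) • (y * x)})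

/-- The (reduced) cyclic functor `A ↦ A / (k + [A, A])`. -/
abbrev cyc (A : DGA k) : PresentedComplex k where
  M := A.carrier
  gr := A.gr
  rel := A.commutators
  d := A.d

end DGA

/-! ### The universal enveloping algebra -/

section Enveloping

variable {k : Type u} [Field k] (L : DGLA k)

/-- The defining relations `x y = (-1)^(|x||y|) y x + [x, y]` of the enveloping algebra. -/
inductive EnvRel : TensorAlgebra k L.carrier → TensorAlgebra k L.carrier → Prop
  | comm {i j : ℤ} {x y : L.carrier} (hx : x ∈ L.gr i) (hy : y ∈ L.gr j) :
      EnvRel (TensorAlgebra.ι k x * TensorAlgebra.ι k y)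
        ((-1 : k) ^ (i * j) • (TensorAlgebra.ι k y * TensorAlgebra.ι k x) +
          TensorAlgebra.ι k (L.bracket x y))

/-- The algebra underlying the universal enveloping algebra of a DG Lie algebra. -/
def Env : Type u := RingQuot (EnvRel L)

namespace Env

instance : Ring (Env L) := inferInstanceAs (Ring (RingQuot (EnvRel L)))
instance : Algebra k (Env L) := inferInstanceAs (Algebra k (RingQuot (EnvRel L)))

/-- The quotient map from the tensor algebra. -/
def mk : TensorAlgebra k L.carrier →ₐ[k] Env L := RingQuot.mkAlgHom k (EnvRel L)

/-- The canonical map of a DG Lie algebra to its enveloping algebra. -/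
def ι : L.carrier →ₗ[k] Env L := (mk L).toLinearMap ∘ₗ TensorAlgebra.ι k

variable {L}

theorem ι_mul_ι {i j : ℤ} {x y : L.carrier} (hx : x ∈ L.gr i) (hy : y ∈ L.gr j) :
    ι L x * ι L y = (-1 : k) ^ (i * j) • (ι L y * ι L x) + ι L (L.bracket x y) := by
  have h : mk L _ = mk L _ := RingQuot.mkAlgHom_rel k (EnvRel.comm (L := L) hx hy)
  rw [map_add, map_smul, map_mul, map_mul] at h
  exact h

/-- A linear map `f : L → B` to an algebra satisfies the defining relations of the enveloping
algebra. -/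
def Respects {B : Type u} [Semiring B] [Algebra k B] (f : L.carrier →ₗ[k] B) : Prop :=
  ∀ i j, ∀ x ∈ L.gr i, ∀ y ∈ L.gr j,
    f x * f y = (-1 : k) ^ (i * j) • (f y * f x) + f (L.bracket x y)

/-- The universal property of the enveloping algebra. -/
def lift {B : Type u} [Semiring B] [Algebra k B] (f : L.carrier →ₗ[k] B) (hf : Respects f) :
    Env L →ₐ[k] B :=
  RingQuot.liftAlgHom k ⟨TensorAlgebra.lift k f, by
    rintro _ _ ⟨hx, hy⟩
    simpa using hf _ _ _ hx _ hy⟩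

@[simp] theorem lift_ι {B : Type u} [Semiring B] [Algebra k B] (f : L.carrier →ₗ[k] B)
    (hf : Respects f) (x : L.carrier) : lift f hf (ι L x) = f x :=
  (RingQuot.liftAlgHom_mkAlgHom_apply k _ _ _).trans (TensorAlgebra.lift_ι_apply _ _)

theorem induction {C : Env L → Prop} (h0 : ∀ r, C (algebraMap k _ r)) (h1 : ∀ x, C (ι L x))
    (hm : ∀ a b, C a → C b → C (a * b)) (ha : ∀ a b, C a → C b → C (a + b)) (a : Env L) :
    C a := by
  obtain ⟨t, rfl⟩ : ∃ t, mk L t = a := RingQuot.mkAlgHom_surjective k (EnvRel L) a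
  induction t using TensorAlgebra.induction with
  | algebraMap r => rw [AlgHom.commutes]; exact h0 r
  | ι x => exact h1 x
  | mul a b iha ihb => rw [map_mul]; exact hm _ _ iha ihb
  | add a b iha ihb => rw [map_add]; exact ha _ _ iha ihb

theorem algHom_ext {B : Type u} [Semiring B] [Algebra k B] {f g : Env L →ₐ[k] B}
    (h : ∀ x, f (ι L x) = g (ι L x)) : f = g := by
  refine AlgHom.ext fun a => ?_
  induction a using induction with
  | h0 r => simp
  | h1 x => exact h x
  | hm a b ha hb => rw [map_mul, map_mul, ha, hb]
  | ha a b ha hb => rw [map_add, map_add, ha, hb]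

theorem respects_twist (L : DGLA k) (m : ℤ) :
    Respects (ι L ∘ₗ degreewise L.gr fun i => (-1 : k) ^ (m * i)) := by
  intro i j x hx y hy
  simp only [LinearMap.comp_apply, degreewise_of_mem L.gr _ hx, degreewise_of_mem L.gr _ hy,
    degreewise_of_mem L.gr _ (L.bracket_mem hx hy), map_smul, smul_mul_smul_comm, ι_mul_ι hx hy,
    mul_add, zpow_add₀ (neg_ne_zero.mpr (one_ne_zero' k))]
  module

/-- The algebra automorphism of the enveloping algebra acting on products of homogeneous elements
of total degree `n` by the sign `(-1)^(m n)`. -/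
def twist (L : DGLA k) (m : ℤ) : Env L →ₐ[k] Env L := lift _ (respects_twist L m)

theorem twist_ι {m i : ℤ} {x : L.carrier} (hx : x ∈ L.gr i) :
    twist L m (ι L x) = (-1 : k) ^ (m * i) • ι L x := by
  rw [twist, lift_ι, LinearMap.comp_apply, degreewise_of_mem L.gr _ hx, map_smul]

/-- `f` is a graded derivation of degree `m` of the graded Lie algebra `L`. -/
structure IsDerivation (m : ℤ) (f : L.carrier →ₗ[k] L.carrier) : Prop where
  mem : ∀ {i x}, x ∈ L.gr i → f x ∈ L.gr (i + m)
  map_bracket : ∀ {i x}, x ∈ L.gr i → ∀ {j y}, y ∈ L.gr j →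
    f (L.bracket x y) = L.bracket (f x) y + (-1 : k) ^ (m * i) • L.bracket x (f y)

/-- The algebra map into upper triangular matrices that encodes `derivation` below. -/
def derivationMatrix {m : ℤ} {f : L.carrier →ₗ[k] L.carrier} (hf : IsDerivation m f) :
    Env L →ₐ[k] Matrix (Fin 2) (Fin 2) (Env L) :=
  lift
    { toFun := fun x => !![twist L m (ι L x), ι L (f x); 0, ι L x]
      map_add' := fun x y => by ext a b; fin_cases a <;> fin_cases b <;> simp
      map_smul' := fun c x => by ext a b; fin_cases a <;> fin_cases b <;> simp }
    (by
      intro i j x hx y hy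
      have h0 : (-1 : k) ≠ 0 := neg_ne_zero.mpr one_ne_zero
      have h1 : ((-1 : k) ^ (m * i)) * (-1 : k) ^ (m * i) = 1 := by
        rw [← mul_zpow]; simp
      have e1 : (-1 : k) ^ ((i + m) * j) = (-1 : k) ^ (i * j) * (-1 : k) ^ (m * j) := by
        rw [add_mul, zpow_add₀ h0]
      have e2 : (-1 : k) ^ (i * (j + m)) = (-1 : k) ^ (i * j) * (-1 : k) ^ (m * i) := by
        rw [mul_add, zpow_add₀ h0, mul_comm i m]
      have p := ι_mul_ι (hf.mem hx) hy
      have q := ι_mul_ι hx (hf.mem hy)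
      have r := ι_mul_ι hx hy
      have t : twist L m (ι L x) * twist L m (ι L y) =
          (-1 : k) ^ (i * j) • (twist L m (ι L y) * twist L m (ι L x)) +
            twist L m (ι L (L.bracket x y)) := by
        rw [← map_mul, r, map_add, map_smul, map_mul]
      ext a b
      fin_cases a <;> fin_cases b
      · simpa [Matrix.mul_apply, Fin.sum_univ_two] using t
      · simp only [LinearMap.coe_mk, AddHom.coe_mk, Matrix.mul_apply, Fin.sum_univ_two,
          twist_ι hx, twist_ι hy, hf.map_bracket hx hy, map_add, map_smul]
        simp only [Fin.zero_eta, Fin.mk_one, Matrix.of_apply, Matrix.cons_val', Matrix.cons_val_zero,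
          Matrix.cons_val_one, Matrix.cons_val_fin_one, Matrix.add_apply, Matrix.smul_apply,
          Matrix.mul_apply, Fin.sum_univ_two, smul_mul_assoc, p, q, e1, e2]
        match_scalars <;> first | ring1 | linear_combination (-1 : k) ^ (i * j) * h1
      · simp [Matrix.mul_apply, Fin.sum_univ_two]
      · simpa [Matrix.mul_apply, Fin.sum_univ_two] using r)

section Derivation

variable {m : ℤ} {f : L.carrier →ₗ[k] L.carrier} (hf : IsDerivation m f)

theorem derivationMatrix_ι (x : L.carrier) :
    derivationMatrix hf (ι L x) = !![twist L m (ι L x), ι L (f x); 0, ι L x] :=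
  lift_ι _ _ x

theorem derivationMatrix_apply (u : Env L) :
    derivationMatrix hf u 0 0 = twist L m u ∧ derivationMatrix hf u 1 0 = 0 ∧
      derivationMatrix hf u 1 1 = u := by
  induction u using induction with
  | h0 r => simp [Matrix.algebraMap_matrix_apply]
  | h1 x => rw [derivationMatrix_ι]; simp
  | hm a b ha hb => simp [Matrix.mul_apply, Fin.sum_univ_two, ha, hb]
  | ha a b ha hb => simp [ha, hb]

/-- The graded derivation of degree `m` of the enveloping algebra that extends a graded
derivation `f` of degree `m` of the graded Lie algebra. -/
def derivation : Env L →ₗ[k] Env L where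
  toFun u := derivationMatrix hf u 0 1
  map_add' u v := by simp
  map_smul' c u := by simp

@[simp] theorem derivation_ι (x : L.carrier) :
    derivation hf (ι L x) = ι L (f x) := by
  change derivationMatrix hf (ι L x) 0 1 = _
  rw [derivationMatrix_ι]; simp

@[simp] theorem derivation_mul (u v : Env L) :
    derivation hf (u * v) =
      derivation hf u * v + twist L m u * derivation hf v := by
  change derivationMatrix hf (u * v) 0 1 = derivationMatrix hf u 0 1 * v +
    twist L m u * derivationMatrix hf v 0 1
  rw [map_mul, Matrix.mul_apply, Fin.sum_univ_two, (derivationMatrix_apply hf u).1,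
    (derivationMatrix_apply hf v).2.2, add_comm]

@[simp] theorem derivation_algebraMap (r : k) :
    derivation hf (algebraMap k _ r) = 0 := by
  change derivationMatrix hf (algebraMap k _ r) 0 1 = 0
  rw [AlgHom.commutes]; simp [Matrix.algebraMap_matrix_apply]

end Derivation

/-- The degree `n` part of the enveloping algebra: the span of all products of homogeneous
elements of `L` of total degree `n`. -/
def gr (L : DGLA k) (n : ℤ) : Submodule k (Env L) :=
  Submodule.span k {z | ∃ l : List (Σ i, L.gr i), (l.map Sigma.fst).sum = n ∧
    z = (l.map fun p => ι L (p.2 : L.carrier)).prod}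

theorem ι_mem_gr {i : ℤ} {x : L.carrier} (hx : x ∈ L.gr i) : ι L x ∈ gr L i :=
  Submodule.subset_span ⟨[⟨i, x, hx⟩], by simp, by simp⟩

instance gradedMonoid (L : DGLA k) : SetLike.GradedMonoid (gr L) where
  one_mem := Submodule.subset_span ⟨[], by simp, by simp⟩
  mul_mem i j x y hx hy := by
    have h : gr L i * gr L j ≤ gr L (i + j) := by
      rw [gr, gr, Submodule.span_mul_span]
      refine Submodule.span_mono ?_
      rintro _ ⟨_, ⟨l, hl, rfl⟩, _, ⟨l', hl', rfl⟩, rfl⟩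
      exact ⟨l ++ l', by simp [hl, hl'], by simp⟩
    exact h (Submodule.mul_mem_mul hx hy)

/-- The map into the graded pieces that defines the grading of the enveloping algebra. -/
def decomposeι (L : DGLA k) : L.carrier →ₗ[k] ⨁ n, gr L n :=
  (DirectSum.toModule k ℤ _ fun i =>
    DirectSum.lof k ℤ (fun n => gr L n) i ∘ₗ
      ((ι L ∘ₗ (L.gr i).subtype).codRestrict (gr L i) fun x => ι_mem_gr x.2)) ∘ₗ
    (DirectSum.decomposeLinearEquiv L.gr).toLinearMap

theorem decomposeι_of_mem {i : ℤ} {x : L.carrier} (hx : x ∈ L.gr i) :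
    decomposeι L x = DirectSum.of (fun n => gr L n) i ⟨ι L x, ι_mem_gr hx⟩ := by
  simp only [decomposeι, LinearMap.comp_apply, LinearEquiv.coe_coe,
    DirectSum.decomposeLinearEquiv_apply, DirectSum.decompose_of_mem L.gr hx]
  rw [← DirectSum.lof_eq_of k, DirectSum.toModule_lof]
  rfl

theorem respects_decomposeι (L : DGLA k) : Respects (decomposeι L) := by
  intro i j x hx y hy
  rw [decomposeι_of_mem hx, decomposeι_of_mem hy, decomposeι_of_mem (L.bracket_mem hx hy),
    DirectSum.of_mul_of, DirectSum.of_mul_of]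
  have h0 : ι L y * ι L x ∈ gr L (i + j) :=
    add_comm j i ▸ SetLike.mul_mem_graded (ι_mem_gr hy) (ι_mem_gr hx)
  have h1 : DirectSum.of (fun n => gr L n) (j + i)
        (GradedMonoid.GMul.mul (A := fun n => gr L n) (⟨ι L y, ι_mem_gr hy⟩ : gr L j)
          (⟨ι L x, ι_mem_gr hx⟩ : gr L i)) =
      DirectSum.of (fun n => gr L n) (i + j) ⟨ι L y * ι L x, h0⟩ := by
    refine DirectSum.of_eq_of_gradedMonoid_eq (Sigma.subtype_ext ?_ ?_)
    · exact add_comm _ _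
    · rfl
  rw [h1, ← DirectSum.lof_eq_of k, ← DirectSum.lof_eq_of k, ← DirectSum.lof_eq_of k,
    ← LinearMap.map_smul, ← LinearMap.map_add]
  congr 1
  exact Subtype.ext (ι_mul_ι hx hy)

/-- The algebra map that defines the grading of the enveloping algebra. -/
def decomposeHom (L : DGLA k) : Env L →ₐ[k] ⨁ n, gr L n := lift _ (respects_decomposeι L)

theorem decomposeHom_ι {i : ℤ} {x : L.carrier} (hx : x ∈ L.gr i) :
    decomposeHom L (ι L x) = DirectSum.of (fun n => gr L n) i ⟨ι L x, ι_mem_gr hx⟩ := by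
  exact (lift_ι _ _ _).trans (decomposeι_of_mem hx)

theorem ι_ext {N : Type u} [AddCommGroup N] [Module k N] {f g : L.carrier →ₗ[k] N}
    (h : ∀ i, ∀ x ∈ L.gr i, f x = g x) (x : L.carrier) : f x = g x :=
  LinearMap.congr_fun (hom_ext_of_homogeneous L.gr h) x

theorem decomposeHom_prod (l : List (Σ i, L.gr i)) :
    ∃ h : (l.map fun p => ι L (p.2 : L.carrier)).prod ∈ gr L (l.map Sigma.fst).sum,
      decomposeHom L (l.map fun p => ι L (p.2 : L.carrier)).prod =
        DirectSum.of (fun n => gr L n) _ ⟨_, h⟩ := by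
  induction l with
  | nil => exact ⟨SetLike.GradedOne.one_mem, by simp only [List.map_nil, List.prod_nil, map_one]; rfl⟩
  | cons p l ih =>
    obtain ⟨h, e⟩ := ih
    refine ⟨by simpa using SetLike.mul_mem_graded (ι_mem_gr p.2.2) h, ?_⟩
    simp only [List.map_cons, List.prod_cons, map_mul, e, decomposeHom_ι p.2.2,
      DirectSum.of_mul_of]
    exact DirectSum.of_eq_of_gradedMonoid_eq (Sigma.subtype_ext List.sum_cons.symm rfl)

instance gradedAlgebra (L : DGLA k) : GradedAlgebra (gr L) :=
  GradedAlgebra.ofAlgHom (gr L) (decomposeHom L)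
    (algHom_ext fun x => by
      refine ι_ext (f := ((DirectSum.coeAlgHom (gr L)).comp (decomposeHom L)).toLinearMap ∘ₗ ι L)
        (g := ι L) (fun i x hx => ?_) x
      simp only [LinearMap.comp_apply, AlgHom.toLinearMap_apply, AlgHom.comp_apply,
        decomposeHom_ι hx, DirectSum.coeAlgHom_of])
    (by
      rintro i ⟨x, hx⟩
      induction hx using Submodule.span_induction with
      | mem x hx =>
        obtain ⟨l, rfl, rfl⟩ := hx
        obtain ⟨h, e⟩ := decomposeHom_prod l
        exact e
      | zero => rw [map_zero]; exact (map_zero (DirectSum.of (fun n => gr L n) i)).symm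
      | add x y hx hy ihx ihy => rw [map_add, ihx, ihy, ← map_add]; rfl
      | smul c x hx ih =>
        rw [map_smul, ih, ← DirectSum.lof_eq_of k, ← map_smul]; rfl)

theorem twist_of_mem {m n : ℤ} {u : Env L} (hu : u ∈ gr L n) :
    twist L m u = (-1 : k) ^ (m * n) • u := by
  induction hu using Submodule.span_induction with
  | mem x hx =>
    obtain ⟨l, rfl, rfl⟩ := hx
    induction l with
    | nil => simp
    | cons p l ih =>
      simp only [List.map_cons, List.prod_cons, map_mul, ih, twist_ι p.2.2, List.sum_cons,
        mul_add, zpow_add₀ (neg_ne_zero.mpr (one_ne_zero' k)), smul_mul_smul_comm]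
  | zero => simp
  | add x y hx hy ihx ihy => rw [map_add, ihx, ihy, smul_add]
  | smul c x hx ih => rw [map_smul, ih, smul_comm]

theorem derivation_mem {m : ℤ} {f : L.carrier →ₗ[k] L.carrier} (hf : IsDerivation m f)
    {n : ℤ} {u : Env L} (hu : u ∈ gr L n) : derivation hf u ∈ gr L (n + m) := by
  induction hu using Submodule.span_induction with
  | mem x hx =>
    obtain ⟨l, rfl, rfl⟩ := hx
    induction l with
    | nil =>
      have := derivation_algebraMap hf 1
      rw [map_one] at this
      simp [this]
    | cons p l ih =>
      obtain ⟨h, -⟩ := decomposeHom_prod l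
      simp only [List.map_cons, List.prod_cons, List.sum_cons, derivation_mul, derivation_ι]
      refine add_mem ?_ ?_
      · have := SetLike.mul_mem_graded (ι_mem_gr (hf.mem p.2.2)) h
        rwa [add_right_comm] at this
      · rw [twist_ι p.2.2, smul_mul_assoc]
        have := SetLike.mul_mem_graded (ι_mem_gr p.2.2) ih
        rw [← add_assoc] at this
        exact Submodule.smul_mem _ _ this
  | zero => simp
  | add x y hx hy ihx ihy => rw [map_add]; exact add_mem ihx ihy
  | smul c x hx ih => rw [map_smul]; exact Submodule.smul_mem _ _ ih

theorem isDerivation_d (L : DGLA k) : IsDerivation (-1) L.d where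
  mem hx := by simpa [sub_eq_add_neg] using L.d_mem hx
  map_bracket {i x} hx j y _ := by
    rw [L.leibniz hx, neg_one_mul, zpow_neg]
    congr 2
    rcases Int.even_or_odd i with h | h <;> simp [h.neg_one_zpow]

/-- The differential of the enveloping algebra, induced by that of the DG Lie algebra. -/
def d (L : DGLA k) : Env L →ₗ[k] Env L := derivation (isDerivation_d L)

theorem d_ι (x : L.carrier) : d L (ι L x) = ι L (L.d x) := derivation_ι _ x

theorem d_algebraMap (r : k) : d L (algebraMap k _ r) = 0 := derivation_algebraMap _ r

theorem d_mul (u v : Env L) : d L (u * v) = d L u * v + twist L (-1) u * d L v :=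
  derivation_mul _ u v

theorem d_mem {n : ℤ} {u : Env L} (hu : u ∈ gr L n) : d L u ∈ gr L (n - 1) :=
  derivation_mem (isDerivation_d L) hu

theorem twist_d (u : Env L) : twist L (-1) (d L u) = - d L (twist L (-1) u) := by
  have key : ∀ n, ∀ u ∈ gr L n, twist L (-1) (d L u) = - d L (twist L (-1) u) := by
    intro n u hu
    rw [twist_of_mem (d_mem hu), twist_of_mem hu, map_smul, mul_sub,
      zpow_sub₀ (neg_ne_zero.mpr (one_ne_zero' k))]
    simp [div_neg]
  exact LinearMap.congr_fun (hom_ext_of_homogeneous (gr L)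
    (f := (twist L (-1)).toLinearMap ∘ₗ d L)
    (g := -(d L ∘ₗ (twist L (-1)).toLinearMap)) fun n u hu => key n u hu) u

theorem d_d (u : Env L) : d L (d L u) = 0 := by
  induction u using induction with
  | h0 r => rw [d_algebraMap, map_zero]
  | h1 x => rw [d_ι, d_ι, L.d_d, map_zero]
  | hm a b ha hb =>
    rw [d_mul, map_add, d_mul, d_mul, ha, hb, twist_d]
    simp
  | ha a b ha hb => rw [map_add, map_add, ha, hb, add_zero]

end Env

/-- The universal enveloping algebra of a DG Lie algebra, as a DG algebra. -/
abbrev U : DGA k where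
  carrier := Env L
  gr := Env.gr L
  d := Env.d L
  d_mem hx := Env.d_mem hx
  d_d := Env.d_d
  leibniz {i x} hx y := by
    rw [Env.d_mul, Env.twist_of_mem hx, smul_mul_assoc, neg_one_mul, zpow_neg]
    congr 2
    rcases Int.even_or_odd i with h | h <;> simp [h.neg_one_zpow]

/-! ### Functoriality of the enveloping algebra -/

variable {L} {L' : DGLA k}

theorem respects_hom (f : DGLA.Hom L L') : Env.Respects (Env.ι L' ∘ₗ f.toLin) := by
  intro i j x hx y hy
  simp only [LinearMap.comp_apply, f.map_bracket]
  exact Env.ι_mul_ι (f.map_gr hx) (f.map_gr hy)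

/-- The algebra map of enveloping algebras induced by a morphism of DG Lie algebras. -/
def Env.map (f : DGLA.Hom L L') : Env L →ₐ[k] Env L' := Env.lift _ (respects_hom f)

@[simp] theorem Env.map_ι (f : DGLA.Hom L L') (x : L.carrier) :
    Env.map f (Env.ι L x) = Env.ι L' (f.toLin x) := Env.lift_ι _ _ x

theorem Env.map_mem (f : DGLA.Hom L L') {n : ℤ} {u : Env L} (hu : u ∈ Env.gr L n) :
    Env.map f u ∈ Env.gr L' n := by
  induction hu using Submodule.span_induction with
  | mem x hx =>
    obtain ⟨l, rfl, rfl⟩ := hx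
    induction l with
    | nil => simpa using (SetLike.GradedOne.one_mem : (1 : Env L') ∈ Env.gr L' 0)
    | cons p l ih =>
      simp only [List.map_cons, List.prod_cons, List.sum_cons, map_mul, Env.map_ι]
      exact SetLike.mul_mem_graded (Env.ι_mem_gr (f.map_gr p.2.2)) ih
  | zero => simp
  | add x y hx hy ihx ihy => rw [map_add]; exact add_mem ihx ihy
  | smul c x hx ih => rw [map_smul]; exact Submodule.smul_mem _ _ ih

theorem Env.map_twist (f : DGLA.Hom L L') (m : ℤ) (u : Env L) :
    Env.map f (Env.twist L m u) = Env.twist L' m (Env.map f u) := by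
  refine LinearMap.congr_fun (hom_ext_of_homogeneous (Env.gr L)
    (f := (Env.map f).toLinearMap ∘ₗ (Env.twist L m).toLinearMap)
    (g := (Env.twist L' m).toLinearMap ∘ₗ (Env.map f).toLinearMap) fun n u hu => ?_) u
  simp only [LinearMap.comp_apply, AlgHom.toLinearMap_apply, Env.twist_of_mem hu,
    Env.twist_of_mem (Env.map_mem f hu), map_smul]

theorem Env.map_derivation (f : DGLA.Hom L L') {m : ℤ} {D : L.carrier →ₗ[k] L.carrier}
    {D' : L'.carrier →ₗ[k] L'.carrier} (hD : Env.IsDerivation m D) (hD' : Env.IsDerivation m D')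
    (h : ∀ x, f.toLin (D x) = D' (f.toLin x)) (u : Env L) :
    Env.map f (Env.derivation hD u) = Env.derivation hD' (Env.map f u) := by
  induction u using Env.induction with
  | h0 r => rw [Env.derivation_algebraMap, AlgHom.commutes, Env.derivation_algebraMap, map_zero]
  | h1 x => rw [Env.derivation_ι, Env.map_ι, Env.map_ι, Env.derivation_ι, h]
  | hm a b ha hb =>
    rw [Env.derivation_mul, map_add, map_mul, map_mul, map_mul, Env.derivation_mul, ha, hb,
      Env.map_twist]
  | ha a b ha hb => rw [map_add, map_add, ha, hb, map_add, map_add]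

/-- The morphism of DG algebras `U(L) → U(L')` induced by a morphism of DG Lie algebras. -/
def U.map (f : DGLA.Hom L L') : DGA.Hom (U L) (U L') where
  toAlgHom := Env.map f
  map_gr := Env.map_mem f
  map_d := Env.map_derivation f _ _ f.map_d

/-! ### The functors `λ^(d)` -/

/-- The graded symmetric algebra of a DG Lie algebra `L` (with the differential induced by that
of `L`): the enveloping algebra of `L` with zero bracket, that is, the quotient of the tensor
algebra by the relations `x y = (-1)^(|x||y|) y x`. -/
abbrev Sym (L : DGLA k) : DGA k := U L.abelian

/-- The `d`-th symmetric power `Sym^d(L)`, the span in `Sym(L)` of all products of `d` elements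
of `L`. -/
def symPow (L : DGLA k) (d : ℕ) : Submodule k (Sym L).carrier :=
  LinearMap.range (Env.ι L.abelian) ^ d

/-- The linear map `y ↦ [x, y]`, on the complex underlying `L`. -/
def bracketLeft (L : DGLA k) (x : L.carrier) : L.abelian.carrier →ₗ[k] L.abelian.carrier :=
  L.bracket x

theorem isDerivation_bracketLeft (L : DGLA k) {m : ℤ} {x : L.carrier} (hx : x ∈ L.gr m) :
    Env.IsDerivation (L := L.abelian) m (bracketLeft L x) where
  mem hy := add_comm m _ ▸ L.bracket_mem hx hy
  map_bracket _ _ _ _ := by simp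

/-- The adjoint action of a homogeneous element `x` of `L` on `Sym(L)`: the graded derivation
extending `y ↦ [x, y]`. -/
def ad (L : DGLA k) {m : ℤ} {x : L.carrier} (hx : x ∈ L.gr m) :
    (Sym L).carrier →ₗ[k] (Sym L).carrier :=
  Env.derivation (isDerivation_bracketLeft L hx)

theorem ad_ι (L : DGLA k) {m : ℤ} {x : L.carrier} (hx : x ∈ L.gr m) (y : L.carrier) :
    ad L hx (Env.ι L.abelian y) = Env.ι L.abelian (L.bracket x y) :=
  Env.derivation_ι _ _

theorem map_symPow (f : DGLA.Hom L L') (d : ℕ) {s : Env L.abelian} (hs : s ∈ symPow L d) :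
    Env.map f.abelian s ∈ symPow L' d := by
  have h : (symPow L d).map (Env.map f.abelian).toLinearMap ≤ symPow L' d := by
    rw [symPow, Submodule.map_pow]
    refine pow_le_pow_left' ?_ d
    rintro _ ⟨_, ⟨x, rfl⟩, rfl⟩
    exact ⟨f.toLin x, (Env.map_ι f.abelian x).symm⟩
  exact h ⟨s, hs, rfl⟩

theorem map_ad (f : DGLA.Hom L L') {m : ℤ} {x : L.carrier} (hx : x ∈ L.gr m) (s : Env L.abelian) :
    Env.map f.abelian (ad L hx s) =
      ad L' (f.map_gr hx) (Env.map f.abelian s) :=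
  Env.map_derivation f.abelian (isDerivation_bracketLeft L hx)
    (isDerivation_bracketLeft L' (f.map_gr hx)) (f.map_bracket x) s

/-- The subspace `[L, Sym^d(L)]`. -/
def adSpan (d : ℕ) (L : DGLA k) : Submodule k (Sym L).carrier :=
  Submodule.span k {z | ∃ m, ∃ x, ∃ hx : x ∈ L.gr m, ∃ s ∈ symPow L d, z = ad L hx s}

theorem map_adSpan (d : ℕ) (f : DGLA.Hom L L') {z : Env L.abelian} (hz : z ∈ adSpan d L) :
    Env.map f.abelian z ∈ adSpan d L' := by
  induction hz using Submodule.span_induction with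
  | mem z hz =>
    obtain ⟨m, x, hx, s, hs, rfl⟩ := hz
    rw [map_ad]
    exact Submodule.subset_span ⟨m, f.toLin x, f.map_gr hx, _, map_symPow f d hs, rfl⟩
  | zero => rw [map_zero]; exact zero_mem _
  | add x y hx hy ihx ihy => rw [map_add]; exact add_mem ihx ihy
  | smul c x hx ih => rw [map_smul]; exact Submodule.smul_mem _ _ ih

/-- The complex `λ^(d)(L) = Sym^d(L) / [L, Sym^d(L)]`. -/
abbrev lam (d : ℕ) (L : DGLA k) : PresentedComplex k where
  M := (Sym L).carrier
  gr n := symPow L d ⊓ (Sym L).gr n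
  rel := adSpan d L
  d := (Sym L).d

/-- The chain map `λ^(d)(f)`. -/
def lam.map (d : ℕ) (f : DGLA.Hom L L') : PresentedComplex.Hom (lam d L) (lam d L') where
  toLin := (Env.map f.abelian).toLinearMap
  map_gr h := ⟨map_symPow f d h.1, Env.map_mem f.abelian h.2⟩
  map_rel := map_adSpan d f
  map_d x := (lam d L').sub_mem_rel ((U.map f.abelian).map_d x)

/-! ### Adams operations -/

variable (L)

/-- The linear map `x ↦ x ⊗ 1 + 1 ⊗ x`. -/
def primitiveι : L.carrier →ₗ[k] GradedTensorProduct k (Env.gr L) (Env.gr L) :=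
  (GradedTensorProduct.includeLeft (Env.gr L) (Env.gr L)).toLinearMap ∘ₗ Env.ι L +
    (GradedTensorProduct.includeRight (Env.gr L) (Env.gr L)).toLinearMap ∘ₗ Env.ι L

theorem respects_primitiveι : Env.Respects (primitiveι L) := by
  intro i j x hx y hy
  have h := GradedTensorProduct.tmul_coe_mul_coe_tmul (R := k) (Env.gr L) (Env.gr L) 1
    (⟨Env.ι L x, Env.ι_mem_gr hx⟩ : Env.gr L i) (⟨Env.ι L y, Env.ι_mem_gr hy⟩ : Env.gr L j) 1
  have h' := GradedTensorProduct.tmul_coe_mul_coe_tmul (R := k) (Env.gr L) (Env.gr L) 1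
    (⟨Env.ι L y, Env.ι_mem_gr hy⟩ : Env.gr L j) (⟨Env.ι L x, Env.ι_mem_gr hx⟩ : Env.gr L i) 1
  have hs : ∀ (n : ℤ) (z : GradedTensorProduct k (Env.gr L) (Env.gr L)),
      ((-1 : ℤˣ) ^ n) • z = (-1 : k) ^ n • z := by
    intro n z
    rcases Int.even_or_odd n with h | h <;> simp [h.neg_one_zpow]
  have hn : (-1 : k) ^ (i * j) * (-1 : k) ^ (i * j) = 1 := by
    rw [← mul_zpow]; simp
  set A := GradedTensorProduct.includeLeft (Env.gr L) (Env.gr L) with hA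
  set B := GradedTensorProduct.includeRight (Env.gr L) (Env.gr L) with hB
  have hBA : B (Env.ι L x) * A (Env.ι L y) =
      (-1 : k) ^ (i * j) • (A (Env.ι L y) * B (Env.ι L x)) := by
    rw [← hs]
    simpa [hA, hB, GradedTensorProduct.tmul_one_mul_one_tmul] using h
  have hBA' : B (Env.ι L y) * A (Env.ι L x) =
      (-1 : k) ^ (i * j) • (A (Env.ι L x) * B (Env.ι L y)) := by
    rw [← hs, mul_comm i j]
    simpa [hA, hB, GradedTensorProduct.tmul_one_mul_one_tmul] using h'
  have e : ∀ x, primitiveι L x = A (Env.ι L x) + B (Env.ι L x) := fun _ => rfl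
  simp only [e, add_mul, mul_add, ← map_mul, Env.ι_mul_ι hx hy, hBA, hBA', map_add, map_smul]
  simp only [smul_add, smul_smul, hn, one_smul]
  abel

/-- The coproduct of `U(L)`: the algebra map to the graded tensor product for which the elements
of `L` are primitive. -/
def comul : Env L →ₐ[k] GradedTensorProduct k (Env.gr L) (Env.gr L) :=
  Env.lift (primitiveι L) (respects_primitiveι L)

/-- The counit of `U(L)`. -/
def counit : Env L →ₐ[k] k :=
  Env.lift 0 fun i j x _ y _ => by simp

/-- The Adams operation `ψ^p = m_p ∘ Δ^p`, the `p`-fold convolution power of the identity. -/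
def adams : ℕ → (Env L →ₗ[k] Env L)
  | 0 => Algebra.linearMap k (Env L) ∘ₗ (counit L).toLinearMap
  | p + 1 => LinearMap.mul' k (Env L) ∘ₗ TensorProduct.map LinearMap.id (adams p) ∘ₗ
      (GradedTensorProduct.of k (Env.gr L) (Env.gr L)).symm.toLinearMap ∘ₗ (comul L).toLinearMap

end Enveloping

/-! ### Reduced cyclic homology -/

section Cyclic

open PiTensorProduct

variable {k : Type u} [Field k]

theorem contractNth_update {R : Type u} [Ring R] [Algebra k R] {n : ℕ} (j : Fin (n + 1))
    (a : Fin (n + 2) → R) (p : Fin (n + 2)) :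
    ∃ (q : Fin (n + 1)) (φ : R →ₗ[k] R), ∀ x,
      Fin.contractNth j.castSucc (· * ·) (Function.update a p x) =
        Function.update (Fin.contractNth j.castSucc (· * ·) a) q (φ x) := by
  have key : ∀ (q : Fin (n + 1)) (φ : R →ₗ[k] R),
      (∀ x, ∀ r : Fin (n + 1), Fin.contractNth j.castSucc (· * ·) (Function.update a p x) r =
        Function.update (Fin.contractNth j.castSucc (· * ·) a) q (φ x) r) →
      ∃ (q : Fin (n + 1)) (φ : R →ₗ[k] R), ∀ x,
        Fin.contractNth j.castSucc (· * ·) (Function.update a p x) =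
          Function.update (Fin.contractNth j.castSucc (· * ·) a) q (φ x) :=
    fun q φ h => ⟨q, φ, fun x => funext (h x)⟩
  obtain ⟨p, hp⟩ := p
  obtain ⟨j, hj⟩ := j
  rcases lt_trichotomy p j with h | h | h
  · refine key ⟨p, by omega⟩ LinearMap.id fun x r => ?_
    obtain ⟨r, hr⟩ := r
    simp only [Fin.contractNth, Function.update_apply, Fin.ext_iff, Fin.val_castSucc, Fin.val_succ,
      LinearMap.id_apply]
    split_ifs <;> first | rfl | omega
  · refine key ⟨j, hj⟩ (LinearMap.mulRight k (a ⟨j + 1, by omega⟩)) fun x r => ?_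
    obtain ⟨r, hr⟩ := r
    simp only [Fin.contractNth, Function.update_apply, Fin.ext_iff, Fin.val_castSucc, Fin.val_succ,
      LinearMap.mulRight_apply]
    split_ifs <;> first | rfl | omega | (subst_vars; rfl)
  · rcases Nat.eq_or_lt_of_le (Nat.succ_le_of_lt h) with h' | h'
    · refine key ⟨j, hj⟩ (LinearMap.mulLeft k (a ⟨j, by omega⟩)) fun x r => ?_
      obtain ⟨r, hr⟩ := r
      simp only [Fin.contractNth, Function.update_apply, Fin.ext_iff, Fin.val_castSucc,
        Fin.val_succ, LinearMap.mulLeft_apply]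
      split_ifs <;> first | rfl | omega | (subst_vars; rfl)
    · refine key ⟨p - 1, by omega⟩ LinearMap.id fun x r => ?_
      obtain ⟨r, hr⟩ := r
      simp only [Fin.contractNth, Function.update_apply, Fin.ext_iff, Fin.val_castSucc,
        Fin.val_succ, LinearMap.id_apply]
      split_ifs <;> first | rfl | omega

/-- The face map `a₀ ⊗ ⋯ ⊗ aₙ₊₁ ↦ a₀ ⊗ ⋯ ⊗ aⱼ aⱼ₊₁ ⊗ ⋯ ⊗ aₙ₊₁` for `0 ≤ j ≤ n`. -/
def face (R : Type u) [Ring R] [Algebra k R] {n : ℕ} (j : Fin (n + 1)) :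
    (⨂[k] _ : Fin (n + 2), R) →ₗ[k] ⨂[k] _ : Fin (n + 1), R :=
  PiTensorProduct.lift
    { toFun := fun a => tprod k (Fin.contractNth j.castSucc (· * ·) a)
      map_update_add' := by
        intro _ a p x y
        obtain ⟨q, φ, h⟩ := contractNth_update (k := k) j a p
        have := Subsingleton.elim ‹DecidableEq (Fin (n + 2))› (instDecidableEqFin (n + 2))
        subst this
        rw [h, h, h, map_add, MultilinearMap.map_update_add]
      map_update_smul' := by
        intro _ a p c x
        obtain ⟨q, φ, h⟩ := contractNth_update (k := k) j a p
        have := Subsingleton.elim ‹DecidableEq (Fin (n + 2))› (instDecidableEqFin (n + 2))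
        subst this
        rw [h, h, map_smul, MultilinearMap.map_update_smul] }

namespace DGA

variable (A : DGA k)

/-- The signed cyclic rotation
`a₀ ⊗ ⋯ ⊗ aₙ ↦ (-1)^(|aₙ| (|a₀| + ⋯ + |aₙ₋₁|)) aₙ ⊗ a₀ ⊗ ⋯ ⊗ aₙ₋₁`
(for homogeneous `aᵢ`), as the sum of the contributions of the even and the odd part of `aₙ`. -/
def rotate (n : ℕ) : (⨂[k] _ : Fin (n + 1), A.carrier) →ₗ[k] ⨂[k] _ : Fin (n + 1), A.carrier :=
  (PiTensorProduct.reindex k (fun _ => A.carrier) (finRotate (n + 1))).toLinearMap ∘ₗ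
    (PiTensorProduct.map (fun i => if i = Fin.last n
        then degreewise A.gr (fun m => if Even m then 1 else 0) else LinearMap.id) +
      PiTensorProduct.map (fun i => if i = Fin.last n
        then degreewise A.gr (fun m => if Even m then 0 else 1)
        else degreewise A.gr (fun m => (-1) ^ m)))

/-- The Hochschild boundary, with the Koszul sign in the last face:
`b(a₀ ⊗ ⋯ ⊗ aₙ₊₁) = ∑_{0 ≤ j ≤ n} (-1)^j a₀ ⊗ ⋯ ⊗ aⱼ aⱼ₊₁ ⊗ ⋯ ⊗ aₙ₊₁
  + (-1)^(n+1) (-1)^(|aₙ₊₁| (|a₀| + ⋯ + |aₙ|)) aₙ₊₁ a₀ ⊗ a₁ ⊗ ⋯ ⊗ aₙ`. -/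
def hochschildB (n : ℕ) :
    (⨂[k] _ : Fin (n + 2), A.carrier) →ₗ[k] ⨂[k] _ : Fin (n + 1), A.carrier :=
  (∑ j : Fin (n + 1), (-1 : k) ^ (j : ℕ) • face A.carrier j) +
    (-1 : k) ^ (n + 1) • (face A.carrier 0 ∘ₗ A.rotate (n + 1))

/-- The internal differential
`a₀ ⊗ ⋯ ⊗ aₙ ↦ ∑ᵢ (-1)^(|a₀| + ⋯ + |aᵢ₋₁|) a₀ ⊗ ⋯ ⊗ d aᵢ ⊗ ⋯ ⊗ aₙ`. -/
def internalD (n : ℕ) :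
    (⨂[k] _ : Fin (n + 1), A.carrier) →ₗ[k] ⨂[k] _ : Fin (n + 1), A.carrier :=
  ∑ i : Fin (n + 1), PiTensorProduct.map fun j =>
    if j < i then degreewise A.gr (fun m => (-1) ^ m) else if j = i then A.d else LinearMap.id

/-- The total Hochschild differential on `⨁ₙ A^{⊗(n+1)}`, equal to `b + (-1)^n d` on the `n`-th
summand. -/
def hochschildD : (⨁ n : ℕ, ⨂[k] _ : Fin (n + 1), A.carrier) →ₗ[k]
    ⨁ n : ℕ, ⨂[k] _ : Fin (n + 1), A.carrier :=
  DirectSum.toModule k ℕ _ fun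
    | 0 => DirectSum.lof k ℕ (fun n => ⨂[k] _ : Fin (n + 1), A.carrier) 0 ∘ₗ A.internalD 0
    | n + 1 =>
      DirectSum.lof k ℕ (fun n => ⨂[k] _ : Fin (n + 1), A.carrier) n ∘ₗ A.hochschildB n +
        (-1 : k) ^ (n + 1) •
          DirectSum.lof k ℕ (fun n => ⨂[k] _ : Fin (n + 1), A.carrier) (n + 1) ∘ₗ
            A.internalD (n + 1)

/-- The reduced Connes complex of a DG algebra over a field of characteristic zero,
`⨁ₙ (A/k)^{⊗(n+1)} / (1 - t)` where `t` is `(-1)^n` times the signed cyclic rotation, with the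
differential induced by the total Hochschild differential. The class of `a₀ ⊗ ⋯ ⊗ aₙ` has degree
`|a₀| + ⋯ + |aₙ| + n`. -/
abbrev connes : PresentedComplex k where
  M := ⨁ n : ℕ, ⨂[k] _ : Fin (n + 1), A.carrier
  gr m := Submodule.span k {z | ∃ (n : ℕ) (e : Fin (n + 1) → ℤ) (a : Fin (n + 1) → A.carrier),
    (∀ i, a i ∈ A.gr (e i)) ∧ (∑ i, e i) + n = m ∧
      z = DirectSum.lof k ℕ (fun n => ⨂[k] _ : Fin (n + 1), A.carrier) n (tprod k a)}
  rel := Submodule.span k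
    ({z | ∃ (n : ℕ) (x : ⨂[k] _ : Fin (n + 1), A.carrier),
        z = DirectSum.lof k ℕ (fun n => ⨂[k] _ : Fin (n + 1), A.carrier) n
          (x - (-1 : k) ^ n • A.rotate n x)} ∪
      {z | ∃ (n : ℕ) (a : Fin (n + 1) → A.carrier), (∃ i, a i = 1) ∧
        z = DirectSum.lof k ℕ (fun n => ⨂[k] _ : Fin (n + 1), A.carrier) n (tprod k a)})
  d := A.hochschildD

/-- Reduced cyclic homology of a DG algebra over a field of characteristic zero. -/
abbrev HC (n : ℤ) : Type u := A.connes.H n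

/-! ### Functoriality of reduced cyclic homology -/

variable {A} {B : DGA k}

theorem face_comp (f : Hom A B) {n : ℕ} (j : Fin (n + 1)) :
    (PiTensorProduct.map fun _ => f.toAlgHom.toLinearMap) ∘ₗ face (k := k) A.carrier j =
      face (k := k) B.carrier j ∘ₗ PiTensorProduct.map fun _ => f.toAlgHom.toLinearMap := by
  ext a
  simp only [LinearMap.compMultilinearMap_apply, LinearMap.comp_apply, face, lift.tprod,
    MultilinearMap.coe_mk, map_tprod]
  congr 1
  ext r
  simp only [Fin.contractNth, AlgHom.toLinearMap_apply]
  split_ifs <;> simp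

theorem degreewise_comp (f : Hom A B) (c : ℤ → k) :
    f.toAlgHom.toLinearMap ∘ₗ degreewise A.gr c =
      degreewise B.gr c ∘ₗ f.toAlgHom.toLinearMap :=
  degreewise_comm c _ f.map_gr

theorem rotate_comp (f : Hom A B) (n : ℕ) :
    (PiTensorProduct.map fun _ => f.toAlgHom.toLinearMap) ∘ₗ A.rotate n =
      B.rotate n ∘ₗ PiTensorProduct.map fun _ => f.toAlgHom.toLinearMap := by
  have h : ∀ x, (PiTensorProduct.map fun _ => f.toAlgHom.toLinearMap)
      (PiTensorProduct.reindex k (fun _ => A.carrier) (finRotate (n + 1)) x) =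
      PiTensorProduct.reindex k (fun _ => B.carrier) (finRotate (n + 1))
        (PiTensorProduct.map (fun _ => f.toAlgHom.toLinearMap) x) := fun x =>
    PiTensorProduct.map_reindex (fun _ => f.toAlgHom.toLinearMap) (finRotate (n + 1)) x
  ext a
  simp only [rotate, LinearMap.compMultilinearMap_apply, LinearMap.comp_apply,
    LinearMap.add_apply, map_add, LinearEquiv.coe_coe, h, map_tprod]
  congr 3
  all_goals
    ext i
    split_ifs
    · exact LinearMap.congr_fun (degreewise_comp f _) _
    · first | rfl | exact LinearMap.congr_fun (degreewise_comp f _) _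

theorem internalD_comp (f : Hom A B) (n : ℕ) :
    (PiTensorProduct.map fun _ => f.toAlgHom.toLinearMap) ∘ₗ A.internalD n =
      B.internalD n ∘ₗ PiTensorProduct.map fun _ => f.toAlgHom.toLinearMap := by
  ext a
  simp only [internalD, LinearMap.compMultilinearMap_apply, LinearMap.comp_apply,
    LinearMap.sum_apply, map_sum, map_tprod]
  refine Finset.sum_congr rfl fun i _ => ?_
  congr 1
  ext j
  split_ifs
  · exact LinearMap.congr_fun (degreewise_comp f _) _
  · exact f.map_d _
  · rfl

theorem hochschildB_comp (f : Hom A B) (n : ℕ) :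
    (PiTensorProduct.map fun _ => f.toAlgHom.toLinearMap) ∘ₗ A.hochschildB n =
      B.hochschildB n ∘ₗ PiTensorProduct.map fun _ => f.toAlgHom.toLinearMap := by
  have h1 := fun j x => LinearMap.congr_fun (face_comp f (n := n) j) x
  have h2 := fun x => LinearMap.congr_fun (rotate_comp f (n + 1)) x
  simp only [LinearMap.comp_apply] at h1 h2
  refine LinearMap.ext fun x => ?_
  simp only [hochschildB, LinearMap.comp_apply, LinearMap.add_apply, LinearMap.sum_apply,
    LinearMap.smul_apply, map_add, map_sum, map_smul, h1, h2]

/-- The linear map of Hochschild chains induced by a morphism of DG algebras. -/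
def chainMap (f : Hom A B) : (⨁ n : ℕ, ⨂[k] _ : Fin (n + 1), A.carrier) →ₗ[k]
    ⨁ n : ℕ, ⨂[k] _ : Fin (n + 1), B.carrier :=
  DirectSum.lmap fun _ => PiTensorProduct.map fun _ => f.toAlgHom.toLinearMap

theorem chainMap_lof (f : Hom A B) (n : ℕ) (x : ⨂[k] _ : Fin (n + 1), A.carrier) :
    chainMap f (DirectSum.lof k ℕ (fun n => ⨂[k] _ : Fin (n + 1), A.carrier) n x) =
      DirectSum.lof k ℕ (fun n => ⨂[k] _ : Fin (n + 1), B.carrier) n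
        (PiTensorProduct.map (fun _ => f.toAlgHom.toLinearMap) x) :=
  DirectSum.lmap_lof _ _ _

theorem chainMap_hochschildD (f : Hom A B) :
    chainMap f ∘ₗ A.hochschildD = B.hochschildD ∘ₗ chainMap f := by
  refine DirectSum.linearMap_ext k fun n => LinearMap.ext fun x => ?_
  have h1 := fun n x => LinearMap.congr_fun (hochschildB_comp f n) x
  have h2 := fun n x => LinearMap.congr_fun (internalD_comp f n) x
  simp only [LinearMap.comp_apply] at h1 h2
  cases n with
  | zero =>
    simp only [LinearMap.comp_apply, chainMap_lof, hochschildD, DirectSum.toModule_lof, h2]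
  | succ n =>
    simp only [LinearMap.comp_apply, chainMap_lof, hochschildD, DirectSum.toModule_lof, h1, h2,
      LinearMap.add_apply, LinearMap.smul_apply, map_add, map_smul]

/-- The chain map of reduced Connes complexes induced by a morphism of DG algebras. -/
def connesMap (f : Hom A B) : PresentedComplex.Hom A.connes B.connes where
  toLin := chainMap f
  map_gr {m x} hx := by
    have h : A.connes.gr m ≤ (B.connes.gr m).comap (chainMap f) := by
      refine Submodule.span_le.2 ?_
      rintro _ ⟨n, e, a, ha, he, rfl⟩
      refine Submodule.subset_span ⟨n, e, fun i => f.toAlgHom (a i), fun i => f.map_gr (ha i), he, ?_⟩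
      rw [chainMap_lof, map_tprod]
      rfl
    exact h hx
  map_rel {x} hx := by
    have h : A.connes.rel ≤ B.connes.rel.comap (chainMap f) := by
      refine Submodule.span_le.2 ?_
      rintro _ (⟨n, x, rfl⟩ | ⟨n, a, ⟨i, hi⟩, rfl⟩)
      · refine Submodule.subset_span (Or.inl
          ⟨n, PiTensorProduct.map (fun _ => f.toAlgHom.toLinearMap) x, ?_⟩)
        have h2 := LinearMap.congr_fun (rotate_comp f n) x
        simp only [LinearMap.comp_apply] at h2
        rw [chainMap_lof, map_sub, map_smul, h2]
      · refine Submodule.subset_span (Or.inr ⟨n, fun i => f.toAlgHom (a i), ⟨i, ?_⟩, ?_⟩)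
        · simp [hi]
        · rw [chainMap_lof, map_tprod]
          rfl
    exact h hx
  map_d x := B.connes.sub_mem_rel (LinearMap.congr_fun (chainMap_hochschildD f) x)

/-- The map induced on reduced cyclic homology by a morphism of DG algebras. -/
def HC.map (f : Hom A B) (n : ℤ) : A.HC n →ₗ[k] B.HC n := (connesMap f).mapH n

variable (A)

/-- The projection of Hochschild chains to `A` (the summand `n = 0`). -/
def proj₀ : (⨁ n : ℕ, ⨂[k] _ : Fin (n + 1), A.carrier) →ₗ[k] A.carrier :=
  DirectSum.toModule k ℕ _ fun
    | 0 => (PiTensorProduct.subsingletonEquiv (0 : Fin 1)).toLinearMap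
    | _ + 1 => 0

theorem proj₀_zero (a : Fin 1 → A.carrier) :
    A.proj₀ (DirectSum.lof k ℕ (fun n => ⨂[k] _ : Fin (n + 1), A.carrier) 0 (tprod k a)) =
      a 0 := by
  simp [proj₀, DirectSum.toModule_lof]

theorem proj₀_succ (n : ℕ) (x : ⨂[k] _ : Fin (n + 1 + 1), A.carrier) :
    A.proj₀ (DirectSum.lof k ℕ (fun n => ⨂[k] _ : Fin (n + 1), A.carrier) (n + 1) x) = 0 := by
  simp [proj₀, DirectSum.toModule_lof]

theorem degreewise_even_add_odd (x : A.carrier) :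
    degreewise A.gr (fun m => if Even m then (1 : k) else 0) x +
      degreewise A.gr (fun m => if Even m then (0 : k) else 1) x = x := by
  refine LinearMap.congr_fun (hom_ext_of_homogeneous A.gr
    (f := degreewise A.gr (fun m => if Even m then (1 : k) else 0) +
      degreewise A.gr (fun m => if Even m then (0 : k) else 1))
    (g := LinearMap.id) fun i x hx => ?_) x
  simp only [LinearMap.add_apply, degreewise_of_mem A.gr _ hx, LinearMap.id_apply]
  split_ifs <;> simp

theorem rotate_zero (x : ⨂[k] _ : Fin (0 + 1), A.carrier) : A.rotate 0 x = x := by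
  induction x using PiTensorProduct.induction_on with
  | smul_tprod r a =>
    rw [map_smul]
    congr 1
    apply (PiTensorProduct.subsingletonEquiv (0 : Fin 1)).injective
    simp only [rotate, LinearMap.comp_apply, LinearMap.add_apply, map_add, map_tprod,
      LinearEquiv.coe_coe, reindex_tprod]
    erw [PiTensorProduct.subsingletonEquiv_apply_tprod,
      PiTensorProduct.subsingletonEquiv_apply_tprod, PiTensorProduct.subsingletonEquiv_apply_tprod]
    exact A.degreewise_even_add_odd (a 0)
  | add x y hx hy => rw [map_add, hx, hy]

theorem mkQ_comm (x y : A.carrier) :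
    A.commutators.mkQ (x * y) =
      A.commutators.mkQ (degreewise A.gr (fun m => if Even m then (1 : k) else 0) y * x) +
      A.commutators.mkQ (degreewise A.gr (fun m => if Even m then (0 : k) else 1) y *
        degreewise A.gr (fun m => (-1 : k) ^ m) x) := by
  have key : ∀ i, ∀ x ∈ A.gr i, ∀ j, ∀ y ∈ A.gr j, A.commutators.mkQ (x * y) =
      A.commutators.mkQ (degreewise A.gr (fun m => if Even m then (1 : k) else 0) y * x) +
      A.commutators.mkQ (degreewise A.gr (fun m => if Even m then (0 : k) else 1) y *
        degreewise A.gr (fun m => (-1 : k) ^ m) x) := by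
    intro i x hx j y hy
    have h : A.commutators.mkQ (x * y) = (-1 : k) ^ (i * j) • A.commutators.mkQ (y * x) := by
      rw [← map_smul, ← sub_eq_zero, ← map_sub, Submodule.mkQ_apply, Submodule.Quotient.mk_eq_zero]
      exact Submodule.subset_span (Or.inr ⟨i, j, x, hx, y, hy, rfl⟩)
    rw [h, degreewise_of_mem A.gr _ hx, degreewise_of_mem A.gr _ hy, degreewise_of_mem A.gr _ hy]
    rcases Int.even_or_odd j with hj | hj
    · simp [hj, (hj.mul_left i).neg_one_zpow]
    · simp [Int.not_even_iff_odd.2 hj, zpow_mul', hj.neg_one_zpow]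
  have h1 : ∀ i, ∀ x ∈ A.gr i, ∀ y, A.commutators.mkQ (x * y) =
      A.commutators.mkQ (degreewise A.gr (fun m => if Even m then (1 : k) else 0) y * x) +
      A.commutators.mkQ (degreewise A.gr (fun m => if Even m then (0 : k) else 1) y *
        degreewise A.gr (fun m => (-1 : k) ^ m) x) := fun i x hx y =>
    LinearMap.congr_fun (hom_ext_of_homogeneous A.gr
      (f := A.commutators.mkQ ∘ₗ LinearMap.mulLeft k x)
      (g := A.commutators.mkQ ∘ₗ LinearMap.mulRight k x ∘ₗ
          degreewise A.gr (fun m => if Even m then (1 : k) else 0) +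
        A.commutators.mkQ ∘ₗ LinearMap.mulRight k (degreewise A.gr (fun m => (-1 : k) ^ m) x) ∘ₗ
          degreewise A.gr (fun m => if Even m then (0 : k) else 1)) (key i x hx)) y
  exact LinearMap.congr_fun (hom_ext_of_homogeneous A.gr
      (f := A.commutators.mkQ ∘ₗ LinearMap.mulRight k y)
      (g := A.commutators.mkQ ∘ₗ LinearMap.mulLeft k
          (degreewise A.gr (fun m => if Even m then (1 : k) else 0) y) +
        A.commutators.mkQ ∘ₗ LinearMap.mulLeft k
          (degreewise A.gr (fun m => if Even m then (0 : k) else 1) y) ∘ₗ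
            degreewise A.gr (fun m => (-1 : k) ^ m)) fun i x hx => h1 i x hx y) x

theorem proj₀_face (a : Fin 2 → A.carrier) :
    A.proj₀ (DirectSum.lof k ℕ (fun n => ⨂[k] _ : Fin (n + 1), A.carrier) 0
      (face (k := k) A.carrier (n := 0) 0 (tprod k a))) = a 0 * a 1 := by
  rw [face, lift.tprod]
  exact A.proj₀_zero _

theorem mkQ_hochschildB_zero (x : ⨂[k] _ : Fin (0 + 2), A.carrier) :
    A.commutators.mkQ (A.proj₀ (DirectSum.lof k ℕ (fun n => ⨂[k] _ : Fin (n + 1), A.carrier) 0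
      (A.hochschildB 0 x))) = 0 := by
  induction x using PiTensorProduct.induction_on with
  | smul_tprod r a =>
    rw [map_smul, map_smul, map_smul, map_smul]
    have h := A.mkQ_comm (a 0) (a 1)
    have e : A.hochschildB 0 (tprod k a) =
        face (k := k) A.carrier (n := 0) 0 (tprod k a) -
          face (k := k) A.carrier (n := 0) 0 (A.rotate 1 (tprod k a)) := by
      simp [hochschildB, sub_eq_add_neg]
    have e' : A.rotate 1 (tprod k a) =
        tprod k ![degreewise A.gr (fun m => if Even m then (1 : k) else 0) (a 1), a 0] +
        tprod k ![degreewise A.gr (fun m => if Even m then (0 : k) else 1) (a 1),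
          degreewise A.gr (fun m => (-1 : k) ^ m) (a 0)] := by
      simp only [rotate, LinearMap.comp_apply, LinearMap.add_apply, map_add, map_tprod,
        LinearEquiv.coe_coe, reindex_tprod]
      congr 2 <;> (ext i; fin_cases i <;> rfl)
    rw [e, e', map_add, map_sub, map_add, map_sub, map_add, proj₀_face, proj₀_face, proj₀_face,
      map_sub, map_add, h]
    simp
  | add x y hx hy => simp only [map_add] at *; rw [hx, hy, add_zero]

/-- The canonical chain map from the reduced Connes complex of `A` to `A / (k + [A, A])`. -/
def connesToCyc : PresentedComplex.Hom A.connes A.cyc where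
  toLin := A.proj₀
  map_gr {m x} hx := by
    have h : A.connes.gr m ≤ (A.gr m).comap A.proj₀ := by
      refine Submodule.span_le.2 ?_
      rintro _ ⟨n, e, a, ha, he, rfl⟩
      cases n with
      | zero =>
        have : e 0 = m := by simpa using he
        simpa [proj₀_zero, this] using ha 0
      | succ n => simp [proj₀_succ]
    exact h hx
  map_rel {x} hx := by
    have h : A.connes.rel ≤ A.commutators.comap A.proj₀ := by
      refine Submodule.span_le.2 ?_
      rintro _ (⟨n, x, rfl⟩ | ⟨n, a, ⟨i, hi⟩, rfl⟩)
      · cases n with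
        | zero => simp [rotate_zero]
        | succ n => simp [proj₀_succ]
      · cases n with
        | zero =>
          rw [Fin.fin_one_eq_zero i] at hi
          simp only [SetLike.mem_coe, Submodule.mem_comap, proj₀_zero, hi]
          exact Submodule.subset_span (Or.inl rfl)
        | succ n => simp [proj₀_succ]
    exact h hx
  map_d x := by
    have h : (A.commutators.mkQ ∘ₗ A.proj₀) ∘ₗ A.hochschildD =
        (A.commutators.mkQ ∘ₗ A.d) ∘ₗ A.proj₀ := by
      refine DirectSum.linearMap_ext k fun n => LinearMap.ext fun x => ?_
      match n, x with
      | 0, x =>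
        induction x using PiTensorProduct.induction_on with
        | smul_tprod r a =>
          have e : A.internalD 0 (tprod k a) = tprod k fun i => A.d (a i) := by
            rw [internalD, Fin.sum_univ_one, map_tprod]
            congr 1
            ext i
            rw [Fin.fin_one_eq_zero i]
            rfl
          simp only [LinearMap.comp_apply, map_smul, hochschildD, DirectSum.toModule_lof,
            proj₀_zero, e]
        | add x y hx hy => rw [map_add, map_add, hx, hy]
      | 1, x =>
        have := A.mkQ_hochschildB_zero x
        simp only [LinearMap.comp_apply, LinearMap.add_apply, LinearMap.smul_apply, map_add,
          map_smul, hochschildD, DirectSum.toModule_lof, proj₀_succ, smul_zero, add_zero, map_zero]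
        exact this
      | n + 2, x =>
        simp only [LinearMap.comp_apply, LinearMap.add_apply, LinearMap.smul_apply, map_add,
          map_smul, hochschildD, DirectSum.toModule_lof, proj₀_succ, smul_zero, add_zero, map_zero]
    have h' := LinearMap.congr_fun h x
    exact (Submodule.Quotient.eq _).1 h'

end DGA

end Cyclic

/-! ### Drinfeld homology and Adams operations on reduced cyclic homology -/

section Drinfeld

variable {k : Type u} [Field k]

/-- The Drinfeld homology `HC^(d)_n(Lie, a)`, that is, the `n`-th homology of the left derived
functor of `λ^(d)`, computed by means of a cofibrant resolution `R` of `a`. -/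
abbrev drinfeldHomology (d : ℕ) {a : DGLA k} (R : a.CofibrantResolution) (n : ℤ) : Type u :=
  (lam d R.L).H n

/-- The map induced on Drinfeld homology by a morphism `f` of cofibrant resolutions. -/
def drinfeldHomology.map (d : ℕ) {a b : DGLA k} {R : a.CofibrantResolution}
    {S : b.CofibrantResolution} (f : DGLA.Hom R.L S.L) (n : ℤ) :
    drinfeldHomology d R n →ₗ[k] drinfeldHomology d S n :=
  (lam.map d f).mapH n

/-- The map `HC(U(R)) → HC(U(a))` on reduced cyclic homology induced by a resolution `R → a`. -/
def fromResolution {a : DGLA k} (R : a.CofibrantResolution) (n : ℤ) :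
    (U R.L).HC n →ₗ[k] (U a).HC n := DGA.HC.map (U.map R.q) n

/-- The map from the reduced cyclic homology of `U(L)` to the homology of
`U(L) / (k + [U(L), U(L)])`. -/
def toCyc (L : DGLA k) (n : ℤ) : (U L).HC n →ₗ[k] (U L).cyc.H n :=
  (DGA.connesToCyc (U L)).mapH n

end Drinfeld

end DrinfeldHodge

end

open DrinfeldHodge
open scoped DirectSum

/-!
# The Hodge decomposition of the reduced cyclic homology of enveloping algebras

*The eigenspaces.* The coproduct of `Sym(L)` turns the linear maps `Sym(L) → U(L)` into a
convolution algebra. The `n`-th power of the map that is the inclusion on `L` and zero on the other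
symmetric powers is `n!` times symmetrization on `Sym^n(L)` (`Env.symm`). Its compatibility with
coproducts is a binomial theorem (`Env.delta_symm`), and it follows that the Adams operation `ψ^p`
is multiplication by `p ^ n` on its image (`Env.adams_symm`). By the theorem of
Poincaré, Birkhoff and Witt (`Env.pbw_bijective`), `U(L)` is the direct sum of these images. Since
symmetrization commutes with the adjoint action and with `d`, and since the commutators of `U(L)`
are spanned by those with elements of `L`, the complex `U(L) / (k + [U(L), U(L)])` is the direct sum
of the complexes `λ^(d)(L)`, `d ≥ 1`, on which `ψ^p` acts by `p ^ d` (`hodgeMap_bijective`).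

*The Poincaré–Birkhoff–Witt theorem.* Surjectivity of symmetrization is an induction along the
standard filtration. Injectivity follows, by an induction with the coproduct, from that of
`L → U(L)`. This is clear for graded Lie algebras inside associative algebras, such as the free
one on `L` and its kernel pair over `L`, and passes to the quotient `L` because `U(L)` is the
coequalizer of the two enveloping algebras and symmetrization is natural
(`ι_injective_of_surjective`). The values of free Lie elements in `L` are well defined because of
the Dynkin map.

*Cofibrant resolutions.* The resolution `CellTerm.cellular a` consists of formal Lie polynomials in
cells, where a cell is attached along each cycle and each chain that bounds the image of this cycle;
all cells are attached in one inductive definition. It is realized inside the free algebra on all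
formal terms, of which its enveloping algebra is a retract (`CellTerm.toFree`, `CellTerm.ofFree`).

*Cyclic homology of a cofibrant enveloping algebra.* For a DG algebra `A`, let `A * k[ε]` be the
free product with differential `d ε = 1`. Words `a₀ ε a₁ ε ⋯ aₙ ε` represent Connes chains, and the
quotient of `A * k[ε]` by `1`, `ε`, the commutators and the multiples of `ε²` is the mapping cone of
the projection from the reduced Connes complex to `A / (k + [A, A])`
(`Bar.connesToCyc_bijective`). If `A = U(L)` for a cellular `L`, the derivation that maps each cell
`x` to `± x ε` is a contraction up to an operator that counts cells, modulo terms with simpler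
cells. This operator is invertible, so the cone is acyclic (`CellTerm.toCyc_cellular_bijective`).
Every cofibrant `L` is a retract of a cellular one.

*Invariance.* Over a field a quasi-isomorphism `f` has a homotopy inverse. Derivations that extend
homotopies show that `Sym`, hence also `U`, preserves quasi-isomorphisms (`Env.isQuasiIso_map`).
On tensor powers the homotopies induce a contraction of the mapping cone of the map of columns of
the Connes complexes, and averaging over cyclic groups passes to the quotient. An induction on the
number of columns gives the invariance of reduced cyclic homology (`DGA.HC.map_bijective`).
-/


noncomputable section

namespace DrinfeldHodge

/-! ### The coalgebra structure of the enveloping algebra -/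

section Coalgebra

variable {k : Type u} [Field k]

namespace Env

variable {L : DGLA k}

/-- Induction along left multiplication by homogeneous elements of the Lie algebra. -/
theorem induction_left {C : Env L → Prop} (h1 : C 1)
    (hmul : ∀ {i : ℤ} {x : L.carrier}, x ∈ L.gr i → ∀ u, C u → C (ι L x * u))
    (hadd : ∀ a b, C a → C b → C (a + b)) (hsmul : ∀ (c : k) a, C a → C (c • a)) (a : Env L) :
    C a := by
  have h0 : C 0 := by simpa using hsmul 0 1 h1
  suffices h : ∀ u, C u → C (a * u) by simpa using h 1 h1
  induction a using induction with
  | h0 r => intro u hu; rw [← Algebra.smul_def]; exact hsmul r u hu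
  | h1 x =>
    intro u hu
    induction x using DirectSum.Decomposition.inductionOn L.gr with
    | zero => simpa using h0
    | homogeneous x => exact hmul x.2 u hu
    | add x y hx hy => rw [map_add, add_mul]; exact hadd _ _ hx hy
  | hm a b ha hb => intro u hu; rw [mul_assoc]; exact ha _ (hb u hu)
  | ha a b ha hb => intro u hu; rw [add_mul]; exact hadd _ _ (ha u hu) (hb u hu)

theorem hom_ext_left {N : Type*} [AddCommGroup N] [Module k N] {F G : Env L →ₗ[k] N}
    (h1 : F 1 = G 1)
    (h : ∀ {i : ℤ} {x : L.carrier}, x ∈ L.gr i → ∀ u, F u = G u → F (ι L x * u) = G (ι L x * u)) :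
    F = G := by
  refine LinearMap.ext fun a => ?_
  induction a using induction_left with
  | h1 => exact h1
  | hmul hx u hu => exact h hx u hu
  | hadd a b ha hb => rw [map_add, map_add, ha, hb]
  | hsmul c a ha => rw [map_smul, map_smul, ha]

variable (L)

/-- The coproduct of the enveloping algebra, with values in the plain tensor product. -/
def delta : Env L →ₗ[k] Env L ⊗[k] Env L :=
  (GradedTensorProduct.of k (Env.gr L) (Env.gr L)).symm.toLinearMap ∘ₗ (comul L).toLinearMap

variable {L}

/-- Left multiplication by the primitive element `x ⊗ 1 + 1 ⊗ x` for `x` of degree `i`, with the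
Koszul sign written as a twist. -/
def primAct (i : ℤ) (x : L.carrier) : Env L ⊗[k] Env L →ₗ[k] Env L ⊗[k] Env L :=
  TensorProduct.map (LinearMap.mulLeft k (ι L x)) LinearMap.id +
    TensorProduct.map (twist L i).toLinearMap (LinearMap.mulLeft k (ι L x))

@[simp] theorem primAct_tmul (i : ℤ) (x : L.carrier) (a b : Env L) :
    primAct i x (a ⊗ₜ b) = (ι L x * a) ⊗ₜ b + twist L i a ⊗ₜ (ι L x * b) := by
  simp [primAct]

theorem units_zpow_smul {N : Type*} [AddCommGroup N] [Module k N] (n : ℤ) (z : N) :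
    ((-1 : ℤˣ) ^ n) • z = (-1 : k) ^ n • z := by
  rcases Int.even_or_odd n with h | h <;> simp [h.neg_one_zpow]

theorem primitiveι_mul {i : ℤ} {x : L.carrier} (hx : x ∈ L.gr i) (t : Env L ⊗[k] Env L) :
    primitiveι L x * GradedTensorProduct.of k (gr L) (gr L) t =
      GradedTensorProduct.of k (gr L) (gr L) (primAct i x t) := by
  induction t using TensorProduct.induction_on with
  | zero => simp
  | add a b ha hb => rw [map_add, mul_add, ha, hb, map_add, map_add]
  | tmul a b =>
    induction a using DirectSum.Decomposition.inductionOn (gr L) with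
    | zero => simp
    | add a a' ha ha' => rw [TensorProduct.add_tmul, map_add, mul_add, ha, ha', map_add, map_add]
    | @homogeneous j a =>
      have e1 := GradedTensorProduct.tmul_one_mul_coe_tmul (R := k) (gr L) (gr L) (ι L x) a b
      have e2 := GradedTensorProduct.tmul_coe_mul_coe_tmul (R := k) (gr L) (gr L) 1
        (⟨ι L x, ι_mem_gr hx⟩ : gr L i) a b
      have e : primitiveι L x = GradedTensorProduct.tmul k (ι L x) 1 +
        GradedTensorProduct.tmul k 1 (ι L x) := rfl
      rw [e, add_mul]
      refine (congrArg₂ (· + ·) e1 e2).trans ?_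
      rw [primAct_tmul, twist_of_mem a.2, map_add, units_zpow_smul (k := k), one_mul,
        ← TensorProduct.smul_tmul', map_smul]

theorem delta_one : delta L 1 = 1 ⊗ₜ 1 := by
  simp [delta, Algebra.TensorProduct.one_def]

theorem delta_ι_mul {i : ℤ} {x : L.carrier} (hx : x ∈ L.gr i) (u : Env L) :
    delta L (ι L x * u) = primAct i x (delta L u) := by
  have h : comul L (ι L x) = primitiveι L x := lift_ι _ _ x
  have := primitiveι_mul hx (delta L u)
  simp only [delta, LinearMap.comp_apply, AlgHom.toLinearMap_apply, LinearEquiv.coe_coe, map_mul, h,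
    GradedTensorProduct.symm_of_of] at this ⊢
  rw [this]
  rfl

theorem twist_twist (m n : ℤ) (u : Env L) : twist L m (twist L n u) = twist L (m + n) u := by
  refine LinearMap.congr_fun (hom_ext_of_homogeneous (gr L)
    (f := (twist L m).toLinearMap ∘ₗ (twist L n).toLinearMap) (g := (twist L (m + n)).toLinearMap)
    fun i u hu => ?_) u
  simp only [LinearMap.comp_apply, AlgHom.toLinearMap_apply, twist_of_mem hu, map_smul, add_mul,
    zpow_add₀ (neg_ne_zero.mpr (one_ne_zero' k)), smul_smul]
  rw [mul_comm]

theorem delta_twist (m : ℤ) (u : Env L) :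
    delta L (twist L m u) =
      TensorProduct.map (twist L m).toLinearMap (twist L m).toLinearMap (delta L u) := by
  refine LinearMap.congr_fun (hom_ext_left (F := delta L ∘ₗ (twist L m).toLinearMap)
    (G := TensorProduct.map (twist L m).toLinearMap (twist L m).toLinearMap ∘ₗ delta L)
    (by simp [delta_one]) fun {i x} hx u hu => ?_) u
  simp only [LinearMap.comp_apply, AlgHom.toLinearMap_apply, map_mul, twist_ι hx, smul_mul_assoc,
    map_smul, delta_ι_mul hx] at hu ⊢
  rw [hu]
  induction delta L u using TensorProduct.induction_on with
  | zero => simp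
  | add a b ha hb => simp only [map_add, smul_add, ha, hb]
  | tmul a b =>
    simp only [TensorProduct.map_tmul, primAct_tmul, AlgHom.toLinearMap_apply, map_add, map_mul,
      twist_ι hx, twist_twist, smul_add, smul_mul_assoc, TensorProduct.tmul_smul,
      TensorProduct.smul_tmul', add_comm m i]

/-- Left multiplication by `x ⊗ 1 ⊗ 1 + 1 ⊗ x ⊗ 1 + 1 ⊗ 1 ⊗ x`. -/
def primAct₃ (i : ℤ) (x : L.carrier) :
    Env L ⊗[k] (Env L ⊗[k] Env L) →ₗ[k] Env L ⊗[k] (Env L ⊗[k] Env L) :=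
  TensorProduct.map (LinearMap.mulLeft k (ι L x)) LinearMap.id +
    TensorProduct.map (twist L i).toLinearMap (primAct i x)

theorem counit_ι_mul (x : L.carrier) (u : Env L) : counit L (ι L x * u) = 0 := by
  have : counit L (ι L x) = 0 := lift_ι _ _ x
  rw [map_mul, this, zero_mul]

theorem counit_twist (m : ℤ) (u : Env L) : counit L (twist L m u) = counit L u := by
  refine LinearMap.congr_fun (hom_ext_left (F := (counit L).toLinearMap ∘ₗ (twist L m).toLinearMap)
    (G := (counit L).toLinearMap) (by simp) fun {i x} hx u _ => ?_) u
  simp only [LinearMap.comp_apply, AlgHom.toLinearMap_apply, map_mul (twist L m), twist_ι hx,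
    smul_mul_assoc, map_smul, counit_ι_mul, smul_zero]

instance coalgebra : Coalgebra k (Env L) where
  comul := delta L
  counit := (counit L).toLinearMap
  coassoc := by
    refine hom_ext_left (by simp [delta_one]) fun {i x} hx u hu => ?_
    have h1 : ∀ t : Env L ⊗[k] Env L,
        TensorProduct.assoc k _ _ _ ((delta L).rTensor _ (primAct i x t)) =
          primAct₃ i x (TensorProduct.assoc k _ _ _ ((delta L).rTensor _ t)) := by
      intro t
      induction t using TensorProduct.induction_on with
      | zero => simp
      | add a b ha hb => simp only [map_add, ha, hb]
      | tmul a b =>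
        rw [primAct_tmul, map_add, LinearMap.rTensor_tmul, LinearMap.rTensor_tmul,
          LinearMap.rTensor_tmul, delta_ι_mul hx, delta_twist]
        induction delta L a using TensorProduct.induction_on with
        | zero => simp
        | add a b ha hb =>
          simp only [map_add, TensorProduct.add_tmul] at ha hb ⊢
          rw [← ha, ← hb]; abel
        | tmul p q =>
          simp only [primAct_tmul, TensorProduct.map_tmul, TensorProduct.add_tmul, map_add,
            TensorProduct.assoc_tmul, primAct₃, LinearMap.add_apply, LinearMap.id_apply,
            AlgHom.toLinearMap_apply, LinearMap.mulLeft_apply, TensorProduct.tmul_add]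
          abel
    have h2 : ∀ t : Env L ⊗[k] Env L,
        (delta L).lTensor _ (primAct i x t) = primAct₃ i x ((delta L).lTensor _ t) := by
      intro t
      induction t using TensorProduct.induction_on with
      | zero => simp
      | add a b ha hb => simp only [map_add, ha, hb]
      | tmul a b =>
        simp [primAct₃, delta_ι_mul hx]
    simp only [LinearMap.comp_apply, LinearEquiv.coe_coe] at hu ⊢
    rw [delta_ι_mul hx, h1, h2, hu]
  rTensor_counit_comp_comul := by
    refine hom_ext_left (by simp [delta_one]) fun {i x} hx u hu => ?_
    have h1 : ∀ t : Env L ⊗[k] Env L, (counit L).toLinearMap.rTensor _ (primAct i x t) =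
        (LinearMap.mulLeft k (ι L x)).lTensor k ((counit L).toLinearMap.rTensor _ t) := by
      intro t
      induction t using TensorProduct.induction_on with
      | zero => simp
      | add a b ha hb => simp only [map_add, ha, hb]
      | tmul a b => simp [counit_twist, -map_mul, counit_ι_mul]
    simp only [LinearMap.comp_apply] at hu ⊢
    rw [delta_ι_mul hx, h1, hu]
    simp
  lTensor_counit_comp_comul := by
    refine hom_ext_left (by simp [delta_one]) fun {i x} hx u hu => ?_
    have h1 : ∀ t : Env L ⊗[k] Env L, (counit L).toLinearMap.lTensor _ (primAct i x t) =
        (LinearMap.mulLeft k (ι L x)).rTensor k ((counit L).toLinearMap.lTensor _ t) := by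
      intro t
      induction t using TensorProduct.induction_on with
      | zero => simp
      | add a b ha hb => simp only [map_add, ha, hb]
      | tmul a b => simp [-map_mul, counit_ι_mul]
    simp only [LinearMap.comp_apply] at hu ⊢
    rw [delta_ι_mul hx, h1, hu]
    simp

/-- The coproduct is graded cocommutative. -/
theorem comm_comul (u : Env L) :
    GradedTensorProduct.comm (gr L) (gr L) (comul L u) = comul L u := by
  refine AlgHom.congr_fun (algHom_ext (f := ((GradedTensorProduct.comm (gr L) (gr L) :
    _ ≃ₐ[k] _) : _ →ₐ[k] _).comp (comul L)) (g := comul L) fun x => ?_) u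
  have h : ∀ x, comul L (ι L x) = primitiveι L x := fun x => lift_ι _ _ x
  refine ι_ext (f := (((GradedTensorProduct.comm (gr L) (gr L) :
    _ ≃ₐ[k] _) : _ →ₐ[k] _).comp (comul L)).toLinearMap ∘ₗ ι L)
    (g := (comul L).toLinearMap ∘ₗ ι L) (fun i x hx => ?_) x
  have e : primitiveι L x = GradedTensorProduct.tmul k (ι L x) 1 +
        GradedTensorProduct.tmul k 1 (ι L x) := rfl
  have e1 := GradedTensorProduct.comm_coe_tmul_coe (R := k) (gr L) (gr L)
    (⟨ι L x, ι_mem_gr hx⟩ : gr L i) (⟨1, SetLike.GradedOne.one_mem⟩ : gr L 0)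
  have e2 := GradedTensorProduct.comm_coe_tmul_coe (R := k) (gr L) (gr L)
    (⟨1, SetLike.GradedOne.one_mem⟩ : gr L 0) (⟨ι L x, ι_mem_gr hx⟩ : gr L i)
  simp only [zero_mul, mul_zero, uzpow_zero, one_smul] at e1 e2
  simp only [LinearMap.comp_apply, AlgHom.toLinearMap_apply, AlgHom.comp_apply, h, e, map_add]
  rw [add_comm]
  exact congrArg₂ (· + ·) e2 e1

end Env

end Coalgebra

/-! ### Convolution powers of the projection to generators -/

section Convolution

variable {k : Type u} [Field k]

/-- In a graded module, an eigenvector of an operator that acts by distinct scalars on the graded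
pieces is homogeneous. -/
theorem mem_of_eigenvector {ι : Type*} [DecidableEq ι] {M : Type*} [AddCommGroup M] [Module k M]
    (gr : ι → Submodule k M) [DirectSum.Decomposition gr] (c : ι → k)
    (hc : Function.Injective c) (F : M →ₗ[k] M) (hF : ∀ i, ∀ x ∈ gr i, F x = c i • x) {i : ι}
    {u : M}
    (hu : F u = c i • u) : u ∈ gr i := by
  classical
  have key : ∀ v : M, ∀ j, (DirectSum.decompose gr (F v) j : M) =
      c j • (DirectSum.decompose gr v j : M) := by
    intro v j
    induction v using DirectSum.Decomposition.inductionOn gr with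
    | zero => simp
    | add a b ha hb => simp only [map_add, DirectSum.decompose_add, DirectSum.add_apply,
        Submodule.coe_add, ha, hb, smul_add]
    | @homogeneous l v =>
      rw [hF l v v.2, DirectSum.decompose_smul, DirectSum.smul_apply, Submodule.coe_smul]
      by_cases h : l = j
      · subst h; rfl
      · rw [DirectSum.decompose_coe, DirectSum.of_eq_of_ne _ _ _ (Ne.symm h)]
        simp
  have h0 : ∀ j, j ≠ i → (DirectSum.decompose gr u j : M) = 0 := by
    intro j hj
    have h := key u j
    rw [hu, DirectSum.decompose_smul, DirectSum.smul_apply, Submodule.coe_smul, ← sub_eq_zero,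
      ← sub_smul, smul_eq_zero, sub_eq_zero] at h
    exact h.resolve_left fun h => hj (hc h).symm
  rw [← DirectSum.sum_support_decompose gr u]
  refine Submodule.sum_mem _ fun j _ => ?_
  by_cases hj : j = i
  · subst hj; exact Subtype.prop _
  · rw [h0 j hj]; exact zero_mem _

namespace Env

variable {L : DGLA k}

section Derivation

variable {m : ℤ} {f : L.carrier →ₗ[k] L.carrier} (hf : IsDerivation m f)

theorem derivation_one : derivation hf 1 = 0 := by
  have := derivation_algebraMap hf 1
  rwa [map_one] at this

theorem derivation_ι_mul {i : ℤ} {x : L.carrier} (hx : x ∈ L.gr i) (u : Env L) :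
    derivation hf (ι L x * u) =
      ι L (f x) * u + (-1 : k) ^ (m * i) • (ι L x * derivation hf u) := by
  rw [derivation_mul, derivation_ι, twist_ι hx, smul_mul_assoc]

theorem derivation_twist (i : ℤ) (u : Env L) :
    derivation hf (twist L i u) = (-1 : k) ^ (m * i) • twist L i (derivation hf u) := by
  refine LinearMap.congr_fun (hom_ext_of_homogeneous (gr L)
    (f := derivation hf ∘ₗ (twist L i).toLinearMap)
    (g := (-1 : k) ^ (m * i) • ((twist L i).toLinearMap ∘ₗ derivation hf)) fun j u hu => ?_) u
  have h : (-1 : k) ^ (m * i) * (-1 : k) ^ (m * i) = 1 := by rw [← mul_zpow]; simp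
  simp only [LinearMap.comp_apply, AlgHom.toLinearMap_apply, twist_of_mem hu, map_smul,
    LinearMap.smul_apply, twist_of_mem (derivation_mem hf hu), smul_smul]
  rw [mul_add, zpow_add₀ (neg_ne_zero.mpr (one_ne_zero' k)), mul_comm i m, mul_left_comm, h,
    mul_one]

theorem counit_derivation (u : Env L) : counit L (derivation hf u) = 0 := by
  refine LinearMap.congr_fun (hom_ext_left (F := (counit L).toLinearMap ∘ₗ derivation hf)
    (G := 0) (by simp [derivation_one]) fun {i x} hx u _ => ?_) u
  simp only [LinearMap.comp_apply, AlgHom.toLinearMap_apply, derivation_ι_mul hf hx, map_add,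
    map_smul, counit_ι_mul, smul_zero, add_zero, LinearMap.zero_apply]

/-- Derivations induced by derivations of the Lie algebra are coderivations. -/
theorem delta_derivation (u : Env L) :
    delta L (derivation hf u) = (TensorProduct.map (derivation hf) LinearMap.id +
      TensorProduct.map (twist L m).toLinearMap (derivation hf) :
        Env L ⊗[k] Env L →ₗ[k] Env L ⊗[k] Env L) (delta L u) := by
  refine LinearMap.congr_fun (hom_ext_left (F := delta L ∘ₗ derivation hf)
    (G := (TensorProduct.map (derivation hf) LinearMap.id +
      TensorProduct.map (twist L m).toLinearMap (derivation hf)) ∘ₗ delta L)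
    (by simp [derivation_one, delta_one]) fun {i x} hx u hu => ?_) u
  simp only [LinearMap.comp_apply, derivation_ι_mul hf hx, map_add, map_smul, delta_ι_mul hx,
    delta_ι_mul (hf.mem hx)] at hu ⊢
  rw [hu]
  induction delta L u using TensorProduct.induction_on with
  | zero => simp
  | add a b ha hb =>
    simp only [map_add, smul_add] at ha hb ⊢
    rw [add_add_add_comm, ha, hb]
  | tmul a b =>
    simp only [primAct_tmul, LinearMap.add_apply, TensorProduct.map_tmul, LinearMap.id_apply,
      AlgHom.toLinearMap_apply, map_add, map_mul, derivation_ι_mul hf hx, twist_ι hx,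
      derivation_twist, twist_twist, TensorProduct.add_tmul, TensorProduct.tmul_add,
      TensorProduct.tmul_smul, ← TensorProduct.smul_tmul', smul_mul_assoc, add_comm m i]
    module

end Derivation

variable (L)

/-- The operator on `k × L` defining the projection to generators. -/
def prAct : Env L.abelian →ₐ[k] Module.End k (k × L.carrier) :=
  lift (L := L.abelian)
    { toFun := fun x => LinearMap.inr k k L.carrier ∘ₗ (LinearMap.toSpanSingleton k L.carrier x) ∘ₗ
        LinearMap.fst k k L.carrier
      map_add' := fun x y => by ext <;> simp
      map_smul' := fun c x => by ext <;> simp }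
    (by
      intro i j x hx y hy
      ext <;> simp)

/-- The projection of the symmetric algebra to its space `L` of generators. -/
def pr : Env L.abelian →ₗ[k] L.carrier :=
  LinearMap.snd k k L.carrier ∘ₗ LinearMap.applyₗ (1, 0) ∘ₗ (prAct L).toLinearMap

variable {L}

/-- `hom_ext_left` for the symmetric algebra, with the generators in `L` itself. -/
theorem hom_ext_left_abelian {N : Type*} [AddCommGroup N] [Module k N]
    {F G : Env L.abelian →ₗ[k] N} (h1 : F 1 = G 1)
    (h : ∀ {i : ℤ} {x : L.carrier}, x ∈ L.gr i → ∀ u, F u = G u →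
      F (ι L.abelian x * u) = G (ι L.abelian x * u)) : F = G :=
  hom_ext_left h1 h

theorem prAct_ι (x : L.carrier) (z : k × L.carrier) :
    prAct L (ι L.abelian x) z = (0, z.1 • x) := by
  have : prAct L (ι L.abelian x) = _ := lift_ι (L := L.abelian) _ _ x
  rw [this]
  simp

theorem prAct_fst (u : Env L.abelian) : (prAct L u (1, 0)).1 = counit L.abelian u := by
  refine LinearMap.congr_fun (hom_ext_left_abelian
    (F := LinearMap.fst k k L.carrier ∘ₗ LinearMap.applyₗ (1, 0) ∘ₗ (prAct L).toLinearMap)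
    (G := (counit L.abelian).toLinearMap) (by simp) fun {i x} hx u _ => ?_) u
  change (prAct L (ι L.abelian x * u) (1, 0)).1 = counit L.abelian (ι L.abelian x * u)
  rw [counit_ι_mul, map_mul, Module.End.mul_apply, prAct_ι]

theorem pr_one : pr L 1 = 0 := by simp [pr]

theorem pr_ι_mul (x : L.carrier) (u : Env L.abelian) :
    pr L (ι L.abelian x * u) = counit L.abelian u • x := by
  change (prAct L (ι L.abelian x * u) (1, 0)).2 = _
  rw [map_mul, Module.End.mul_apply, prAct_ι, prAct_fst]

theorem pr_ι (x : L.carrier) : pr L (ι L.abelian x) = x := by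
  have := pr_ι_mul x (1 : Env L.abelian)
  rwa [mul_one, map_one, one_smul] at this

theorem ι_abelian_injective : Function.Injective (ι L.abelian) :=
  Function.LeftInverse.injective (g := pr L) pr_ι

variable (L)

/-- The linear map `Sym(L) → U(L)` that is the inclusion on `L` and zero on the other symmetric
powers. -/
def kappa : Env L.abelian →ₗ[k] Env L := ι L ∘ₗ pr L

/-- The `n`-th convolution power of `kappa`. On `Sym^n(L)` it is `n!` times the symmetrization map
to `U(L)`, and it vanishes on the other symmetric powers. -/
def symm (n : ℕ) : Env L.abelian →ₗ[k] Env L := (WithConv.toConv (kappa L) ^ n).ofConv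

variable {L}

theorem symm_zero (s : Env L.abelian) : symm L 0 s = algebraMap k _ (counit L.abelian s) := rfl

theorem symm_one : symm L 1 = kappa L := by
  rw [symm, pow_one]

theorem symm_add (m n : ℕ) (s : Env L.abelian) :
    symm L (m + n) s =
      LinearMap.mul' k _ (TensorProduct.map (symm L m) (symm L n) (delta L.abelian s)) := by
  rw [symm, pow_add]
  rfl

theorem symm_succ (n : ℕ) (s : Env L.abelian) :
    symm L (n + 1) s =
      LinearMap.mul' k _ (TensorProduct.map (kappa L) (symm L n) (delta L.abelian s)) := by
  rw [add_comm, symm_add, symm_one]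

theorem kappa_one : kappa L 1 = 0 := by simp [kappa, pr_one]

theorem kappa_ι_mul (x : L.carrier) (u : Env L.abelian) :
    kappa L (ι L.abelian x * u) = counit L.abelian u • ι L x := by
  rw [kappa, LinearMap.comp_apply, pr_ι_mul, map_smul]

theorem kappa_twist (m : ℤ) (s : Env L.abelian) :
    kappa L (twist L.abelian m s) = twist L m (kappa L s) := by
  refine LinearMap.congr_fun (hom_ext_left_abelian (F := kappa L ∘ₗ (twist L.abelian m).toLinearMap)
    (G := (twist L m).toLinearMap ∘ₗ kappa L) (by simp [kappa_one]) fun {i x} hx u _ => ?_) s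
  rw [LinearMap.comp_apply, LinearMap.comp_apply, AlgHom.toLinearMap_apply,
    AlgHom.toLinearMap_apply, map_mul, twist_ι (L := L.abelian) hx, smul_mul_assoc, map_smul,
    kappa_ι_mul, counit_twist, kappa_ι_mul, map_smul, twist_ι hx, smul_comm]

section Derivation

variable {m : ℤ} {f : L.carrier →ₗ[k] L.carrier} (hs : IsDerivation (L := L.abelian) m f)

theorem pr_derivation (s : Env L.abelian) : pr L (derivation hs s) = f (pr L s) := by
  refine LinearMap.congr_fun (hom_ext_left_abelian (F := pr L ∘ₗ derivation hs)
    (G := f ∘ₗ pr L) (by simp [pr_one, derivation_one]) fun {i x} hx u _ => ?_) s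
  rw [LinearMap.comp_apply, LinearMap.comp_apply, derivation_ι_mul hs hx, map_add, map_smul,
    pr_ι_mul, pr_ι_mul, pr_ι_mul, counit_derivation, zero_smul, smul_zero, add_zero, map_smul]

/-- The symmetrization maps intertwine the derivations of `Sym(L)` and of `U(L)` induced by a
derivation of `L`. -/
theorem symm_derivation (hf : IsDerivation (L := L) m f) (n : ℕ) (s : Env L.abelian) :
    symm L n (derivation hs s) = derivation hf (symm L n s) := by
  induction n generalizing s with
  | zero => rw [symm_zero, symm_zero, counit_derivation, map_zero, derivation_algebraMap]
  | succ n ih =>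
    rw [symm_succ, symm_succ, delta_derivation]
    induction delta L.abelian s using TensorProduct.induction_on with
    | zero => simp
    | add a b ha hb => simp only [map_add, ha, hb]
    | tmul a b =>
      have e : kappa L (derivation hs a) = derivation hf (kappa L a) := by
        rw [kappa, LinearMap.comp_apply, pr_derivation, LinearMap.comp_apply, derivation_ι]
      simp only [LinearMap.add_apply, TensorProduct.map_tmul, LinearMap.id_apply, map_add,
        AlgHom.toLinearMap_apply, LinearMap.mul'_apply, derivation_mul, ih, e, kappa_twist]

end Derivation

/-! ### Length and degree as eigenvalues -/

theorem isDerivation_id (L : DGLA k) : IsDerivation (L := L.abelian) 0 LinearMap.id where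
  mem hx := by simpa using hx
  map_bracket _ _ _ _ := by simp

/-- The Euler derivation of `Sym(L)`, which multiplies `Sym^n(L)` by `n`. -/
def euler (L : DGLA k) : Env L.abelian →ₗ[k] Env L.abelian := derivation (isDerivation_id L)

theorem twist_zero (u : Env L) : twist L 0 u = u := by
  refine LinearMap.congr_fun (hom_ext_of_homogeneous (gr L)
    (f := (twist L 0).toLinearMap) (g := LinearMap.id) fun j u hu => ?_) u
  simp [twist_of_mem hu]

theorem derivation_ι_pow_mem {m : ℤ} {f : L.carrier →ₗ[k] L.carrier} (hf : IsDerivation m f)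
    {n : ℕ} {u : Env L} (hu : u ∈ LinearMap.range (ι L) ^ n) :
    derivation hf u ∈ LinearMap.range (ι L) ^ n := by
  have htw : ∀ x, twist L m (ι L x) ∈ LinearMap.range (ι L) := by
    intro x
    rw [twist, lift_ι]
    exact ⟨_, rfl⟩
  induction hu using Submodule.pow_induction_on_left' with
  | algebraMap r => rw [derivation_algebraMap]; exact zero_mem _
  | add x y i hx hy ihx ihy => rw [map_add]; exact add_mem ihx ihy
  | mem_mul x hx i u hu ih =>
    obtain ⟨x, rfl⟩ := hx
    rw [derivation_mul, derivation_ι, pow_succ']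
    exact add_mem (Submodule.mul_mem_mul ⟨_, rfl⟩ hu) (Submodule.mul_mem_mul (htw x) ih)

theorem euler_of_mem {n : ℕ} {s : Env L.abelian} (hs : s ∈ symPow L n) :
    euler L s = (n : k) • s := by
  induction hs using Submodule.pow_induction_on_left' with
  | algebraMap r => rw [euler, derivation_algebraMap]; simp
  | add x y i hx hy ihx ihy => rw [map_add, ihx, ihy, smul_add]
  | mem_mul x hx i u hu ih =>
    obtain ⟨x, rfl⟩ := hx
    rw [euler] at ih ⊢
    rw [derivation_mul, derivation_ι, twist_zero, ih]
    simp only [LinearMap.id_apply, mul_smul_comm]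
    push_cast
    module

theorem kappa_euler (s : Env L.abelian) : kappa L (euler L s) = kappa L s := by
  rw [kappa, LinearMap.comp_apply, euler, pr_derivation]
  rfl

theorem symm_euler (n : ℕ) (s : Env L.abelian) :
    symm L n (euler L s) = (n : k) • symm L n s := by
  induction n generalizing s with
  | zero => rw [symm_zero, euler, counit_derivation]; simp
  | succ n ih =>
    rw [symm_succ, symm_succ, euler, delta_derivation]
    change LinearMap.mul' k _ (TensorProduct.map (kappa L) (symm L n)
      ((TensorProduct.map (euler L) LinearMap.id +
        TensorProduct.map (twist L.abelian 0).toLinearMap (euler L) :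
        Env L.abelian ⊗[k] Env L.abelian →ₗ[k] Env L.abelian ⊗[k] Env L.abelian)
          (delta L.abelian s))) = _
    induction delta L.abelian s using TensorProduct.induction_on with
    | zero => simp
    | add a b ha hb => simp only [map_add, smul_add, ha, hb]
    | tmul a b =>
      simp only [LinearMap.add_apply, TensorProduct.map_tmul, LinearMap.id_apply, map_add,
        AlgHom.toLinearMap_apply, LinearMap.mul'_apply, ih, kappa_euler, twist_zero, mul_smul_comm]
      push_cast
      module

theorem symm_of_ne [CharZero k] {m n : ℕ} (h : m ≠ n) {s : Env L.abelian} (hs : s ∈ symPow L n) :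
    symm L m s = 0 := by
  have h1 := symm_euler m s
  rw [euler_of_mem hs, map_smul, ← sub_eq_zero, ← sub_smul, smul_eq_zero, sub_eq_zero] at h1
  exact h1.resolve_left fun h2 => h (Nat.cast_injective h2).symm

theorem isDerivation_degree (L : DGLA k) :
    IsDerivation (L := L) 0 (degreewise L.gr fun i => (i : k)) where
  mem hx := by
    rw [degreewise_of_mem L.gr _ hx, add_zero]
    exact Submodule.smul_mem _ _ hx
  map_bracket hx j y hy := by
    simp only [degreewise_of_mem L.gr _ hx, degreewise_of_mem L.gr _ hy,
      degreewise_of_mem L.gr _ (L.bracket_mem hx hy), map_smul, LinearMap.smul_apply]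
    rw [zero_mul, zpow_zero]
    push_cast
    module

/-- The derivation of `U(L)` that multiplies the part of degree `n` by `n`. -/
def degree (L : DGLA k) : Env L →ₗ[k] Env L := derivation (isDerivation_degree L)

theorem degree_of_mem {n : ℤ} {u : Env L} (hu : u ∈ gr L n) : degree L u = (n : k) • u := by
  induction hu using Submodule.span_induction with
  | mem x hx =>
    obtain ⟨l, rfl, rfl⟩ := hx
    induction l with
    | nil => simp [degree, derivation_one]
    | cons p l ih =>
      simp only [List.map_cons, List.prod_cons, List.sum_cons]
      rw [degree] at ih ⊢
      rw [derivation_ι_mul _ p.2.2, ih, degreewise_of_mem L.gr _ p.2.2]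
      simp only [zero_mul, zpow_zero, one_smul, map_smul, mul_smul_comm, smul_mul_assoc]
      push_cast
      module
  | zero => simp
  | add x y hx hy ihx ihy => rw [map_add, ihx, ihy, smul_add]
  | smul c x hx ih => rw [map_smul, ih, smul_comm]

theorem mem_gr_iff [CharZero k] {n : ℤ} {u : Env L} : u ∈ gr L n ↔ degree L u = (n : k) • u :=
  ⟨degree_of_mem, mem_of_eigenvector (gr L) (fun n : ℤ => (n : k)) Int.cast_injective (degree L)
    fun _ _ => degree_of_mem⟩

theorem symm_degree (n : ℕ) (s : Env L.abelian) :
    symm L n (degree L.abelian s) = degree L (symm L n s) :=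
  symm_derivation (L := L) (isDerivation_degree L.abelian) (isDerivation_degree L) n s

theorem symm_mem_gr [CharZero k] (n : ℕ) {i : ℤ} {s : Env L.abelian} (hs : s ∈ gr L.abelian i) :
    symm L n s ∈ gr L i := by
  rw [mem_gr_iff] at hs ⊢
  rw [← symm_degree, hs, map_smul]

/-! ### Symmetrization and the coproduct -/

/-- The coproduct of `U(L)` applied to a convolution power of `kappa`. -/
theorem delta_symm [CharZero k] (n : ℕ) (s : Env L.abelian) :
    delta L (symm L n s) = ∑ p ∈ Finset.HasAntidiagonal.antidiagonal n, (n.choose p.1 : k) •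
      TensorProduct.map (symm L p.1) (symm L p.2) (delta L.abelian s) := by
  let iL := GradedTensorProduct.includeLeft (R := k) (gr L) (gr L)
  let iR := GradedTensorProduct.includeRight (R := k) (gr L) (gr L)
  let α := WithConv.toConv (iL.toLinearMap ∘ₗ kappa L)
  let β := WithConv.toConv (iR.toLinearMap ∘ₗ kappa L)
  -- composition with an algebra map is multiplicative for convolution
  have hpow : ∀ {B : Type u} [Ring B] [Algebra k B] (φ : Env L →ₐ[k] B) (n : ℕ),
      WithConv.toConv (φ.toLinearMap ∘ₗ symm L n) =
        WithConv.toConv (φ.toLinearMap ∘ₗ kappa L) ^ n := by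
    intro B _ _ φ n
    induction n with
    | zero =>
      rw [pow_zero]
      refine WithConv.ext (LinearMap.ext fun s => ?_)
      exact φ.commutes _
    | succ n ih =>
      have := LinearMap.algHom_comp_convMul_distrib φ (WithConv.toConv (kappa L) ^ n)
        (WithConv.toConv (kappa L))
      rw [← pow_succ] at this
      rw [pow_succ, ← ih]
      exact WithConv.ext this
  have hsum : WithConv.toConv ((comul L).toLinearMap ∘ₗ kappa L) = α + β := by
    refine WithConv.ext (LinearMap.ext fun s => ?_)
    exact lift_ι _ _ (pr L s)
  have hswap : ∀ t : GradedTensorProduct k (gr L.abelian) (gr L.abelian),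
      LinearMap.mul' k _ (TensorProduct.map β.ofConv α.ofConv
        ((GradedTensorProduct.of k (gr L.abelian) (gr L.abelian)).symm
          (GradedTensorProduct.comm (gr L.abelian) (gr L.abelian) t))) =
      LinearMap.mul' k _ (TensorProduct.map α.ofConv β.ofConv
        ((GradedTensorProduct.of k (gr L.abelian) (gr L.abelian)).symm t)) := by
    intro t
    obtain ⟨t, rfl⟩ := (GradedTensorProduct.of k (gr L.abelian) (gr L.abelian)).surjective t
    induction t using TensorProduct.induction_on with
    | zero => simp
    | add a b ha hb => simp only [map_add, ha, hb]
    | tmul a b =>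
      induction a using DirectSum.Decomposition.inductionOn (gr L.abelian) with
      | zero => simp
      | add a a' ha ha' => simp only [TensorProduct.add_tmul, map_add, ha, ha']
      | @homogeneous i a =>
        induction b using DirectSum.Decomposition.inductionOn (gr L.abelian) with
        | zero => simp
        | add a a' ha ha' => simp only [TensorProduct.tmul_add, map_add, ha, ha']
        | @homogeneous j b =>
          have e := GradedTensorProduct.comm_coe_tmul_coe (R := k) (gr L.abelian) (gr L.abelian) a b
          have ha := symm_mem_gr (L := L) 1 a.2
          have hb := symm_mem_gr (L := L) 1 b.2
          rw [symm_one] at ha hb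
          have e' := GradedTensorProduct.tmul_coe_mul_coe_tmul (R := k) (gr L) (gr L) 1
            (⟨_, hb⟩ : gr L j) (⟨_, ha⟩ : gr L i) 1
          have hn : (-1 : k) ^ (j * i) * (-1 : k) ^ (j * i) = 1 := by rw [← mul_zpow]; simp
          rw [units_zpow_smul (k := k)] at e e'
          rw [e, map_smul, map_smul, map_smul]
          change (-1 : k) ^ (j * i) •
              ((GradedTensorProduct.tmul k (1 : Env L) (kappa L b) :
                  GradedTensorProduct k (gr L) (gr L)) *
                (GradedTensorProduct.tmul k (kappa L a) (1 : Env L))) =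
              (GradedTensorProduct.tmul k (kappa L a) (1 : Env L) :
                  GradedTensorProduct k (gr L) (gr L)) *
                (GradedTensorProduct.tmul k (1 : Env L) (kappa L b))
          refine (congrArg _ e').trans ?_
          rw [smul_smul, hn, one_smul, one_mul, mul_one,
            GradedTensorProduct.tmul_one_mul_one_tmul]
  have hcomm : Commute α β := by
    refine WithConv.ext (LinearMap.ext fun s => ?_)
    have := hswap (comul L.abelian s)
    rw [comm_comul] at this
    exact this.symm
  have h := congrArg (fun f => f.ofConv s) ((hpow (comul L) n).trans
    ((congrArg (· ^ n) hsum).trans (hcomm.add_pow' n)))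
  simp only [LinearMap.comp_apply, AlgHom.toLinearMap_apply] at h
  refine (congrArg (GradedTensorProduct.of k (gr L) (gr L)).symm h).trans ?_
  have hev : ∀ (F : Finset (ℕ × ℕ)) (g : ℕ × ℕ → WithConv (Env L.abelian →ₗ[k]
      GradedTensorProduct k (gr L) (gr L))),
      (∑ p ∈ F, g p).ofConv s = ∑ p ∈ F, (g p).ofConv s := by
    intro F g
    exact map_sum ((LinearMap.applyₗ s) ∘ₗ (WithConv.linearEquiv k _).toLinearMap) _ _
  rw [hev, map_sum]
  refine Finset.sum_congr rfl fun p _ => ?_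
  rw [← Nat.cast_smul_eq_nsmul k, WithConv.ofConv_smul, LinearMap.smul_apply, map_smul]
  congr 1
  rw [← hpow iL, ← hpow iR, LinearMap.convMul_apply]
  change (GradedTensorProduct.of k (gr L) (gr L)).symm (LinearMap.mul' k _ (TensorProduct.map
    (iL.toLinearMap ∘ₗ symm L p.1) (iR.toLinearMap ∘ₗ symm L p.2) (delta L.abelian s))) = _
  induction delta L.abelian s using TensorProduct.induction_on with
  | zero => simp
  | add a b ha hb => simp only [map_add, ha, hb]
  | tmul a b =>
    exact GradedTensorProduct.tmul_one_mul_one_tmul (gr L) (gr L) (symm L p.1 a) (symm L p.2 b)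

/-- The image of the `n`-th symmetrization map consists of eigenvectors of the Adams operations
`ψ^p`, of eigenvalue `p ^ n`. -/
theorem adams_symm [CharZero k] (p n : ℕ) (s : Env L.abelian) :
    adams L p (symm L n s) = (p : k) ^ n • symm L n s := by
  induction p generalizing n s with
  | zero =>
    change algebraMap k _ (counit L (symm L n s)) = _
    cases n with
    | zero => simp [symm_zero]
    | succ n =>
      rw [symm_succ]
      have : ∀ t, counit L (LinearMap.mul' k _ (TensorProduct.map (kappa L) (symm L n) t)) = 0 := by
        intro t
        induction t using TensorProduct.induction_on with
        | zero => simp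
        | add a b ha hb => simp only [map_add, ha, hb, add_zero]
        | tmul a b =>
          simp only [TensorProduct.map_tmul, LinearMap.mul'_apply, kappa, LinearMap.comp_apply,
            counit_ι_mul]
      rw [this]
      simp
  | succ p ih =>
    change LinearMap.mul' k _ (TensorProduct.map LinearMap.id (adams L p)
      (delta L (symm L n s))) = _
    rw [delta_symm, map_sum, map_sum, Nat.cast_succ, add_comm, Commute.add_pow' (Commute.all _ _),
      Finset.sum_smul]
    refine Finset.sum_congr rfl fun q hq => ?_
    rw [map_smul, map_smul, ← LinearMap.comp_apply (TensorProduct.map _ _),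
      ← TensorProduct.map_comp]
    have : adams L p ∘ₗ symm L q.2 = (p : k) ^ q.2 • symm L q.2 := LinearMap.ext fun s => ih _ s
    rw [this, TensorProduct.map_smul_right, LinearMap.smul_apply, map_smul, LinearMap.id_comp,
      ← symm_add, Finset.HasAntidiagonal.mem_antidiagonal.1 hq, one_pow, one_mul, nsmul_eq_mul,
        smul_smul]

end Env

end Convolution

/-! ### The symmetrization isomorphism -/

section Symmetrization

variable {k : Type u} [Field k]

/-- Eigenvectors of distinct eigenvalues that add up to zero vanish. -/
theorem eq_zero_of_sum_eigenvectors {ι M : Type*} [AddCommGroup M] [Module k M]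
    (F : Module.End k M) {c : ι → k} (hc : Function.Injective c) {v : ι → M}
    (hv : ∀ i, F (v i) = c i • v i) {s : Finset ι} (h : ∑ i ∈ s, v i = 0) {i : ι} (hi : i ∈ s) :
    v i = 0 := by
  have := (F.eigenspaces_iSupIndep.comp hc)
  exact (iSupIndep_iff_finsetSum_eq_zero_imp_eq_zero _).1 this s v
    (fun i _ => Module.End.mem_eigenspace_iff.2 (hv i)) h i hi

namespace Env

variable {L : DGLA k}

/-! #### The length grading of the symmetric algebra -/

theorem ι_mul_mem_symPow (x : L.carrier) {n : ℕ} {s : Env L.abelian} (hs : s ∈ symPow L n) :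
    ι L.abelian x * s ∈ symPow L (n + 1) := by
  rw [symPow, pow_succ']
  exact Submodule.mul_mem_mul ⟨x, rfl⟩ hs

theorem one_mem_symPow : (1 : Env L.abelian) ∈ symPow L 0 := by
  rw [symPow, pow_zero]
  exact Submodule.one_le.1 le_rfl

theorem symPow_isInternal [CharZero k] (L : DGLA k) : DirectSum.IsInternal (symPow L) := by
  refine (DirectSum.isInternal_submodule_iff_iSupIndep_and_iSup_eq_top _).2 ⟨?_, ?_⟩
  · refine iSupIndep.mono ((Module.End.eigenspaces_iSupIndep
      (euler L : Module.End k (Env L.abelian))).comp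
      (f := fun n : ℕ => (n : k)) Nat.cast_injective) fun n s hs => ?_
    exact Module.End.mem_eigenspace_iff.2 (euler_of_mem hs)
  · suffices h : ∀ s, s ∈ iSup (symPow L) from eq_top_iff.2 fun s _ => h s
    intro s
    induction s using induction_left with
    | h1 => exact Submodule.mem_iSup_of_mem 0 one_mem_symPow
    | @hmul i x hx u hu =>
      induction hu using Submodule.iSup_induction' with
      | mem n u hu => exact Submodule.mem_iSup_of_mem (n + 1) (ι_mul_mem_symPow x hu)
      | zero => rw [mul_zero]; exact zero_mem _
      | add a b _ _ ha hb => rw [mul_add]; exact add_mem ha hb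
    | hadd a b ha hb => exact add_mem ha hb
    | hsmul c a ha => exact Submodule.smul_mem _ c ha

instance symPowDecomposition [CharZero k] (L : DGLA k) :
    DirectSum.Decomposition (symPow L) := (symPow_isInternal L).chooseDecomposition

/-- Two linear maps on the symmetric algebra that agree on the symmetric powers are equal. -/
theorem hom_ext_of_symPow [CharZero k] {N : Type*} [AddCommGroup N] [Module k N]
    {F G : Env L.abelian →ₗ[k] N} (h : ∀ n, ∀ s ∈ symPow L n, F s = G s) : F = G :=
  DirectSum.decompose_lhom_ext (symPow L) fun n => LinearMap.ext fun s => h n s s.2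

/-- The Poincaré–Birkhoff–Witt map `Sym(L) → U(L)`, equal to `n!` times symmetrization on
`Sym^n(L)`. -/
def pbw [CharZero k] (L : DGLA k) : Env L.abelian →ₗ[k] Env L :=
  (DirectSum.toModule k ℕ _ fun n => symm L n ∘ₗ (symPow L n).subtype) ∘ₗ
    (DirectSum.decomposeLinearEquiv (symPow L)).toLinearMap

theorem pbw_of_mem [CharZero k] {n : ℕ} {s : Env L.abelian} (hs : s ∈ symPow L n) :
    pbw L s = symm L n s := by
  simp only [pbw, LinearMap.comp_apply, LinearEquiv.coe_coe,
    DirectSum.decomposeLinearEquiv_apply, DirectSum.decompose_of_mem (symPow L) hs]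
  rw [← DirectSum.lof_eq_of k, DirectSum.toModule_lof]
  rfl

theorem symm_mem_range_pbw [CharZero k] (n : ℕ) (s : Env L.abelian) :
    symm L n s ∈ LinearMap.range (pbw L) := by
  induction s using DirectSum.Decomposition.inductionOn (symPow L) with
  | zero => rw [map_zero]; exact zero_mem _
  | add a b ha hb => rw [map_add]; exact add_mem ha hb
  | @homogeneous j s =>
    by_cases h : n = j
    · subst h; exact ⟨s, pbw_of_mem s.2⟩
    · rw [symm_of_ne h s.2]; exact zero_mem _

/-! #### Injectivity -/

/-- The multiplication of a generator split off by the coproduct recovers the Euler derivation. -/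
theorem mul_map_pr_delta (s : Env L.abelian) :
    LinearMap.mul' k _ (TensorProduct.map (ι L.abelian ∘ₗ pr L) LinearMap.id (delta L.abelian s)) =
      euler L s := by
  refine LinearMap.congr_fun (hom_ext_left_abelian
    (F := LinearMap.mul' k _ ∘ₗ TensorProduct.map (ι L.abelian ∘ₗ pr L) LinearMap.id ∘ₗ
      delta L.abelian) (G := euler L)
    (by simp [delta_one, euler, derivation_one, pr_one]) fun {i x} hx s hs => ?_) s
  have hsw : ∀ a : Env L.abelian, ι L.abelian (pr L (twist L.abelian i a)) * ι L.abelian x =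
      ι L.abelian x * ι L.abelian (pr L a) := by
    intro a
    have h1 : ∀ y : L.carrier, twist L.abelian i (ι L.abelian y) * ι L.abelian x =
        ι L.abelian x * ι L.abelian y := by
      intro y
      refine ι_ext (L := L.abelian)
        (f := LinearMap.mulRight k (ι L.abelian x) ∘ₗ (twist L.abelian i).toLinearMap ∘ₗ
          ι L.abelian)
        (g := LinearMap.mulLeft k (ι L.abelian x) ∘ₗ ι L.abelian) (fun j y hy => ?_) y
      have := ι_mul_ι (L := L.abelian) hx hy
      simp only [LinearMap.zero_apply, map_zero, add_zero] at this
      simp only [LinearMap.comp_apply, AlgHom.toLinearMap_apply, LinearMap.mulRight_apply,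
        LinearMap.mulLeft_apply, twist_ι (L := L.abelian) hy, this, smul_mul_assoc]
    rw [← h1]
    congr 1
    have := kappa_twist (L := L.abelian) i a
    exact this
  have h2 : ∀ t : Env L.abelian ⊗[k] Env L.abelian,
      LinearMap.mul' k _ (TensorProduct.map (ι L.abelian ∘ₗ pr L) LinearMap.id
        (primAct (L := L.abelian) i x t)) =
      ι L.abelian x * (TensorProduct.lid k _ ((counit L.abelian).toLinearMap.rTensor _ t)) +
        ι L.abelian x * LinearMap.mul' k _
          (TensorProduct.map (ι L.abelian ∘ₗ pr L) LinearMap.id t) := by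
    intro t
    induction t using TensorProduct.induction_on with
    | zero => simp
    | add a b ha hb => simp only [map_add, mul_add] at ha hb ⊢; rw [ha, hb]; abel
    | tmul a b =>
      simp only [primAct_tmul, map_add, TensorProduct.map_tmul, LinearMap.comp_apply,
        LinearMap.mul'_apply, LinearMap.id_apply, LinearMap.rTensor_tmul, TensorProduct.lid_tmul,
        AlgHom.toLinearMap_apply]
      rw [pr_ι_mul, ← mul_assoc, hsw, LinearMap.map_smul, smul_mul_assoc, mul_smul_comm, mul_assoc]
  have h3 : (counit L.abelian).toLinearMap.rTensor _ (delta L.abelian s) = 1 ⊗ₜ[k] s :=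
    Coalgebra.rTensor_counit_comul s
  simp only [LinearMap.comp_apply] at hs ⊢
  rw [delta_ι_mul (L := L.abelian) hx, h2, hs, h3, TensorProduct.lid_tmul, one_smul, euler,
    derivation_ι_mul (L := L.abelian) _ hx]
  simp

theorem map_pr_delta_mem {n : ℕ} {s : Env L.abelian} (hs : s ∈ symPow L (n + 1)) :
    TensorProduct.map (pr L) LinearMap.id (delta L.abelian s) ∈
      LinearMap.range ((symPow L n).subtype.lTensor L.carrier) := by
  suffices h : ∀ (m : ℕ) (s : Env L.abelian), s ∈ symPow L m → (∀ n, m = n + 1 →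
      TensorProduct.map (pr L) LinearMap.id (delta L.abelian s) ∈
        LinearMap.range ((symPow L n).subtype.lTensor L.carrier)) ∧
      (m = 0 → TensorProduct.map (pr L) LinearMap.id (delta L.abelian s) = 0) from
    (h _ s hs).1 n rfl
  intro m s hs
  induction hs using Submodule.pow_induction_on_left' with
  | algebraMap r =>
    refine ⟨fun n h => by omega, fun _ => ?_⟩
    rw [Algebra.algebraMap_eq_smul_one, map_smul, delta_one, map_smul, TensorProduct.map_tmul,
      pr_one, TensorProduct.zero_tmul, smul_zero]
  | add x y i hx hy ihx ihy =>
    refine ⟨fun n h => ?_, fun h => ?_⟩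
    · rw [map_add, map_add]; exact add_mem (ihx.1 n h) (ihy.1 n h)
    · rw [map_add, map_add, ihx.2 h, ihy.2 h, add_zero]
  | mem_mul x hx m u hu ih =>
    obtain ⟨x, rfl⟩ := hx
    refine ⟨fun n h => ?_, fun h => by omega⟩
    obtain rfl : m = n := by omega
    clear h
    induction x using DirectSum.Decomposition.inductionOn L.gr with
    | zero => rw [map_zero, zero_mul, map_zero, map_zero]; exact zero_mem _
    | add x y hx hy =>
      rw [LinearMap.map_add (ι L.abelian) x y, add_mul, map_add, map_add]; exact add_mem hx hy
    | @homogeneous i x =>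
      have h2 : ∀ t : Env L.abelian ⊗[k] Env L.abelian,
          TensorProduct.map (pr L) LinearMap.id (primAct (L := L.abelian) i x t) =
          (x : L.carrier) ⊗ₜ (TensorProduct.lid k _ ((counit L.abelian).toLinearMap.rTensor _ t)) +
          TensorProduct.map (degreewise L.gr fun j => (-1 : k) ^ (i * j))
            (LinearMap.mulLeft k (ι L.abelian x))
            (TensorProduct.map (pr L) LinearMap.id t) := by
        intro t
        induction t using TensorProduct.induction_on with
        | zero => simp
        | add a b ha hb =>
          simp only [map_add, TensorProduct.tmul_add] at ha hb ⊢; rw [ha, hb]; abel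
        | tmul a b =>
          simp only [primAct_tmul, map_add, TensorProduct.map_tmul,
            LinearMap.id_apply, LinearMap.rTensor_tmul, TensorProduct.lid_tmul,
            AlgHom.toLinearMap_apply, LinearMap.mulLeft_apply]
          rw [pr_ι_mul, TensorProduct.smul_tmul]
          congr 2
          refine ι_abelian_injective (L := L) ?_
          have := kappa_twist (L := L.abelian) i a
          refine (this : ι L.abelian _ = _).trans ?_
          exact lift_ι (L := L.abelian) _ _ _
      have h3 : (counit L.abelian).toLinearMap.rTensor _ (delta L.abelian u) = 1 ⊗ₜ[k] u :=
        Coalgebra.rTensor_counit_comul u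
      rw [delta_ι_mul (L := L.abelian) x.2, h2, h3, TensorProduct.lid_tmul, one_smul]
      refine add_mem ⟨(x : L.carrier) ⊗ₜ ⟨u, hu⟩, rfl⟩ ?_
      rcases Nat.eq_zero_or_pos m with h0 | h0
      · rw [ih.2 h0, map_zero]; exact zero_mem _
      · obtain ⟨m, rfl⟩ : ∃ l, m = l + 1 := ⟨m - 1, by omega⟩
        obtain ⟨t, ht⟩ := ih.1 m rfl
        rw [← ht]
        clear ht
        induction t using TensorProduct.induction_on with
        | zero => simp
        | add a b ha hb => rw [map_add, map_add]; exact add_mem ha hb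
        | tmul a b =>
          exact ⟨degreewise L.gr (fun j => (-1 : k) ^ (i * j)) a ⊗ₜ
            ⟨ι L.abelian x * b, ι_mul_mem_symPow _ b.2⟩, rfl⟩

theorem algebraMap_injective : Function.Injective (algebraMap k (Env L)) :=
  Function.LeftInverse.injective (g := counit L) fun r => (counit L).commutes r

theorem two_pow_injective [CharZero k] : Function.Injective fun i : ℕ => ((2 : ℕ) : k) ^ i := by
  intro i j hij
  have h : ((2 ^ i : ℕ) : k) = ((2 ^ j : ℕ) : k) := by
    rw [Nat.cast_pow, Nat.cast_pow]; exact hij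
  exact Nat.pow_right_injective le_rfl (Nat.cast_injective h)

/-- If `L` embeds in `U(L)` then so does `Sym^n(L)`. The coproduct and the eigenvalues of `ψ²`
separate the terms of the coproduct of a symmetrized element, which reduces the claim to
`L ⊗ Sym^(n-1)(L)`. -/
theorem symm_injOn [CharZero k] (hι : Function.Injective (ι L)) (n : ℕ) {s : Env L.abelian}
    (hs : s ∈ symPow L n) (h0 : symm L n s = 0) : s = 0 := by
  induction n generalizing s with
  | zero =>
    rw [symPow, pow_zero] at hs
    obtain ⟨r, rfl⟩ := Submodule.mem_one.1 hs
    rw [symm_zero, AlgHom.commutes] at h0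
    have : r = 0 := algebraMap_injective (h0.trans (map_zero (algebraMap k (Env L))).symm)
    rw [this, map_zero]
  | succ n ih =>
    have h1 := delta_symm (n + 1) s
    rw [h0, map_zero, Finset.Nat.sum_antidiagonal_eq_sum_range_succ_mk] at h1
    -- the summand of `Δ (symm (n + 1) s)` whose first factor has length `1` is the component of
    -- eigenvalue `2` of `ψ² ⊗ 1`
    have h2 := eq_zero_of_sum_eigenvectors (k := k) (TensorProduct.map (adams L 2) LinearMap.id)
      (c := fun i : ℕ => ((2 : ℕ) : k) ^ i)
      two_pow_injective (fun i => by
        rw [map_smul, ← LinearMap.comp_apply, ← TensorProduct.map_comp, LinearMap.id_comp]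
        have : adams L 2 ∘ₗ symm L i = ((2 : ℕ) : k) ^ i • symm L i :=
          LinearMap.ext fun s => adams_symm (L := L) 2 i s
        rw [this, TensorProduct.map_smul_left, LinearMap.smul_apply, smul_comm]) h1.symm
      (i := 1) (by simp)
    rw [smul_eq_zero] at h2
    replace h2 := h2.resolve_left (by simp; exact_mod_cast Nat.succ_ne_zero n)
    rw [symm_one, Nat.add_sub_cancel] at h2
    obtain ⟨t, ht⟩ := map_pr_delta_mem hs
    have h3 : TensorProduct.map (ι L) (symm L n ∘ₗ (symPow L n).subtype) t = 0 := by
      rw [← h2, kappa, ← LinearMap.comp_id (symm L n), TensorProduct.map_comp (ι L),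
        LinearMap.comp_apply,
        ← ht, LinearMap.comp_id, LinearMap.lTensor, ← LinearMap.comp_apply (TensorProduct.map _ _),
        ← TensorProduct.map_comp, LinearMap.comp_id]
    have hinj : Function.Injective (TensorProduct.map (ι L) (symm L n ∘ₗ (symPow L n).subtype)) :=
      TensorProduct.map_injective_of_flat_flat _ _ hι
        ((injective_iff_map_eq_zero _).2 fun u hu => Subtype.ext (ih u.2 hu))
    have h4 : t = 0 := hinj (h3.trans (map_zero _).symm)
    -- multiplying the split off generator back gives `(n + 1) s`
    have h5 := mul_map_pr_delta s
    rw [← LinearMap.comp_id LinearMap.id, TensorProduct.map_comp, LinearMap.comp_apply, ← ht, h4,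
      map_zero, map_zero, map_zero, euler_of_mem hs] at h5
    exact (smul_eq_zero.1 h5.symm).resolve_left (by exact_mod_cast Nat.succ_ne_zero n)

theorem pbw_injective_of_ι_injective [CharZero k] (hι : Function.Injective (ι L)) :
    Function.Injective (pbw L) := by
  classical
  refine (injective_iff_map_eq_zero _).2 fun s hs => ?_
  rw [← DirectSum.sum_support_decompose (symPow L) s, map_sum] at hs
  rw [← DirectSum.sum_support_decompose (symPow L) s]
  refine Finset.sum_eq_zero fun i hi => symm_injOn hι i (Subtype.prop _) ?_
  rw [← pbw_of_mem (Subtype.prop _)]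
  refine eq_zero_of_sum_eigenvectors (adams L 2) two_pow_injective (fun i => ?_) hs hi
  rw [pbw_of_mem (Subtype.prop _), adams_symm]

/-! #### Surjectivity -/

/-- The span of the products of at most one element of `L`; its `n`-th power is the `n`-th step of
the standard filtration of `U(L)`. -/
def fil (L : DGLA k) : Submodule k (Env L) := 1 ⊔ LinearMap.range (ι L)

theorem one_le_fil : 1 ≤ fil L := le_sup_left

theorem ι_mem_fil (x : L.carrier) : ι L x ∈ fil L := le_sup_right (a := (1 : Submodule k (Env L)))
    ⟨x, rfl⟩

theorem fil_pow_mono : Monotone fun n => fil L ^ n := fun _ _ h => pow_right_mono₀ one_le_fil h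

theorem symm_mem_fil (n : ℕ) (s : Env L.abelian) : symm L n s ∈ fil L ^ n := by
  induction n generalizing s with
  | zero => rw [symm_zero, pow_zero]; exact Submodule.algebraMap_mem _
  | succ n ih =>
    rw [symm_succ]
    induction delta L.abelian s using TensorProduct.induction_on with
    | zero => simp
    | add a b ha hb => rw [map_add, map_add]; exact add_mem ha hb
    | tmul a b =>
      rw [TensorProduct.map_tmul, LinearMap.mul'_apply, pow_succ']
      exact Submodule.mul_mem_mul (ι_mem_fil _) (ih b)

theorem kappa_twist_mul_sub_mem {i : ℤ} {x : L.carrier} (hx : x ∈ L.gr i) (a : Env L.abelian) :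
    kappa L (twist L.abelian i a) * ι L x - ι L x * kappa L a ∈ fil L := by
  rw [kappa_twist]
  change twist L i (ι L (pr L a)) * ι L x - ι L x * ι L (pr L a) ∈ fil L
  induction pr L a using DirectSum.Decomposition.inductionOn L.gr with
  | zero => simp
  | add a b ha hb =>
    rw [map_add, map_add, add_mul, mul_add, add_sub_add_comm]
    exact add_mem ha hb
  | @homogeneous j y =>
    rw [twist_ι y.2, ι_mul_ι hx y.2, smul_mul_assoc, sub_add_cancel_left]
    exact neg_mem (ι_mem_fil _)

/-- Left multiplication by an element of `L` and symmetrization commute up to lower order. -/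
theorem symm_ι_mul_sub_mem {i : ℤ} {x : L.carrier} (hx : x ∈ L.gr i) (n : ℕ) (s : Env L.abelian) :
    symm L (n + 1) (ι L.abelian x * s) - ((n + 1 : ℕ) : k) • (ι L x * symm L n s) ∈
      fil L ^ n := by
  induction n generalizing s with
  | zero =>
    rw [zero_add, symm_one, kappa_ι_mul, symm_zero, ← Algebra.commutes, ← Algebra.smul_def]
    simp
  | succ n ih =>
    have h3 : (counit L.abelian).toLinearMap.rTensor _ (delta L.abelian s) = 1 ⊗ₜ[k] s :=
      Coalgebra.rTensor_counit_comul s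
    have h4 : ∀ t : Env L.abelian ⊗[k] Env L.abelian,
        LinearMap.mul' k _ (TensorProduct.map (kappa L) (symm L (n + 1))
          (primAct (L := L.abelian) i x t)) -
        ι L x * symm L (n + 1)
          (TensorProduct.lid k _ ((counit L.abelian).toLinearMap.rTensor _ t)) -
        ((n + 1 : ℕ) : k) • (ι L x * LinearMap.mul' k _
            (TensorProduct.map (kappa L) (symm L n) t)) ∈
          fil L ^ (n + 1) := by
      intro t
      induction t using TensorProduct.induction_on with
      | zero => simp
      | add a b ha hb =>
        simp only [map_add, mul_add, smul_add]
        convert! add_mem ha hb using 1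
        abel
      | tmul a b =>
        simp only [primAct_tmul, map_add, TensorProduct.map_tmul, LinearMap.mul'_apply,
          LinearMap.rTensor_tmul, TensorProduct.lid_tmul, AlgHom.toLinearMap_apply]
        rw [kappa_ι_mul, LinearMap.map_smul, smul_mul_assoc, mul_smul_comm, add_sub_cancel_left]
        have e : kappa L (twist L.abelian i a) * symm L (n + 1) (ι L.abelian x * b) -
            ((n + 1 : ℕ) : k) • (ι L x * (kappa L a * symm L n b)) =
            kappa L (twist L.abelian i a) * (symm L (n + 1) (ι L.abelian x * b) -
              ((n + 1 : ℕ) : k) • (ι L x * symm L n b)) +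
            ((n + 1 : ℕ) : k) • ((kappa L (twist L.abelian i a) * ι L x - ι L x * kappa L a) *
              symm L n b) := by
          simp only [mul_sub, sub_mul, smul_sub, mul_smul_comm, mul_assoc]
          abel
        rw [e, pow_succ']
        exact add_mem (Submodule.mul_mem_mul (ι_mem_fil _) (ih b))
          (Submodule.smul_mem _ _ (Submodule.mul_mem_mul (kappa_twist_mul_sub_mem hx a)
            (symm_mem_fil n b)))
    have h5 := h4 (delta L.abelian s)
    rw [h3, TensorProduct.lid_tmul, one_smul, ← symm_succ, ← delta_ι_mul (L := L.abelian) hx,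
      ← symm_succ] at h5
    convert! h5 using 1
    push_cast
    module

theorem fil_pow_le [CharZero k] (n : ℕ) :
    fil L ^ n ≤ ⨆ j : Fin (n + 1), LinearMap.range (symm L j) := by
  have hmono : ∀ {m n : ℕ}, m ≤ n → (⨆ j : Fin (m + 1), LinearMap.range (symm L j)) ≤
      ⨆ j : Fin (n + 1), LinearMap.range (symm L j) := fun {m n} h => iSup_le fun j =>
    le_iSup (fun j : Fin (n + 1) => LinearMap.range (symm L j)) ⟨j, by omega⟩
  induction n with
  | zero =>
    rw [pow_zero]
    intro u hu
    obtain ⟨r, rfl⟩ := Submodule.mem_one.1 hu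
    refine Submodule.mem_iSup_of_mem 0 ⟨algebraMap k _ r, ?_⟩
    exact (symm_zero _).trans (by rw [AlgHom.commutes]; rfl)
  | succ n ih =>
    rw [pow_succ', Submodule.mul_le]
    intro v hv u hu
    obtain ⟨r, hr, w, ⟨x, rfl⟩, rfl⟩ := Submodule.mem_sup.1 hv
    obtain ⟨r, rfl⟩ := Submodule.mem_one.1 hr
    rw [add_mul, ← Algebra.smul_def]
    refine add_mem (Submodule.smul_mem _ _ (hmono n.le_succ (ih hu))) ?_
    clear hv hr
    induction x using DirectSum.Decomposition.inductionOn L.gr with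
    | zero => simp
    | add x y hx hy => rw [map_add, add_mul]; exact add_mem hx hy
    | @homogeneous i x =>
      have hu' := ih hu
      clear hu
      induction hu' using Submodule.iSup_induction' with
      | zero => simp
      | add a b _ _ ha hb => rw [mul_add]; exact add_mem ha hb
      | mem j u hu =>
        obtain ⟨s, rfl⟩ := hu
        have h1 := symm_ι_mul_sub_mem x.2 j s
        have h2 := hmono n.le_succ (ih (fil_pow_mono (Nat.lt_succ_iff.1 j.2) h1))
        have h3 : symm L (j + 1) (ι L.abelian x * s) ∈
            ⨆ j : Fin (n + 1 + 1), LinearMap.range (symm L j) :=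
          Submodule.mem_iSup_of_mem (⟨j + 1, by omega⟩ : Fin (n + 1 + 1)) ⟨_, rfl⟩
        have h4 := Submodule.sub_mem _ h3 h2
        rw [sub_sub_cancel] at h4
        have hne : (((j : ℕ) + 1 : ℕ) : k) ≠ 0 := by exact_mod_cast Nat.succ_ne_zero j
        exact (Submodule.smul_mem_iff _ hne).1 h4

theorem pbw_surjective [CharZero k] : Function.Surjective (pbw L) := by
  intro u
  have h : ∃ n, u ∈ fil L ^ n := by
    induction u using induction_left with
    | h1 => exact ⟨0, by rw [pow_zero]; exact Submodule.one_le.1 le_rfl⟩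
    | hmul hx u hu =>
      obtain ⟨n, hn⟩ := hu
      exact ⟨n + 1, by rw [pow_succ']; exact Submodule.mul_mem_mul (ι_mem_fil _) hn⟩
    | hadd a b ha hb =>
      obtain ⟨m, hm⟩ := ha
      obtain ⟨n, hn⟩ := hb
      exact ⟨max m n, add_mem (fil_pow_mono (le_max_left m n) hm)
        (fil_pow_mono (le_max_right m n) hn)⟩
    | hsmul c a ha => exact ha.imp fun n hn => Submodule.smul_mem _ _ hn
  obtain ⟨n, hn⟩ := h
  have h1 : (⨆ j : Fin (n + 1), LinearMap.range (symm L j)) ≤ LinearMap.range (pbw L) := by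
    refine iSup_le fun j => ?_
    rintro _ ⟨s, rfl⟩
    exact symm_mem_range_pbw _ s
  exact h1 (fil_pow_le n hn)

/-! #### Naturality -/

variable {L' : DGLA k} (f : DGLA.Hom L L')

theorem counit_map (u : Env L) : counit L' (Env.map f u) = counit L u := by
  refine LinearMap.congr_fun (hom_ext_left (F := (counit L').toLinearMap ∘ₗ (Env.map f).toLinearMap)
    (G := (counit L).toLinearMap) (by simp) fun {i x} hx u _ => ?_) u
  rw [LinearMap.comp_apply, AlgHom.toLinearMap_apply, AlgHom.toLinearMap_apply,
    AlgHom.toLinearMap_apply, map_mul (Env.map f), Env.map_ι, counit_ι_mul, counit_ι_mul]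

theorem delta_map (u : Env L) : delta L' (Env.map f u) =
    TensorProduct.map (Env.map f).toLinearMap (Env.map f).toLinearMap (delta L u) := by
  refine LinearMap.congr_fun (hom_ext_left (F := delta L' ∘ₗ (Env.map f).toLinearMap)
    (G := TensorProduct.map (Env.map f).toLinearMap (Env.map f).toLinearMap ∘ₗ delta L)
    (by simp [delta_one]) fun {i x} hx u hu => ?_) u
  simp only [LinearMap.comp_apply, AlgHom.toLinearMap_apply, map_mul, Env.map_ι,
    delta_ι_mul hx, delta_ι_mul (f.map_gr hx)] at hu ⊢
  rw [hu]
  induction delta L u using TensorProduct.induction_on with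
  | zero => simp
  | add a b ha hb => simp only [map_add, ha, hb]
  | tmul a b => simp [Env.map_twist]

theorem pr_map (s : Env L.abelian) : pr L' (Env.map f.abelian s) = f.toLin (pr L s) := by
  refine LinearMap.congr_fun (hom_ext_left_abelian
    (F := pr L' ∘ₗ (Env.map f.abelian).toLinearMap)
    (G := f.toLin ∘ₗ pr L) (by simp [pr_one]) fun {i x} hx u _ => ?_) s
  rw [LinearMap.comp_apply, AlgHom.toLinearMap_apply, LinearMap.comp_apply, map_mul, Env.map_ι]
  refine (pr_ι_mul (L := L') _ _).trans ?_
  rw [counit_map]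
  refine Eq.trans ?_ (congrArg f.toLin (pr_ι_mul (L := L) _ _)).symm
  exact (map_smul f.toLin _ _).symm

theorem symm_map (n : ℕ) (s : Env L.abelian) :
    symm L' n (Env.map f.abelian s) = Env.map f (symm L n s) := by
  induction n generalizing s with
  | zero => rw [symm_zero, symm_zero, AlgHom.commutes, counit_map]
  | succ n ih =>
    rw [symm_succ, symm_succ, delta_map]
    induction delta L.abelian s using TensorProduct.induction_on with
    | zero => simp
    | add a b ha hb => simp only [map_add, ha, hb]
    | tmul a b =>
      simp only [TensorProduct.map_tmul, AlgHom.toLinearMap_apply, LinearMap.mul'_apply, ih,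
        map_mul,
        kappa, LinearMap.comp_apply, pr_map, Env.map_ι]

theorem pbw_map [CharZero k] (s : Env L.abelian) :
    pbw L' (Env.map f.abelian s) = Env.map f (pbw L s) := by
  refine LinearMap.congr_fun (hom_ext_of_symPow (F := pbw L' ∘ₗ (Env.map f.abelian).toLinearMap)
    (G := (Env.map f).toLinearMap ∘ₗ pbw L) fun n s hs => ?_) s
  simp only [LinearMap.comp_apply, AlgHom.toLinearMap_apply]
  rw [pbw_of_mem hs, pbw_of_mem (map_symPow f n hs), symm_map]

end Env

end Symmetrization

/-! ### Graded Lie subalgebras of associative algebras -/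

section LieFamily

variable {k : Type u} [Field k] {B : Type u} [Ring B] [Algebra k B]

/-- The supercommutator of elements of degrees `i` and `j` of an associative algebra. -/
def superComm (i j : ℤ) : B →ₗ[k] B →ₗ[k] B :=
  LinearMap.mul k B - (-1 : k) ^ (i * j) • (LinearMap.mul k B).flip

theorem superComm_apply (i j : ℤ) (x y : B) :
    superComm (k := k) i j x y = x * y - (-1 : k) ^ (i * j) • (y * x) := rfl

theorem neg_one_zpow_mul_self (n : ℤ) : (-1 : k) ^ n * (-1 : k) ^ n = 1 := by
  rw [← mul_zpow]; simp

theorem superComm_skew (i j : ℤ) (x y : B) :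
    superComm (k := k) i j x y = -((-1 : k) ^ (i * j) • superComm (k := k) j i y x) := by
  rw [superComm_apply, superComm_apply, mul_comm j i, smul_sub, smul_smul, neg_one_zpow_mul_self,
    one_smul, neg_sub]

theorem superComm_jacobi (i j l : ℤ) (x y z : B) :
    superComm (k := k) i (j + l) x (superComm (k := k) j l y z) =
      superComm (k := k) (i + j) l (superComm (k := k) i j x y) z +
        (-1 : k) ^ (i * j) • superComm (k := k) j (i + l) y (superComm (k := k) i l x z) := by
  have h0 : (-1 : k) ≠ 0 := neg_ne_zero.mpr one_ne_zero
  have h1 := neg_one_zpow_mul_self (k := k) (i * j)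
  simp only [superComm_apply, mul_add, add_mul, zpow_add₀ h0, mul_comm j i, mul_sub, sub_mul,
    mul_smul_comm, smul_mul_assoc, mul_assoc, smul_sub, smul_smul]
  match_scalars <;> first
    | ring1
    | linear_combination (-1 : k) ^ (j * l) * h1
    | linear_combination -((-1 : k) ^ (j * l)) * h1
    | linear_combination (-1 : k) ^ (i * l) * (-1 : k) ^ (j * l) * h1
    | linear_combination -((-1 : k) ^ (i * l) * (-1 : k) ^ (j * l)) * h1

variable (k B) in
/-- A family of subspaces of an associative algebra, closed under graded commutators, together
with a differential. The subspaces need not be independent. -/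
structure LieFamily where
  Q : ℤ → Submodule k B
  d : B →ₗ[k] B
  d_mem : ∀ {i x}, x ∈ Q i → d x ∈ Q (i - 1)
  d_d : ∀ {i x}, x ∈ Q i → d (d x) = 0
  bracket_mem : ∀ {i j x y}, x ∈ Q i → y ∈ Q j → superComm (k := k) i j x y ∈ Q (i + j)
  leibniz : ∀ {i j x y}, x ∈ Q i → y ∈ Q j → d (x * y) = d x * y + (-1 : k) ^ i • (x * d y)

namespace LieFamily

variable (F : LieFamily k B)

/-- The element of degree `n` of `⨁ n, Q n` given by `x ∈ Q n`. -/
def of (n : ℤ) : F.Q n →ₗ[k] ⨁ n, F.Q n := DirectSum.lof k ℤ (fun n => F.Q n) n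

theorem toModule_of {N : Type*} [AddCommMonoid N] [Module k N] (φ : ∀ n, F.Q n →ₗ[k] N) {n : ℤ}
    (x : F.Q n) : DirectSum.toModule k ℤ N φ (F.of n x) = φ n x :=
  DirectSum.toModule_lof (M := fun n => F.Q n) (φ := φ) k n x

theorem of_congr {m n : ℤ} (h : m = n) {x y : B} (hx : x ∈ F.Q m) (hy : y ∈ F.Q n) (e : x = y) :
    F.of m ⟨x, hx⟩ = F.of n ⟨y, hy⟩ := by
  subst h; subst e; rfl

theorem hom_ext {N : Type*} [AddCommMonoid N] [Module k N] {f g : (⨁ n, F.Q n) →ₗ[k] N}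
    (h : ∀ n, ∀ x : F.Q n, f (F.of n x) = g (F.of n x)) : f = g :=
  DirectSum.linearMap_ext k fun n => LinearMap.ext fun x => h n x

/-- The bracket of the elements of degrees `i` and `j`. -/
def bracketOf (i j : ℤ) : F.Q i →ₗ[k] F.Q j →ₗ[k] ⨁ n, F.Q n :=
  LinearMap.mk₂ k (fun x y => F.of (i + j) ⟨superComm (k := k) i j (x : B) y,
    F.bracket_mem x.2 y.2⟩)
    (fun x x' y => by rw [← map_add]; congr 1; ext; simp)
    (fun c x y => by rw [← map_smul]; congr 1; ext; simp)
    (fun x y y' => by rw [← map_add]; congr 1; ext; simp)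
    (fun c x y => by rw [← map_smul]; congr 1; ext; simp)

/-- The bracket of `⨁ n, Q n`. -/
def bracket : (⨁ n, F.Q n) →ₗ[k] (⨁ n, F.Q n) →ₗ[k] ⨁ n, F.Q n :=
  DirectSum.toModule k ℤ _ fun i =>
    (DirectSum.toModule k ℤ _ fun j => (F.bracketOf i j).flip).flip

theorem bracket_of {i j : ℤ} (x : F.Q i) (y : F.Q j) : F.bracket (F.of i x) (F.of j y) =
    F.of (i + j) ⟨superComm (k := k) i j (x : B) y, F.bracket_mem x.2 y.2⟩ := by
  rw [bracket, of, DirectSum.toModule_lof, LinearMap.flip_apply, of, DirectSum.toModule_lof]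
  rfl

/-- The differential of `⨁ n, Q n`. -/
def diff : (⨁ n, F.Q n) →ₗ[k] ⨁ n, F.Q n :=
  DirectSum.toModule k ℤ _ fun i =>
    F.of (i - 1) ∘ₗ F.d.restrict (p := F.Q i) (q := F.Q (i - 1)) fun _ => F.d_mem

theorem diff_of {i : ℤ} (x : F.Q i) : F.diff (F.of i x) = F.of (i - 1) ⟨F.d x, F.d_mem x.2⟩ := by
  rw [diff, of, DirectSum.toModule_lof]
  rfl

/-- The subspace of elements of degree `n` of `⨁ n, Q n`. -/
def gr (n : ℤ) : Submodule k (⨁ n, F.Q n) := LinearMap.range (F.of n)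

instance : DirectSum.Decomposition F.gr :=
  DirectSum.Decomposition.ofLinearMap _
    (DirectSum.toModule k ℤ _ fun n => DirectSum.lof k ℤ (fun n => F.gr n) n ∘ₗ
      (F.of n).rangeRestrict)
    (by
      refine F.hom_ext fun n x => ?_
      refine (congrArg (DirectSum.coeLinearMap F.gr) (F.toModule_of
        (fun n => DirectSum.lof k ℤ (fun n => F.gr n) n ∘ₗ (F.of n).rangeRestrict) x)).trans ?_
      exact DirectSum.coeLinearMap_lof _ _ _)
    (by
      refine DirectSum.linearMap_ext k fun n => LinearMap.ext ?_
      rintro ⟨_, x, rfl⟩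
      simp only [LinearMap.comp_apply, DirectSum.coeLinearMap_lof]
      exact F.toModule_of _ x)

/-- The DG Lie algebra defined by a family of subspaces of an associative algebra. -/
def toDGLA : DGLA k where
  carrier := ⨁ n, F.Q n
  gr := F.gr
  d := F.diff
  bracket := F.bracket
  d_mem := by
    rintro i _ ⟨x, rfl⟩
    exact ⟨_, (F.diff_of x).symm⟩
  d_d x := by
    refine LinearMap.congr_fun (F.hom_ext (N := ⨁ n, F.Q n) (f := F.diff ∘ₗ F.diff) (g := 0)
      fun n x => ?_) x
    rw [LinearMap.comp_apply, diff_of, diff_of, LinearMap.zero_apply, ← map_zero (F.of (n - 1 - 1))]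
    exact F.of_congr rfl _ (zero_mem _) (F.d_d x.2)
  bracket_mem := by
    rintro i j _ _ ⟨x, rfl⟩ ⟨y, rfl⟩
    exact ⟨_, (F.bracket_of x y).symm⟩
  skew := by
    rintro i j _ _ ⟨x, rfl⟩ ⟨y, rfl⟩
    rw [bracket_of, bracket_of, ← map_smul, ← map_neg]
    exact F.of_congr (add_comm _ _) _ _ (superComm_skew _ _ _ _)
  jacobi := by
    rintro i j _ _ ⟨x, rfl⟩ ⟨y, rfl⟩ z
    refine LinearMap.congr_fun (F.hom_ext (N := ⨁ n, F.Q n)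
      (f := F.bracket (F.of i x) ∘ₗ F.bracket (F.of j y))
      (g := F.bracket (F.bracket (F.of i x) (F.of j y)) +
        (-1 : k) ^ (i * j) • F.bracket (F.of j y) ∘ₗ F.bracket (F.of i x)) fun l z => ?_) z
    simp only [LinearMap.comp_apply, LinearMap.add_apply, LinearMap.smul_apply, bracket_of]
    have h : superComm (k := k) j (i + l) (y : B) (superComm (k := k) i l (x : B) z) ∈
        F.Q (i + j + l) := by
      have := F.bracket_mem y.2 (F.bracket_mem x.2 z.2)
      rwa [← add_assoc, add_comm j i] at this
    rw [F.of_congr (show j + (i + l) = i + j + l by ring) _ h rfl, ← map_smul, ← map_add]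
    exact F.of_congr (add_assoc _ _ _).symm _ _ (superComm_jacobi _ _ _ _ _ _)
  leibniz := by
    rintro i _ ⟨x, rfl⟩ y
    refine LinearMap.congr_fun (F.hom_ext (N := ⨁ n, F.Q n)
      (f := F.diff ∘ₗ F.bracket (F.of i x))
      (g := F.bracket (F.diff (F.of i x)) +
        (-1 : k) ^ i • F.bracket (F.of i x) ∘ₗ F.diff) fun j y => ?_) y
    simp only [LinearMap.comp_apply, LinearMap.add_apply, LinearMap.smul_apply, bracket_of, diff_of]
    have h1 : superComm (k := k) (i - 1) j (F.d x) (y : B) ∈ F.Q (i + j - 1) := by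
      have := F.bracket_mem (F.d_mem x.2) y.2
      rwa [sub_add_eq_add_sub] at this
    have h2 : superComm (k := k) i (j - 1) (x : B) (F.d y) ∈ F.Q (i + j - 1) := by
      have := F.bracket_mem x.2 (F.d_mem y.2)
      rwa [← add_sub_assoc] at this
    rw [F.of_congr (show i - 1 + j = i + j - 1 by ring) _ h1 rfl,
      F.of_congr (show i + (j - 1) = i + j - 1 by ring) _ h2 rfl, ← map_smul, ← map_add]
    refine F.of_congr rfl _ _ ?_
    have h0 : (-1 : k) ≠ 0 := neg_ne_zero.mpr one_ne_zero
    change F.d (superComm (k := k) i j (x : B) y) = superComm (k := k) (i - 1) j (F.d x) (y : B) +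
      (-1 : k) ^ i • superComm (k := k) i (j - 1) (x : B) (F.d y)
    rw [superComm_apply, superComm_apply, superComm_apply, map_sub, map_smul, F.leibniz x.2 y.2,
      F.leibniz y.2 x.2, sub_mul, mul_sub, one_mul, mul_one, zpow_sub₀ h0, zpow_sub₀ h0]
    have h3 := neg_one_zpow_mul_self (k := k) i
    have h4 := neg_one_zpow_mul_self (k := k) j
    rcases Int.even_or_odd i with hi | hi <;> rcases Int.even_or_odd j with hj | hj <;>
      simp [hi.neg_one_zpow, hj.neg_one_zpow, zpow_mul] <;> abel

/-- The action of `⨁ n, Q n` on doubly infinite sequences of elements of `B`, regarded as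
formal sums `∑ₘ f m T^m`: an element `x ∈ Q n` acts as multiplication by `x T^n`. -/
def laurentAction : F.toDGLA.carrier →ₗ[k] Module.End k (ℤ → B) :=
  DirectSum.toModule k ℤ (Module.End k (ℤ → B)) fun n =>
    { toFun := fun x => LinearMap.pi fun m => LinearMap.mulLeft k (x : B) ∘ₗ LinearMap.proj (m - n)
      map_add' := fun x y => by ext; simp [add_mul]
      map_smul' := fun c x => by ext; simp }

theorem laurentAction_of {n : ℤ} (x : F.Q n) (f : ℤ → B) (m : ℤ) :
    F.laurentAction (F.of n x) f m = (x : B) * f (m - n) := by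
  exact congrFun (LinearMap.congr_fun (F.toModule_of _ x) _) _

theorem laurentAction_apply (x : ⨁ n, F.Q n) (n : ℤ) :
    F.laurentAction x (Pi.single 0 1) n = x n := by
  classical
  induction x using DirectSum.induction_on with
  | zero => exact congrFun (LinearMap.congr_fun (map_zero F.laurentAction) _) _
  | of i x =>
    have := F.laurentAction_of x (Pi.single 0 1) n
    rw [of, DirectSum.lof_eq_of] at this
    rw [this]
    by_cases h : i = n
    · subst h; simp [DirectSum.of_eq_same]
    · rw [DirectSum.of_eq_of_ne _ _ _ (Ne.symm h), Pi.single_eq_of_ne (by omega)]; simp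
  | add x y hx hy =>
    rw [DirectSum.add_apply, Submodule.coe_add, ← hx, ← hy]
    exact congrFun (LinearMap.congr_fun (map_add F.laurentAction x y) _) _

/-- The DG Lie algebra defined by a family of subspaces of an associative algebra embeds in its
enveloping algebra: its action on sequences separates the degrees, hence is faithful. -/
theorem ι_injective : Function.Injective (Env.ι F.toDGLA) := by
  have hr : Env.Respects (L := F.toDGLA) F.laurentAction := by
    rintro i j _ ⟨x, rfl⟩ _ ⟨y, rfl⟩
    change _ = _ + F.laurentAction (F.bracket _ _)
    rw [bracket_of]
    ext f m
    simp only [Module.End.mul_apply, LinearMap.add_apply, LinearMap.smul_apply, Pi.add_apply,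
      Pi.smul_apply, laurentAction_of, superComm_apply, sub_mul, smul_mul_assoc, mul_assoc]
    rw [show m - (i + j) = m - i - j by ring, show m - j - i = m - i - j by ring]
    abel
  intro x y h
  have h1 := congrArg (Env.lift _ hr) h
  rw [Env.lift_ι, Env.lift_ι] at h1
  refine DFinsupp.ext fun n => Subtype.ext ?_
  exact (F.laurentAction_apply x n).symm.trans
    ((congrFun (LinearMap.congr_fun h1 _) _).trans (F.laurentAction_apply y n))

end LieFamily

end LieFamily

/-! ### A DG Lie algebra embeds in its enveloping algebra -/

section Embedding

variable {k : Type u} [Field k]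

/-! #### Free Lie elements of the tensor algebra -/

section Dynkin

variable (L : DGLA k)

/-- The pairs of an iterated graded commutator of length `m` of elements of `L` in the tensor
algebra of `L`, of degree `i`, and of the value of that commutator in `L`. -/
inductive LieWord : ℤ → ℕ → TensorAlgebra k L.carrier → L.carrier → Prop
  | gen {i x} : x ∈ L.gr i → LieWord i 1 (TensorAlgebra.ι k x) x
  | bracket {i j m n u v x y} : LieWord i m u x → LieWord j n v y →
      LieWord (i + j) (m + n) (superComm (k := k) i j u v) (L.bracket x y)

variable {L}

theorem LieWord.mem {i m u x} (h : LieWord L i m u x) : x ∈ L.gr i := by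
  induction h with
  | gen h => exact h
  | bracket _ _ h1 h2 => exact L.bracket_mem h1 h2

theorem LieWord.pos {i m u x} (h : LieWord L i m u x) : m ≠ 0 := by
  induction h with
  | gen h => exact one_ne_zero
  | bracket _ _ h1 h2 => omega

variable (L)

theorem hom_ext_word {N : Type*} [AddCommMonoid N] [Module k N] {f g : (ℕ →₀ L.carrier) × k →ₗ[k] N}
    (h1 : f (0, 1) = g (0, 1))
    (h2 : ∀ n i, ∀ x ∈ L.gr i, f (Finsupp.single n x, 0) = g (Finsupp.single n x, 0)) :
    f = g := by
  refine LinearMap.prod_ext (Finsupp.lhom_ext' fun n => ?_) (LinearMap.ext_ring ?_)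
  · exact DirectSum.decompose_lhom_ext L.gr fun i => LinearMap.ext fun x => h2 n i x x.2
  · exact h1

/-- The action of an element `x` of `L` of length `m` on `L[T] ⊕ k` that sends `(y, c)` to
`([x, y] T^m + c m x T^m, 0)`. -/
def wordMap (m : ℕ) (x : L.carrier) : Module.End k ((ℕ →₀ L.carrier) × k) :=
  LinearMap.inl k _ _ ∘ₗ
    ((Finsupp.lsum k fun n => (Finsupp.lsingle (n + m) : L.carrier →ₗ[k] ℕ →₀ L.carrier) ∘ₗ
        L.bracket x) ∘ₗ LinearMap.fst k _ _ +
      (m : k) • (Finsupp.lsingle m : L.carrier →ₗ[k] ℕ →₀ L.carrier) ∘ₗ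
        LinearMap.toSpanSingleton k _ x ∘ₗ LinearMap.snd k _ _)

theorem wordMap_single (m n : ℕ) (x y : L.carrier) : wordMap L m x (Finsupp.single n y, 0) =
    (Finsupp.single (n + m) (L.bracket x y), 0) := by
  simp [wordMap]

theorem wordMap_one (m : ℕ) (x : L.carrier) : wordMap L m x (0, 1) =
    (Finsupp.single m ((m : k) • x), 0) := by
  simp [wordMap]

/-- The action of elements of `L` of length `m` on `L[T] ⊕ k`, as a linear map. -/
def wordAction (m : ℕ) : L.carrier →ₗ[k] Module.End k ((ℕ →₀ L.carrier) × k) where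
  toFun := wordMap L m
  map_add' x y := hom_ext_word L
    (by rw [LinearMap.add_apply, wordMap_one, wordMap_one, wordMap_one]; simp)
    fun n i z _ => by rw [LinearMap.add_apply, wordMap_single, wordMap_single, wordMap_single]; simp
  map_smul' c x := hom_ext_word L
    (by rw [LinearMap.smul_apply, wordMap_one, wordMap_one]; simp [smul_comm (m : k) c])
    fun n i z _ => by rw [LinearMap.smul_apply, wordMap_single, wordMap_single]; simp

theorem wordAction_single (m n : ℕ) (x y : L.carrier) : wordAction L m x (Finsupp.single n y, 0) =
    (Finsupp.single (n + m) (L.bracket x y), 0) := wordMap_single L m n x y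

theorem wordAction_one (m : ℕ) (x : L.carrier) : wordAction L m x (0, 1) =
    (Finsupp.single m ((m : k) • x), 0) := wordMap_one L m x

/-- The action of the tensor algebra on `L[T] ⊕ k`. -/
def tensorAction : TensorAlgebra k L.carrier →ₐ[k] Module.End k ((ℕ →₀ L.carrier) × k) :=
  TensorAlgebra.lift k (wordAction L 1)

variable {L}

theorem LieWord.tensorAction_eq {i m u x} (h : LieWord L i m u x) :
    tensorAction L u = wordAction L m x := by
  induction h with
  | gen h => exact TensorAlgebra.lift_ι_apply _ _
  | @bracket i j m n u v x y hu hv h1 h2 =>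
    rw [superComm_apply, map_sub, map_smul, map_mul, map_mul, h1, h2]
    refine hom_ext_word L ?_ fun l r z hz => ?_
    · simp only [LinearMap.sub_apply, LinearMap.smul_apply, Module.End.mul_apply, wordAction_one,
        wordAction_single, map_smul]
      rw [L.skew hv.mem hu.mem]
      ext1
      · simp only [Prod.fst_sub, Prod.smul_fst, add_comm n m, Finsupp.smul_single,
          ← Finsupp.single_sub]
        congr 1
        have := neg_one_zpow_mul_self (k := k) (i * j)
        rw [mul_comm j i]
        match_scalars
        linear_combination (m : k) * this
      · simp
    · simp only [LinearMap.sub_apply, LinearMap.smul_apply, Module.End.mul_apply,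
        wordAction_single]
      rw [L.jacobi hu.mem hv.mem]
      ext1
      · simp only [Prod.fst_sub, Prod.smul_fst, Finsupp.smul_single]
        rw [add_right_comm l m n, ← add_assoc l, add_right_comm l n m, ← Finsupp.single_sub]
        congr 1
        abel
      · simp

variable (L)

/-- The Dynkin map from the tensor algebra of `L` to `L`: on a product of `m` elements it is `1/m`
times the iterated bracket. It evaluates iterated commutators. -/
def dynkin : TensorAlgebra k L.carrier →ₗ[k] L.carrier :=
  (Finsupp.lsum k fun m : ℕ => ((m : k)⁻¹ • LinearMap.id : L.carrier →ₗ[k] L.carrier)) ∘ₗ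
    LinearMap.fst k (ℕ →₀ L.carrier) k ∘ₗ
    LinearMap.applyₗ (R := k) ((0 : ℕ →₀ L.carrier), (1 : k)) ∘ₗ (tensorAction L).toLinearMap

theorem dynkin_word [CharZero k] {i m u x} (h : LieWord L i m u x) : dynkin L u = x := by
  have h0 : (m : k) ≠ 0 := Nat.cast_ne_zero.2 h.pos
  simp only [dynkin, LinearMap.comp_apply, AlgHom.toLinearMap_apply, h.tensorAction_eq,
    LinearMap.applyₗ_apply_apply, wordAction_one, LinearMap.fst_apply, Finsupp.lsum_single,
    LinearMap.smul_apply, LinearMap.id_apply]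
  rw [smul_smul, inv_mul_cancel₀ h0, one_smul]

variable [CharZero k]

/-- The free graded Lie algebra on `L`, realized in the tensor algebra of `L`, with zero
differential. -/
def freeFamily : LieFamily k (TensorAlgebra k L.carrier) where
  Q i := Submodule.span k {u | ∃ m x, LieWord L i m u x}
  d := 0
  d_mem _ := zero_mem _
  d_d _ := rfl
  bracket_mem {i j u v} hu hv := by
    induction hu using Submodule.span_induction with
    | zero => rw [map_zero]; exact zero_mem _
    | add a b _ _ ha hb => rw [map_add]; exact add_mem ha hb
    | smul c a _ ha => rw [map_smul]; exact Submodule.smul_mem _ _ ha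
    | mem u hu =>
      obtain ⟨m, x, hu⟩ := hu
      induction hv using Submodule.span_induction with
      | zero => rw [map_zero]; exact zero_mem _
      | add a b _ _ ha hb => rw [map_add]; exact add_mem ha hb
      | smul c a _ ha => rw [map_smul]; exact Submodule.smul_mem _ _ ha
      | mem v hv =>
        obtain ⟨n, y, hv⟩ := hv
        exact Submodule.subset_span ⟨_, _, hu.bracket hv⟩
  leibniz _ _ := by simp

theorem dynkin_mem {i : ℤ} {u : TensorAlgebra k L.carrier} (hu : u ∈ (freeFamily L).Q i) :
    dynkin L u ∈ L.gr i := by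
  induction hu using Submodule.span_induction with
  | zero => rw [map_zero]; exact zero_mem _
  | add a b _ _ ha hb => rw [map_add]; exact add_mem ha hb
  | smul c a _ ha => rw [map_smul]; exact Submodule.smul_mem _ _ ha
  | mem u hu =>
    obtain ⟨m, x, hu⟩ := hu
    rw [dynkin_word L hu]
    exact hu.mem

theorem dynkin_bracket {i j : ℤ} {u v : TensorAlgebra k L.carrier} (hu : u ∈ (freeFamily L).Q i)
    (hv : v ∈ (freeFamily L).Q j) :
    dynkin L (superComm (k := k) i j u v) = L.bracket (dynkin L u) (dynkin L v) := by
  induction hu using Submodule.span_induction with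
  | zero => simp
  | add a b _ _ ha hb => simp only [map_add, LinearMap.add_apply, ha, hb]
  | smul c a _ ha => simp only [map_smul, LinearMap.smul_apply, ha]
  | mem u hu =>
    obtain ⟨m, x, hu⟩ := hu
    induction hv using Submodule.span_induction with
    | zero => simp
    | add a b _ _ ha hb => simp only [map_add, ha, hb]
    | smul c a _ ha => simp only [map_smul, ha]
    | mem v hv =>
      obtain ⟨n, y, hv⟩ := hv
      rw [dynkin_word L hu, dynkin_word L hv, dynkin_word L (hu.bracket hv)]

end Dynkin

/-- The graded Lie algebra `L` with the differential replaced by zero. -/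
abbrev DGLA.zeroDiff (L : DGLA k) : DGLA k where
  carrier := L.carrier
  gr := L.gr
  d := 0
  bracket := L.bracket
  d_mem _ := zero_mem _
  d_d _ := rfl
  bracket_mem := L.bracket_mem
  skew := L.skew
  jacobi := L.jacobi
  leibniz _ _ := by simp

/-- The projection of the free graded Lie algebra on `L` to `L`. -/
def freeProj [CharZero k] (L : DGLA k) : DGLA.Hom (freeFamily L).toDGLA L.zeroDiff where
  toLin := DirectSum.toModule k ℤ L.carrier fun n => dynkin L ∘ₗ ((freeFamily L).Q n).subtype
  map_gr := by
    rintro i _ ⟨x, rfl⟩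
    erw [(freeFamily L).toModule_of]
    exact dynkin_mem L x.2
  map_d x := by
    change _ = 0
    have : (freeFamily L).diff = 0 := (freeFamily L).hom_ext fun n x => by
      rw [LieFamily.diff_of]
      exact map_zero ((freeFamily L).of (n - 1))
    exact (congrArg (DirectSum.toModule k ℤ L.carrier fun n =>
      dynkin L ∘ₗ ((freeFamily L).Q n).subtype) (LinearMap.congr_fun this x)).trans (map_zero _)
  map_bracket x y := by
    let F := freeFamily L
    let φ : (⨁ n, F.Q n) →ₗ[k] L.carrier :=
      DirectSum.toModule k ℤ L.carrier fun n => dynkin L ∘ₗ (F.Q n).subtype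
    refine LinearMap.congr_fun₂ (f := F.bracket.compr₂ φ) (g := L.bracket.compl₁₂ φ φ)
      (F.hom_ext fun i x => F.hom_ext fun j y => ?_) x y
    simp only [LinearMap.compr₂_apply, LinearMap.compl₁₂_apply, F.bracket_of]
    simp only [φ, F.toModule_of]
    exact dynkin_bracket L x.2 y.2

theorem freeProj_of [CharZero k] {L : DGLA k} {n : ℤ} (x : (freeFamily L).Q n) :
    (freeProj L).toLin ((freeFamily L).of n x) = dynkin L x :=
  (freeFamily L).toModule_of _ x

theorem freeProj_surjective_of_mem [CharZero k] {L : DGLA k} {i : ℤ} {x : L.carrier}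
    (hx : x ∈ L.gr i) :
    ∃ y ∈ (freeFamily L).gr i, (freeProj L).toLin y = x :=
  ⟨_, ⟨⟨TensorAlgebra.ι k x, Submodule.subset_span ⟨1, x, .gen hx⟩⟩, rfl⟩,
    (freeProj_of _).trans (dynkin_word L (.gen hx))⟩

/-! #### Quotients of graded Lie algebras -/

theorem decompose_map {M N : Type u} [AddCommGroup M] [Module k M] [AddCommGroup N] [Module k N]
    {gr : ℤ → Submodule k M} [DirectSum.Decomposition gr] {gr' : ℤ → Submodule k N}
    [DirectSum.Decomposition gr'] (f : M →ₗ[k] N) (hf : ∀ {i x}, x ∈ gr i → f x ∈ gr' i)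
    (x : M) (i : ℤ) :
    (DirectSum.decompose gr' (f x) i : N) = f (DirectSum.decompose gr x i) := by
  induction x using DirectSum.Decomposition.inductionOn gr with
  | zero => simp
  | add a b ha hb => simp [DirectSum.decompose_add, ha, hb]
  | @homogeneous j x =>
    by_cases h : j = i
    · subst h
      rw [DirectSum.decompose_of_mem_same gr' (hf x.2), DirectSum.decompose_of_mem_same gr x.2]
    · rw [DirectSum.decompose_of_mem_ne gr' (hf x.2) h, DirectSum.decompose_of_mem_ne gr x.2 h,
        map_zero]

section KernelPair

variable {P L : DGLA k} (π : DGLA.Hom P L)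

/-- The fibre product of `P` with itself over `L`, realized in `U(P) × U(P)`, with zero
differential. -/
def kernelPairFamily : LieFamily k (Env P × Env P) where
  Q n := ((P.gr n).prod (P.gr n) ⊓
      LinearMap.ker (π.toLin ∘ₗ LinearMap.fst k _ _ - π.toLin ∘ₗ LinearMap.snd k _ _)).map
    ((Env.ι P).prodMap (Env.ι P))
  d := 0
  d_mem _ := zero_mem _
  d_d _ := rfl
  bracket_mem := by
    rintro i j _ _ ⟨⟨p, p'⟩, ⟨⟨hp, hp'⟩, h⟩, rfl⟩ ⟨⟨q, q'⟩, ⟨⟨hq, hq'⟩, h'⟩, rfl⟩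
    refine ⟨(P.bracket p q, P.bracket p' q'),
      ⟨⟨P.bracket_mem hp hq, P.bracket_mem hp' hq'⟩, ?_⟩, ?_⟩
    · simp only [SetLike.mem_coe, LinearMap.mem_ker, LinearMap.sub_apply, LinearMap.comp_apply,
        LinearMap.fst_apply, LinearMap.snd_apply, sub_eq_zero] at h h' ⊢
      rw [π.map_bracket, π.map_bracket, h, h']
    · simp only [superComm_apply, LinearMap.prodMap_apply, Prod.mk_mul_mk, Prod.smul_mk,
        Prod.mk_sub_mk]
      rw [Env.ι_mul_ι hp hq, Env.ι_mul_ι hp' hq', add_sub_cancel_left, add_sub_cancel_left]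
  leibniz _ _ := by simp

theorem mem_kernelPair {n : ℤ} {p p' : P.carrier} (hp : p ∈ P.gr n) (hp' : p' ∈ P.gr n)
    (h : π.toLin p = π.toLin p') : (Env.ι P p, Env.ι P p') ∈ (kernelPairFamily π).Q n :=
  ⟨(p, p'), ⟨⟨hp, hp'⟩, by simp [h]⟩, rfl⟩

variable {π}

/-- The morphisms from the fibre product to `P`, for each linear map `e` from `U(P) × U(P)` to
`P` that selects one of the two components. -/
def kernelPairProj (hP : P.d = 0) (e : Env P × Env P →ₗ[k] P.carrier)
    {c : P.carrier × P.carrier →ₗ[k] P.carrier}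
    (hc : ∀ p p', e (Env.ι P p, Env.ι P p') = c (p, p'))
    (h : c = LinearMap.fst k _ _ ∨ c = LinearMap.snd k _ _) :
    DGLA.Hom (kernelPairFamily π).toDGLA P where
  toLin := DirectSum.toModule k ℤ P.carrier fun n => e ∘ₗ ((kernelPairFamily π).Q n).subtype
  map_gr := by
    rintro i _ ⟨⟨_, ⟨p, p'⟩, ⟨⟨hp, hp'⟩, -⟩, rfl⟩, rfl⟩
    erw [(kernelPairFamily π).toModule_of]
    rcases h with rfl | rfl
    · exact (hc p p').symm ▸ hp
    · exact (hc p p').symm ▸ hp'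
  map_d x := by
    rw [hP]
    have : (kernelPairFamily π).diff = 0 := (kernelPairFamily π).hom_ext fun n x => by
      rw [LieFamily.diff_of]
      exact map_zero ((kernelPairFamily π).of (n - 1))
    exact (congrArg (DirectSum.toModule k ℤ P.carrier fun n =>
      e ∘ₗ ((kernelPairFamily π).Q n).subtype) (LinearMap.congr_fun this x)).trans (map_zero _)
  map_bracket x y := by
    let F := kernelPairFamily π
    let φ : (⨁ n, F.Q n) →ₗ[k] P.carrier :=
      DirectSum.toModule k ℤ P.carrier fun n => e ∘ₗ (F.Q n).subtype
    refine LinearMap.congr_fun₂ (f := F.bracket.compr₂ φ) (g := P.bracket.compl₁₂ φ φ)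
      (F.hom_ext fun i x => F.hom_ext fun j y => ?_) x y
    simp only [LinearMap.compr₂_apply, LinearMap.compl₁₂_apply, F.bracket_of]
    simp only [φ, F.toModule_of]
    obtain ⟨_, ⟨p, p'⟩, ⟨⟨hp, hp'⟩, -⟩, rfl⟩ := x
    obtain ⟨_, ⟨q, q'⟩, ⟨⟨hq, hq'⟩, -⟩, rfl⟩ := y
    simp only [LinearMap.comp_apply, Submodule.subtype_apply, superComm_apply,
      LinearMap.prodMap_apply, Prod.mk_mul_mk, Prod.smul_mk, Prod.mk_sub_mk]
    rw [Env.ι_mul_ι hp hq, Env.ι_mul_ι hp' hq', add_sub_cancel_left, add_sub_cancel_left,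
      hc, hc, hc]
    rcases h with rfl | rfl <;> rfl

theorem kernelPairProj_of (hP : P.d = 0) (e : Env P × Env P →ₗ[k] P.carrier)
    {c : P.carrier × P.carrier →ₗ[k] P.carrier}
    (hc : ∀ p p', e (Env.ι P p, Env.ι P p') = c (p, p'))
    (h : c = LinearMap.fst k _ _ ∨ c = LinearMap.snd k _ _) {n : ℤ} (x : (kernelPairFamily π).Q n) :
    (kernelPairProj hP e hc h).toLin ((kernelPairFamily π).of n x) = e x :=
  (kernelPairFamily π).toModule_of _ x

/-- If `P` has zero differential and embeds in `U(P)` then every quotient of `P` embeds in its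
enveloping algebra. Both `P` and the kernel pair of `P → L` satisfy the Poincaré–Birkhoff–Witt
theorem, and `U(L)` is the coequalizer of the enveloping algebras. -/
theorem ι_injective_of_surjective [CharZero k] (hP : P.d = 0) (hι : Function.Injective (Env.ι P))
    (hπ : Function.Surjective π.toLin) : Function.Injective (Env.ι L) := by
  obtain ⟨r, hr⟩ := LinearMap.exists_leftInverse_of_injective (Env.ι P) (LinearMap.ker_eq_bot.2 hι)
  have hr' : ∀ p, r (Env.ι P p) = p := LinearMap.congr_fun hr
  let F := kernelPairFamily π
  let d₀ : DGLA.Hom F.toDGLA P := kernelPairProj hP (r ∘ₗ LinearMap.fst k _ _)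
    (c := LinearMap.fst k _ _) (fun p p' => hr' p) (Or.inl rfl)
  let d₁ : DGLA.Hom F.toDGLA P := kernelPairProj hP (r ∘ₗ LinearMap.snd k _ _)
    (c := LinearMap.snd k _ _) (fun p p' => hr' p') (Or.inr rfl)
  have hpair : ∀ {n : ℤ} {p p' : P.carrier}, p ∈ P.gr n → p' ∈ P.gr n → π.toLin p = π.toLin p' →
      ∃ w : Env F.toDGLA, Env.map d₀ w = Env.ι P p ∧ Env.map d₁ w = Env.ι P p' := by
    intro n p p' hp hp' h
    refine ⟨Env.ι F.toDGLA (F.of n ⟨_, mem_kernelPair π hp hp' h⟩), ?_, ?_⟩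
    · exact (Env.map_ι d₀ _).trans
        (congrArg (Env.ι P) ((kernelPairProj_of _ _ _ _ _).trans (hr' p)))
    · exact (Env.map_ι d₁ _).trans
        (congrArg (Env.ι P) ((kernelPairProj_of _ _ _ _ _).trans (hr' p')))
  let D : Env F.toDGLA →ₗ[k] Env P := (Env.map d₀).toLinearMap - (Env.map d₁).toLinearMap
  have hD : ∀ w, D w = Env.map d₀ w - Env.map d₁ w := fun _ => rfl
  let K : Submodule k (Env P) := LinearMap.range D
  -- every element of `U(P)` lifts to the diagonal, so the image `K` of `D` is a two-sided ideal
  have hdiag : ∀ u : Env P, ∃ w, Env.map d₀ w = u ∧ Env.map d₁ w = u := by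
    intro u
    induction u using Env.induction_left with
    | h1 => exact ⟨1, map_one _, map_one _⟩
    | @hmul i x hx u hu =>
      obtain ⟨w, h0, h1⟩ := hu
      obtain ⟨v, h2, h3⟩ := hpair hx hx rfl
      exact ⟨v * w, by rw [map_mul, h0, h2], by rw [map_mul, h1, h3]⟩
    | hadd a b ha hb =>
      obtain ⟨w, h0, h1⟩ := ha
      obtain ⟨v, h2, h3⟩ := hb
      exact ⟨w + v, by rw [map_add, h0, h2], by rw [map_add, h1, h3]⟩
    | hsmul c a ha =>
      obtain ⟨w, h0, h1⟩ := ha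
      exact ⟨c • w, by rw [map_smul, h0], by rw [map_smul, h1]⟩
  have hl : ∀ u v, v ∈ K → u * v ∈ K := by
    rintro u _ ⟨w, rfl⟩
    obtain ⟨v, h0, h1⟩ := hdiag u
    exact ⟨v * w, by rw [hD, hD, map_mul, map_mul, h0, h1, mul_sub]⟩
  have hrt : ∀ u v, v ∈ K → v * u ∈ K := by
    rintro u _ ⟨w, rfl⟩
    obtain ⟨v, h0, h1⟩ := hdiag u
    exact ⟨w * v, by rw [hD, hD, map_mul, map_mul, h0, h1, sub_mul]⟩
  let c : RingCon (Env P) :=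
    { r := fun a b => a - b ∈ K
      iseqv := ⟨fun a => by rw [sub_self]; exact zero_mem _,
        fun {a b} h => by rw [← neg_sub]; exact neg_mem h,
        fun {a b c} h h' => by rw [← sub_add_sub_cancel]; exact add_mem h h'⟩
      add' := fun {a b c d} h h' => by
        have h : a - b ∈ K := h
        have h' : c - d ∈ K := h'
        change a + c - (b + d) ∈ K
        rw [add_sub_add_comm]; exact add_mem h h'
      mul' := fun {a b c d} h h' => by
        have h : a - b ∈ K := h
        have h' : c - d ∈ K := h'
        change a * c - b * d ∈ K
        have e : a * c - b * d = (a - b) * c + b * (c - d) := by noncomm_ring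
        rw [e]; exact add_mem (hrt _ _ h) (hl _ _ h') }
  have hc : ∀ a b, c.mkₐ (α := k) a = c.mkₐ (α := k) b ↔ a - b ∈ K := fun a b => c.eq
  -- the canonical map of `P` to `U(P) / K` factors through a map `f` from `L`, which respects the
  -- relations of `U(L)`
  have hker : ∀ p p', π.toLin p = π.toLin p' → Env.ι P p - Env.ι P p' ∈ K := by
    classical
    intro p p' h
    rw [← map_sub]
    have h0 : π.toLin (p - p') = 0 := by rw [map_sub, h, sub_self]
    rw [← DirectSum.sum_support_decompose P.gr (p - p'), map_sum]
    refine Submodule.sum_mem _ fun i _ => ?_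
    obtain ⟨w, h1, h2⟩ := hpair (Subtype.prop (DirectSum.decompose P.gr (p - p') i))
      (zero_mem _) (by rw [← decompose_map π.toLin (gr' := L.gr) π.map_gr, h0]; simp)
    exact ⟨w, by rw [hD, h1, h2, map_zero, sub_zero]⟩
  obtain ⟨σ, hσ⟩ := LinearMap.exists_rightInverse_of_surjective π.toLin
    (LinearMap.range_eq_top.2 hπ)
  have hσ' : ∀ x, π.toLin (σ x) = x := LinearMap.congr_fun hσ
  let f : L.carrier →ₗ[k] c.Quotient := (c.mkₐ (α := k)).toLinearMap ∘ₗ Env.ι P ∘ₗ σ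
  have hf : ∀ p, f (π.toLin p) = c.mkₐ (α := k) (Env.ι P p) := fun p =>
    (hc _ _).2 (hker _ _ (hσ' _))
  have hlift : ∀ i, ∀ x ∈ L.gr i, ∃ p ∈ P.gr i, π.toLin p = x := by
    intro i x hx
    obtain ⟨p, rfl⟩ := hπ x
    exact ⟨_, Subtype.prop (DirectSum.decompose P.gr p i), by
      rw [← decompose_map π.toLin (gr' := L.gr) π.map_gr, DirectSum.decompose_of_mem_same _ hx]⟩
  have hres : Env.Respects f := by
    intro i j x hx y hy
    obtain ⟨p, hp, rfl⟩ := hlift i x hx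
    obtain ⟨q, hq, rfl⟩ := hlift j y hy
    rw [← π.map_bracket, hf, hf, hf, ← map_mul (c.mkₐ (α := k)), Env.ι_mul_ι hp hq, map_add,
      map_smul,
      map_mul]
  refine (injective_iff_map_eq_zero _).2 fun y hy => ?_
  obtain ⟨p, rfl⟩ := hπ y
  have h1 : f (π.toLin p) = 0 := by rw [← Env.lift_ι f hres, hy, map_zero]
  rw [hf, ← map_zero (c.mkₐ (α := k)), hc, sub_zero] at h1
  obtain ⟨w, hw⟩ := h1
  -- in terms of symmetric algebras, a generator in the image of `D` is the difference of the two
  -- projections of a generator, hence in the kernel of `P → L`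
  obtain ⟨s, rfl⟩ := Env.pbw_surjective w
  rw [hD, ← Env.pbw_map, ← Env.pbw_map, ← map_sub] at hw
  have h2 : Env.pbw P (Env.ι P.abelian p) = Env.ι P p := by
    have : Env.ι P.abelian p ∈ symPow P 1 := by
      rw [symPow, pow_one]; exact ⟨p, rfl⟩
    rw [Env.pbw_of_mem this, Env.symm_one]
    exact (congrArg (Env.ι P) (Env.pr_ι p))
  have h3 := Env.pbw_injective_of_ι_injective hι (hw.trans h2.symm)
  have h4 := congrArg (Env.pr P) h3
  rw [map_sub, Env.pr_map, Env.pr_map, Env.pr_ι] at h4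
  rw [← h4, map_sub, sub_eq_zero]
  generalize Env.pr F.toDGLA s = z
  refine LinearMap.congr_fun (F.hom_ext (f := π.toLin ∘ₗ d₀.toLin) (g := π.toLin ∘ₗ d₁.toLin)
    fun n x => ?_) z
  obtain ⟨_, ⟨q, q'⟩, ⟨-, h⟩, rfl⟩ := x
  have e0 : ∀ hx, d₀.toLin (F.of n ⟨(Env.ι P q, Env.ι P q'), hx⟩) = q := fun _ =>
    (kernelPairProj_of _ _ _ _ _).trans (hr' q)
  have e1 : ∀ hx, d₁.toLin (F.of n ⟨(Env.ι P q, Env.ι P q'), hx⟩) = q' := fun _ =>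
    (kernelPairProj_of _ _ _ _ _).trans (hr' q')
  refine (congrArg π.toLin (e0 _)).trans (Eq.trans ?_ (congrArg π.toLin (e1 _)).symm)
  simpa [sub_eq_zero] using h

end KernelPair

variable [CharZero k] (L : DGLA k)

theorem Env.ι_injective : Function.Injective (Env.ι L) := by
  have h0 : Function.Surjective (freeProj L).toLin := by
    intro x
    induction x using DirectSum.Decomposition.inductionOn L.gr with
    | zero => exact ⟨0, map_zero _⟩
    | add a b ha hb =>
      obtain ⟨a, rfl⟩ := ha
      obtain ⟨b, rfl⟩ := hb
      exact ⟨a + b, map_add _ _ _⟩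
    | homogeneous x => exact (freeProj_surjective_of_mem x.2).imp fun _ h => h.2
  have h1 : (freeFamily L).toDGLA.d = 0 := (freeFamily L).hom_ext fun n x =>
    ((freeFamily L).diff_of x).trans (map_zero ((freeFamily L).of (n - 1)))
  have h2 := ι_injective_of_surjective h1 (freeFamily L).ι_injective h0
  -- the relations of the enveloping algebra do not involve the differential
  have h3 : Env.Respects (L := L) (Env.ι L.zeroDiff) := fun i j x hx y hy =>
    Env.ι_mul_ι (L := L.zeroDiff) hx hy
  intro x y h
  refine h2 ?_
  have := congrArg (Env.lift _ h3) h
  rwa [Env.lift_ι, Env.lift_ι] at this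

namespace Env

/-- The Poincaré–Birkhoff–Witt theorem. -/
theorem pbw_bijective : Function.Bijective (pbw L) :=
  ⟨pbw_injective_of_ι_injective (ι_injective L), pbw_surjective⟩

end Env

end Embedding

/-! ### Homology of presented complexes -/

namespace PresentedComplex

variable {k : Type u} [Field k] {C D E : PresentedComplex k}

/-- The homology class of a cycle. -/
def mkH (C : PresentedComplex k) (n : ℤ) : C.cycles n →ₗ[k] C.H n :=
  ((C.boundaries n).submoduleOf (C.cycles n)).mkQ

theorem mkH_surjective (n : ℤ) : Function.Surjective (C.mkH n) := Submodule.mkQ_surjective _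

theorem mkH_eq_zero {n : ℤ} {x : C.cycles n} : C.mkH n x = 0 ↔ (x : C.M) ∈ C.boundaries n :=
  Submodule.Quotient.mk_eq_zero _

theorem mkH_eq_iff {n : ℤ} {x y : C.cycles n} :
    C.mkH n x = C.mkH n y ↔ (x : C.M) - y ∈ C.boundaries n := by
  rw [← sub_eq_zero, ← map_sub, mkH_eq_zero]; rfl

theorem rel_le_boundaries (n : ℤ) : C.rel ≤ C.boundaries n := le_sup_right

theorem Hom.map_mem_cycles (f : Hom C D) {n : ℤ} {x : C.M} (hx : x ∈ C.cycles n) :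
    f.toLin x ∈ D.cycles n := by
  refine ⟨f.map_gr hx.1, ?_⟩
  have h := D.rel.sub_mem (f.map_rel hx.2) (f.map_d x)
  simpa using h

theorem Hom.mapH_mkH (f : Hom C D) {n : ℤ} (x : C.cycles n) :
    f.mapH n (C.mkH n x) = D.mkH n ⟨f.toLin x, f.map_mem_cycles x.2⟩ := rfl

theorem Hom.mapH_eq_self {f : Hom C C} {n : ℤ}
    (h : ∀ x ∈ C.cycles n, f.toLin x - x ∈ C.boundaries n) (x : C.H n) : f.mapH n x = x := by
  obtain ⟨x, rfl⟩ := mkH_surjective n x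
  rw [mapH_mkH, mkH_eq_iff]
  exact h x x.2

/-- A chain map is bijective on homology if it is injective and surjective on homology classes of
cycles. -/
theorem Hom.mapH_bijective {f : Hom C D} {n : ℤ}
    (hi : ∀ x ∈ C.cycles n, f.toLin x ∈ D.boundaries n → x ∈ C.boundaries n)
    (hs : ∀ y ∈ D.cycles n, ∃ x ∈ C.cycles n, f.toLin x - y ∈ D.boundaries n) :
    Function.Bijective (f.mapH n) := by
  constructor
  · refine (injective_iff_map_eq_zero _).2 fun x hx => ?_
    obtain ⟨x, rfl⟩ := mkH_surjective n x
    rw [mapH_mkH, mkH_eq_zero] at hx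
    exact mkH_eq_zero.2 (hi x x.2 hx)
  · intro y
    obtain ⟨y, rfl⟩ := mkH_surjective n y
    obtain ⟨x, hx, h⟩ := hs y y.2
    exact ⟨C.mkH n ⟨x, hx⟩, mkH_eq_iff.2 h⟩

theorem Hom.mem_boundaries_of_injective {f : Hom C D} {n : ℤ} (h : Function.Injective (f.mapH n))
    {x : C.M} (hx : x ∈ C.cycles n) (hf : f.toLin x ∈ D.boundaries n) : x ∈ C.boundaries n := by
  refine (mkH_eq_zero (x := ⟨x, hx⟩)).1 (h ?_)
  rw [map_zero, mapH_mkH, mkH_eq_zero]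
  exact hf

theorem Hom.exists_of_surjective {f : Hom C D} {n : ℤ} (h : Function.Surjective (f.mapH n))
    {y : D.M} (hy : y ∈ D.cycles n) : ∃ x ∈ C.cycles n, f.toLin x - y ∈ D.boundaries n := by
  obtain ⟨x, hx⟩ := h (D.mkH n ⟨y, hy⟩)
  obtain ⟨x, rfl⟩ := mkH_surjective n x
  exact ⟨x, x.2, mkH_eq_iff.1 hx⟩

end PresentedComplex

/-! ### The Hodge decomposition of the cyclic functor -/

section Hodge

variable {k : Type u} [Field k] {L : DGLA k}

namespace Env

theorem isDerivation_bracket (L : DGLA k) {m : ℤ} {x : L.carrier} (hx : x ∈ L.gr m) :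
    IsDerivation (L := L) m (L.bracket x) where
  mem hy := add_comm m _ ▸ L.bracket_mem hx hy
  map_bracket hy _ z _ := L.jacobi hx hy z

/-- The adjoint action on the enveloping algebra is given by graded commutators. -/
theorem derivation_bracket {m : ℤ} {x : L.carrier} (hx : x ∈ L.gr m) (u : Env L) :
    derivation (isDerivation_bracket L hx) u = ι L x * u - twist L m u * ι L x := by
  refine LinearMap.congr_fun (hom_ext_left (F := derivation (isDerivation_bracket L hx))
    (G := LinearMap.mulLeft k (ι L x) - LinearMap.mulRight k (ι L x) ∘ₗ (twist L m).toLinearMap)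
    (by simp [derivation_one]) fun {i y} hy u hu => ?_) u
  simp only [LinearMap.sub_apply, LinearMap.mulLeft_apply, LinearMap.comp_apply,
    LinearMap.mulRight_apply, AlgHom.toLinearMap_apply] at hu ⊢
  have h := neg_one_zpow_mul_self (k := k) (m * i)
  rw [derivation_ι_mul _ hy, hu, map_mul, twist_ι hy, mul_sub, ← mul_assoc (ι L x), ι_mul_ι hx hy]
  simp only [add_mul, smul_mul_assoc, mul_assoc, smul_sub]
  abel

theorem ι_mul_sub_mem_commutators {i : ℤ} {x : L.carrier} (hx : x ∈ L.gr i) (u : Env L) :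
    ι L x * u - twist L i u * ι L x ∈ (U L).commutators := by
  induction u using DirectSum.Decomposition.inductionOn (gr L) with
  | zero => simp
  | add a b ha hb =>
    rw [map_add, mul_add, add_mul, add_sub_add_comm]
    exact add_mem ha hb
  | @homogeneous j u =>
    rw [twist_of_mem u.2, smul_mul_assoc]
    exact Submodule.subset_span (Or.inr ⟨i, j, _, ι_mem_gr hx, u, u.2, rfl⟩)

/-- The subspace spanned by `1` and by the commutators with elements of `L`. -/
def adjointSpan (L : DGLA k) : Submodule k (Env L) :=
  Submodule.span k ({1} ∪ {z | ∃ i x, x ∈ L.gr i ∧ ∃ u, z = ι L x * u - twist L i u * ι L x})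

theorem mul_sub_mem_adjointSpan (u : Env L) : ∀ {j : ℤ} {v : Env L}, v ∈ gr L j → ∀ m,
    twist L m u * v - v * twist L j (twist L m u) ∈ adjointSpan L := by
  induction u using induction_left with
  | h1 => intro j v _ m; simp
  | hadd a b ha hb =>
    intro j v hv m
    rw [map_add, map_add, add_mul, mul_add, add_sub_add_comm]
    exact add_mem (ha hv m) (hb hv m)
  | hsmul c a ha =>
    intro j v hv m
    rw [map_smul, map_smul, smul_mul_assoc, mul_smul_comm, ← smul_sub]
    exact Submodule.smul_mem _ _ (ha hv m)
  | @hmul i x hx u hu =>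
    intro j v hv m
    -- `x u v ≡ ± u v x ≡ ± v x u`
    have h1 : ι L x * (twist L m u * v) - twist L i (twist L m u * v) * ι L x ∈ adjointSpan L :=
      Submodule.subset_span (Or.inr ⟨i, x, hx, _, rfl⟩)
    have h2 := hu (SetLike.mul_mem_graded hv (ι_mem_gr hx)) (i + m)
    rw [map_mul, twist_of_mem hv, twist_twist] at h1
    rw [twist_twist] at h2
    have e0 : (twist L (j + i + (i + m))) u = twist L (j + m) u := by
      rw [show j + i + (i + m) = (i + i) + (j + m) by ring, ← twist_twist]
      generalize twist L (j + m) u = w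
      refine LinearMap.congr_fun (hom_ext_of_homogeneous (gr L)
        (f := (twist L (i + i)).toLinearMap) (g := LinearMap.id) fun n u hu => ?_) w
      rw [AlgHom.toLinearMap_apply, twist_of_mem hu, add_mul,
        zpow_add₀ (neg_ne_zero.mpr (one_ne_zero' k)), neg_one_zpow_mul_self, one_smul]
      rfl
    rw [e0] at h2
    have h3 := add_mem h1 (Submodule.smul_mem _ ((-1 : k) ^ (i * j)) h2)
    have h4 := Submodule.smul_mem _ ((-1 : k) ^ (m * i)) h3
    convert! h4 using 1
    simp only [map_mul, twist_ι hx, twist_twist, smul_mul_assoc, mul_smul_comm, map_smul,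
      mul_assoc, smul_sub, smul_add, mul_comm j i]
    abel

/-- Since `L` generates `U(L)`, the commutators with elements of `L` span all commutators. -/
theorem commutators_le_adjointSpan : (U L).commutators ≤ adjointSpan L := by
  refine Submodule.span_le.2 ?_
  rintro _ (rfl | ⟨i, j, u, hu, v, hv, rfl⟩)
  · exact Submodule.subset_span (Or.inl rfl)
  · have := mul_sub_mem_adjointSpan u hv 0
    rwa [twist_zero, twist_of_mem hu, mul_smul_comm, mul_comm j i] at this

theorem symm_d (n : ℕ) (s : Env L.abelian) : symm L n (d L.abelian s) = d L (symm L n s) :=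
  symm_derivation (L := L) (isDerivation_d L.abelian) (isDerivation_d L) n s

theorem symm_mem_commutators {n : ℕ} {z : Env L.abelian} (hz : z ∈ adSpan n L) :
    symm L n z ∈ (U L).commutators := by
  induction hz using Submodule.span_induction with
  | zero => rw [map_zero]; exact zero_mem _
  | add a b _ _ ha hb => rw [map_add]; exact add_mem ha hb
  | smul c a _ ha => rw [map_smul]; exact Submodule.smul_mem _ _ ha
  | mem z hz =>
    obtain ⟨m, x, hx, s, hs, rfl⟩ := hz
    have e : symm L n (ad L hx s) = derivation (isDerivation_bracket L hx) (symm L n s) :=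
      symm_derivation (L := L) (isDerivation_bracketLeft L hx) (isDerivation_bracket L hx) n s
    rw [e, derivation_bracket hx]
    exact ι_mul_sub_mem_commutators hx _

variable [CharZero k]

/-- The component in `Sym^n(L)` of an element of `Sym(L)`. -/
def symComp (L : DGLA k) (n : ℕ) : Env L.abelian →ₗ[k] Env L.abelian :=
  (symPow L n).subtype ∘ₗ DirectSum.component k ℕ (fun n => symPow L n) n ∘ₗ
    (DirectSum.decomposeLinearEquiv (symPow L)).toLinearMap

theorem symComp_mem (n : ℕ) (s : Env L.abelian) : symComp L n s ∈ symPow L n := Subtype.prop _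

theorem symComp_of_mem {n : ℕ} {s : Env L.abelian} (hs : s ∈ symPow L n) : symComp L n s = s :=
  DirectSum.decompose_of_mem_same (symPow L) hs

theorem symComp_of_ne {m n : ℕ} (h : m ≠ n) {s : Env L.abelian} (hs : s ∈ symPow L m) :
    symComp L n s = 0 :=
  DirectSum.decompose_of_mem_ne (symPow L) hs h

theorem symComp_comm {T : Env L.abelian →ₗ[k] Env L.abelian}
    (hT : ∀ n, ∀ s ∈ symPow L n, T s ∈ symPow L n) (n : ℕ) (s : Env L.abelian) :
    symComp L n (T s) = T (symComp L n s) := by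
  refine LinearMap.congr_fun (hom_ext_of_symPow (F := symComp L n ∘ₗ T) (G := T ∘ₗ symComp L n)
    fun m s hs => ?_) s
  rw [LinearMap.comp_apply, LinearMap.comp_apply]
  by_cases h : m = n
  · subst h; rw [symComp_of_mem hs, symComp_of_mem (hT m s hs)]
  · rw [symComp_of_ne h hs, symComp_of_ne h (hT m s hs), map_zero]

/-- The Poincaré–Birkhoff–Witt isomorphism. -/
def pbwEquiv (L : DGLA k) : Env L.abelian ≃ₗ[k] Env L := LinearEquiv.ofBijective _ (pbw_bijective L)

/-- The component in `Sym^n(L)` of the element of `Sym(L)` that corresponds to an element of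
`U(L)`. -/
def pbwComp (L : DGLA k) (n : ℕ) : Env L →ₗ[k] Env L.abelian :=
  symComp L n ∘ₗ (pbwEquiv L).symm.toLinearMap

theorem pbwComp_pbw (n : ℕ) (s : Env L.abelian) : pbwComp L n (pbw L s) = symComp L n s :=
  congrArg (symComp L n) ((pbwEquiv L).symm_apply_apply s)

theorem pbwComp_mem (n : ℕ) (u : Env L) : pbwComp L n u ∈ symPow L n := symComp_mem _ _

theorem pbwComp_symm {n : ℕ} {s : Env L.abelian} (hs : s ∈ symPow L n) :
    pbwComp L n (symm L n s) = s := by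
  rw [← pbw_of_mem hs, pbwComp_pbw, symComp_of_mem hs]

theorem pbwComp_symm_of_ne {m n : ℕ} (h : m ≠ n) (s : Env L.abelian) :
    pbwComp L n (symm L m s) = 0 := by
  have e : symm L m s = pbw L (symComp L m s) := by
    rw [pbw_of_mem (symComp_mem m s)]
    refine LinearMap.congr_fun (hom_ext_of_symPow (F := symm L m) (G := symm L m ∘ₗ symComp L m)
      fun j s hs => ?_) s
    rw [LinearMap.comp_apply]
    by_cases h : j = m
    · subst h; rw [symComp_of_mem hs]
    · rw [symComp_of_ne h hs, symm_of_ne (Ne.symm h) hs, map_zero]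
  rw [e, pbwComp_pbw, symComp_of_ne h (symComp_mem m s)]

theorem exists_sum_pbwComp (u : Env L) : ∃ N, ∀ F : Finset ℕ, Finset.range N ⊆ F →
    ∑ n ∈ F, symm L n (pbwComp L n u) = u := by
  classical
  obtain ⟨s, rfl⟩ := pbw_surjective u
  refine ⟨((DirectSum.decompose (symPow L) s).support.sup id) + 1, fun F hF => ?_⟩
  have h : s = ∑ n ∈ F, symComp L n s := by
    conv_lhs => rw [← DirectSum.sum_support_decompose (symPow L) s]
    refine Finset.sum_subset (fun n hn => hF ?_) fun n _ hn => ?_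
    · rw [Finset.mem_range, Nat.lt_succ_iff]
      exact Finset.le_sup (f := id) hn
    · rw [DFinsupp.notMem_support_iff] at hn
      rw [hn]; rfl
  conv_rhs => rw [h, map_sum]
  exact Finset.sum_congr rfl fun n _ => by rw [pbwComp_pbw, pbw_of_mem (symComp_mem n s)]

/-- Derivations of `U(L)` and `Sym(L)` induced by the same map correspond to each other. -/
theorem pbw_derivation {m : ℤ} {f : L.carrier →ₗ[k] L.carrier}
    (hs : IsDerivation (L := L.abelian) m f) (hf : IsDerivation (L := L) m f) (s : Env L.abelian) :
    pbw L (derivation hs s) = derivation hf (pbw L s) := by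
  refine LinearMap.congr_fun (hom_ext_of_symPow (F := pbw L ∘ₗ derivation hs)
    (G := derivation hf ∘ₗ pbw L) fun n s h => ?_) s
  rw [LinearMap.comp_apply, LinearMap.comp_apply, pbw_of_mem h,
    pbw_of_mem (derivation_ι_pow_mem (L := L.abelian) hs h), symm_derivation]

theorem pbwComp_derivation {m : ℤ} {f : L.carrier →ₗ[k] L.carrier}
    (hs : IsDerivation (L := L.abelian) m f) (hf : IsDerivation (L := L) m f) (n : ℕ) (u : Env L) :
    pbwComp L n (derivation hf u) = derivation hs (pbwComp L n u) := by
  obtain ⟨s, rfl⟩ := pbw_surjective u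
  rw [← pbw_derivation hs, pbwComp_pbw, pbwComp_pbw, symComp_comm]
  exact fun n s h => derivation_ι_pow_mem (L := L.abelian) hs h

theorem pbwComp_mem_gr {i : ℤ} {u : Env L} (hu : u ∈ gr L i) (n : ℕ) :
    pbwComp L n u ∈ gr L.abelian i := by
  rw [mem_gr_iff] at hu ⊢
  have := pbwComp_derivation (L := L) (isDerivation_degree L.abelian) (isDerivation_degree L) n u
  refine this.symm.trans ?_
  rw [← map_smul]
  exact congrArg _ hu

/-- The Poincaré–Birkhoff–Witt isomorphism is equivariant for the adjoint action, which identifies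
the commutators of `U(L)` with the image of that action on `Sym(L)`. -/
theorem pbwComp_mem_adSpan {u : Env L} (hu : u ∈ (U L).commutators) {n : ℕ} (hn : n ≠ 0) :
    pbwComp L n u ∈ adSpan n L := by
  have hu' := commutators_le_adjointSpan hu
  clear hu
  induction hu' using Submodule.span_induction with
  | zero => rw [map_zero]; exact zero_mem _
  | add a b _ _ ha hb => rw [map_add]; exact add_mem ha hb
  | smul c a _ ha => rw [map_smul]; exact Submodule.smul_mem _ _ ha
  | mem z hz =>
    obtain rfl | ⟨i, x, hx, u, rfl⟩ := hz
    · have h : (1 : Env L) = symm L 0 1 := by rw [symm_zero, map_one, map_one]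
      rw [h, pbwComp_symm_of_ne (Ne.symm hn)]
      exact zero_mem _
    · have e : pbwComp L n (derivation (isDerivation_bracket L hx) u) = ad L hx (pbwComp L n u) :=
        pbwComp_derivation (L := L) (isDerivation_bracketLeft L hx) (isDerivation_bracket L hx) n u
      rw [← derivation_bracket hx, e]
      exact Submodule.subset_span ⟨i, x, hx, _, pbwComp_mem n u, rfl⟩

theorem symm_pbwComp_mem_commutators {u : Env L} (hu : u ∈ (U L).commutators) (n : ℕ) :
    symm L n (pbwComp L n u) ∈ (U L).commutators := by
  cases n with
  | zero =>
    rw [symm_zero, Algebra.algebraMap_eq_smul_one]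
    exact Submodule.smul_mem _ _ (Submodule.subset_span (Or.inl rfl))
  | succ n => exact symm_mem_commutators (pbwComp_mem_adSpan hu n.succ_ne_zero)

theorem adams_eq_sum (p : ℕ) {u : Env L} {F : Finset ℕ}
    (h : ∑ n ∈ F, symm L n (pbwComp L n u) = u) :
    adams L p u = ∑ n ∈ F, (p : k) ^ n • symm L n (pbwComp L n u) := by
  conv_lhs => rw [← h, map_sum]
  exact Finset.sum_congr rfl fun n _ => adams_symm _ _ _

theorem pbwComp_d (n : ℕ) (u : Env L) : pbwComp L n (d L u) = d L.abelian (pbwComp L n u) :=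
  pbwComp_derivation (L := L) (isDerivation_d L.abelian) (isDerivation_d L) n u

end Env

variable [CharZero k]

open Env

/-- The chain map of `U(L) / (k + [U(L), U(L)])` induced by the Adams operation. -/
def adamsCyc (p : ℕ) (L : DGLA k) : PresentedComplex.Hom (U L).cyc (U L).cyc where
  toLin := adams L p
  map_gr {n u} hu := by
    obtain ⟨N, hN⟩ := exists_sum_pbwComp u
    rw [adams_eq_sum p (hN _ subset_rfl)]
    exact Submodule.sum_mem _ fun i _ => Submodule.smul_mem _ _
      (symm_mem_gr i (pbwComp_mem_gr hu i))
  map_rel {u} hu := by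
    obtain ⟨N, hN⟩ := exists_sum_pbwComp u
    rw [adams_eq_sum p (hN _ subset_rfl)]
    exact Submodule.sum_mem _ fun i _ =>
      Submodule.smul_mem _ _ (symm_pbwComp_mem_commutators hu i)
  map_d u := by
    refine (U L).cyc.sub_mem_rel ?_
    obtain ⟨N, hN⟩ := exists_sum_pbwComp u
    obtain ⟨N', hN'⟩ := exists_sum_pbwComp (d L u)
    have h1 := hN (Finset.range (max N N')) (by simp)
    have h2 := hN' (Finset.range (max N N')) (by simp)
    change adams L p (d L u) = d L (adams L p u)
    rw [adams_eq_sum p h1, adams_eq_sum p h2, map_sum]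
    exact Finset.sum_congr rfl fun n _ => by rw [map_smul, pbwComp_d, symm_d]

/-- The chain map `λ^(n)(L) → U(L) / (k + [U(L), U(L)])` given by symmetrization. -/
def lamToCyc (n : ℕ) (L : DGLA k) : PresentedComplex.Hom (lam n L) (U L).cyc where
  toLin := symm L n
  map_gr hs := symm_mem_gr n hs.2
  map_rel := symm_mem_commutators
  map_d s := (U L).cyc.sub_mem_rel (symm_d n s)

/-- The chain map `U(L) / (k + [U(L), U(L)]) → λ^(n)(L)` given by the component of degree `n` of
the inverse of symmetrization. -/
def cycToLam {n : ℕ} (hn : n ≠ 0) (L : DGLA k) : PresentedComplex.Hom (U L).cyc (lam n L) where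
  toLin := pbwComp L n
  map_gr hu := ⟨pbwComp_mem n _, pbwComp_mem_gr hu n⟩
  map_rel hu := pbwComp_mem_adSpan hu hn
  map_d u := (lam n L).sub_mem_rel (pbwComp_d n u)

theorem cycToLam_lamToCyc {n : ℕ} (hn : n ≠ 0) (L : DGLA k) (i : ℤ) (x : (lam n L).H i) :
    (cycToLam hn L).mapH i ((lamToCyc n L).mapH i x) = x := by
  obtain ⟨⟨s, hs⟩, rfl⟩ := PresentedComplex.mkH_surjective i x
  rw [PresentedComplex.Hom.mapH_mkH, PresentedComplex.Hom.mapH_mkH]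
  congr 1
  exact Subtype.ext (pbwComp_symm hs.1.1)

theorem cycToLam_lamToCyc_of_ne {m n : ℕ} (hn : n ≠ 0) (h : m ≠ n) (L : DGLA k) (i : ℤ)
    (x : (lam m L).H i) : (cycToLam hn L).mapH i ((lamToCyc m L).mapH i x) = 0 := by
  obtain ⟨x, rfl⟩ := PresentedComplex.mkH_surjective i x
  rw [PresentedComplex.Hom.mapH_mkH, PresentedComplex.Hom.mapH_mkH, PresentedComplex.mkH_eq_zero]
  have : pbwComp L n (symm L m (x : Env L.abelian)) = 0 := pbwComp_symm_of_ne h _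
  change pbwComp L n (symm L m (x : Env L.abelian)) ∈ _
  rw [this]
  exact zero_mem _

/-- The map from the homology of the complexes `λ^(d)(L)` to that of `U(L) / (k + [U(L), U(L)])`. -/
def hodgeMap (L : DGLA k) (i : ℤ) : (⨁ d : ℕ+, (lam (d : ℕ) L).H i) →ₗ[k] (U L).cyc.H i :=
  DirectSum.toModule k ℕ+ _ fun d => (lamToCyc d L).mapH i

theorem hodgeMap_lof (L : DGLA k) (i : ℤ) (d : ℕ+) (x : (lam (d : ℕ) L).H i) :
    hodgeMap L i (DirectSum.lof k ℕ+ (fun d : ℕ+ => (lam (d : ℕ) L).H i) d x) =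
      (lamToCyc d L).mapH i x :=
  DirectSum.toModule_lof k (φ := fun d : ℕ+ => (lamToCyc d L).mapH i) d x

theorem hodgeMap_bijective (L : DGLA k) (i : ℤ) : Function.Bijective (hodgeMap L i) := by
  constructor
  · have key : ∀ (d : ℕ+) (x : ⨁ d : ℕ+, (lam (d : ℕ) L).H i),
        (cycToLam d.ne_zero L).mapH i (hodgeMap L i x) = x d := by
      intro d x
      induction x using DirectSum.induction_on with
      | zero => simp
      | add x y hx hy => rw [map_add, map_add, hx, hy, DirectSum.add_apply]
      | of e x =>
        have h := hodgeMap_lof L i e x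
        rw [DirectSum.lof_eq_of] at h
        rw [h]
        by_cases he : e = d
        · subst he
          rw [cycToLam_lamToCyc, DirectSum.of_eq_same]
        · rw [cycToLam_lamToCyc_of_ne _ fun h => he (PNat.coe_injective h),
            DirectSum.of_eq_of_ne _ _ _ (Ne.symm he)]
    intro x y h
    refine DFinsupp.ext fun d => ?_
    exact (key d x).symm.trans ((congrArg _ h).trans (key d y))
  · intro y
    obtain ⟨u, rfl⟩ := PresentedComplex.mkH_surjective i y
    obtain ⟨N, hN⟩ := exists_sum_pbwComp (u : Env L)
    have hc : ∀ n : ℕ+, pbwComp L n (u : Env L) ∈ (lam (n : ℕ) L).cycles i := fun n =>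
      (cycToLam n.ne_zero L).map_mem_cycles u.2
    let F : Finset ℕ+ := Finset.univ.image fun j : Fin N => j.val.succPNat
    have hF : insert 0 (F.map ⟨fun d : ℕ+ => (d : ℕ), PNat.coe_injective⟩) =
        Finset.range (N + 1) := by
      ext j
      simp only [F, Finset.mem_insert, Finset.mem_map, Finset.mem_image, Finset.mem_univ, true_and,
        Function.Embedding.coeFn_mk, Finset.mem_range]
      constructor
      · rintro (rfl | ⟨_, ⟨j, rfl⟩, rfl⟩)
        · omega
        · have := j.2; simp
      · intro h
        rcases j with - | j
        · exact Or.inl rfl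
        · exact Or.inr ⟨j.succPNat, ⟨⟨j, by omega⟩, rfl⟩, rfl⟩
    have hsum := hN (Finset.range (N + 1)) (by simp)
    rw [← hF, Finset.sum_insert (by simp), Finset.sum_map] at hsum
    refine ⟨∑ d ∈ F, DirectSum.lof k ℕ+ (fun d : ℕ+ => (lam (d : ℕ) L).H i) d
      ((lam (d : ℕ) L).mkH i ⟨_, hc d⟩), ?_⟩
    rw [map_sum]
    have e : ∀ d ∈ F, hodgeMap L i (DirectSum.lof k ℕ+ (fun d : ℕ+ => (lam (d : ℕ) L).H i) d
        ((lam (d : ℕ) L).mkH i ⟨_, hc d⟩)) =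
        (U L).cyc.mkH i ⟨_, (lamToCyc d L).map_mem_cycles (hc d)⟩ := fun d _ => hodgeMap_lof _ _ _ _
    rw [Finset.sum_congr rfl e, ← map_sum, PresentedComplex.mkH_eq_iff,
      AddSubmonoidClass.coe_finsetSum]
    refine PresentedComplex.rel_le_boundaries (C := (U L).cyc) i ?_
    change (∑ d ∈ F, symm L d (pbwComp L d (u : Env L))) - (u : Env L) ∈ (U L).commutators
    have e' : (∑ d ∈ F, symm L d (pbwComp L d (u : Env L))) - (u : Env L) =
        -symm L 0 (pbwComp L 0 (u : Env L)) := by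
      rw [sub_eq_iff_eq_add, eq_neg_add_iff_add_eq]
      exact hsum
    rw [e', symm_zero, Algebra.algebraMap_eq_smul_one]
    exact neg_mem (Submodule.smul_mem _ _ (Submodule.subset_span (Or.inl rfl)))

theorem adamsCyc_lamToCyc (p n : ℕ) (L : DGLA k) (i : ℤ) (x : (lam n L).H i) :
    (adamsCyc p L).mapH i ((lamToCyc n L).mapH i x) = (p : k) ^ n • (lamToCyc n L).mapH i x := by
  obtain ⟨x, rfl⟩ := PresentedComplex.mkH_surjective i x
  rw [PresentedComplex.Hom.mapH_mkH, PresentedComplex.Hom.mapH_mkH, ← map_smul]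
  exact congrArg ((U L).cyc.mkH i) (Subtype.ext (adams_symm p n (x : Env L.abelian)))

theorem lamToCyc_natural {L' : DGLA k} (f : DGLA.Hom L L') (n : ℕ) (x : Env L.abelian) :
    (lamToCyc n L').toLin ((lam.map n f).toLin x) = Env.map f ((lamToCyc n L).toLin x) :=
  symm_map f n x

end Hodge

/-! ### Twisted derivations of free algebras -/

section FreeDerivation

variable {k : Type u} [Field k] {X C : Type u} [Ring C] [Algebra k C]
  (φ ψ : FreeAlgebra k X →ₐ[k] C) (g : X → C)

/-- The algebra map into upper triangular matrices that encodes `freeDerivation` below. -/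
def freeMatrix : FreeAlgebra k X →ₐ[k] Matrix (Fin 2) (Fin 2) C :=
  FreeAlgebra.lift k fun t => !![φ (FreeAlgebra.ι k t), g t; 0, ψ (FreeAlgebra.ι k t)]

theorem freeMatrix_apply (u : FreeAlgebra k X) :
    freeMatrix φ ψ g u 0 0 = φ u ∧ freeMatrix φ ψ g u 1 0 = 0 ∧ freeMatrix φ ψ g u 1 1 = ψ u := by
  induction u using FreeAlgebra.induction with
  | grade0 r => simp [Matrix.algebraMap_matrix_apply]
  | grade1 x => rw [freeMatrix, FreeAlgebra.lift_ι_apply]; simp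
  | mul a b ha hb => simp [Matrix.mul_apply, Fin.sum_univ_two, ha, hb]
  | add a b ha hb => simp [ha, hb]

/-- The linear map `D` from a free algebra with prescribed values on the generators such that
`D (u v) = D u * ψ v + φ u * D v`. -/
def freeDerivation : FreeAlgebra k X →ₗ[k] C where
  toFun u := freeMatrix φ ψ g u 0 1
  map_add' u v := by simp
  map_smul' c u := by simp

theorem freeDerivation_ι (t : X) : freeDerivation φ ψ g (FreeAlgebra.ι k t) = g t := by
  change freeMatrix φ ψ g _ 0 1 = _
  rw [freeMatrix, FreeAlgebra.lift_ι_apply]; simp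

theorem freeDerivation_mul (u v : FreeAlgebra k X) : freeDerivation φ ψ g (u * v) =
    freeDerivation φ ψ g u * ψ v + φ u * freeDerivation φ ψ g v := by
  change freeMatrix φ ψ g (u * v) 0 1 = freeMatrix φ ψ g u 0 1 * ψ v + φ u * freeMatrix φ ψ g v 0 1
  rw [map_mul, Matrix.mul_apply, Fin.sum_univ_two, (freeMatrix_apply φ ψ g u).1,
    (freeMatrix_apply φ ψ g v).2.2, add_comm]

end FreeDerivation

/-! ### Existence of cofibrant resolutions -/

section Resolution

variable {k : Type u} [Field k]

/-- Acyclic fibrations have the lifting property for the inclusion of the boundary of a cell. -/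
theorem DGLA.Hom.exists_fill {X Y : DGLA k} {p : DGLA.Hom X Y} (hp : Function.Surjective p.toLin)
    (hq : p.IsQuasiIso) {n : ℤ} {x : X.carrier} (hx : x ∈ X.gr (n - 1)) (hdx : X.d x = 0)
    {y : Y.carrier} (hy : y ∈ Y.gr n) (h : p.toLin x = Y.d y) :
    ∃ x' ∈ X.gr n, X.d x' = x ∧ p.toLin x' = y := by
  have hlift : ∀ i, ∀ y ∈ Y.gr i, ∃ x ∈ X.gr i, p.toLin x = y := by
    intro i y hy
    obtain ⟨x, rfl⟩ := hp y
    exact ⟨_, Subtype.prop (DirectSum.decompose X.gr x i), by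
      rw [← decompose_map p.toLin (gr' := Y.gr) p.map_gr, DirectSum.decompose_of_mem_same _ hy]⟩
  have h1 : x ∈ X.cx.boundaries (n - 1) := by
    refine PresentedComplex.Hom.mem_boundaries_of_injective (hq (n - 1)).1 ⟨hx, hdx⟩ ?_
    refine Submodule.mem_sup_left ⟨y, ?_, h.symm⟩
    rw [sub_add_cancel]; exact hy
  obtain ⟨_, ⟨x₁, hx₁, rfl⟩, r, hr, h2⟩ := Submodule.mem_sup.1 h1
  rw [(Submodule.mem_bot k).1 hr, add_zero] at h2
  rw [sub_add_cancel] at hx₁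
  have h3 : y - p.toLin x₁ ∈ Y.cx.cycles n := by
    refine ⟨sub_mem hy (p.map_gr hx₁), ?_⟩
    change Y.d (y - p.toLin x₁) = 0
    rw [map_sub, ← p.map_d, h2, h, sub_self]
  obtain ⟨c, hc, h4⟩ := PresentedComplex.Hom.exists_of_surjective (hq n).2 h3
  obtain ⟨_, ⟨y₂, hy₂, rfl⟩, r, hr, h5⟩ := Submodule.mem_sup.1 h4
  rw [(Submodule.mem_bot k).1 hr, add_zero] at h5
  obtain ⟨x₂, hx₂, rfl⟩ := hlift _ y₂ hy₂
  have hdc : X.d c = 0 := hc.2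
  have h6 : X.d x₂ ∈ X.gr n := by
    have := X.d_mem hx₂
    rwa [add_sub_cancel_right] at this
  refine ⟨x₁ + c - X.d x₂, sub_mem (add_mem hx₁ hc.1) h6, ?_, ?_⟩
  · rw [map_sub, map_add, hdc, X.d_d, add_zero, sub_zero, h2]
  · have h7 : p.toLin c - (y - p.toLin x₁) = Y.d (p.toLin x₂) := h5.symm
    rw [map_sub, map_add, p.map_d, ← h7]
    abel

/-- Terms for the elements of a cofibrant resolution. A term `cell n z w` stands for a free
generator of degree `n` with boundary `z` that is mapped to `w`. -/
inductive CellTerm (k V : Type u) : Type u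
  | cell : ℤ → CellTerm k V → V → CellTerm k V
  | zero : CellTerm k V
  | add : CellTerm k V → CellTerm k V → CellTerm k V
  | smul : k → CellTerm k V → CellTerm k V
  | bracket : ℤ → ℤ → CellTerm k V → CellTerm k V → CellTerm k V

namespace CellTerm

section Eval

variable {V : Type u}

/-- The value of a term in the free algebra on all terms. -/
def eval : CellTerm k V → FreeAlgebra k (CellTerm k V)
  | cell n z w => FreeAlgebra.ι k (cell n z w)
  | zero => 0
  | add s t => eval s + eval t
  | smul c t => c • eval t
  | bracket i j s t => superComm (k := k) i j (eval s) (eval t)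

/-- The automorphism of the free algebra that multiplies cells of degree `n` by `(-1)^n`. -/
def sign : FreeAlgebra k (CellTerm k V) →ₐ[k] FreeAlgebra k (CellTerm k V) :=
  FreeAlgebra.lift k fun
    | cell n z w => (-1 : k) ^ n • FreeAlgebra.ι k (cell n z w)
    | t => FreeAlgebra.ι k t

/-- The boundary of a generator. -/
def boundary : CellTerm k V → FreeAlgebra k (CellTerm k V)
  | cell _ z _ => eval z
  | _ => 0

/-- The differential of the free algebra. -/
def diff : FreeAlgebra k (CellTerm k V) →ₗ[k] FreeAlgebra k (CellTerm k V) :=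
  freeDerivation sign (AlgHom.id k _) boundary

theorem diff_cell (n : ℤ) (z : CellTerm k V) (w : V) : diff (eval (cell n z w)) = eval z :=
  freeDerivation_ι _ _ _ _

theorem diff_mul (u v : FreeAlgebra k (CellTerm k V)) : diff (u * v) =
    diff u * v + sign u * diff v :=
  freeDerivation_mul _ _ _ _ _

end Eval

variable {a : DGLA k}

/-- The map to `U(a)` that sends `cell n z w` to `w`. -/
def toEnv (a : DGLA k) : FreeAlgebra k (CellTerm k a.carrier) →ₐ[k] Env a :=
  FreeAlgebra.lift k fun
    | cell _ _ w => Env.ι a w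
    | _ => 0

/-- A term is well formed of degree `n` if its cells are attached along cycles and are mapped to
chains that bound the images of those cycles. -/
def WF (a : DGLA k) : ℤ → CellTerm k a.carrier → Prop
  | n, cell m z w => m = n ∧ WF a (n - 1) z ∧ diff (eval z) = 0 ∧ w ∈ a.gr n ∧
      toEnv a (eval z) = Env.ι a (a.d w)
  | _, zero => True
  | n, add s t => WF a n s ∧ WF a n t
  | n, smul _ t => WF a n t
  | n, bracket i j s t => i + j = n ∧ WF a i s ∧ WF a j t

theorem WF.sign {t : CellTerm k a.carrier} : ∀ {n : ℤ}, WF a n t →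
    CellTerm.sign (eval t) = (-1 : k) ^ n • eval t := by
  induction t with
  | cell m z w _ =>
    rintro n ⟨rfl, -⟩
    exact FreeAlgebra.lift_ι_apply _ _
  | zero => intro n _; simp [eval]
  | add s t hs ht => intro n h; rw [eval, map_add, hs h.1, ht h.2, smul_add]
  | smul c t ht => intro n h; rw [eval, map_smul, ht h, smul_comm]
  | bracket i j s t hs ht =>
    rintro n ⟨rfl, h1, h2⟩
    rw [eval, superComm_apply, map_sub, map_smul, map_mul, map_mul, hs h1, ht h2,
      smul_mul_smul_comm, smul_mul_smul_comm, zpow_add₀ (neg_ne_zero.mpr (one_ne_zero' k)),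
      smul_sub, mul_comm ((-1 : k) ^ j), smul_comm]

/-- The differential of a graded commutator. -/
theorem diff_superComm {i j : ℤ} {s t : CellTerm k a.carrier} (hs : WF a i s) (ht : WF a j t) :
    diff (superComm (k := k) i j (eval s) (eval t)) =
      superComm (k := k) (i - 1) j (diff (eval s)) (eval t) +
        (-1 : k) ^ i • superComm (k := k) i (j - 1) (eval s) (diff (eval t)) := by
  have h0 : (-1 : k) ≠ 0 := neg_ne_zero.mpr one_ne_zero
  rw [superComm_apply, superComm_apply, superComm_apply, map_sub, map_smul, diff_mul, diff_mul,
    hs.sign, ht.sign, sub_mul, mul_sub, one_mul, mul_one, zpow_sub₀ h0, zpow_sub₀ h0]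
  rcases Int.even_or_odd i with hi | hi <;> rcases Int.even_or_odd j with hj | hj <;>
    simp [hi.neg_one_zpow, hj.neg_one_zpow, zpow_mul] <;> abel

theorem WF.exists_diff {t : CellTerm k a.carrier} : ∀ {n : ℤ}, WF a n t →
    ∃ s, WF a (n - 1) s ∧ diff (eval t) = eval s := by
  induction t with
  | cell m z w _ =>
    rintro n ⟨rfl, h, -⟩
    exact ⟨z, h, diff_cell _ _ _⟩
  | zero => intro n _; exact ⟨zero, trivial, map_zero _⟩
  | add s t hs ht =>
    intro n h
    obtain ⟨s', h1, h2⟩ := hs h.1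
    obtain ⟨t', h3, h4⟩ := ht h.2
    exact ⟨add s' t', ⟨h1, h3⟩, by rw [eval, map_add, h2, h4, eval]⟩
  | smul c t ht =>
    intro n h
    obtain ⟨t', h1, h2⟩ := ht h
    exact ⟨smul c t', h1, by rw [eval, map_smul, h2, eval]⟩
  | bracket i j s t hs ht =>
    rintro n ⟨rfl, h1, h2⟩
    obtain ⟨s', h3, h4⟩ := hs h1
    obtain ⟨t', h5, h6⟩ := ht h2
    refine ⟨add (bracket (i - 1) j s' t) (smul ((-1) ^ i) (bracket i (j - 1) s t')),
      ⟨⟨by ring, h3, h2⟩, ⟨by ring, h1, h5⟩⟩, ?_⟩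
    simp only [eval]
    rw [diff_superComm h1 h2, h4, h6]

theorem WF.diff_diff {t : CellTerm k a.carrier} : ∀ {n : ℤ}, WF a n t → diff (diff (eval t)) =
    0 := by
  induction t with
  | cell m z w _ =>
    rintro n ⟨rfl, -, h, -⟩
    rw [diff_cell, h]
  | zero => intro n _; simp [eval]
  | add s t hs ht => intro n h; rw [eval, map_add, map_add, hs h.1, ht h.2, add_zero]
  | smul c t ht => intro n h; rw [eval, map_smul, map_smul, ht h, smul_zero]
  | bracket i j s t hs ht =>
    rintro n ⟨rfl, h1, h2⟩
    obtain ⟨s', h3, h4⟩ := h1.exists_diff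
    obtain ⟨t', h5, h6⟩ := h2.exists_diff
    rw [eval, diff_superComm h1 h2, map_add, map_smul, h4, h6, diff_superComm h3 h2,
      diff_superComm h1 h5, ← h4, ← h6, hs h1, ht h2]
    rw [zpow_sub₀ (neg_ne_zero.mpr (one_ne_zero' k))]
    simp [div_neg]

theorem WF.exists_toEnv {t : CellTerm k a.carrier} : ∀ {n : ℤ}, WF a n t →
    ∃ y ∈ a.gr n, toEnv a (eval t) = Env.ι a y ∧ toEnv a (diff (eval t)) = Env.ι a (a.d y) := by
  induction t with
  | cell m z w _ =>
    rintro n ⟨rfl, -, -, h1, h2⟩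
    exact ⟨w, h1, FreeAlgebra.lift_ι_apply _ _, by rw [diff_cell, h2]⟩
  | zero => intro n _; exact ⟨0, zero_mem _, by simp [eval], by simp [eval]⟩
  | add s t hs ht =>
    intro n h
    obtain ⟨y, h1, h2, h3⟩ := hs h.1
    obtain ⟨y', h4, h5, h6⟩ := ht h.2
    exact ⟨y + y', add_mem h1 h4, by rw [eval, map_add, map_add, h2, h5],
      by rw [eval, map_add, map_add, h3, h6, map_add, map_add]⟩
  | smul c t ht =>
    intro n h
    obtain ⟨y, h1, h2, h3⟩ := ht h
    exact ⟨c • y, Submodule.smul_mem _ _ h1, by rw [eval, map_smul, map_smul, h2],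
      by rw [eval, map_smul, map_smul, h3, map_smul, map_smul]⟩
  | bracket i j s t hs ht =>
    rintro n ⟨rfl, h1, h2⟩
    obtain ⟨y, h3, h4, h5⟩ := hs h1
    obtain ⟨y', h6, h7, h8⟩ := ht h2
    refine ⟨a.bracket y y', a.bracket_mem h3 h6, ?_, ?_⟩
    · rw [eval, superComm_apply, map_sub, map_smul, map_mul, map_mul, h4, h7, Env.ι_mul_ι h3 h6,
        add_sub_cancel_left]
    · rw [eval, diff_superComm h1 h2, superComm_apply, superComm_apply, map_add, map_smul, map_sub,
        map_sub, map_smul, map_smul, map_mul, map_mul, map_mul, map_mul, h4, h7, h5, h8,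
        Env.ι_mul_ι (a.d_mem h3) h6, Env.ι_mul_ι h3 (a.d_mem h6), add_sub_cancel_left,
        add_sub_cancel_left, a.leibniz h3, map_add, map_smul]

/-- The DG Lie algebra of values of well-formed terms, as a family of subspaces of a free
algebra. -/
def family (a : DGLA k) : LieFamily k (FreeAlgebra k (CellTerm k a.carrier)) where
  Q n :=
    { carrier := {u | ∃ t, WF a n t ∧ eval t = u}
      zero_mem' := ⟨zero, trivial, rfl⟩
      add_mem' := by
        rintro _ _ ⟨s, hs, rfl⟩ ⟨t, ht, rfl⟩
        exact ⟨add s t, ⟨hs, ht⟩, rfl⟩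
      smul_mem' := by
        rintro c _ ⟨t, ht, rfl⟩
        exact ⟨smul c t, ht, rfl⟩ }
  d := diff
  d_mem := by
    rintro i _ ⟨t, ht, rfl⟩
    obtain ⟨s, hs, h⟩ := ht.exists_diff
    exact ⟨s, hs, h.symm⟩
  d_d := by
    rintro i _ ⟨t, ht, rfl⟩
    exact ht.diff_diff
  bracket_mem := by
    rintro i j _ _ ⟨s, hs, rfl⟩ ⟨t, ht, rfl⟩
    exact ⟨bracket i j s t, ⟨rfl, hs, ht⟩, rfl⟩
  leibniz := by
    rintro i j _ y ⟨s, hs, rfl⟩ -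
    rw [diff_mul, hs.sign, smul_mul_assoc]

/-- The underlying DG Lie algebra of the cellular resolution of `a`. -/
abbrev cellular (a : DGLA k) : DGLA k := (family a).toDGLA

/-- The element of `cellular a` given by a well-formed term. -/
def mk {n : ℤ} {t : CellTerm k a.carrier} (ht : WF a n t) : (cellular a).carrier :=
  (family a).of n ⟨eval t, t, ht, rfl⟩

theorem mk_mem {n : ℤ} {t : CellTerm k a.carrier} (ht : WF a n t) : mk ht ∈ (cellular a).gr n :=
  ⟨_, rfl⟩

theorem exists_mk {n : ℤ} {x : (cellular a).carrier} (hx : x ∈ (cellular a).gr n) :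
    ∃ t, ∃ ht : WF a n t, x = mk ht := by
  obtain ⟨⟨_, t, ht, rfl⟩, rfl⟩ := hx
  exact ⟨t, ht, rfl⟩

theorem mk_d {n : ℤ} {s t : CellTerm k a.carrier} (ht : WF a n t) (hs : WF a (n - 1) s)
    (h : diff (eval t) = eval s) : (cellular a).d (mk ht) = mk hs :=
  ((family a).diff_of _).trans ((family a).of_congr rfl _ _ h)

theorem mk_add {n : ℤ} {s t : CellTerm k a.carrier} (hs : WF a n s) (ht : WF a n t) :
    mk (t := add s t) ⟨hs, ht⟩ = mk hs + mk ht :=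
  (map_add ((family a).of n) _ _).symm ▸ rfl

theorem mk_smul {n : ℤ} (c : k) {t : CellTerm k a.carrier} (ht : WF a n t) :
    mk (n := n) (t := smul c t) ht = c • mk ht :=
  (map_smul ((family a).of n) _ _).symm ▸ rfl

theorem mk_zero (n : ℤ) : mk (a := a) (n := n) (t := zero) trivial = 0 :=
  map_zero ((family a).of n)

theorem mk_bracket {i j n : ℤ} (h : i + j = n) {s t : CellTerm k a.carrier} (hs : WF a i s)
    (ht : WF a j t) :
    mk (n := n) (t := bracket i j s t) ⟨h, hs, ht⟩ = (cellular a).bracket (mk hs) (mk ht) := by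
  subst h
  exact ((family a).bracket_of ⟨eval s, s, hs, rfl⟩ ⟨eval t, t, ht, rfl⟩).symm

theorem hom_ext_mk {N : Type*} [AddCommGroup N] [Module k N] {f g : (cellular a).carrier →ₗ[k] N}
    (h : ∀ n t (ht : WF a n t), f (mk ht) = g (mk ht)) : f = g :=
  (family a).hom_ext fun n ⟨_, t, ht, e⟩ => by subst e; exact h n t ht

/-- A linear map from the cellular resolution given by an algebra map from the free algebra to an
enveloping algebra. -/
theorem exists_hom [CharZero k] {X : DGLA k} (H : FreeAlgebra k (CellTerm k a.carrier) →ₐ[k] Env X)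
    (hH : ∀ n t, WF a n t → ∃ y ∈ X.gr n, H (eval t) = Env.ι X y ∧
      H (diff (eval t)) = Env.ι X (X.d y)) :
    ∃ f : DGLA.Hom (cellular a) X, ∀ n t (ht : WF a n t), Env.ι X (f.toLin (mk ht)) =
        H (eval t) := by
  obtain ⟨r, hr⟩ := LinearMap.exists_leftInverse_of_injective (Env.ι X)
    (LinearMap.ker_eq_bot.2 (Env.ι_injective X))
  have hr' : ∀ y, r (Env.ι X y) = y := LinearMap.congr_fun hr
  let φ : (cellular a).carrier →ₗ[k] X.carrier := DirectSum.toModule k ℤ X.carrier fun n =>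
    r ∘ₗ H.toLinearMap ∘ₗ ((family a).Q n).subtype
  have hφ : ∀ {n t} (ht : WF a n t), φ (mk ht) = r (H (eval t)) := fun ht =>
    (family a).toModule_of _ _
  have hφ' : ∀ {n t} (ht : WF a n t) {y}, H (eval t) = Env.ι X y → φ (mk ht) = y :=
    fun ht y h => by rw [hφ ht, h, hr']
  refine ⟨⟨φ, fun {n x} hx => ?_, fun x => ?_, fun x y => ?_⟩, fun n t ht => ?_⟩
  · obtain ⟨t, ht, rfl⟩ := exists_mk hx
    obtain ⟨y, hy, h, -⟩ := hH n t ht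
    rwa [hφ' ht h]
  · refine LinearMap.congr_fun (hom_ext_mk (f := φ ∘ₗ (cellular a).d) (g := X.d ∘ₗ φ)
      fun n t ht => ?_) x
    obtain ⟨y, hy, h1, h2⟩ := hH n t ht
    obtain ⟨s, hs, h3⟩ := ht.exists_diff
    rw [LinearMap.comp_apply, LinearMap.comp_apply, mk_d ht hs h3, hφ' ht h1]
    exact hφ' hs (by rw [← h3, h2])
  · refine LinearMap.congr_fun₂ (f := (cellular a).bracket.compr₂ φ) (g := X.bracket.compl₁₂ φ φ)
      (hom_ext_mk fun i s hs => hom_ext_mk fun j t ht => ?_) x y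
    obtain ⟨y, hy, h1, -⟩ := hH i s hs
    obtain ⟨z, hz, h2, -⟩ := hH j t ht
    rw [LinearMap.compr₂_apply, LinearMap.compl₁₂_apply, hφ' hs h1, hφ' ht h2,
      ← mk_bracket rfl hs ht]
    refine hφ' (t := bracket i j s t) _ ?_
    rw [eval, superComm_apply, map_sub, map_smul, map_mul, map_mul, h1, h2, Env.ι_mul_ι hy hz,
      add_sub_cancel_left]
  · obtain ⟨y, hy, h1, -⟩ := hH n t ht
    change Env.ι X (φ (mk ht)) = _
    rw [hφ' ht h1, h1]

theorem WF_cell_zero {n : ℤ} {w : a.carrier} (hw : w ∈ a.gr n) (h : a.d w = 0) :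
    WF a n (cell n zero w) :=
  ⟨rfl, trivial, map_zero _, hw, by rw [h]; simp [eval]⟩

variable [CharZero k]

/-- The projection of the cellular resolution. -/
def proj (a : DGLA k) : DGLA.Hom (cellular a) a :=
  (exists_hom (toEnv a) fun _ _ ht => ht.exists_toEnv).choose

theorem ι_proj {n : ℤ} {t : CellTerm k a.carrier} (ht : WF a n t) :
    Env.ι a ((proj a).toLin (mk ht)) = toEnv a (eval t) :=
  (exists_hom (toEnv a) fun _ _ ht => ht.exists_toEnv).choose_spec n t ht

theorem proj_cell {n : ℤ} {z : CellTerm k a.carrier} {w : a.carrier} (ht : WF a n (cell n z w)) :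
    (proj a).toLin (mk ht) = w :=
  Env.ι_injective a ((ι_proj ht).trans (FreeAlgebra.lift_ι_apply _ _))

theorem proj_surjective (a : DGLA k) : Function.Surjective (proj a).toLin := by
  intro w
  induction w using DirectSum.Decomposition.inductionOn a.gr with
  | zero => exact ⟨0, map_zero _⟩
  | add a b ha hb =>
    obtain ⟨a, rfl⟩ := ha
    obtain ⟨b, rfl⟩ := hb
    exact ⟨a + b, map_add _ _ _⟩
  | @homogeneous n w =>
    -- a cell over `w`, attached along a cell without boundary over `d w`
    have h1 : WF a (n - 1) (cell (n - 1) zero (a.d w)) := WF_cell_zero (a.d_mem w.2) (a.d_d _)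
    have h2 : WF a n (cell n (cell (n - 1) zero (a.d w)) w) :=
      ⟨rfl, h1, diff_cell _ _ _, w.2, FreeAlgebra.lift_ι_apply _ _⟩
    exact ⟨mk h2, proj_cell h2⟩

theorem proj_isQuasiIso (a : DGLA k) : (proj a).IsQuasiIso := by
  intro n
  refine PresentedComplex.Hom.mapH_bijective (fun x hx h => ?_) fun w hw => ?_
  · obtain ⟨t, ht, rfl⟩ := exists_mk hx.1
    obtain ⟨_, ⟨w, hw, rfl⟩, r, hr, h1⟩ := Submodule.mem_sup.1 h
    rw [(Submodule.mem_bot k).1 hr, add_zero] at h1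
    have h1 : a.d w = (proj a).toLin (mk ht) := h1
    -- a cell attached along a cycle over the boundary `d w` bounds that cycle
    have h2 : WF a (n + 1) (cell (n + 1) t w) := by
      refine ⟨rfl, by rwa [add_sub_cancel_right], ?_, hw, by rw [h1, ι_proj]⟩
      obtain ⟨s, hs, e⟩ := ht.exists_diff
      have h3 : (cellular a).d (mk ht) = 0 := hx.2
      rw [mk_d ht hs e] at h3
      have h4 := DirectSum.of_injective (β := fun n => (family a).Q n) (n - 1)
        (show _ = DirectSum.of (fun n => (family a).Q n) (n - 1) 0 from h3.trans (map_zero _).symm)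
      rw [e]
      exact congrArg Subtype.val h4
    refine Submodule.mem_sup_left ⟨mk h2, mk_mem h2, ?_⟩
    have ht' : WF a (n + 1 - 1) t := by rwa [add_sub_cancel_right]
    refine (mk_d h2 ht' (diff_cell _ _ _)).trans ?_
    exact (family a).of_congr (add_sub_cancel_right n 1) _ _ rfl
  · have h : a.d w = 0 := hw.2
    have h1 := WF_cell_zero hw.1 h
    refine ⟨mk h1, ⟨mk_mem h1, ?_⟩, ?_⟩
    · change (cellular a).d (mk h1) = 0
      rw [mk_d h1 (s := zero) trivial (diff_cell _ _ _), mk_zero]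
    · have : (proj a).cx.toLin (mk h1) = w := proj_cell h1
      rw [this, sub_self]
      exact zero_mem _

section Lifting

variable {X Y : DGLA k} (p : DGLA.Hom X Y) (g : DGLA.Hom (cellular a) Y)

open Classical in
/-- The values of a lift of `g` along `p` on the cells of the resolution, constructed by recursion
on terms: the value on a cell is any filler of the value on its boundary. -/
def lift : CellTerm k a.carrier → X.carrier
  | cell n z w => if h : ∃ x ∈ X.gr n, X.d x = lift z ∧ ∀ ht : WF a n (cell n z w),
      p.toLin x = g.toLin (mk ht) then h.choose else 0
  | zero => 0
  | add s t => lift s + lift t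
  | smul c t => c • lift t
  | bracket _ _ s t => X.bracket (lift s) (lift t)

/-- The algebra map from the free algebra given by the lift. -/
def liftHom : FreeAlgebra k (CellTerm k a.carrier) →ₐ[k] Env X :=
  FreeAlgebra.lift k fun t => Env.ι X (lift p g t)

variable {p}

theorem lift_spec (hp : Function.Surjective p.toLin) (hq : p.IsQuasiIso)
    {t : CellTerm k a.carrier} :
    ∀ {n : ℤ} (ht : WF a n t), lift p g t ∈ X.gr n ∧ p.toLin (lift p g t) = g.toLin (mk ht) ∧
      liftHom p g (eval t) = Env.ι X (lift p g t) ∧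
      liftHom p g (diff (eval t)) = Env.ι X (X.d (lift p g t)) := by
  induction t with
  | cell m z w hz =>
    intro n ht
    obtain ⟨rfl, h1, h2, h3, h4⟩ := ht
    obtain ⟨h5, h6, h7, h8⟩ := hz h1
    have hdz : X.d (lift p g z) = 0 := Env.ι_injective X (by rw [← h8, h2, map_zero, map_zero])
    have hex : ∃ x ∈ X.gr m, X.d x = lift p g z ∧ ∀ ht : WF a m (cell m z w),
        p.toLin x = g.toLin (mk ht) := by
      have ht : WF a m (cell m z w) := ⟨rfl, h1, h2, h3, h4⟩
      obtain ⟨x, hx, e1, e2⟩ := DGLA.Hom.exists_fill hp hq h5 hdz (g.map_gr (mk_mem ht)) (by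
        rw [h6, ← g.map_d, mk_d ht h1 (diff_cell _ _ _)])
      exact ⟨x, hx, e1, fun _ => e2⟩
    have e : lift p g (cell m z w) = hex.choose := by rw [lift, dif_pos hex]
    obtain ⟨hx, e1, e2⟩ := hex.choose_spec
    rw [← e] at hx e1 e2
    refine ⟨hx, e2 _, FreeAlgebra.lift_ι_apply _ _, ?_⟩
    rw [diff_cell, h7, e1]
  | zero =>
    intro n ht
    refine ⟨zero_mem _, ?_, by simp [eval, lift], by simp [eval, lift]⟩
    rw [mk_zero, lift, map_zero, map_zero]
  | add s t hs ht =>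
    rintro n ⟨h1, h2⟩
    obtain ⟨a1, a2, a3, a4⟩ := hs h1
    obtain ⟨b1, b2, b3, b4⟩ := ht h2
    refine ⟨add_mem a1 b1, ?_, ?_, ?_⟩
    · rw [lift, map_add, a2, b2, ← map_add, ← mk_add]
    · rw [eval, lift, map_add, map_add, a3, b3]
    · rw [eval, lift, map_add, map_add, a4, b4, map_add, map_add]
  | smul c t ht =>
    intro n (h : WF a n t)
    obtain ⟨b1, b2, b3, b4⟩ := ht h
    refine ⟨Submodule.smul_mem _ _ b1, ?_, ?_, ?_⟩
    · rw [lift, map_smul, b2, ← map_smul]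
      exact congrArg g.toLin (mk_smul c h).symm
    · rw [eval, lift, map_smul, map_smul, b3]
    · rw [eval, lift, map_smul, map_smul, b4, map_smul, map_smul]
  | bracket i j s t hs ht =>
    rintro n ⟨h0, h1, h2⟩
    obtain ⟨a1, a2, a3, a4⟩ := hs h1
    obtain ⟨b1, b2, b3, b4⟩ := ht h2
    refine ⟨h0 ▸ X.bracket_mem a1 b1, ?_, ?_, ?_⟩
    · rw [lift, p.map_bracket, a2, b2, mk_bracket h0 h1 h2, g.map_bracket]
    · rw [eval, lift, superComm_apply, map_sub, map_smul, map_mul, map_mul, a3, b3,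
        Env.ι_mul_ι a1 b1, add_sub_cancel_left]
    · rw [eval, diff_superComm h1 h2, superComm_apply, superComm_apply, map_add, map_smul, map_sub,
        map_sub, map_smul, map_smul, map_mul, map_mul, map_mul, map_mul, a3, b3, a4, b4,
        Env.ι_mul_ι (X.d_mem a1) b1, Env.ι_mul_ι a1 (X.d_mem b1), add_sub_cancel_left,
        add_sub_cancel_left, lift, X.leibniz a1, map_add, map_smul]

end Lifting

theorem cellular_isCofibrant (a : DGLA k) : (cellular a).IsCofibrant := by
  intro X Y p hp hq g
  obtain ⟨f, hf⟩ := exists_hom (liftHom p g) fun n t ht =>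
    ⟨_, (lift_spec g hp hq ht).1, (lift_spec g hp hq ht).2.2⟩
  refine ⟨f, hom_ext_mk fun n t ht => ?_⟩
  have : f.toLin (mk ht) = lift p g t :=
    Env.ι_injective X ((hf n t ht).trans (lift_spec g hp hq ht).2.2.1)
  rw [LinearMap.comp_apply, this, (lift_spec g hp hq ht).2.1]

end CellTerm

variable [CharZero k]

/-- The cellular resolution of a DG Lie algebra. -/
def cellularResolution (a : DGLA k) : a.CofibrantResolution where
  L := CellTerm.cellular a
  cofibrant := CellTerm.cellular_isCofibrant a
  q := CellTerm.proj a
  quasiIso := CellTerm.proj_isQuasiIso a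

end Resolution

/-! ### Signs of DG algebras -/

section Sign

variable {k : Type u} [Field k]

theorem exists_neg_one_pow (i : ℤ) : ∃ p : ℕ, (-1 : k) ^ i = (-1) ^ p := by
  rcases Int.even_or_odd i with h | h
  · exact ⟨0, by simp [h.neg_one_zpow]⟩
  · exact ⟨1, by simp [h.neg_one_zpow]⟩

theorem neg_one_pow_mul_self (n : ℕ) : (-1 : k) ^ n * (-1 : k) ^ n = 1 := by
  rw [← mul_pow]; simp

section Involution

variable {C : Type*} [Ring C] [Algebra k C] (s : C →ₐ[k] C)

theorem pow_apply_of_eigen {v : C} {c : k} (h : s v = c • v) (p : ℕ) : (s ^ p) v = c ^ p • v := by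
  induction p with
  | zero => simp
  | succ p ih =>
    rw [pow_succ, AlgHom.mul_apply, h, map_smul, ih, smul_smul, pow_succ, mul_comm]

theorem pow_succ_apply' (p : ℕ) (v : C) : (s ^ (p + 1)) v = s ((s ^ p) v) := by
  rw [pow_succ', AlgHom.mul_apply]

theorem pow_succ_apply (p : ℕ) (v : C) : (s ^ (p + 1)) v = (s ^ p) (s v) := by
  rw [pow_succ, AlgHom.mul_apply]

variable {s}

theorem pow_add_two_apply (hs : ∀ x, s (s x) = x) (p : ℕ) (v : C) : (s ^ (p + 2)) v =
    (s ^ p) v := by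
  rw [pow_succ_apply, pow_succ_apply, hs]

theorem pow_pow_apply (hs : ∀ x, s (s x) = x) (p : ℕ) (v : C) : (s ^ p) ((s ^ p) v) = v := by
  induction p generalizing v with
  | zero => simp
  | succ p ih => rw [pow_succ_apply s p ((s ^ (p + 1)) v), pow_succ_apply' s p v, hs, ih]

/-- Every element is the sum of an even and an odd one. -/
theorem exists_even_add_odd [CharZero k] (hs : ∀ x, s (s x) = x) (x : C) :
    ∃ y z, s y = y ∧ s z = -z ∧ x = y + z := by
  refine ⟨(2⁻¹ : k) • (x + s x), (2⁻¹ : k) • (x - s x), ?_, ?_, ?_⟩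
  · rw [map_smul, map_add, hs, add_comm]
  · rw [map_smul, map_sub, hs, ← smul_neg, neg_sub]
  · rw [← smul_add, add_add_sub_cancel, ← two_smul k x, smul_smul, inv_mul_cancel₀ two_ne_zero,
      one_smul]

end Involution

namespace DGA

variable (A : DGA k)

/-- The involution of a DG algebra that acts on homogeneous elements of degree `i` by `(-1)^i`. -/
def sign : A.carrier →ₐ[k] A.carrier :=
  AlgHom.ofLinearMap (degreewise A.gr fun m => (-1) ^ m)
    (by rw [degreewise_of_mem A.gr _ (SetLike.GradedOne.one_mem (A := A.gr))]; simp)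
    (by
      intro x y
      refine LinearMap.congr_fun (hom_ext_of_homogeneous A.gr
        (f := degreewise A.gr (fun m => (-1 : k) ^ m) ∘ₗ LinearMap.mulRight k y)
        (g := LinearMap.mulRight k (degreewise A.gr (fun m => (-1 : k) ^ m) y) ∘ₗ
          degreewise A.gr (fun m => (-1 : k) ^ m)) fun i x hx => ?_) x
      refine LinearMap.congr_fun (hom_ext_of_homogeneous A.gr
        (f := degreewise A.gr (fun m => (-1 : k) ^ m) ∘ₗ LinearMap.mulLeft k x)
        (g := LinearMap.mulLeft k (degreewise A.gr (fun m => (-1 : k) ^ m) x) ∘ₗ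
          degreewise A.gr (fun m => (-1 : k) ^ m)) fun j y hy => ?_) y
      simp only [LinearMap.comp_apply, LinearMap.mulLeft_apply, degreewise_of_mem A.gr _ hx,
        degreewise_of_mem A.gr _ hy, degreewise_of_mem A.gr _ (SetLike.mul_mem_graded hx hy),
        smul_mul_smul_comm, zpow_add₀ (neg_ne_zero.mpr (one_ne_zero' k))])

variable {A}

theorem sign_of_mem {i : ℤ} {x : A.carrier} (hx : x ∈ A.gr i) : A.sign x = (-1 : k) ^ i • x :=
  degreewise_of_mem A.gr _ hx

theorem sign_mem {i : ℤ} {x : A.carrier} (hx : x ∈ A.gr i) : A.sign x ∈ A.gr i := by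
  rw [sign_of_mem hx]; exact Submodule.smul_mem _ _ hx

theorem sign_pow_mem {i : ℤ} {x : A.carrier} (hx : x ∈ A.gr i) (p : ℕ) :
    (A.sign ^ p) x ∈ A.gr i := by
  rw [pow_apply_of_eigen _ (sign_of_mem hx)]; exact Submodule.smul_mem _ _ hx

theorem sign_sign (x : A.carrier) : A.sign (A.sign x) = x := by
  refine LinearMap.congr_fun (hom_ext_of_homogeneous A.gr
    (f := A.sign.toLinearMap ∘ₗ A.sign.toLinearMap) (g := LinearMap.id) fun i x hx => ?_) x
  simp only [LinearMap.comp_apply, AlgHom.toLinearMap_apply, sign_of_mem hx, map_smul, smul_smul,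
    neg_one_zpow_mul_self, one_smul, LinearMap.id_apply]

theorem sign_d (x : A.carrier) : A.sign (A.d x) = -A.d (A.sign x) := by
  refine LinearMap.congr_fun (hom_ext_of_homogeneous A.gr
    (f := A.sign.toLinearMap ∘ₗ A.d) (g := -(A.d ∘ₗ A.sign.toLinearMap)) fun i x hx => ?_) x
  simp only [LinearMap.comp_apply, AlgHom.toLinearMap_apply, sign_of_mem hx, map_smul,
    sign_of_mem (A.d_mem hx), LinearMap.neg_apply, zpow_sub₀ (neg_ne_zero.mpr (one_ne_zero' k))]
  simp [div_neg]

theorem d_mul (x y : A.carrier) : A.d (x * y) = A.d x * y + A.sign x * A.d y := by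
  refine LinearMap.congr_fun (hom_ext_of_homogeneous A.gr
    (f := A.d ∘ₗ LinearMap.mulRight k y)
    (g := LinearMap.mulRight k y ∘ₗ A.d + LinearMap.mulRight k (A.d y) ∘ₗ A.sign.toLinearMap)
    fun i x hx => ?_) x
  simp only [LinearMap.comp_apply, LinearMap.mulRight_apply, AlgHom.toLinearMap_apply,
    LinearMap.add_apply, sign_of_mem hx, smul_mul_assoc, A.leibniz hx]

theorem sign_pow_d (n : ℕ) (x : A.carrier) :
    (A.sign ^ n) (A.d x) = (-1 : k) ^ n • A.d ((A.sign ^ n) x) := by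
  induction n with
  | zero => simp
  | succ n ih => rw [pow_succ_apply', pow_succ_apply', ih, map_smul, sign_d, pow_succ]; simp

theorem comm_mem_commutators {p : ℕ} {a : A.carrier} (ha : A.sign a = (-1 : k) ^ p • a)
    (x : A.carrier) : a * x - (A.sign ^ p) x * a ∈ A.commutators := by
  have key : ∀ i, ∀ x ∈ A.gr i, ∀ (q : ℕ), (-1 : k) ^ i = (-1) ^ q → ∀ a : A.carrier,
      a * x - x * (A.sign ^ q) a ∈ A.commutators := by
    intro i x hx q hq a
    induction a using DirectSum.Decomposition.inductionOn A.gr with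
    | zero => simp
    | add a b ha hb => rw [map_add, mul_add, add_mul, add_sub_add_comm]; exact add_mem ha hb
    | @homogeneous l a =>
      rw [pow_apply_of_eigen _ (sign_of_mem a.2), mul_smul_comm]
      refine Submodule.subset_span (Or.inr ⟨l, i, a, a.2, x, hx, ?_⟩)
      have e : (((-1 : k) ^ l) ^ i) = ((-1 : k) ^ l) ^ q := by
        rcases Int.even_or_odd l with hl | hl
        · simp [hl.neg_one_zpow]
        · rw [hl.neg_one_zpow, hq]
      rw [zpow_mul, e]
  induction x using DirectSum.Decomposition.inductionOn A.gr with
  | zero => simp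
  | add x y hx hy => rw [map_add, mul_add, add_mul, add_sub_add_comm]; exact add_mem hx hy
  | @homogeneous i x =>
    obtain ⟨q, hq⟩ := exists_neg_one_pow (k := k) i
    have h := key i x x.2 q hq a
    rw [pow_apply_of_eigen _ ha, mul_smul_comm] at h
    rwa [pow_apply_of_eigen _ (sign_of_mem x.2), hq, smul_mul_assoc, ← pow_mul, mul_comm q, pow_mul]

end DGA

end Sign

/-! ### The algebra obtained by adjoining a contraction of the unit -/

section Bar

variable {k : Type u} [Field k] (A : DGA k)

/-- The defining relations of the free product of `A` with the polynomial algebra in one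
variable: the tensor algebra on `A × k` modulo the relations of `A`. -/
inductive BarRel : TensorAlgebra k (A.carrier × k) → TensorAlgebra k (A.carrier × k) → Prop
  | mul (a b : A.carrier) : BarRel (TensorAlgebra.ι k (a, 0) * TensorAlgebra.ι k (b, 0))
      (TensorAlgebra.ι k (a * b, 0))
  | one : BarRel (TensorAlgebra.ι k (1, 0)) 1

/-- The free product `A * k[ε]`, which becomes an acyclic DG algebra with `d ε = 1`. The products
`a₀ ε a₁ ε ⋯ aₙ ε` represent the chains `a₀ ⊗ ⋯ ⊗ aₙ` of the Connes complex. -/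
def Bar : Type u := RingQuot (BarRel A)

namespace Bar

instance : Ring (Bar A) := inferInstanceAs (Ring (RingQuot (BarRel A)))
instance : Algebra k (Bar A) := inferInstanceAs (Algebra k (RingQuot (BarRel A)))

/-- The quotient map from the tensor algebra. -/
def mk : TensorAlgebra k (A.carrier × k) →ₐ[k] Bar A := RingQuot.mkAlgHom k (BarRel A)

/-- The inclusion of `A`. -/
def j : A.carrier →ₐ[k] Bar A :=
  AlgHom.ofLinearMap ((mk A).toLinearMap ∘ₗ TensorAlgebra.ι k ∘ₗ LinearMap.inl k A.carrier k)
    ((RingQuot.mkAlgHom_rel k (BarRel.one (A := A))).trans (map_one _))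
    (fun a b => ((RingQuot.mkAlgHom_rel k (BarRel.mul (A := A) a b)).symm.trans (map_mul _ _ _)))

/-- The adjoined variable. -/
def ε : Bar A := mk A (TensorAlgebra.ι k (0, 1))

variable {A}

/-- The universal property of the free product. -/
def lift {C : Type u} [Ring C] [Algebra k C] (f : A.carrier →ₐ[k] C) (e : C) : Bar A →ₐ[k] C :=
  RingQuot.liftAlgHom k ⟨TensorAlgebra.lift k
    (f.toLinearMap.coprod (LinearMap.toSpanSingleton k C e)), by
      rintro _ _ (⟨a, b⟩ | _) <;> simp⟩

theorem lift_mk {C : Type u} [Ring C] [Algebra k C] (f : A.carrier →ₐ[k] C) (e : C)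
    (x : A.carrier × k) : lift f e (mk A (TensorAlgebra.ι k x)) = f x.1 + x.2 • e :=
  (RingQuot.liftAlgHom_mkAlgHom_apply k _ _ _).trans
    ((TensorAlgebra.lift_ι_apply _ _).trans (by simp))

@[simp] theorem lift_j {C : Type u} [Ring C] [Algebra k C] (f : A.carrier →ₐ[k] C) (e : C)
    (a : A.carrier) : lift f e (j A a) = f a :=
  (lift_mk f e (a, 0)).trans (by simp)

@[simp] theorem lift_ε {C : Type u} [Ring C] [Algebra k C] (f : A.carrier →ₐ[k] C) (e : C) :
    lift f e (ε A) = e :=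
  (lift_mk f e (0, 1)).trans (by simp)

theorem mk_ι (x : A.carrier × k) : mk A (TensorAlgebra.ι k x) = j A x.1 + x.2 • ε A := by
  have h : x = (x.1, 0) + x.2 • ((0, 1) : A.carrier × k) := by ext <;> simp
  conv_lhs => rw [h, map_add, map_add, map_smul, map_smul]
  rfl

theorem induction_left {P : Bar A → Prop} (h1 : P 1) (hj : ∀ a u, P u → P (j A a * u))
    (hε : ∀ u, P u → P (ε A * u)) (hadd : ∀ u v, P u → P v → P (u + v))
    (hsmul : ∀ (c : k) u, P u → P (c • u)) (u : Bar A) : P u := by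
  suffices h : ∀ v, P v → P (u * v) by simpa using h 1 h1
  obtain ⟨t, rfl⟩ : ∃ t, mk A t = u := RingQuot.mkAlgHom_surjective k (BarRel A) u
  induction t using TensorAlgebra.induction with
  | algebraMap r => intro v hv; rw [AlgHom.commutes, ← Algebra.smul_def]; exact hsmul r v hv
  | ι x =>
    intro v hv
    rw [mk_ι, add_mul, smul_mul_assoc]
    exact hadd _ _ (hj _ _ hv) (hsmul _ _ (hε _ hv))
  | mul a b ha hb => intro v hv; rw [map_mul, mul_assoc]; exact ha _ (hb v hv)
  | add a b ha hb => intro v hv; rw [map_add, add_mul]; exact hadd _ _ (ha v hv) (hb v hv)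

theorem algHom_ext {C : Type u} [Ring C] [Algebra k C] {f g : Bar A →ₐ[k] C}
    (h : ∀ a, f (j A a) = g (j A a)) (hε : f (ε A) = g (ε A)) : f = g := by
  refine AlgHom.ext fun u => ?_
  induction u using induction_left with
  | h1 => simp
  | hj a u hu => rw [map_mul, map_mul, h, hu]
  | hε u hu => rw [map_mul, map_mul, hε, hu]
  | hadd u v hu hv => rw [map_add, map_add, hu, hv]
  | hsmul c u hu => rw [map_smul, map_smul, hu]

variable (A)

/-- The parity involution, for which `ε` is odd. -/
def sign : Bar A →ₐ[k] Bar A := lift ((j A).comp A.sign) (-ε A)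

variable {A}

@[simp] theorem sign_j (a : A.carrier) : sign A (j A a) = j A (A.sign a) := lift_j _ _ _
@[simp] theorem sign_ε : sign A (ε A) = -ε A := lift_ε _ _

theorem sign_sign (u : Bar A) : sign A (sign A u) = u := by
  refine AlgHom.congr_fun (algHom_ext (f := (sign A).comp (sign A)) (g := AlgHom.id k _)
    (fun a => ?_) ?_) u
  · simp [DGA.sign_sign]
  · simp

theorem sign_pow_j (p : ℕ) (a : A.carrier) : (sign A ^ p) (j A a) = j A ((A.sign ^ p) a) := by
  induction p with
  | zero => simp
  | succ p ih => rw [pow_succ_apply', pow_succ_apply', ih, sign_j]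

/-- An odd derivation of `A` with values in `A * k[ε]`. -/
def IsOddDerivation (F : A.carrier →ₗ[k] Bar A) : Prop :=
  ∀ a b, F (a * b) = F a * j A b + j A (A.sign a) * F b

section Derivation

variable {F : A.carrier →ₗ[k] Bar A} (hF : IsOddDerivation F) (e : Bar A)

theorem IsOddDerivation.map_one (hF : IsOddDerivation F) : F 1 = 0 := by
  simpa using hF 1 1

/-- The algebra map into upper triangular matrices that encodes `derivation` below. -/
def derivationMatrix : Bar A →ₐ[k] Matrix (Fin 2) (Fin 2) (Bar A) :=
  lift (AlgHom.ofLinearMap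
    { toFun := fun a => !![j A (A.sign a), F a; 0, j A a]
      map_add' := fun x y => by ext a b; fin_cases a <;> fin_cases b <;> simp
      map_smul' := fun c x => by ext a b; fin_cases a <;> fin_cases b <;> simp }
    (by ext a b; fin_cases a <;> fin_cases b <;> simp [hF.map_one])
    (fun x y => by
      ext a b
      fin_cases a <;> fin_cases b <;> simp [Matrix.mul_apply, Fin.sum_univ_two, hF x y, add_comm]))
    !![-ε A, e; 0, ε A]

theorem derivationMatrix_j (a : A.carrier) :
    derivationMatrix hF e (j A a) = !![j A (A.sign a), F a; 0, j A a] := lift_j _ _ _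

theorem derivationMatrix_ε : derivationMatrix hF e (ε A) = !![-ε A, e; 0, ε A] := lift_ε _ _

theorem derivationMatrix_apply (u : Bar A) :
    derivationMatrix hF e u 0 0 = sign A u ∧ derivationMatrix hF e u 1 0 = 0 ∧
      derivationMatrix hF e u 1 1 = u := by
  induction u using induction_left with
  | h1 => simp
  | hj a u hu => simp [derivationMatrix_j, Matrix.mul_apply, Fin.sum_univ_two, hu]
  | hε u hu => simp [derivationMatrix_ε, Matrix.mul_apply, Fin.sum_univ_two, hu]
  | hadd u v hu hv => simp [hu, hv]
  | hsmul c u hu => simp [hu]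

/-- The odd derivation of `A * k[ε]` that extends an odd derivation of `A` and has the value `e`
at `ε`. -/
def derivation : Bar A →ₗ[k] Bar A where
  toFun u := derivationMatrix hF e u 0 1
  map_add' u v := by simp
  map_smul' c u := by simp

theorem derivation_j (a : A.carrier) : derivation hF e (j A a) = F a := by
  change derivationMatrix hF e (j A a) 0 1 = _
  rw [derivationMatrix_j]; simp

theorem derivation_ε : derivation hF e (ε A) = e := by
  change derivationMatrix hF e (ε A) 0 1 = _
  rw [derivationMatrix_ε]; simp

theorem derivation_mul (u v : Bar A) :
    derivation hF e (u * v) = derivation hF e u * v + sign A u * derivation hF e v := by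
  change derivationMatrix hF e (u * v) 0 1 =
    derivationMatrix hF e u 0 1 * v + sign A u * derivationMatrix hF e v 0 1
  rw [map_mul, Matrix.mul_apply, Fin.sum_univ_two, (derivationMatrix_apply hF e u).1,
    (derivationMatrix_apply hF e v).2.2, add_comm]

theorem derivation_one : derivation hF e 1 = 0 := by
  simpa using derivation_mul hF e 1 1

/-- An odd derivation that anticommutes with the parity involution on generators does so
everywhere. -/
theorem derivation_sign (h : ∀ a, F (A.sign a) = -sign A (F a)) (he : sign A e = e) (u : Bar A) :
    derivation hF e (sign A u) = -sign A (derivation hF e u) := by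
  induction u using induction_left with
  | h1 => simp [derivation_one]
  | hj a u hu =>
    simp only [map_mul, derivation_mul, map_add, sign_j, derivation_j, h, hu]
    simp only [DGA.sign_sign, neg_mul, mul_neg, neg_add]
  | hε u hu =>
    simp only [map_mul, derivation_mul, map_add, sign_ε, derivation_ε, he, hu, map_neg]
    simp only [neg_mul, mul_neg, neg_add]
  | hadd u v hu hv => rw [map_add, map_add, map_add, map_add, hu, hv, neg_add]
  | hsmul c u hu => rw [map_smul, map_smul, map_smul, map_smul, hu, smul_neg]

end Derivation

variable (A)

theorem isOddDerivation_d : IsOddDerivation ((j A).toLinearMap ∘ₗ A.d) := by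
  intro a b
  simp [DGA.d_mul]

/-- The differential of `A * k[ε]`, for which `d ε = 1`. -/
def d : Bar A →ₗ[k] Bar A := derivation (isOddDerivation_d A) 1

variable {A}

@[simp] theorem d_j (a : A.carrier) : d A (j A a) = j A (A.d a) := derivation_j _ _ _

@[simp] theorem d_ε : d A (ε A) = 1 := derivation_ε _ _

theorem d_mul (u v : Bar A) : d A (u * v) = d A u * v + sign A u * d A v := derivation_mul _ _ _ _

theorem d_one : d A 1 = 0 := derivation_one _ _

theorem d_sign (u : Bar A) : d A (sign A u) = -sign A (d A u) :=
  derivation_sign _ _ (fun a => by simp [DGA.sign_d]) (map_one _) u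

theorem d_d (u : Bar A) : d A (d A u) = 0 := by
  induction u using induction_left with
  | h1 => rw [d_one, map_zero]
  | hj a u hu =>
    simp only [d_mul, map_add, d_j, hu, sign_j, A.d_d, map_zero, DGA.sign_d, map_neg]
    simp
  | hε u hu =>
    simp only [d_mul, map_add, hu, sign_ε, d_ε, d_one, map_neg, map_one]
    simp
  | hadd u v hu hv => rw [map_add, map_add, hu, hv, add_zero]
  | hsmul c u hu => rw [map_smul, map_smul, hu, smul_zero]

/-! ### The relations of the Connes complex -/

variable (A)

/-- The subspace of `A * k[ε]` by which one has to divide to obtain the cone of the map from the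
reduced Connes complex of `A` to `A / (k + [A, A])`: it is spanned by `1`, `ε`, the graded
commutators, and the multiples of `ε²`. -/
def rel : Submodule k (Bar A) :=
  Submodule.span k ({1, ε A} ∪
    {z | ∃ (p : ℕ) (v x : Bar A), sign A v = (-1 : k) ^ p • v ∧ z = v * x - (sign A ^ p) x * v} ∪
    {z | ∃ x, z = x * (ε A * ε A)})

variable {A}

theorem one_mem_rel : (1 : Bar A) ∈ rel A := Submodule.subset_span (Or.inl (Or.inl (Or.inl rfl)))

theorem ε_mem_rel : ε A ∈ rel A := Submodule.subset_span (Or.inl (Or.inl (Or.inr rfl)))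

theorem comm_mem_rel {p : ℕ} {v : Bar A} (hv : sign A v = (-1 : k) ^ p • v) (x : Bar A) :
    v * x - (sign A ^ p) x * v ∈ rel A :=
  Submodule.subset_span (Or.inl (Or.inr ⟨p, v, x, hv, rfl⟩))

theorem comm_mem_rel' {p : ℕ} {v : Bar A} (hv : sign A v = (-1 : k) ^ p • v) (x : Bar A) :
    x * v - v * (sign A ^ p) x ∈ rel A := by
  have := (rel A).neg_mem (comm_mem_rel hv ((sign A ^ p) x))
  rwa [pow_pow_apply sign_sign, neg_sub] at this

theorem mul_ε_ε_mem_rel (x : Bar A) : x * (ε A * ε A) ∈ rel A :=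
  Submodule.subset_span (Or.inr ⟨x, rfl⟩)

theorem mul_ε_ε_mul_mem_rel [CharZero k] (x y : Bar A) : x * (ε A * ε A) * y ∈ rel A := by
  obtain ⟨y, z, hy, hz, rfl⟩ := exists_even_add_odd sign_sign y
  have key : ∀ (p : ℕ) (v : Bar A), sign A v = (-1 : k) ^ p • v →
      x * (ε A * ε A) * v ∈ rel A := by
    intro p v hv
    have h := comm_mem_rel' hv (x * (ε A * ε A))
    have e : (sign A ^ p) (ε A * ε A) = ε A * ε A := by
      rw [pow_apply_of_eigen (c := 1)] <;> simp
    rw [map_mul, e, ← mul_assoc v] at h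
    exact (Submodule.sub_mem_iff_left _ (mul_ε_ε_mem_rel _)).1 h
  rw [mul_add]
  exact add_mem (key 0 y (by simpa using hy)) (key 1 z (by simpa using hz))

/-- Odd derivations that are compatible with the relations `ε = 0` and `ε² = 0` preserve the
relations. -/
theorem derivation_mem_rel [CharZero k] {F : A.carrier →ₗ[k] Bar A} (hF : IsOddDerivation F)
    {e : Bar A} (he : e ∈ rel A) (heε : e * ε A = ε A * e)
    (hs : ∀ u, derivation hF e (sign A u) = -sign A (derivation hF e u)) {u : Bar A}
    (hu : u ∈ rel A) : derivation hF e u ∈ rel A := by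
  have hs' : ∀ (p : ℕ) u, derivation hF e ((sign A ^ p) u) =
      (-1 : k) ^ p • (sign A ^ p) (derivation hF e u) := by
    intro p u
    induction p with
    | zero => simp
    | succ p ih => rw [pow_succ_apply', hs, ih, map_smul, pow_succ_apply', pow_succ]; simp
  induction hu using Submodule.span_induction with
  | zero => rw [map_zero]; exact zero_mem _
  | add x y _ _ hx hy => rw [map_add]; exact add_mem hx hy
  | smul c x _ hx => rw [map_smul]; exact Submodule.smul_mem _ _ hx
  | mem z hz =>
    rcases hz with ((rfl | rfl) | ⟨p, v, x, hv, rfl⟩) | ⟨x, rfl⟩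
    · rw [derivation_one]; exact zero_mem _
    · rwa [derivation_ε]
    · have h1 : sign A (derivation hF e v) = (-1 : k) ^ (p + 1) • derivation hF e v := by
        have := hs v
        rw [hv, map_smul] at this
        rw [pow_succ, mul_neg_one, neg_smul, this, neg_neg]
      have h2 := comm_mem_rel h1 x
      have h3 := (rel A).smul_mem ((-1 : k) ^ p) (comm_mem_rel hv (derivation hF e x))
      convert add_mem h2 h3 using 1
      simp only [map_sub, derivation_mul, hv, hs', pow_succ_apply', smul_sub, smul_mul_assoc]
      abel
    · rw [derivation_mul, derivation_mul, derivation_ε, sign_ε, neg_mul, heε, add_neg_cancel,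
        mul_zero, add_zero]
      exact mul_ε_ε_mem_rel _

theorem d_mem_rel [CharZero k] {u : Bar A} (hu : u ∈ rel A) : d A u ∈ rel A :=
  derivation_mem_rel _ one_mem_rel (by simp) d_sign hu

/-- A linear map kills the relations modulo `N` if it does so for commutators with generators. -/
theorem rel_le_comap [CharZero k] {M : Type*} [AddCommGroup M] [Module k M] (f : Bar A →ₗ[k] M)
    (N : Submodule k M) (h1 : f 1 ∈ N) (hε : f (ε A) ∈ N)
    (hj : ∀ (p : ℕ) (a : A.carrier), A.sign a = (-1 : k) ^ p • a → ∀ x,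
      f (j A a * x) - f ((sign A ^ p) x * j A a) ∈ N)
    (hεc : ∀ x, f (ε A * x) - f (sign A x * ε A) ∈ N) (hεε : ∀ x, f (x * (ε A * ε A)) ∈ N) :
    rel A ≤ N.comap f := by
  have key : ∀ (u : Bar A) (p : ℕ) (v : Bar A), sign A v = (-1 : k) ^ p • v → ∀ m : ℕ,
      f ((sign A ^ m) u * v) - f (v * (sign A ^ p) ((sign A ^ m) u)) ∈ N := by
    -- the claim for a left factor `x` of parity `q` and for `u` gives the one for `x u`
    have step : ∀ (q : ℕ) (x : Bar A), sign A x = (-1 : k) ^ q • x →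
        (∀ y, f (x * y) - f ((sign A ^ q) y * x) ∈ N) → ∀ u : Bar A,
        (∀ (p : ℕ) (v : Bar A), sign A v = (-1 : k) ^ p • v → ∀ m : ℕ,
          f ((sign A ^ m) u * v) - f (v * (sign A ^ p) ((sign A ^ m) u)) ∈ N) →
        ∀ (p : ℕ) (v : Bar A), sign A v = (-1 : k) ^ p • v → ∀ m : ℕ,
          f ((sign A ^ m) (x * u) * v) - f (v * (sign A ^ p) ((sign A ^ m) (x * u))) ∈ N := by
      intro q x hx hc u hu p v hv m
      have e1 := hc ((sign A ^ m) u * v)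
      have hvx : sign A (v * x) = (-1 : k) ^ (p + q) • (v * x) := by
        rw [map_mul, hv, hx, smul_mul_smul_comm, pow_add]
      have e2 := N.smul_mem ((-1 : k) ^ (q * p)) (hu (p + q) (v * x) hvx (q + m))
      have h3 : (sign A ^ q) v = (-1 : k) ^ (q * p) • v := by
        rw [pow_apply_of_eigen _ hv, ← pow_mul, mul_comm p q]
      have h4 : (sign A ^ p) x = (-1 : k) ^ (q * p) • x := by
        rw [pow_apply_of_eigen _ hx, ← pow_mul]
      have h5 : (sign A ^ (p + q)) ((sign A ^ (q + m)) u) = (sign A ^ p) ((sign A ^ m) u) := by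
        rw [pow_add, pow_add, AlgHom.mul_apply, AlgHom.mul_apply, pow_pow_apply sign_sign]
      have h6 : (sign A ^ (q + m)) u = (sign A ^ q) ((sign A ^ m) u) := by
        rw [pow_add, AlgHom.mul_apply]
      rw [h5, h6] at e2
      have h7 : (sign A ^ m) x = (-1 : k) ^ (q * m) • x := by
        rw [pow_apply_of_eigen _ hx, ← pow_mul]
      have := N.smul_mem ((-1 : k) ^ (q * m)) (add_mem e1 e2)
      convert this using 1
      simp only [map_mul, map_smul, h3, h4, h7, smul_mul_assoc, mul_smul_comm, mul_assoc, smul_sub,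
        smul_add]
      module
    intro u
    induction u using induction_left with
    | h1 => intro p v hv m; simp
    | hj a u hu =>
      have h : ∀ (q : ℕ) (a : A.carrier), A.sign a = (-1 : k) ^ q • a → ∀ (p : ℕ) (v : Bar A),
          sign A v = (-1 : k) ^ p • v → ∀ m : ℕ, f ((sign A ^ m) (j A a * u) * v) -
            f (v * (sign A ^ p) ((sign A ^ m) (j A a * u))) ∈ N := fun q a ha =>
        step q (j A a) (by rw [sign_j, ha, map_smul]) (hj q a ha) u hu
      intro p v hv m
      obtain ⟨y, z, hy, hz, rfl⟩ := exists_even_add_odd DGA.sign_sign a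
      have := add_mem (h 0 y (by simpa using hy) p v hv m) (h 1 z (by simpa using hz) p v hv m)
      convert this using 1
      simp only [map_add, add_mul, mul_add]
      abel
    | hε u hu => exact step 1 (ε A) (by simp) (by simpa using hεc) u hu
    | hadd u u' hu hu' =>
      intro p v hv m
      simp only [map_add, add_mul, mul_add, add_sub_add_comm]
      exact add_mem (hu p v hv m) (hu' p v hv m)
    | hsmul c u hu =>
      intro p v hv m
      simp only [map_smul, smul_mul_assoc, mul_smul_comm, ← smul_sub]
      exact N.smul_mem _ (hu p v hv m)
  refine Submodule.span_le.2 ?_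
  rintro _ (((rfl | rfl) | ⟨p, v, x, hv, rfl⟩) | ⟨x, rfl⟩)
  · exact h1
  · exact hε
  · have := N.neg_mem (key ((sign A ^ p) x) p v hv 0)
    rw [pow_zero, AlgHom.one_apply, pow_pow_apply sign_sign, neg_sub, ← map_sub] at this
    exact this
  · exact hεε x

theorem j_mem_rel {x : A.carrier} (hx : x ∈ A.commutators) : j A x ∈ rel A := by
  induction hx using Submodule.span_induction with
  | zero => rw [map_zero]; exact zero_mem _
  | add x y _ _ hx hy => rw [map_add]; exact add_mem hx hy
  | smul c x _ hx => rw [map_smul]; exact Submodule.smul_mem _ _ hx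
  | mem z hz =>
    rcases hz with rfl | ⟨i, l, x, hx, y, hy, rfl⟩
    · rw [map_one]; exact one_mem_rel
    · obtain ⟨p, hp⟩ := exists_neg_one_pow (k := k) i
      have h := comm_mem_rel (A := A) (v := j A x) (p := p)
        (by rw [sign_j, DGA.sign_of_mem hx, hp, map_smul]) (j A y)
      rw [sign_pow_j, pow_apply_of_eigen _ (DGA.sign_of_mem hy)] at h
      rw [mul_comm i, zpow_mul]
      have e : (((-1 : k) ^ l) ^ i) = ((-1 : k) ^ l) ^ p := by
        rcases Int.even_or_odd l with hl | hl
        · simp [hl.neg_one_zpow]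
        · rw [hl.neg_one_zpow, hp]
      rw [e, map_sub, map_smul, map_mul, map_mul]
      rwa [map_smul, smul_mul_assoc] at h

variable (A)

/-- The projection to `A` with `ε ↦ 0`. -/
def toAlg : Bar A →ₐ[k] A.carrier := lift (AlgHom.id k _) 0

variable {A}

@[simp] theorem toAlg_j (a : A.carrier) : toAlg A (j A a) = a := lift_j _ _ _
@[simp] theorem toAlg_ε : toAlg A (ε A) = 0 := lift_ε _ _

theorem toAlg_mem_commutators [CharZero k] {u : Bar A} (hu : u ∈ rel A) :
    toAlg A u ∈ A.commutators := by
  have hs : ∀ (p : ℕ) u, toAlg A ((sign A ^ p) u) = (A.sign ^ p) (toAlg A u) := by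
    intro p
    induction p with
    | zero => simp
    | succ p ih =>
      have h : (toAlg A).comp (sign A) = A.sign.comp (toAlg A) :=
        algHom_ext (by simp) (by simp)
      intro u
      rw [pow_succ_apply, ih, pow_succ_apply]
      exact congrArg _ (AlgHom.congr_fun h u)
  refine rel_le_comap (toAlg A).toLinearMap A.commutators ?_ ?_ ?_ ?_ ?_ hu
  · rw [AlgHom.toLinearMap_apply, map_one]; exact Submodule.subset_span (Or.inl rfl)
  · simp
  · intro p a ha x
    rw [AlgHom.toLinearMap_apply, AlgHom.toLinearMap_apply, map_mul, map_mul, hs, toAlg_j]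
    exact DGA.comm_mem_commutators ha (toAlg A x)
  · simp
  · simp

end Bar

end Bar

/-! ### Hochschild chains as words -/

section Words

open PiTensorProduct

variable {k : Type u} [Field k]

namespace DGA

variable (A : DGA k)

/-- The chain `a₀ ⊗ ⋯ ⊗ aₙ`. -/
def chain (n : ℕ) : MultilinearMap k (fun _ : Fin (n + 1) => A.carrier) A.connes.M :=
  (DirectSum.lof k ℕ (fun n => ⨂[k] _ : Fin (n + 1), A.carrier) n).compMultilinearMap (tprod k)

theorem chain_apply (n : ℕ) (a : Fin (n + 1) → A.carrier) : A.chain n a =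
    DirectSum.lof k ℕ (fun n => ⨂[k] _ : Fin (n + 1), A.carrier) n (tprod k a) := rfl

variable {A}

theorem chain_ext {N : Type*} [AddCommGroup N] [Module k N] {f g : A.connes.M →ₗ[k] N}
    (h : ∀ n a, f (A.chain n a) = g (A.chain n a)) : f = g :=
  DirectSum.linearMap_ext k fun n => PiTensorProduct.ext (MultilinearMap.ext fun a => h n a)

/-- Linear maps on tensors are equal if they agree on pure tensors whose last entry is even or
odd. -/
theorem tensor_ext_last [CharZero k] {N : Type*} [AddCommGroup N] [Module k N] {n : ℕ}
    {f g : (⨂[k] _ : Fin (n + 1), A.carrier) →ₗ[k] N}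
    (h : ∀ (p : ℕ) (a : Fin (n + 1) → A.carrier),
      A.sign (a (Fin.last n)) = (-1 : k) ^ p • a (Fin.last n) → f (tprod k a) = g (tprod k a)) :
    f = g := by
  refine PiTensorProduct.ext (MultilinearMap.ext fun a => ?_)
  obtain ⟨y, z, hy, hz, e⟩ := exists_even_add_odd sign_sign (a (Fin.last n))
  rw [← Function.update_eq_self (Fin.last n) a, e]
  simp only [LinearMap.compMultilinearMap_apply]
  rw [MultilinearMap.map_update_add, map_add, map_add, h 0 _ (by simpa using hy),
    h 1 _ (by simpa using hz)]

theorem finRotate_symm_zero (n : ℕ) : (finRotate (n + 1)).symm 0 = Fin.last n := by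
  rw [Equiv.symm_apply_eq, finRotate_last]

theorem finRotate_symm_succ {n : ℕ} (i : Fin n) :
    (finRotate (n + 1)).symm i.succ = i.castSucc := by
  rw [Equiv.symm_apply_eq, finRotate_apply]
  simp

theorem rotate_tprod' (n : ℕ) (a : Fin (n + 1) → A.carrier) :
    A.rotate n (tprod k a) =
      tprod k (Fin.cons (degreewise A.gr (fun m => if Even m then (1 : k) else 0) (a (Fin.last n)))
        (Fin.init a) : Fin (n + 1) → A.carrier) +
      tprod k (Fin.cons (degreewise A.gr (fun m => if Even m then (0 : k) else 1) (a (Fin.last n)))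
        (fun i => A.sign (Fin.init a i)) : Fin (n + 1) → A.carrier) := by
  simp only [rotate, LinearMap.comp_apply, LinearMap.add_apply, map_add, map_tprod,
    LinearEquiv.coe_coe, reindex_tprod]
  congr 2
  · ext i
    refine Fin.cases ?_ (fun i => ?_) i
    · rw [finRotate_symm_zero]; simp
    · rw [finRotate_symm_succ]; simp [Fin.init]
  · ext i
    refine Fin.cases ?_ (fun i => ?_) i
    · rw [finRotate_symm_zero]; simp
    · rw [finRotate_symm_succ]; simp [Fin.init]; rfl

theorem sign_eq_even_sub_odd (x : A.carrier) :
    A.sign x = degreewise A.gr (fun m => if Even m then (1 : k) else 0) x -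
      degreewise A.gr (fun m => if Even m then (0 : k) else 1) x := by
  refine LinearMap.congr_fun (hom_ext_of_homogeneous A.gr (f := A.sign.toLinearMap)
    (g := degreewise A.gr (fun m => if Even m then (1 : k) else 0) -
      degreewise A.gr (fun m => if Even m then (0 : k) else 1)) fun i x hx => ?_) x
  simp only [LinearMap.sub_apply, degreewise_of_mem A.gr _ hx, AlgHom.toLinearMap_apply,
    sign_of_mem hx]
  split_ifs with h
  · simp [h.neg_one_zpow]
  · simp [(Int.not_even_iff_odd.1 h).neg_one_zpow]

theorem rotate_tprod [CharZero k] {n p : ℕ} {a : Fin (n + 1) → A.carrier}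
    (h : A.sign (a (Fin.last n)) = (-1 : k) ^ p • a (Fin.last n)) :
    A.rotate n (tprod k a) =
      tprod k (Fin.cons (a (Fin.last n)) (fun i => (A.sign ^ p) (Fin.init a i)) :
        Fin (n + 1) → A.carrier) := by
  rw [rotate_tprod']
  have h1 := A.degreewise_even_add_odd (a (Fin.last n))
  have h2 := sign_eq_even_sub_odd (a (Fin.last n))
  set x := degreewise A.gr (fun m => if Even m then (1 : k) else 0) (a (Fin.last n))
  set y := degreewise A.gr (fun m => if Even m then (0 : k) else 1) (a (Fin.last n))
  have two : ∀ z : A.carrier, z + z = 0 → z = 0 := fun z hz => by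
    rw [← two_smul k] at hz
    exact (smul_eq_zero.1 hz).resolve_left two_ne_zero
  rcases Nat.even_or_odd p with hp | hp
  · have hy : y = 0 := two _ (by
      rw [h2, hp.neg_one_pow, one_smul, ← h1] at h
      have := sub_eq_zero.2 h.symm
      simpa using this)
    have hs : A.sign ^ p = 1 := by
      obtain ⟨q, rfl⟩ := hp
      exact AlgHom.ext fun v => by
        rw [pow_add, AlgHom.mul_apply, pow_pow_apply sign_sign]; rfl
    rw [hy, add_zero] at h1
    rw [hy, h1, hs, (PiTensorProduct.tprod k).map_coord_zero (0 : Fin (n + 1)) (Fin.cons_zero _ _),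
      add_zero]
    rfl
  · have hx : x = 0 := two _ (by
      rw [h2, hp.neg_one_pow, ← h1] at h
      have := sub_eq_zero.2 h
      simpa [sub_eq_add_neg, add_assoc, add_comm, add_left_comm] using this)
    have hs : A.sign ^ p = A.sign := by
      obtain ⟨q, rfl⟩ := hp
      exact AlgHom.ext fun v => by
        rw [pow_succ_apply, two_mul, pow_add, AlgHom.mul_apply, pow_pow_apply sign_sign]
    rw [hx, zero_add] at h1
    rw [hx, h1, hs, (PiTensorProduct.tprod k).map_coord_zero (0 : Fin (n + 1)) (Fin.cons_zero _ _),
      zero_add]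

theorem face_zero_cons {n : ℕ} (c : A.carrier) (b : Fin (n + 1) → A.carrier) :
    face (k := k) A.carrier 0 (tprod k (Fin.cons c b : Fin (n + 2) → A.carrier)) =
      tprod k (Function.update b 0 (c * b 0)) := by
  rw [face, lift.tprod]
  refine congrArg (PiTensorProduct.tprod k) ?_
  ext i
  refine Fin.cases ?_ (fun i => ?_) i
  · simp [Fin.contractNth]
  · rw [Function.update_of_ne (Fin.succ_ne_zero i)]
    simp only [Fin.contractNth]
    simp

theorem chain_sub_rotate_mem (n : ℕ) (x : ⨂[k] _ : Fin (n + 1), A.carrier) :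
    DirectSum.lof k ℕ (fun n => ⨂[k] _ : Fin (n + 1), A.carrier) n
      (x - (-1 : k) ^ n • A.rotate n x) ∈ A.connes.rel :=
  Submodule.subset_span (Or.inl ⟨n, x, rfl⟩)

theorem chain_mem_rel {n : ℕ} {a : Fin (n + 1) → A.carrier} {i : Fin (n + 1)} (hi : a i = 1) :
    A.chain n a ∈ A.connes.rel :=
  Submodule.subset_span (Or.inr ⟨n, a, ⟨i, hi⟩, rfl⟩)

theorem chain_mem_gr {n : ℕ} {a : Fin (n + 1) → A.carrier} {e : Fin (n + 1) → ℤ}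
    (ha : ∀ i, a i ∈ A.gr (e i)) : A.chain n a ∈ A.connes.gr ((∑ i, e i) + n) :=
  Submodule.subset_span ⟨n, e, a, ha, rfl, rfl⟩

theorem hochschildD_zero (a : Fin 1 → A.carrier) :
    A.hochschildD (A.chain 0 a) = A.chain 0 fun i => A.d (a i) := by
  have e : A.internalD 0 (tprod k a) = tprod k fun i => A.d (a i) := by
    rw [internalD, Fin.sum_univ_one, map_tprod]
    congr 1
    ext i
    rw [Fin.fin_one_eq_zero i]
    rfl
  rw [chain_apply, chain_apply, ← e]
  exact DirectSum.toModule_lof (M := fun n : ℕ => ⨂[k] _ : Fin (n + 1), A.carrier) k 0 (tprod k a)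

theorem hochschildD_succ (n : ℕ) (x : ⨂[k] _ : Fin (n + 2), A.carrier) :
    A.hochschildD (DirectSum.lof k ℕ (fun n => ⨂[k] _ : Fin (n + 1), A.carrier) (n + 1) x) =
      DirectSum.lof k ℕ (fun n => ⨂[k] _ : Fin (n + 1), A.carrier) n (A.hochschildB n x) +
      (-1 : k) ^ (n + 1) • DirectSum.lof k ℕ (fun n => ⨂[k] _ : Fin (n + 1), A.carrier) (n + 1)
        (A.internalD (n + 1) x) := by
  exact DirectSum.toModule_lof (M := fun n : ℕ => ⨂[k] _ : Fin (n + 1), A.carrier) k (n + 1) x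

end DGA

namespace Bar

variable (A : DGA k)

/-- The word `a₀ ε a₁ ε ⋯ aₙ₋₁ ε`, with the signs `(-1)^{(n-1-i)|aᵢ|}`. -/
def word (n : ℕ) : MultilinearMap k (fun _ : Fin n => A.carrier) (Bar A) :=
  (MultilinearMap.mkPiAlgebraFin k n (Bar A)).compLinearMap fun i =>
    LinearMap.mulRight k (ε A) ∘ₗ (j A).toLinearMap ∘ₗ (A.sign ^ (n - 1 - (i : ℕ))).toLinearMap

/-- The word `a₀ ε a₁ ε ⋯ ε aₙ`, with signs. -/
def openWord (n : ℕ) : MultilinearMap k (fun _ : Fin (n + 1) => A.carrier) (Bar A) :=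
  (MultilinearMap.mkPiAlgebraFin k (n + 1) (Bar A)).compLinearMap fun i =>
    if i = Fin.last n then (j A).toLinearMap ∘ₗ A.sign.toLinearMap
    else LinearMap.mulRight k (ε A) ∘ₗ (j A).toLinearMap ∘ₗ
      (A.sign ^ (n - 1 - (i : ℕ))).toLinearMap

variable {A}

theorem word_apply (n : ℕ) (a : Fin n → A.carrier) :
    word A n a = (List.ofFn fun i : Fin n => j A ((A.sign ^ (n - 1 - (i : ℕ))) (a i)) * ε A).prod :=
  rfl

theorem word_zero (a : Fin 0 → A.carrier) : word A 0 a = 1 := rfl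

theorem word_succ (n : ℕ) (a : Fin (n + 1) → A.carrier) :
    word A (n + 1) a = j A ((A.sign ^ n) (a 0)) * ε A * word A n (Fin.tail a) := by
  rw [word_apply, word_apply, List.ofFn_succ, List.prod_cons]
  congr 4
  ext i
  have : n + 1 - 1 - ((i.succ : Fin (n + 1)) : ℕ) = n - 1 - (i : ℕ) := by
    rw [Fin.val_succ]; omega
  rw [this]; rfl

theorem word_snoc (n : ℕ) (a : Fin (n + 1) → A.carrier) :
    word A (n + 1) a =
      word A n (fun i => A.sign (Fin.init a i)) * (j A (a (Fin.last n)) * ε A) := by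
  rw [word_apply, word_apply, List.ofFn_succ', List.concat_eq_append, List.prod_append,
    List.prod_singleton]
  congr 3
  · ext i
    have : n + 1 - 1 - ((i.castSucc : Fin (n + 1)) : ℕ) = (n - 1 - (i : ℕ)) + 1 := by
      rw [Fin.val_castSucc]; omega
    rw [this, pow_succ_apply]; rfl
  · simp

theorem openWord_apply (n : ℕ) (a : Fin (n + 1) → A.carrier) :
    openWord A n a = word A n (Fin.init a) * j A (A.sign (a (Fin.last n))) := by
  change (List.ofFn _).prod = _
  rw [word_apply, List.ofFn_succ', List.concat_eq_append, List.prod_append, List.prod_singleton]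
  refine congrArg₂ (· * ·) (congrArg (fun f => (List.ofFn f).prod) ?_) ?_
  · ext i
    exact (congrArg (fun f : A.carrier →ₗ[k] Bar A => f (a i.castSucc))
      (if_neg (Fin.castSucc_lt_last i).ne)).trans rfl
  · exact (congrArg (fun f : A.carrier →ₗ[k] Bar A => f (a (Fin.last n))) (if_pos rfl)).trans rfl

theorem word_sign (n : ℕ) (a : Fin n → A.carrier) :
    sign A (word A n a) = (-1 : k) ^ n • word A n fun i => A.sign (a i) := by
  induction n with
  | zero => simp [word_zero]
  | succ n ih =>
    rw [word_succ, word_succ, map_mul, map_mul, sign_j, sign_ε, ih, pow_succ, ← pow_succ_apply',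
      pow_succ_apply]
    simp only [mul_neg, neg_mul, mul_smul_comm, neg_smul, mul_one, smul_neg]
    rfl

theorem word_sign_pow (n p : ℕ) (a : Fin n → A.carrier) :
    (sign A ^ p) (word A n a) = (-1 : k) ^ (n * p) • word A n fun i => (A.sign ^ p) (a i) := by
  induction p with
  | zero => simp
  | succ p ih =>
    rw [pow_succ_apply', ih, map_smul, word_sign, smul_smul, ← pow_add, mul_add, mul_one]
    simp only [pow_succ_apply']

variable (A)

/-- The map that sends the chain `a₀ ⊗ ⋯ ⊗ aₙ` to the word `a₀ ε ⋯ aₙ ε`. -/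
def ofChain : A.connes.M →ₗ[k] Bar A :=
  DirectSum.toModule k ℕ _ fun n => PiTensorProduct.lift (word A (n + 1))

/-- The map that sends the chain `a₀ ⊗ ⋯ ⊗ aₙ` to the word `a₀ ε ⋯ ε aₙ`. -/
def ofChainOpen : A.connes.M →ₗ[k] Bar A :=
  DirectSum.toModule k ℕ _ fun n => PiTensorProduct.lift (openWord A n)

variable {A}

theorem ofChain_chain (n : ℕ) (a : Fin (n + 1) → A.carrier) :
    ofChain A (A.chain n a) = word A (n + 1) a := by
  rw [DGA.chain_apply, ofChain, DirectSum.toModule_lof, lift.tprod]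

theorem ofChainOpen_chain (n : ℕ) (a : Fin (n + 1) → A.carrier) :
    ofChainOpen A (A.chain n a) = openWord A n a := by
  rw [DGA.chain_apply, ofChainOpen, DirectSum.toModule_lof, lift.tprod]

section Relations

variable [CharZero k]

theorem mul_word_mem_rel (n : ℕ) : ∀ (a : Fin n → A.carrier) (i : Fin n), a i = 1 → ∀ u,
    u * ε A * word A n a ∈ rel A := by
  induction n with
  | zero => intro a i; exact i.elim0
  | succ n ih =>
    intro a i hi u
    rw [word_succ]
    induction i using Fin.cases with
    | zero =>
      rw [hi, map_one, map_one, one_mul, ← mul_assoc, mul_assoc u]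
      exact mul_ε_ε_mul_mem_rel _ _
    | succ i =>
      have := ih (Fin.tail a) i hi (u * ε A * j A ((A.sign ^ n) (a 0)))
      simpa only [mul_assoc] using this

theorem word_mem_rel {n : ℕ} {a : Fin (n + 1) → A.carrier} {i : Fin (n + 1)} (hi : a i = 1) :
    word A (n + 1) a ∈ rel A := by
  induction i using Fin.cases with
  | zero =>
    rw [word_succ, hi, map_one, map_one, one_mul]
    cases n with
    | zero => rw [word_zero, mul_one]; exact ε_mem_rel
    | succ n =>
      rw [word_snoc]
      set u := word A n (fun i => A.sign (Fin.init (Fin.tail a) i)) *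
        j A (Fin.tail a (Fin.last n)) with hu
      have h1 := comm_mem_rel (A := A) (v := ε A) (p := 1) (by simp) (u * ε A)
      have h2 := (rel A).neg_mem (mul_ε_ε_mem_rel (sign A u))
      have := add_mem h1 h2
      simp only [map_mul, sign_ε, pow_one, mul_neg, neg_mul, sub_neg_eq_add] at this
      rwa [mul_assoc (sign A u), add_neg_cancel_right, hu, mul_assoc (word A n _)] at this
  | succ i =>
    rw [word_succ]
    exact mul_word_mem_rel n _ i hi _

/-- The words satisfy the relations of the Connes complex. -/
theorem ofChain_mem_rel {x : A.connes.M} (hx : x ∈ A.connes.rel) : ofChain A x ∈ rel A := by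
  have h : A.connes.rel ≤ (rel A).comap (ofChain A) := by
    refine Submodule.span_le.2 ?_
    rintro _ (⟨n, x, rfl⟩ | ⟨n, a, ⟨i, hi⟩, rfl⟩)
    · have key : (rel A).mkQ ∘ₗ ofChain A ∘ₗ
          DirectSum.lof k ℕ (fun n => ⨂[k] _ : Fin (n + 1), A.carrier) n =
          (-1 : k) ^ n • ((rel A).mkQ ∘ₗ ofChain A ∘ₗ
            DirectSum.lof k ℕ (fun n => ⨂[k] _ : Fin (n + 1), A.carrier) n ∘ₗ A.rotate n) := by
        refine DGA.tensor_ext_last fun p a hp => ?_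
        simp only [LinearMap.comp_apply, LinearMap.smul_apply, DGA.rotate_tprod hp]
        refine (congrArg _ (ofChain_chain n a)).trans
          (Eq.trans ?_ (congrArg (fun z => (-1 : k) ^ n • (rel A).mkQ z) (ofChain_chain n _)).symm)
        rw [← map_smul]
        refine (Submodule.Quotient.eq _).2 ?_
        have h := comm_mem_rel' (A := A) (p := p + 1) (v := j A (a (Fin.last n)) * ε A)
          (by simp [hp, pow_succ]) (word A n fun i => A.sign (Fin.init a i))
        rw [word_snoc, word_succ]
        convert h using 2
        simp only [word_sign_pow, Fin.cons_zero, pow_apply_of_eigen _ hp, mul_smul_comm, map_smul,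
          smul_mul_assoc, smul_smul, ← pow_succ_apply, pow_add_two_apply DGA.sign_sign]
        congr 1
        rw [← pow_mul, ← pow_add]
        congr 1
        ring
      have h1 := LinearMap.congr_fun key x
      refine Submodule.mem_comap.2 ((Submodule.Quotient.mk_eq_zero _).1 ?_)
      change (rel A).mkQ (ofChain A (DirectSum.lof k ℕ (fun n => ⨂[k] _ : Fin (n + 1), A.carrier) n
        (x - (-1 : k) ^ n • A.rotate n x))) = 0
      rw [map_sub, map_sub, map_sub, map_smul, map_smul, map_smul]
      exact sub_eq_zero.2 h1
    · have e := ofChain_chain n a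
      exact Submodule.mem_comap.2 (e.symm ▸ word_mem_rel hi)
  exact h hx

variable (A)

/-- The operation that multiplies the last factor of a chain into the first one. -/
def close : A.connes.M →ₗ[k] A.connes.M :=
  DirectSum.toModule k ℕ _ fun
    | 0 => 0
    | n + 1 => DirectSum.lof k ℕ (fun n => ⨂[k] _ : Fin (n + 1), A.carrier) n ∘ₗ
        face A.carrier 0 ∘ₗ A.rotate (n + 1)

end Relations

end Bar

end Words

/-! ### Chains from words -/

section Unword

open PiTensorProduct

variable {k : Type u} [Field k] {A : DGA k}

namespace Bar

theorem close_chain_zero (a : Fin 1 → A.carrier) : close A (A.chain 0 a) = 0 :=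
  DirectSum.toModule_lof (M := fun n : ℕ => ⨂[k] _ : Fin (n + 1), A.carrier) k 0
    (PiTensorProduct.tprod k a)

theorem close_lof_succ (n : ℕ) (x : ⨂[k] _ : Fin (n + 1 + 1), A.carrier) :
    close A (DirectSum.lof k ℕ (fun n => ⨂[k] _ : Fin (n + 1), A.carrier) (n + 1) x) =
      DirectSum.lof k ℕ (fun n => ⨂[k] _ : Fin (n + 1), A.carrier) n
        (face A.carrier 0 (A.rotate (n + 1) x)) :=
  DirectSum.toModule_lof (M := fun n : ℕ => ⨂[k] _ : Fin (n + 1), A.carrier) k (n + 1) x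

theorem close_chain_succ [CharZero k] {n p : ℕ} {a : Fin (n + 2) → A.carrier}
    (h : A.sign (a (Fin.last _)) = (-1 : k) ^ p • a (Fin.last _)) :
    close A (A.chain (n + 1) a) = A.chain n (Function.update
      (fun i => (A.sign ^ p) (Fin.init a i)) 0 (a (Fin.last _) * (A.sign ^ p) (a 0))) := by
  rw [DGA.chain_apply, close_lof_succ, DGA.rotate_tprod h, DGA.face_zero_cons]
  rfl

theorem chain_ext_last [CharZero k] {N : Type*} [AddCommGroup N] [Module k N]
    {f g : A.connes.M →ₗ[k] N}
    (h : ∀ (n p : ℕ) (a : Fin (n + 1) → A.carrier),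
      A.sign (a (Fin.last n)) = (-1 : k) ^ p • a (Fin.last n) →
        f (A.chain n a) = g (A.chain n a)) : f = g :=
  DirectSum.linearMap_ext k fun n => DGA.tensor_ext_last fun p a ha => h n p a ha

theorem neg_one_pow_succ_smul {M : Type*} [AddCommGroup M] [Module k M] (n : ℕ) (z : M) :
    (-1 : k) ^ (n + 1) • z = -((-1 : k) ^ n • z) := by
  rw [pow_succ, mul_neg_one, neg_smul]

theorem word_update_zero (n : ℕ) (b : Fin (n + 1) → A.carrier) (v : A.carrier) :
    word A (n + 1) (Function.update b 0 v) =
        j A ((A.sign ^ n) v) * ε A * word A n (Fin.tail b) := by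
  rw [word_succ, Function.update_self, Fin.tail_update_zero]

/-- Modulo the relations, moving the last factor of an open word to the front closes the word. -/
theorem ofChainOpen_sub_mem_rel [CharZero k] (y : A.connes.M) :
    ofChainOpen A y - (j A (A.sign (A.proj₀ y)) + ofChain A (close A y)) ∈ rel A := by
  refine (Submodule.Quotient.eq _).1 (LinearMap.congr_fun (chain_ext_last
    (f := (rel A).mkQ ∘ₗ ofChainOpen A)
    (g := (rel A).mkQ ∘ₗ ((j A).toLinearMap ∘ₗ A.sign.toLinearMap ∘ₗ A.proj₀ +
      ofChain A ∘ₗ close A)) fun n p a hp => ?_) y)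
  simp only [LinearMap.comp_apply, LinearMap.add_apply, AlgHom.toLinearMap_apply]
  refine (Submodule.Quotient.eq _).2 ?_
  rw [ofChainOpen_chain, openWord_apply]
  cases n with
  | zero =>
    rw [close_chain_zero, DGA.chain_apply, A.proj₀_zero, map_zero, word_zero, one_mul, add_zero]
    exact (sub_self (j A (A.sign (a 0)))).symm ▸ zero_mem _
  | succ n =>
    rw [close_chain_succ hp, ofChain_chain, DGA.chain_apply, A.proj₀_succ, map_zero, map_zero,
      zero_add, word_update_zero, hp]
    have h := (rel A).smul_mem ((-1 : k) ^ p) (comm_mem_rel' (A := A) (p := p)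
      (v := j A (a (Fin.last _))) (by simp [hp]) (word A (n + 1) (Fin.init a)))
    convert h using 1
    rw [smul_sub, word_sign_pow, word_succ, map_smul, mul_smul_comm, map_mul (A.sign ^ n),
      pow_apply_of_eigen _ hp, smul_mul_assoc, map_smul, map_mul]
    congr 1
    simp only [smul_mul_assoc, mul_smul_comm, smul_smul, mul_assoc]
    refine congrArg₂ (· • ·) ?_ (by rw [word_succ]; simp only [mul_assoc]; rfl)
    rw [← pow_mul, ← pow_add, mul_comm p n, add_mul, one_mul, add_comm p, add_assoc, ← two_mul,
      pow_add _ (n * p), pow_mul _ 2]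
    simp

variable (A)

/-- Left multiplication by an element of `A` on the first factor of chains, with signs. -/
def mulFirst (a : A.carrier) : Module.End k A.connes.M :=
  DirectSum.lmap fun n => PiTensorProduct.map
    (Function.update (fun _ => LinearMap.id) 0 (LinearMap.mulLeft k ((A.sign ^ (n + 1)) a)))

/-- Right multiplication by an element of `A` on the last factor of chains. -/
def mulLast (a : A.carrier) : Module.End k A.connes.M :=
  DirectSum.lmap fun n => PiTensorProduct.map
    (Function.update (fun _ => LinearMap.id) (Fin.last n) (LinearMap.mulRight k a))

/-- The operation `a₀ ⊗ ⋯ ⊗ aₙ ↦ 1 ⊗ a₀ ⊗ ⋯ ⊗ aₙ`. -/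
def consOne : Module.End k A.connes.M :=
  DirectSum.toModule k ℕ _ fun n => PiTensorProduct.lift ((A.chain (n + 1)).curryLeft 1)

/-- The operation `a₀ ⊗ ⋯ ⊗ aₙ ↦ a₀ ⊗ ⋯ ⊗ aₙ ⊗ 1`, with signs. -/
def snocOne : Module.End k A.connes.M :=
  DirectSum.toModule k ℕ _ fun n => PiTensorProduct.lift
    (((LinearMap.applyₗ (1 : A.carrier)).compMultilinearMap
      (A.chain (n + 1)).curryRight).compLinearMap fun _ => A.sign.toLinearMap)

/-- The operation on chains that corresponds to the parity involution on open words. -/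
def chainSign : Module.End k A.connes.M :=
  DirectSum.lmap fun n => (-1 : k) ^ n • PiTensorProduct.map fun _ => A.sign.toLinearMap

variable {A}

theorem map_update_tprod {n : ℕ} (i : Fin n) (f : A.carrier →ₗ[k] A.carrier)
    (a : Fin n → A.carrier) :
    PiTensorProduct.map (Function.update (fun _ => LinearMap.id) i f) (PiTensorProduct.tprod k a) =
      PiTensorProduct.tprod k (Function.update a i (f (a i))) := by
  rw [map_tprod]
  congr 1
  ext l
  by_cases h : l = i
  · subst h; simp
  · simp [h]

theorem mulFirst_chain (c : A.carrier) (n : ℕ) (a : Fin (n + 1) → A.carrier) :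
    mulFirst A c (A.chain n a) =
      A.chain n (Function.update a 0 ((A.sign ^ (n + 1)) c * a 0)) := by
  refine (DirectSum.lmap_lof _ _ _).trans ?_
  rw [map_update_tprod]; rfl

theorem mulLast_chain (c : A.carrier) (n : ℕ) (a : Fin (n + 1) → A.carrier) :
    mulLast A c (A.chain n a) =
      A.chain n (Function.update a (Fin.last n) (a (Fin.last n) * c)) := by
  refine (DirectSum.lmap_lof _ _ _).trans ?_
  rw [map_update_tprod]; rfl

theorem consOne_chain (n : ℕ) (a : Fin (n + 1) → A.carrier) :
    consOne A (A.chain n a) = A.chain (n + 1) (Fin.cons 1 a : Fin (n + 2) → A.carrier) := by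
  rw [DGA.chain_apply, consOne, DirectSum.toModule_lof, lift.tprod]
  rfl

theorem snocOne_chain (n : ℕ) (a : Fin (n + 1) → A.carrier) :
    snocOne A (A.chain n a) =
      A.chain (n + 1) (Fin.snoc (fun i => A.sign (a i)) 1 : Fin (n + 2) → A.carrier) := by
  rw [DGA.chain_apply, snocOne, DirectSum.toModule_lof, lift.tprod]
  rfl

theorem chainSign_chain (n : ℕ) (a : Fin (n + 1) → A.carrier) :
    chainSign A (A.chain n a) = (-1 : k) ^ n • A.chain n fun i => A.sign (a i) := by
  refine (DirectSum.lmap_lof _ _ _).trans ?_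
  rw [LinearMap.smul_apply, map_tprod, map_smul]
  rfl

theorem chainSign_pow_chain (p n : ℕ) (a : Fin (n + 1) → A.carrier) :
    (chainSign A ^ p) (A.chain n a) =
        (-1 : k) ^ (n * p) • A.chain n fun i => (A.sign ^ p) (a i) := by
  induction p with
  | zero => simp
  | succ p ih =>
    rw [pow_succ', Module.End.mul_apply, ih, map_smul, chainSign_chain, smul_smul, ← pow_add,
      mul_add, mul_one]
    simp only [pow_succ_apply']

variable (A)

/-- The action of `A * k[ε]` on chains that corresponds to left multiplication of open words. -/
def act : Bar A →ₐ[k] Module.End k A.connes.M :=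
  lift (AlgHom.ofLinearMap
    { toFun := mulFirst A
      map_add' := fun x y => DGA.chain_ext fun n a => by
        rw [LinearMap.add_apply, mulFirst_chain, mulFirst_chain, mulFirst_chain, map_add, add_mul,
          MultilinearMap.map_update_add]
      map_smul' := fun c x => DGA.chain_ext fun n a => by
        rw [LinearMap.smul_apply, mulFirst_chain, mulFirst_chain, map_smul, smul_mul_assoc,
          MultilinearMap.map_update_smul, RingHom.id_apply] }
    (DGA.chain_ext fun n a => by
      change mulFirst A 1 _ = _
      rw [mulFirst_chain, map_one, one_mul, Function.update_eq_self]; rfl)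
    (fun x y => DGA.chain_ext fun n a => by
      change mulFirst A (x * y) _ = mulFirst A x (mulFirst A y _)
      rw [mulFirst_chain, mulFirst_chain, mulFirst_chain, map_mul, Function.update_self,
        Function.update_idem, mul_assoc])) (consOne A)

variable {A}

theorem act_j (a : A.carrier) : act A (j A a) = mulFirst A a := lift_j _ _ _
theorem act_ε : act A (ε A) = consOne A := lift_ε _ _

theorem ofChainOpen_act (b : Bar A) (y : A.connes.M) :
    ofChainOpen A (act A b y) = b * ofChainOpen A y := by
  induction b using induction_left generalizing y with
  | h1 => simp
  | hadd u v hu hv => rw [map_add, LinearMap.add_apply, map_add, hu, hv, add_mul]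
  | hsmul c u hu => rw [map_smul, LinearMap.smul_apply, map_smul, hu, smul_mul_assoc]
  | hj a u hu =>
    rw [map_mul, Module.End.mul_apply, mul_assoc, ← hu, act_j]
    generalize act A u y = y
    refine LinearMap.congr_fun (DGA.chain_ext (f := ofChainOpen A ∘ₗ mulFirst A a)
      (g := LinearMap.mulLeft k (j A a) ∘ₗ ofChainOpen A) fun n b => ?_) y
    rw [LinearMap.comp_apply, LinearMap.comp_apply, mulFirst_chain, ofChainOpen_chain,
      ofChainOpen_chain, openWord_apply, openWord_apply, LinearMap.mulLeft_apply]
    cases n with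
    | zero =>
      change _ * j A (A.sign (Function.update b 0 _ 0)) = j A a * (_ * j A (A.sign (b 0)))
      rw [word_zero, word_zero, Function.update_self, map_mul, pow_succ_apply, pow_zero,
        AlgHom.one_apply, DGA.sign_sign, one_mul, one_mul, map_mul]
    | succ n =>
      have e : Fin.init (Function.update b 0 ((A.sign ^ (n + 1 + 1)) a * b 0)) =
          Function.update (Fin.init b) 0 ((A.sign ^ (n + 1 + 1)) a * b 0) :=
        Fin.init_update_castSucc (i := 0) (q := b) (y := (A.sign ^ (n + 1 + 1)) a * b 0)
      have e' : (A.sign ^ n) ((A.sign ^ (n + 1 + 1)) a * b 0) = a * (A.sign ^ n) (b 0) := by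
        rw [map_mul, pow_add_two_apply DGA.sign_sign, pow_pow_apply DGA.sign_sign]
      rw [e, word_update_zero, e', Function.update_of_ne (Fin.last_pos).ne', word_succ, map_mul]
      simp only [mul_assoc]
      rfl
  | hε u hu =>
    rw [map_mul, Module.End.mul_apply, mul_assoc, ← hu, act_ε]
    generalize act A u y = y
    refine LinearMap.congr_fun (DGA.chain_ext (f := ofChainOpen A ∘ₗ consOne A)
      (g := LinearMap.mulLeft k (ε A) ∘ₗ ofChainOpen A) fun n b => ?_) y
    rw [LinearMap.comp_apply, LinearMap.comp_apply, consOne_chain, ofChainOpen_chain,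
      ofChainOpen_chain, openWord_apply, openWord_apply, LinearMap.mulLeft_apply, word_succ]
    change j A ((A.sign ^ n) 1) * _ * word A n (Fin.init b) * j A (A.sign (b (Fin.last n))) = _
    rw [map_one, map_one, one_mul, mul_assoc]

variable (A)

/-- The chain `1 ∈ A`. -/
def chainOne : A.connes.M := A.chain 0 1

variable {A}

theorem ofChainOpen_act_one (b : Bar A) : ofChainOpen A (act A b (chainOne A)) = b := by
  rw [ofChainOpen_act, chainOne, ofChainOpen_chain, openWord_apply, word_zero]
  simp

theorem act_mulLast (b : Bar A) (c : A.carrier) (y : A.connes.M) :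
    act A b (mulLast A c y) = mulLast A c (act A b y) := by
  induction b using induction_left generalizing y with
  | h1 => simp
  | hadd u v hu hv => simp only [map_add, LinearMap.add_apply, hu, hv]
  | hsmul c u hu => simp only [map_smul, LinearMap.smul_apply, hu]
  | hj a u hu =>
    rw [map_mul, Module.End.mul_apply, Module.End.mul_apply, hu, act_j]
    generalize act A u y = y
    refine LinearMap.congr_fun (DGA.chain_ext (f := mulFirst A a ∘ₗ mulLast A c)
      (g := mulLast A c ∘ₗ mulFirst A a) fun n b => ?_) y
    rw [LinearMap.comp_apply, LinearMap.comp_apply, mulFirst_chain, mulLast_chain, mulLast_chain,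
      mulFirst_chain]
    cases n with
    | zero =>
      change A.chain 0 (Function.update (Function.update b 0 (b 0 * c)) 0
        (_ * Function.update b 0 _ 0)) =
        A.chain 0 (Function.update (Function.update b 0 _) 0 (Function.update b 0 _ 0 * c))
      rw [Function.update_self, Function.update_self, Function.update_idem, Function.update_idem,
        mul_assoc]
      rfl
    | succ n =>
      rw [Function.update_of_ne (Fin.last_pos).ne, Function.update_of_ne (Fin.last_pos).ne',
        Function.update_comm (Fin.last_pos).ne]
  | hε u hu =>
    rw [map_mul, Module.End.mul_apply, Module.End.mul_apply, hu, act_ε]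
    generalize act A u y = y
    refine LinearMap.congr_fun (DGA.chain_ext (f := consOne A ∘ₗ mulLast A c)
      (g := mulLast A c ∘ₗ consOne A) fun n b => ?_) y
    rw [LinearMap.comp_apply, LinearMap.comp_apply, consOne_chain, mulLast_chain, mulLast_chain,
      consOne_chain, ← Fin.succ_last, ← Fin.cons_update]
    rfl

theorem act_sign (b : Bar A) (y : A.connes.M) :
    act A (sign A b) (chainSign A y) = chainSign A (act A b y) := by
  induction b using induction_left generalizing y with
  | h1 => simp
  | hadd u v hu hv => simp only [map_add, LinearMap.add_apply, hu, hv]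
  | hsmul c u hu => simp only [map_smul, LinearMap.smul_apply, hu]
  | hj a u hu =>
    rw [map_mul, map_mul, map_mul, Module.End.mul_apply, Module.End.mul_apply, hu, sign_j, act_j,
      act_j]
    generalize act A u y = y
    refine LinearMap.congr_fun (DGA.chain_ext (f := mulFirst A (A.sign a) ∘ₗ chainSign A)
      (g := chainSign A ∘ₗ mulFirst A a) fun n b => ?_) y
    rw [LinearMap.comp_apply, LinearMap.comp_apply, mulFirst_chain, chainSign_chain,
      chainSign_chain, map_smul, mulFirst_chain]
    congr 2
    ext i
    refine Fin.cases ?_ (fun i => ?_) i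
    · rw [Function.update_self, Function.update_self, map_mul, ← pow_succ_apply, ← pow_succ_apply']
    · rw [Function.update_of_ne (Fin.succ_ne_zero i), Function.update_of_ne (Fin.succ_ne_zero i)]
  | hε u hu =>
    rw [map_mul, map_mul, map_mul, Module.End.mul_apply, Module.End.mul_apply, hu, sign_ε, map_neg,
      act_ε]
    generalize act A u y = y
    refine LinearMap.congr_fun (DGA.chain_ext (f := (-consOne A) ∘ₗ chainSign A)
      (g := chainSign A ∘ₗ consOne A) fun n b => ?_) y
    rw [LinearMap.comp_apply, LinearMap.comp_apply, consOne_chain, chainSign_chain,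
      chainSign_chain, map_smul, LinearMap.neg_apply, consOne_chain, smul_neg]
    refine Eq.trans ?_ (neg_one_pow_succ_smul (M := A.connes.M) n _).symm
    congr 3
    ext i
    refine Fin.cases ?_ (fun i => ?_) i
    · simp
    · simp

theorem act_sign_pow_one (p : ℕ) (b : Bar A) :
    act A ((sign A ^ p) b) (chainOne A) = (chainSign A ^ p) (act A b (chainOne A)) := by
  have h1 : chainSign A (chainOne A) = chainOne A := by
    rw [chainOne, chainSign_chain, pow_zero, one_smul]
    congr 1
    ext i
    simp
  induction p with
  | zero => simp
  | succ p ih =>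
    rw [pow_succ_apply', pow_succ', Module.End.mul_apply, ← ih, ← act_sign, h1]

theorem act_snocOne (b : Bar A) (y : A.connes.M) :
    act A b (snocOne A y) = snocOne A (act A b y) := by
  induction b using induction_left generalizing y with
  | h1 => simp
  | hadd u v hu hv => simp only [map_add, LinearMap.add_apply, hu, hv]
  | hsmul c u hu => simp only [map_smul, LinearMap.smul_apply, hu]
  | hj a u hu =>
    rw [map_mul, Module.End.mul_apply, Module.End.mul_apply, hu, act_j]
    generalize act A u y = y
    refine LinearMap.congr_fun (DGA.chain_ext (f := mulFirst A a ∘ₗ snocOne A)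
      (g := snocOne A ∘ₗ mulFirst A a) fun n b => ?_) y
    rw [LinearMap.comp_apply, LinearMap.comp_apply, mulFirst_chain, snocOne_chain,
      snocOne_chain, mulFirst_chain]
    congr 1
    ext i
    refine Fin.lastCases ?_ (fun i => ?_) i
    · rw [Function.update_of_ne (Fin.last_pos).ne', Fin.snoc_last, Fin.snoc_last]
    · rw [Fin.snoc_castSucc]
      refine Fin.cases ?_ (fun i => ?_) i
      · rw [Function.update_self]
        change Function.update _ 0 _ 0 = _
        rw [Function.update_self, map_mul, ← pow_succ_apply']
        rfl
      · rw [Function.update_of_ne (Fin.succ_ne_zero i), Function.update_of_ne, Fin.snoc_castSucc]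
        exact Fin.succ_ne_zero (i.castSucc)
  | hε u hu =>
    rw [map_mul, Module.End.mul_apply, Module.End.mul_apply, hu, act_ε]
    generalize act A u y = y
    refine LinearMap.congr_fun (DGA.chain_ext (f := consOne A ∘ₗ snocOne A)
      (g := snocOne A ∘ₗ consOne A) fun n b => ?_) y
    rw [LinearMap.comp_apply, LinearMap.comp_apply, consOne_chain, snocOne_chain,
      snocOne_chain, consOne_chain, Fin.cons_snoc_eq_snoc_cons]
    congr 2
    ext i
    refine Fin.cases ?_ (fun i => ?_) i
    · simp
    · simp

variable (A)

/-- The map from words to chains. -/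
def toChain : Bar A →ₗ[k] A.connes.M :=
  close A ∘ₗ (LinearMap.applyₗ (chainOne A)) ∘ₗ (act A).toLinearMap

variable {A}

theorem toChain_apply (b : Bar A) : toChain A b = close A (act A b (chainOne A)) := rfl

end Bar

end Unword

/-! ### The cone of the projection of the Connes complex -/

section UnwordRel

open PiTensorProduct

variable {k : Type u} [Field k] {A : DGA k}

namespace Bar

theorem mulFirst_chainOne (a : A.carrier) :
    mulFirst A a (chainOne A) = mulLast A (A.sign a) (chainOne A) := by
  rw [chainOne, mulFirst_chain, mulLast_chain]
  refine congrArg _ (funext fun i => ?_)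
  rw [Fin.fin_one_eq_zero i]
  simp [Function.update_self]

theorem consOne_chainOne : consOne A (chainOne A) = snocOne A (chainOne A) := by
  rw [chainOne, consOne_chain, snocOne_chain]
  refine congrArg _ (funext fun i => ?_)
  refine Fin.cases ?_ (fun i => ?_) i
  · rw [Fin.cons_zero]
    exact (map_one A.sign).symm
  · rw [Fin.fin_one_eq_zero i, Fin.cons_succ]
    rfl

theorem close_mulFirst [CharZero k] {p : ℕ} {a : A.carrier} (ha : A.sign a = (-1 : k) ^ p • a)
    (y : A.connes.M) :
    close A (mulFirst A a y) = close A (mulLast A (A.sign a) ((chainSign A ^ p) y)) := by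
  refine LinearMap.congr_fun (chain_ext_last (f := close A ∘ₗ mulFirst A a)
    (g := close A ∘ₗ mulLast A (A.sign a) ∘ₗ (chainSign A ^ p)) fun n q b hq => ?_) y
  rw [LinearMap.comp_apply, LinearMap.comp_apply, LinearMap.comp_apply, mulFirst_chain,
    chainSign_pow_chain, map_smul, map_smul, mulLast_chain]
  cases n with
  | zero => exact (close_chain_zero _).trans (by rw [close_chain_zero, smul_zero])
  | succ n =>
    have h1 : A.sign (Function.update b 0 ((A.sign ^ (n + 1 + 1)) a * b 0) (Fin.last _)) =
        (-1 : k) ^ q • Function.update b 0 ((A.sign ^ (n + 1 + 1)) a * b 0) (Fin.last _) := by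
      rw [Function.update_of_ne (Fin.last_pos).ne', hq]
    have h2 : A.sign (Function.update (fun i => (A.sign ^ p) (b i)) (Fin.last (n + 1))
          ((A.sign ^ p) (b (Fin.last (n + 1))) * A.sign a) (Fin.last _)) =
        (-1 : k) ^ (q + p) • Function.update (fun i => (A.sign ^ p) (b i)) (Fin.last (n + 1))
          ((A.sign ^ p) (b (Fin.last (n + 1))) * A.sign a) (Fin.last _) := by
      rw [Function.update_self, map_mul, pow_apply_of_eigen _ hq, ha, map_smul, map_smul, hq, ha,
        pow_add]
      simp only [smul_mul_assoc, mul_smul_comm, smul_smul]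
      congr 1
      ring
    rw [close_chain_succ h1, close_chain_succ h2, Function.update_self,
      Function.update_of_ne (Fin.last_pos).ne', Function.update_self,
      Function.update_of_ne (Fin.last_pos).ne, ← MultilinearMap.map_update_smul]
    refine congrArg _ (funext fun i => ?_)
    refine Fin.cases ?_ (fun i => ?_) i
    · rw [Function.update_self, Function.update_self, map_mul, pow_add (A.sign) q p,
        AlgHom.mul_apply, pow_pow_apply DGA.sign_sign, pow_apply_of_eigen _ ha,
        pow_apply_of_eigen _ hq, ha, map_smul, pow_apply_of_eigen _ ha]
      simp only [smul_mul_assoc, mul_smul_comm, smul_smul, mul_assoc]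
      congr 1
      simp only [← pow_mul, pow_add, add_mul, one_mul, mul_one, mul_comm n p, mul_comm q p]
      ring
    · rw [Function.update_of_ne (Fin.succ_ne_zero i), Function.update_of_ne (Fin.succ_ne_zero i)]
      have e1 : Fin.init (Function.update b 0 ((A.sign ^ (n + 1 + 1)) a * b 0)) i.succ =
          b i.succ.castSucc :=
        Function.update_of_ne (Fin.succ_ne_zero i.castSucc) _ _
      have e2 : Fin.init (Function.update (fun i => (A.sign ^ p) (b i)) (Fin.last (n + 1))
          ((A.sign ^ p) (b (Fin.last (n + 1))) * A.sign a)) i.succ =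
          (A.sign ^ p) (b i.succ.castSucc) :=
        Function.update_of_ne (Fin.castSucc_lt_last _).ne _ _
      rw [e1, e2, pow_add, AlgHom.mul_apply, pow_pow_apply DGA.sign_sign]

theorem close_consOne [CharZero k] (n : ℕ) (x : ⨂[k] _ : Fin (n + 1), A.carrier) :
    close A (consOne A (DirectSum.lof k ℕ (fun n => ⨂[k] _ : Fin (n + 1), A.carrier) n x)) =
      DirectSum.lof k ℕ (fun n => ⨂[k] _ : Fin (n + 1), A.carrier) n (A.rotate n x) := by
  refine LinearMap.congr_fun (DGA.tensor_ext_last (f := close A ∘ₗ consOne A ∘ₗ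
    DirectSum.lof k ℕ (fun n => ⨂[k] _ : Fin (n + 1), A.carrier) n)
    (g := DirectSum.lof k ℕ (fun n => ⨂[k] _ : Fin (n + 1), A.carrier) n ∘ₗ A.rotate n)
    fun p a ha => ?_) x
  rw [LinearMap.comp_apply, LinearMap.comp_apply, LinearMap.comp_apply, DGA.rotate_tprod ha]
  refine (congrArg _ (consOne_chain n a)).trans ?_
  have h1 : A.sign ((Fin.cons 1 a : Fin (n + 2) → A.carrier) (Fin.last _)) =
      (-1 : k) ^ p • (Fin.cons 1 a : Fin (n + 2) → A.carrier) (Fin.last _) := by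
    rw [← Fin.succ_last, Fin.cons_succ, ha]
  rw [close_chain_succ h1]
  refine congrArg (A.chain n) (funext fun i => ?_)
  refine Fin.cases ?_ (fun i => ?_) i
  · rw [Function.update_self, ← Fin.succ_last, Fin.cons_succ, Fin.cons_zero, map_one, mul_one,
      Fin.cons_zero]
  · rw [Function.update_of_ne (Fin.succ_ne_zero i), Fin.cons_succ]
    rfl

theorem close_snocOne [CharZero k] (n : ℕ) (a : Fin (n + 1) → A.carrier) :
    close A (snocOne A (A.chain n a)) = A.chain n fun i => A.sign (a i) := by
  rw [snocOne_chain, close_chain_succ (p := 0) (by rw [Fin.snoc_last]; simp)]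
  refine congrArg _ (funext fun i => ?_)
  refine Fin.cases ?_ (fun i => ?_) i
  · rw [Function.update_self, Fin.snoc_last, one_mul]
    rfl
  · rw [Function.update_of_ne (Fin.succ_ne_zero i), Fin.init_snoc]
    rfl

/-- The map from words to chains is compatible with the relations. -/
theorem toChain_mem_rel [CharZero k] {b : Bar A} (hb : b ∈ rel A) : toChain A b ∈ A.connes.rel := by
  refine rel_le_comap (toChain A) A.connes.rel ?_ ?_ ?_ ?_ ?_ hb
  · rw [toChain_apply, map_one, Module.End.one_apply, chainOne, close_chain_zero]
    exact zero_mem _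
  · rw [toChain_apply, act_ε, consOne_chainOne, chainOne, close_snocOne]
    exact DGA.chain_mem_rel (i := 0) (by simp)
  · intro p a ha x
    rw [toChain_apply, toChain_apply, map_mul, map_mul, Module.End.mul_apply, Module.End.mul_apply,
      act_j, mulFirst_chainOne, act_mulLast, act_sign_pow_one, ← close_mulFirst ha, sub_self]
    exact zero_mem _
  · intro x
    have e := act_sign_pow_one 1 x
    rw [pow_one, pow_one] at e
    rw [toChain_apply, toChain_apply, map_mul, map_mul, Module.End.mul_apply, Module.End.mul_apply,
      act_ε, consOne_chainOne, act_snocOne, e]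
    generalize act A x (chainOne A) = y
    have key : (A.connes.rel).mkQ ∘ₗ close A ∘ₗ consOne A =
        (A.connes.rel).mkQ ∘ₗ close A ∘ₗ snocOne A ∘ₗ chainSign A := by
      refine DGA.chain_ext fun n a => ?_
      simp only [LinearMap.comp_apply]
      refine (Submodule.Quotient.eq _).2 ?_
      have h := neg_mem (DGA.chain_sub_rotate_mem (A := A) n (PiTensorProduct.tprod k a))
      rw [chainSign_chain, map_smul, map_smul, close_snocOne, DGA.chain_apply, close_consOne]
      have h' := A.connes.rel.smul_mem ((-1 : k) ^ n) h
      rw [map_sub, map_smul, neg_sub, smul_sub, smul_smul, neg_one_pow_mul_self, one_smul] at h'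
      have e : (fun i => A.sign (A.sign (a i))) = a := funext fun i => DGA.sign_sign _
      rw [e]
      exact h'
    exact (Submodule.Quotient.eq _).1 (LinearMap.congr_fun key y)
  · intro x
    rw [toChain_apply, map_mul, map_mul, Module.End.mul_apply, Module.End.mul_apply, act_ε,
      consOne_chainOne, chainOne, ]
    have e : consOne A (snocOne A (chainOne A)) = snocOne A (snocOne A (chainOne A)) := by
      have := act_snocOne (ε A) (chainOne A)
      rw [act_ε, consOne_chainOne] at this
      exact this
    rw [← chainOne, e, act_snocOne, act_snocOne]
    generalize act A x (chainOne A) = y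
    have key : (A.connes.rel).mkQ ∘ₗ close A ∘ₗ snocOne A ∘ₗ snocOne A = 0 := by
      refine DGA.chain_ext fun n a => ?_
      simp only [LinearMap.comp_apply]
      refine (Submodule.Quotient.mk_eq_zero _).2 ?_
      rw [snocOne_chain, close_snocOne]
      refine DGA.chain_mem_rel (i := Fin.last _) ?_
      rw [Fin.snoc_last, map_one]
    exact (Submodule.Quotient.mk_eq_zero _).1 (LinearMap.congr_fun key y)

/-- Words represent chains faithfully. -/
theorem toChain_ofChain [CharZero k] (x : A.connes.M) : toChain A (ofChain A x) = x := by
  have h1 : ∀ (n : ℕ) (a : Fin n → A.carrier) (y : A.carrier),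
      act A (openWord A n (Fin.snoc a y)) (chainOne A) = A.chain n (Fin.snoc a y) := by
    intro n
    induction n with
    | zero =>
      intro a y
      rw [openWord_apply, word_zero, one_mul, act_j, chainOne, mulFirst_chain, Fin.snoc_last]
      refine congrArg (A.chain 0) (funext fun i => ?_)
      rw [Fin.fin_one_eq_zero i, Function.update_self]
      refine (mul_one _).trans ?_
      rw [pow_succ_apply, DGA.sign_sign]
      rfl
    | succ n ih =>
      intro a y
      obtain ⟨c, b, rfl⟩ : ∃ c b, a = Fin.cons c b := ⟨_, _, (Fin.cons_self_tail a).symm⟩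
      have e := ih b y
      rw [openWord_apply, Fin.init_snoc, Fin.snoc_last] at e ⊢
      rw [word_succ, mul_assoc, map_mul, Module.End.mul_apply, Fin.tail_cons, e, Fin.cons_zero,
        map_mul, Module.End.mul_apply, act_ε, act_j, consOne_chain, mulFirst_chain, Fin.cons_zero,
        mul_one, Fin.update_cons_zero, pow_add_two_apply DGA.sign_sign,
        pow_pow_apply DGA.sign_sign, Fin.cons_snoc_eq_snoc_cons]
  refine LinearMap.congr_fun (DGA.chain_ext (f := toChain A ∘ₗ ofChain A) (g := LinearMap.id)
    fun n a => ?_) x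
  have e := h1 (n + 1) a 1
  rw [openWord_apply, Fin.init_snoc, Fin.snoc_last, map_one, map_one, mul_one] at e
  rw [LinearMap.comp_apply, ofChain_chain, toChain_apply, e, LinearMap.id_apply]
  have := close_snocOne n fun i => A.sign (a i)
  rw [snocOne_chain] at this
  simpa only [DGA.sign_sign] using this

/-- Every element is, modulo the relations, the sum of a word of a chain and an element of `A`. -/
theorem sub_ofChain_toChain_mem_rel [CharZero k] (b : Bar A) :
    ∃ a, b - (j A a + ofChain A (toChain A b)) ∈ rel A ∧
      a = A.sign (A.proj₀ (act A b (chainOne A))) := by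
  have := ofChainOpen_sub_mem_rel (act A b (chainOne A))
  rw [ofChainOpen_act_one] at this
  exact ⟨_, this, rfl⟩

theorem toChain_j (a : A.carrier) : toChain A (j A a) = 0 := by
  rw [toChain_apply, act_j, chainOne, mulFirst_chain, close_chain_zero]

theorem word_cons (n : ℕ) (c : A.carrier) (b : Fin n → A.carrier) :
    word A (n + 1) (Fin.cons c b : Fin (n + 1) → A.carrier) =
      j A ((A.sign ^ n) c) * ε A * word A n b := by
  rw [word_succ, Fin.tail_cons, Fin.cons_zero]

theorem openWord_cons (n : ℕ) (c : A.carrier) (b : Fin (n + 1) → A.carrier) :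
    openWord A (n + 1) (Fin.cons c b : Fin (n + 2) → A.carrier) =
      j A ((A.sign ^ n) c) * ε A * openWord A n b := by
  rw [openWord_apply, openWord_apply, word_succ, ← Fin.succ_last, Fin.cons_succ]
  simp only [mul_assoc]
  rfl

theorem d_word (n : ℕ) (a : Fin (n + 1) → A.carrier) : d A (word A (n + 1) a) =
    (-1 : k) ^ n • ∑ i : Fin (n + 1), word A (n + 1)
      (fun l => if l < i then A.sign (a l) else if l = i then A.d (a l) else a l) +
    ∑ i : Fin n, (-1 : k) ^ (i : ℕ) • word A n (Fin.contractNth i.castSucc (· * ·) a) +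
    (-1 : k) ^ n • openWord A n a := by
  induction n with
  | zero =>
    rw [openWord_apply, word_zero, word_succ, word_zero, Fin.sum_univ_one, word_succ, word_zero,
      d_mul, d_mul]
    simp [d_one]
  | succ n ih =>
    obtain ⟨c, b, rfl⟩ : ∃ c b, a = Fin.cons c b := ⟨_, _, (Fin.cons_self_tail a).symm⟩
    have e1 : (fun l : Fin (n + 2) => if l < 0 then A.sign ((Fin.cons c b : Fin (n + 2) → _) l) else
        if l = 0 then A.d ((Fin.cons c b : Fin (n + 2) → _) l) else
          (Fin.cons c b : Fin (n + 2) → _) l) = (Fin.cons (A.d c) b : Fin (n + 2) → _) := by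
      ext l
      refine Fin.cases ?_ (fun l => ?_) l
      · simp
      · simp
    have e2 : ∀ i : Fin (n + 1), (fun l : Fin (n + 2) => if l < i.succ then
        A.sign ((Fin.cons c b : Fin (n + 2) → _) l) else
        if l = i.succ then A.d ((Fin.cons c b : Fin (n + 2) → _) l) else
          (Fin.cons c b : Fin (n + 2) → _) l) = (Fin.cons (A.sign c) (fun l => if l < i then
            A.sign (b l) else if l = i then A.d (b l) else b l) : Fin (n + 2) → _) := by
      intro i
      ext l
      refine Fin.cases ?_ (fun l => ?_) l
      · simp
      · simp
    have e3 : (Fin.contractNth (Fin.castSucc 0) (· * ·) (Fin.cons c b : Fin (n + 2) → A.carrier) :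
        Fin (n + 1) → A.carrier) = Function.update b 0 (c * b 0) := by
      ext l
      refine Fin.cases ?_ (fun l => ?_) l
      · simp [Fin.contractNth]
      · rw [Function.update_of_ne (Fin.succ_ne_zero l)]
        simp [Fin.contractNth]
    have e4 : ∀ i : Fin n, (Fin.contractNth (Fin.castSucc i.succ) (· * ·)
        (Fin.cons c b : Fin (n + 2) → A.carrier) : Fin (n + 1) → A.carrier) =
        Fin.cons c (Fin.contractNth i.castSucc (· * ·) b) := by
      intro i
      ext l
      refine Fin.cases ?_ (fun l => ?_) l
      · simp [Fin.contractNth]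
      · simp [Fin.contractNth]
    rw [Fin.sum_univ_succ (n := n), Fin.sum_univ_succ (n := n + 1), e1, e3, openWord_cons,
      word_cons,
      word_cons, word_update_zero]
    simp only [e2, e4, word_cons]
    rw [mul_assoc, d_mul, d_mul, ih b, d_j, d_ε, sign_j, sign_ε, one_mul]
    have f1 : (A.sign ^ (n + 1)) (A.d c) = (-1 : k) ^ (n + 1) • A.d ((A.sign ^ (n + 1)) c) :=
      DGA.sign_pow_d _ _
    have f2 : A.sign ((A.sign ^ (n + 1)) c) = (A.sign ^ n) c := by
      rw [← pow_succ_apply', pow_add_two_apply DGA.sign_sign]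
    have f3 : (A.sign ^ (n + 1)) (A.sign c) = (A.sign ^ n) c := by
      rw [← pow_succ_apply, pow_add_two_apply DGA.sign_sign]
    have f4 : word A (n + 1) b = j A ((A.sign ^ n) (b 0)) * ε A * word A n (Fin.tail b) :=
      word_succ n b
    have f5 : j A ((A.sign ^ n) c) * word A (n + 1) b =
        j A ((A.sign ^ n) (c * b 0)) * ε A * word A n (Fin.tail b) := by
      rw [f4, map_mul, map_mul]; simp only [mul_assoc]
    simp only [f1, f2, f3, f5, Fin.val_zero, pow_zero, one_smul, Fin.val_succ, mul_add,
      Finset.mul_sum, smul_add, Finset.smul_sum, mul_smul_comm,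
      neg_one_pow_succ_smul, neg_mul, mul_neg, Finset.sum_neg_distrib, mul_assoc]
    simp only [map_neg, map_smul, smul_neg, neg_neg, smul_mul_assoc, neg_mul, smul_smul,
      neg_one_pow_mul_self, one_smul, Finset.sum_neg_distrib]
    abel

/-- The differential of `A * k[ε]` restricts to that of the Connes complex, up to the projection to
`A`. -/
theorem d_ofChain_sub_mem_rel [CharZero k] (x : A.connes.M) :
    d A (ofChain A x) - (ofChain A (A.connes.d x) + j A (A.sign (A.proj₀ x))) ∈ rel A := by
  refine (Submodule.Quotient.eq _).1 (LinearMap.congr_fun (DGA.chain_ext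
    (f := (rel A).mkQ ∘ₗ d A ∘ₗ ofChain A)
    (g := (rel A).mkQ ∘ₗ (ofChain A ∘ₗ A.hochschildD +
      (j A).toLinearMap ∘ₗ A.sign.toLinearMap ∘ₗ A.proj₀)) fun n a => ?_) x)
  simp only [LinearMap.comp_apply, LinearMap.add_apply, AlgHom.toLinearMap_apply]
  refine (Submodule.Quotient.eq _).2 ?_
  rw [ofChain_chain, d_word]
  cases n with
  | zero =>
    rw [DGA.hochschildD_zero, ofChain_chain, DGA.chain_apply, A.proj₀_zero, openWord_apply,
      word_zero,
      Fin.sum_univ_one, Finset.univ_eq_empty, Finset.sum_empty, pow_zero, one_smul, one_smul,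
      one_mul, add_zero]
    refine (sub_eq_zero.2 (congrArg₂ (· + ·) (congrArg (word A 1) ?_) rfl)).symm ▸ zero_mem _
    ext l
    rw [Fin.fin_one_eq_zero l]
    simp
  | succ n =>
    have e1 : ofChain A (A.hochschildD (A.chain (n + 1) a)) =
        (∑ i : Fin (n + 1),
          (-1 : k) ^ (i : ℕ) • word A (n + 1) (Fin.contractNth i.castSucc (· * ·) a)) +
        (-1 : k) ^ (n + 1) • ofChain A (close A (A.chain (n + 1) a)) +
        (-1 : k) ^ (n + 1) • ∑ i : Fin (n + 2), word A (n + 2)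
          (fun l => if l < i then A.sign (a l) else if l = i then A.d (a l) else a l) := by
      rw [DGA.chain_apply, DGA.hochschildD_succ, close_lof_succ, map_add, map_smul]
      refine congrArg₂ (· + ·) ?_ (congrArg _ ?_)
      · rw [DGA.hochschildB, LinearMap.add_apply, LinearMap.sum_apply, map_add, map_add, map_sum,
          map_sum]
        refine congrArg₂ (· + ·) (Finset.sum_congr rfl fun i _ => ?_) ?_
        · rw [LinearMap.smul_apply, map_smul, map_smul, face, lift.tprod]
          exact congrArg _ (ofChain_chain n _)
        · rw [LinearMap.smul_apply, map_smul, map_smul]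
          rfl
      · rw [DGA.internalD, LinearMap.sum_apply, map_sum, map_sum]
        refine Finset.sum_congr rfl fun i _ => ?_
        rw [map_tprod]
        refine (ofChain_chain (n + 1) _).trans (congrArg _ (funext fun l => ?_))
        split_ifs <;> rfl
    have h := (rel A).smul_mem ((-1 : k) ^ (n + 1)) (ofChainOpen_sub_mem_rel (A.chain (n + 1) a))
    rw [e1]
    rw [DGA.chain_apply, A.proj₀_succ, map_zero, map_zero, ← DGA.chain_apply, ofChainOpen_chain,
      smul_sub, smul_add, smul_zero, zero_add] at h
    rw [DGA.chain_apply, A.proj₀_succ, map_zero, map_zero, ← DGA.chain_apply, add_zero]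
    convert h using 1
    abel

end Bar

namespace DGA

theorem d_mem_connes_rel [CharZero k] {x : A.connes.M} (hx : x ∈ A.connes.rel) :
    A.connes.d x ∈ A.connes.rel := by
  have h1 := Bar.d_mem_rel (Bar.ofChain_mem_rel hx)
  have h2 := Bar.toChain_mem_rel ((Submodule.sub_mem_iff_right _ h1).1
    (Bar.d_ofChain_sub_mem_rel x))
  rwa [map_add, Bar.toChain_ofChain, Bar.toChain_j, add_zero] at h2

theorem d_d_mem_connes_rel [CharZero k] (x : A.connes.M) :
    A.connes.d (A.connes.d x) ∈ A.connes.rel := by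
  have h1 := Bar.d_mem_rel (Bar.d_ofChain_sub_mem_rel x)
  rw [map_sub, Bar.d_d, zero_sub, map_add, Bar.d_j] at h1
  have h2 := Bar.toChain_mem_rel (add_mem (neg_mem h1) (neg_mem
    (Bar.d_ofChain_sub_mem_rel (A.connes.d x))))
  rw [map_add, neg_neg, neg_sub, map_add, map_sub, map_add, Bar.toChain_ofChain, Bar.toChain_j,
    Bar.toChain_j, add_zero, add_zero] at h2
  convert h2 using 1
  abel

end DGA

namespace Bar

/-- Homogeneous words in elements of `A` and in `ε` (of degree `1`). -/
inductive IsWord (A : DGA k) : ℤ → Bar A → Prop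
  | one : IsWord A 0 1
  | j {i n : ℤ} {a : A.carrier} {u : Bar A} : a ∈ A.gr i → IsWord A n u →
      IsWord A (i + n) (j A a * u)
  | ε {n : ℤ} {u : Bar A} : IsWord A n u → IsWord A (1 + n) (ε A * u)

/-- The degree `n` part of `A * k[ε]`. -/
def gr (A : DGA k) (n : ℤ) : Submodule k (Bar A) := Submodule.span k {u | IsWord A n u}

theorem one_mem_gr : (1 : Bar A) ∈ gr A 0 := Submodule.subset_span IsWord.one

theorem IsWord.mul {m n : ℤ} {u v : Bar A} (hu : IsWord A m u) (hv : IsWord A n v) :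
    IsWord A (m + n) (u * v) := by
  induction hu with
  | one => simpa using hv
  | j ha _ ih => rw [mul_assoc, add_assoc]; exact IsWord.j ha ih
  | ε _ ih => rw [mul_assoc, add_assoc]; exact IsWord.ε ih

theorem mul_mem_gr {m n : ℤ} {u v : Bar A} (hu : u ∈ gr A m) (hv : v ∈ gr A n) :
    u * v ∈ gr A (m + n) := by
  have h : gr A m * gr A n ≤ gr A (m + n) := by
    rw [gr, gr, Submodule.span_mul_span]
    refine Submodule.span_mono ?_
    rintro _ ⟨u, hu, v, hv, rfl⟩
    exact hu.mul hv
  exact h (Submodule.mul_mem_mul hu hv)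

theorem j_mem_gr {i : ℤ} {a : A.carrier} (ha : a ∈ A.gr i) : j A a ∈ gr A i := by
  have := Submodule.subset_span (R := k) (IsWord.j ha IsWord.one)
  rwa [mul_one, add_zero] at this

theorem ε_mem_gr : ε A ∈ gr A 1 := by
  have := Submodule.subset_span (R := k) (IsWord.ε (A := A) IsWord.one)
  rwa [mul_one, add_zero] at this

/-- Induction along left multiplication by homogeneous elements. -/
theorem gr_induction {P : ∀ (n : ℤ) (u : Bar A), u ∈ gr A n → Prop} (h1 : P 0 1 one_mem_gr)
    (hj : ∀ {i n a u} (ha : a ∈ A.gr i) (hu : u ∈ gr A n), P n u hu →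
      P (i + n) (j A a * u) (mul_mem_gr (j_mem_gr ha) hu))
    (hε : ∀ {n u} (hu : u ∈ gr A n), P n u hu → P (1 + n) (ε A * u) (mul_mem_gr ε_mem_gr hu))
    (h0 : ∀ n, P n 0 (zero_mem _))
    (hadd : ∀ {n u v} (hu : u ∈ gr A n) (hv : v ∈ gr A n), P n u hu → P n v hv →
      P n (u + v) (add_mem hu hv))
    (hsmul : ∀ {n u} (c : k) (hu : u ∈ gr A n), P n u hu → P n (c • u) (Submodule.smul_mem _ c hu))
    {n : ℤ} {u : Bar A} (hu : u ∈ gr A n) : P n u hu := by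
  induction hu using Submodule.span_induction with
  | zero => exact h0 n
  | add u v hu hv ihu ihv => exact hadd hu hv ihu ihv
  | smul c u hu ih => exact hsmul c hu ih
  | mem u hu =>
    induction hu with
    | one => exact h1
    | j ha hu ih => exact hj ha (Submodule.subset_span hu) ih
    | ε hu ih => exact hε (Submodule.subset_span hu) ih

theorem sign_of_mem {n : ℤ} {u : Bar A} (hu : u ∈ gr A n) : sign A u = (-1 : k) ^ n • u := by
  induction hu using gr_induction with
  | h1 => simp
  | hj ha hu ih =>
    rw [map_mul, sign_j, DGA.sign_of_mem ha, ih, map_smul, smul_mul_smul_comm,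
      zpow_add₀ (neg_ne_zero.mpr (one_ne_zero' k))]
  | hε hu ih =>
    rw [map_mul, sign_ε, ih, neg_mul, mul_smul_comm, zpow_add₀ (neg_ne_zero.mpr (one_ne_zero' k)),
      zpow_one, neg_one_mul, neg_smul]
  | h0 => simp
  | hadd hu hv ihu ihv => rw [map_add, ihu, ihv, smul_add]
  | hsmul c hu ih => rw [map_smul, ih, smul_comm]

/-- Odd derivations shift degrees if they do so on generators. -/
theorem derivation_mem_gr {F : A.carrier →ₗ[k] Bar A} (hF : IsOddDerivation F) {e : Bar A} {m : ℤ}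
    (h : ∀ {i a}, a ∈ A.gr i → F a ∈ gr A (i + m)) (he : e ∈ gr A (1 + m)) {n : ℤ} {u : Bar A}
    (hu : u ∈ gr A n) : derivation hF e u ∈ gr A (n + m) := by
  induction hu using gr_induction with
  | h1 => rw [derivation_one]; exact zero_mem _
  | @hj i n a u ha hu ih =>
    rw [derivation_mul, derivation_j, sign_j]
    refine add_mem ?_ ?_
    · rw [add_right_comm]; exact mul_mem_gr (h ha) hu
    · rw [add_assoc]; exact mul_mem_gr (j_mem_gr (DGA.sign_mem ha)) ih
  | hε hu ih =>
    rw [derivation_mul, derivation_ε, sign_ε, neg_mul]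
    refine add_mem ?_ (neg_mem ?_)
    · rw [add_right_comm]; exact mul_mem_gr he hu
    · rw [add_assoc]; exact mul_mem_gr ε_mem_gr ih
  | h0 => rw [map_zero]; exact zero_mem _
  | hadd hu hv ihu ihv => rw [map_add]; exact add_mem ihu ihv
  | hsmul c hu ih => rw [map_smul]; exact Submodule.smul_mem _ _ ih

theorem d_mem_gr {n : ℤ} {u : Bar A} (hu : u ∈ gr A n) : d A u ∈ gr A (n - 1) :=
  derivation_mem_gr _ (m := -1) (fun ha => j_mem_gr (A.d_mem ha)) (by simpa using one_mem_gr) hu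

theorem word_mem_gr {n : ℕ} {a : Fin n → A.carrier} {e : Fin n → ℤ} (ha : ∀ i, a i ∈ A.gr (e i)) :
    word A n a ∈ gr A ((∑ i, e i) + n) := by
  induction n with
  | zero => simpa [word_zero] using one_mem_gr
  | succ n ih =>
    rw [word_succ, Fin.sum_univ_succ]
    have := mul_mem_gr (mul_mem_gr (j_mem_gr (DGA.sign_pow_mem (ha 0) n)) ε_mem_gr)
      (ih (a := Fin.tail a) fun i => ha i.succ)
    convert this using 2
    push_cast
    ring

theorem ofChain_mem_gr {n : ℤ} {x : A.connes.M} (hx : x ∈ A.connes.gr n) :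
    ofChain A x ∈ gr A (n + 1) := by
  have h : A.connes.gr n ≤ (gr A (n + 1)).comap (ofChain A) := by
    refine Submodule.span_le.2 ?_
    rintro _ ⟨n, e, a, ha, rfl, rfl⟩
    change ofChain A (A.chain n a) ∈ gr A _
    have e : (∑ i, e i) + n + 1 = (∑ i, e i) + ((n + 1 : ℕ) : ℤ) := by push_cast; ring
    rw [ofChain_chain, e]
    exact word_mem_gr ha
  exact h hx

theorem close_mem_gr [CharZero k] {n : ℤ} {x : A.connes.M} (hx : x ∈ A.connes.gr n) :
    close A x ∈ A.connes.gr (n - 1) := by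
  have h : A.connes.gr n ≤ (A.connes.gr (n - 1)).comap (close A) := by
    refine Submodule.span_le.2 ?_
    rintro _ ⟨n, e, a, ha, rfl, rfl⟩
    change close A (A.chain n a) ∈ A.connes.gr _
    cases n with
    | zero => rw [close_chain_zero]; exact zero_mem _
    | succ n =>
      obtain ⟨p, hp⟩ := exists_neg_one_pow (k := k) (e (Fin.last _))
      rw [close_chain_succ (p := p) (by rw [DGA.sign_of_mem (ha _), hp])]
      have e1 : (∑ i, e i) + ((n + 1 : ℕ) : ℤ) - 1 =
          (∑ i, Function.update (Fin.init e : Fin (n + 1) → ℤ) 0 (e (Fin.last _) + e 0) i) + n := by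
        rw [Fin.sum_univ_castSucc, Fin.sum_univ_succ, Fin.sum_univ_succ, Function.update_self]
        have : ∀ i : Fin n, Function.update (Fin.init e : Fin (n + 1) → ℤ) 0
            (e (Fin.last _) + e 0) i.succ = e i.succ.castSucc := fun i =>
          Function.update_of_ne (Fin.succ_ne_zero i) _ _
        simp only [this, Fin.castSucc_zero]
        push_cast
        ring
      rw [e1]
      refine DGA.chain_mem_gr fun i => ?_
      refine Fin.cases ?_ (fun i => ?_) i
      · rw [Function.update_self, Function.update_self]
        exact SetLike.mul_mem_graded (ha _) (DGA.sign_pow_mem (ha 0) p)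
      · rw [Function.update_of_ne (Fin.succ_ne_zero i), Function.update_of_ne (Fin.succ_ne_zero i)]
        exact DGA.sign_pow_mem (ha i.succ.castSucc) p
  exact h hx

theorem mulFirst_mem_gr {i n : ℤ} {c : A.carrier} (hc : c ∈ A.gr i) {x : A.connes.M}
    (hx : x ∈ A.connes.gr n) : mulFirst A c x ∈ A.connes.gr (i + n) := by
  have h : A.connes.gr n ≤ (A.connes.gr (i + n)).comap (mulFirst A c) := by
    refine Submodule.span_le.2 ?_
    rintro _ ⟨n, e, a, ha, rfl, rfl⟩
    change mulFirst A c (A.chain n a) ∈ A.connes.gr _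
    have e1 : i + ((∑ i, e i) + n) = (∑ l, Function.update e 0 (i + e 0) l) + n := by
      rw [Fin.sum_univ_succ, Fin.sum_univ_succ, Function.update_self]
      have : ∀ l : Fin n, Function.update e 0 (i + e 0) l.succ = e l.succ := fun l =>
        Function.update_of_ne (Fin.succ_ne_zero l) _ _
      simp only [this]
      ring
    rw [mulFirst_chain, e1]
    refine DGA.chain_mem_gr fun i => ?_
    refine Fin.cases ?_ (fun i => ?_) i
    · rw [Function.update_self, Function.update_self]
      exact SetLike.mul_mem_graded (DGA.sign_pow_mem hc _) (ha 0)
    · rw [Function.update_of_ne (Fin.succ_ne_zero i), Function.update_of_ne (Fin.succ_ne_zero i)]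
      exact ha i.succ
  exact h hx

theorem consOne_mem_gr {n : ℤ} {x : A.connes.M} (hx : x ∈ A.connes.gr n) :
    consOne A x ∈ A.connes.gr (1 + n) := by
  have h : A.connes.gr n ≤ (A.connes.gr (1 + n)).comap (consOne A) := by
    refine Submodule.span_le.2 ?_
    rintro _ ⟨n, e, a, ha, rfl, rfl⟩
    change consOne A (A.chain n a) ∈ A.connes.gr _
    have e1 : 1 + ((∑ i, e i) + n) =
        (∑ l, (Fin.cons 0 e : Fin (n + 2) → ℤ) l) + ((n + 1 : ℕ) : ℤ) := by
      rw [Fin.sum_univ_succ (n := n + 1)]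
      simp only [Fin.cons_zero, Fin.cons_succ]
      push_cast
      ring
    rw [consOne_chain, e1]
    refine DGA.chain_mem_gr fun i => ?_
    refine Fin.cases ?_ (fun i => ?_) i
    · exact SetLike.GradedOne.one_mem
    · exact ha i
  exact h hx

theorem act_chainOne_mem_gr {n : ℤ} {u : Bar A} (hu : u ∈ gr A n) :
    act A u (chainOne A) ∈ A.connes.gr n := by
  induction hu using gr_induction with
  | h1 =>
    rw [map_one, Module.End.one_apply, chainOne]
    have := DGA.chain_mem_gr (A := A) (n := 0) (a := 1) (e := 0)
      fun _ => SetLike.GradedOne.one_mem (A := A.gr)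
    simpa using this
  | hj ha hu ih =>
    rw [map_mul, Module.End.mul_apply, act_j]
    exact mulFirst_mem_gr ha ih
  | hε hu ih =>
    rw [map_mul, Module.End.mul_apply, act_ε]
    exact consOne_mem_gr ih
  | h0 => rw [map_zero]; exact zero_mem _
  | hadd hu hv ihu ihv => rw [map_add, LinearMap.add_apply]; exact add_mem ihu ihv
  | hsmul c hu ih => rw [map_smul, LinearMap.smul_apply]; exact Submodule.smul_mem _ _ ih

theorem toChain_mem_gr [CharZero k] {n : ℤ} {u : Bar A} (hu : u ∈ gr A n) :
    toChain A u ∈ A.connes.gr (n - 1) := close_mem_gr (act_chainOne_mem_gr hu)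

theorem exists_sub_mem_rel [CharZero k] {n : ℤ} {b : Bar A} (hb : b ∈ gr A n) :
    ∃ a ∈ A.gr n, b - (j A a + ofChain A (toChain A b)) ∈ rel A := by
  obtain ⟨a, h, rfl⟩ := sub_ofChain_toChain_mem_rel b
  exact ⟨_, DGA.sign_mem ((DGA.connesToCyc A).map_gr (act_chainOne_mem_gr hb)), h⟩

/-- The differential in terms of the decomposition of elements into words of chains and elements
of `A`. -/
theorem d_sub_mem_rel [CharZero k] {b : Bar A} {a : A.carrier} {y : A.connes.M}
    (h : b - (j A a + ofChain A y) ∈ rel A) :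
    d A b - (j A (A.d a + A.sign (A.proj₀ y)) + ofChain A (A.connes.d y)) ∈ rel A := by
  have h1 := d_mem_rel h
  rw [map_sub, map_add, d_j] at h1
  convert add_mem h1 (d_ofChain_sub_mem_rel y) using 1
  rw [map_add]
  abel

theorem sign_mem_commutators {x : A.carrier} (hx : x ∈ A.commutators) :
    A.sign x ∈ A.commutators := by
  induction hx using Submodule.span_induction with
  | zero => rw [map_zero]; exact zero_mem _
  | add x y _ _ hx hy => rw [map_add]; exact add_mem hx hy
  | smul c x _ hx => rw [map_smul]; exact Submodule.smul_mem _ _ hx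
  | mem z hz =>
    rcases hz with rfl | ⟨i, l, x, hx, y, hy, rfl⟩
    · rw [map_one]; exact Submodule.subset_span (Or.inl rfl)
    · rw [map_sub, map_smul, map_mul, map_mul]
      exact Submodule.subset_span (Or.inr ⟨i, l, _, DGA.sign_mem hx, _, DGA.sign_mem hy, rfl⟩)

/-- If the quotient of `A * k[ε]` by the relations is acyclic, then the reduced cyclic homology of
`A` is the homology of `A / (k + [A, A])`. -/
theorem connesToCyc_bijective [CharZero k]
    (hac : ∀ (m : ℤ) (b : Bar A), b ∈ gr A m → d A b ∈ rel A →
      ∃ c ∈ gr A (m + 1), b - d A c ∈ rel A) (n : ℤ) :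
    Function.Bijective ((DGA.connesToCyc A).mapH n) := by
  refine PresentedComplex.Hom.mapH_bijective (fun x hx hb => ?_) (fun u hu => ?_)
  · obtain ⟨_, ⟨u, hu, rfl⟩, r, hr, hur⟩ := Submodule.mem_sup.1 hb
    change A.d u + r = A.proj₀ x at hur
    -- `x` and `u` form a cycle of the mapping cone; the component in the Connes complex of the
    -- element `c` that it bounds is a chain with boundary `x` modulo the relations
    obtain ⟨c, hc, h⟩ := hac (n + 1) (ofChain A x + j A (A.sign u))
      (add_mem (ofChain_mem_gr hx.1) (j_mem_gr (DGA.sign_mem hu))) (by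
        rw [map_add, d_j]
        have h1 := add_mem (d_ofChain_sub_mem_rel x) (add_mem (ofChain_mem_rel hx.2)
          (j_mem_rel (sign_mem_commutators hr)))
        convert h1 using 1
        rw [← hur, map_add A.sign, DGA.sign_d, map_add, map_neg]
        abel)
    obtain ⟨a, -, h1⟩ := exists_sub_mem_rel hc
    have h2 := toChain_mem_rel (add_mem h (d_sub_mem_rel h1))
    rw [sub_add_sub_cancel, map_sub, map_add, map_add, toChain_j, toChain_j, toChain_ofChain,
      toChain_ofChain, add_zero, zero_add] at h2
    refine Submodule.mem_sup.2 ⟨_, ⟨toChain A c, ?_, rfl⟩, _, h2, add_sub_cancel _ _⟩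
    have := toChain_mem_gr hc
    rwa [add_sub_cancel_right] at this
  · have h0 : j A (A.sign u) ∈ gr A n := j_mem_gr (DGA.sign_mem hu.1)
    obtain ⟨c, hc, h⟩ := hac n _ h0 (by
      rw [d_j]
      have := j_mem_rel (neg_mem (sign_mem_commutators (x := A.d u) hu.2))
      rwa [DGA.sign_d, neg_neg] at this)
    obtain ⟨a, ha, h1⟩ := exists_sub_mem_rel hc
    have h2 := add_mem h (d_sub_mem_rel h1)
    rw [sub_add_sub_cancel] at h2
    have h3 := toChain_mem_rel h2
    rw [map_sub, map_add, toChain_j, toChain_j, toChain_ofChain, zero_add, zero_sub] at h3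
    have h4 := neg_mem_iff.1 h3
    have hy := toChain_mem_gr hc
    rw [add_sub_cancel_right] at hy
    refine ⟨toChain A c, ⟨hy, h4⟩, ?_⟩
    have h5 := toAlg_mem_commutators (add_mem h2 (ofChain_mem_rel h4))
    rw [← sub_sub, sub_add_cancel, ← map_sub, toAlg_j] at h5
    have h6 := neg_mem (sign_mem_commutators h5)
    rw [map_sub, map_add, DGA.sign_sign, DGA.sign_sign, DGA.sign_d] at h6
    refine Submodule.mem_sup.2 ⟨_, ⟨A.sign a, DGA.sign_mem ha, rfl⟩, _,
      h6, ?_⟩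
    change A.d (A.sign a) + _ = A.proj₀ _ - u
    abel

end Bar

end UnwordRel

/-! ### Acyclicity by positivity of an Euler operator -/

section Acyclic

variable {k : Type u} [Field k]

/-- `x` is a sum of generalized eigenvectors of `E` with eigenvalues that are positive integers,
expressed by successive applications of the operators `E - l`. -/
inductive IsPositive {B : Type u} [AddCommGroup B] [Module k B] (E : B →ₗ[k] B) : B → Prop
  | zero : IsPositive E 0
  | step {x : B} (l : ℕ) : IsPositive E (E x - ((l : k) + 1) • x) → IsPositive E x

namespace IsPositive

section Module

variable {B : Type u} [AddCommGroup B] [Module k B] {E : B →ₗ[k] B}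

theorem map_of_commute {C : Type u} [AddCommGroup C] [Module k C] {E' : C →ₗ[k] C} {f : B →ₗ[k] C}
    (hf : ∀ x, f (E x) = E' (f x)) {x : B} (hx : IsPositive E x) : IsPositive E' (f x) := by
  induction hx with
  | zero => rw [map_zero]; exact zero
  | @step x l _ ih =>
    rw [map_sub, map_smul, hf] at ih
    exact step l ih

theorem smul (c : k) {x : B} (hx : IsPositive E x) : IsPositive E (c • x) :=
  map_of_commute (f := c • LinearMap.id) (fun x => by simp) hx

theorem neg {x : B} (hx : IsPositive E x) : IsPositive E (-x) := by
  simpa using smul (-1) hx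

theorem add {x : B} (hx : IsPositive E x) : ∀ {y : B}, IsPositive E y → IsPositive E (x + y) := by
  induction hx with
  | zero => intro y hy; rwa [zero_add]
  | @step x l _ ih =>
    intro y hy
    refine step l ?_
    have := ih (map_of_commute (f := E - ((l : k) + 1) • LinearMap.id) (by simp) hy)
    convert this using 1
    simp only [map_add, smul_add, LinearMap.sub_apply, LinearMap.smul_apply, LinearMap.id_apply]
    abel

end Module

theorem mul {B : Type u} [Ring B] [Algebra k B] {E : B →ₗ[k] B}
    (hE : ∀ x y, E (x * y) = E x * y + x * E y) {x : B} (hx : IsPositive E x) :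
    ∀ {y : B}, IsPositive E y → IsPositive E (x * y) := by
  induction hx with
  | zero => intro y _; rw [zero_mul]; exact zero
  | @step x l hx ihx =>
    intro y hy
    have hx' := step l hx
    induction hy with
    | zero => rw [mul_zero]; exact zero
    | @step y m hy ihy =>
      refine step (l + m + 1) ?_
      have := (ihx (step m hy)).add ihy
      convert this using 1
      rw [hE, sub_mul, mul_sub, mul_smul_comm, smul_mul_assoc]
      push_cast
      module

end IsPositive

namespace CellTerm

variable {a : DGLA k}

/-- The linear map from the cellular resolution to the free algebra that sends a term to its
value. -/
def evalLin (a : DGLA k) : (cellular a).carrier →ₗ[k] FreeAlgebra k (CellTerm k a.carrier) :=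
  DirectSum.toModule k ℤ _ fun n => ((family a).Q n).subtype

theorem evalLin_mk {n : ℤ} {t : CellTerm k a.carrier} (ht : WF a n t) :
    evalLin a (mk ht) = eval t := (family a).toModule_of _ _

theorem respects_evalLin (a : DGLA k) : Env.Respects (L := cellular a) (evalLin a) := by
  intro i j x hx y hy
  obtain ⟨s, hs, rfl⟩ := exists_mk hx
  obtain ⟨t, ht, rfl⟩ := exists_mk hy
  have h : WF a (i + j) (bracket i j s t) := ⟨rfl, hs, ht⟩
  have e : evalLin a ((cellular a).bracket (mk hs) (mk ht)) = eval (bracket i j s t) :=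
    (congrArg _ (mk_bracket rfl hs ht).symm).trans (evalLin_mk h)
  rw [e, evalLin_mk, evalLin_mk, eval, superComm_apply, add_sub_cancel]

/-- The comparison of the enveloping algebra of the cellular resolution with the free algebra. -/
def toFree (a : DGLA k) : Env (cellular a) →ₐ[k] FreeAlgebra k (CellTerm k a.carrier) :=
  Env.lift (evalLin a) (respects_evalLin a)

open Classical in
/-- The map from the free algebra that kills all terms except the well-formed cells. -/
def ofFree (a : DGLA k) : FreeAlgebra k (CellTerm k a.carrier) →ₐ[k] Env (cellular a) :=
  FreeAlgebra.lift k fun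
    | cell n z w => if h : WF a n (cell n z w) then Env.ι (cellular a) (mk h) else 0
    | _ => 0

theorem ofFree_eval {t : CellTerm k a.carrier} : ∀ {n : ℤ} (ht : WF a n t),
    ofFree a (eval t) = Env.ι (cellular a) (mk ht) := by
  induction t with
  | cell m z w _ =>
    intro n ht
    obtain rfl : m = n := ht.1
    exact (FreeAlgebra.lift_ι_apply _ _).trans (dif_pos ht)
  | zero => intro n ht; rw [eval, map_zero, mk_zero, map_zero]
  | add s t hs ht => intro n h; rw [eval, map_add, hs h.1, ht h.2, mk_add, map_add]
  | smul c t ht =>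
    intro n h
    have h' : WF a n t := h
    rw [eval, map_smul, ht h', mk_smul c h', map_smul]
  | bracket i j s t hs ht =>
    intro n h
    obtain ⟨rfl, h1, h2⟩ := h
    have e := Env.ι_mul_ι (mk_mem h1) (mk_mem h2)
    rw [eval, superComm_apply, map_sub, map_smul, map_mul, map_mul, hs h1, ht h2, e,
      add_sub_cancel_left, mk_bracket rfl h1 h2]

theorem toFree_mk {n : ℤ} {t : CellTerm k a.carrier} (ht : WF a n t) :
    toFree a (Env.ι (cellular a) (mk ht)) = eval t := (Env.lift_ι _ _ _).trans (evalLin_mk ht)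

theorem ofFree_toFree (u : Env (cellular a)) : ofFree a (toFree a u) = u := by
  refine AlgHom.congr_fun (Env.algHom_ext (f := (ofFree a).comp (toFree a)) (g := AlgHom.id k _)
    fun x => ?_) u
  refine LinearMap.congr_fun (hom_ext_mk (f := ((ofFree a).comp (toFree a)).toLinearMap ∘ₗ
    Env.ι (cellular a)) (g := Env.ι (cellular a)) fun n t ht => ?_) x
  exact (congrArg (ofFree a) (toFree_mk ht)).trans (ofFree_eval ht)

/-- The odd derivation with the value `± x ε` at the cells `x`. -/
def contraction₀ (a : DGLA k) : Env (cellular a) →ₗ[k] Bar (U (cellular a)) :=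
  freeDerivation (((Bar.j (U (cellular a))).comp (U (cellular a)).sign).comp (ofFree a))
    ((Bar.j (U (cellular a))).comp (ofFree a))
    (fun t => Bar.j (U (cellular a)) ((U (cellular a)).sign (ofFree a (FreeAlgebra.ι k t))) *
      Bar.ε (U (cellular a))) ∘ₗ (toFree a).toLinearMap

theorem contraction₀_mul (u v : Env (cellular a)) : contraction₀ a (u * v) =
    contraction₀ a u * Bar.j (U (cellular a)) v +
      Bar.j (U (cellular a)) ((U (cellular a)).sign u) * contraction₀ a v := by
  simp only [contraction₀, LinearMap.comp_apply, AlgHom.toLinearMap_apply, map_mul,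
    freeDerivation_mul, AlgHom.comp_apply, ofFree_toFree]

theorem isOddDerivation_contraction₀ (a : DGLA k) :
    Bar.IsOddDerivation (A := U (cellular a)) (contraction₀ a) := contraction₀_mul

theorem contraction₀_cell {n : ℤ} {z : CellTerm k a.carrier} {w : a.carrier}
    (h : WF a n (cell n z w)) : contraction₀ a (Env.ι (cellular a) (mk h)) =
      Bar.j (U (cellular a)) ((U (cellular a)).sign (Env.ι (cellular a) (mk h))) *
        Bar.ε (U (cellular a)) := by
  have e : ofFree a (FreeAlgebra.ι k (cell n z w)) = Env.ι (cellular a) (mk h) := ofFree_eval h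
  rw [contraction₀, LinearMap.comp_apply, AlgHom.toLinearMap_apply, toFree_mk h, ← e]
  exact freeDerivation_ι _ _ _ _

/-- The contraction maps homogeneous elements of degree `n` to elements of degree `n + 1`. -/
theorem contraction₀_mk_mem_gr {t : CellTerm k a.carrier} : ∀ {n : ℤ} (ht : WF a n t),
    contraction₀ a (Env.ι (cellular a) (mk ht)) ∈ Bar.gr (U (cellular a)) (n + 1) := by
  induction t with
  | cell m z w _ =>
    intro n ht
    obtain rfl : m = n := ht.1
    rw [contraction₀_cell]
    exact Bar.mul_mem_gr (Bar.j_mem_gr (DGA.sign_mem (A := U (cellular a))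
      (Env.ι_mem_gr (mk_mem ht)))) Bar.ε_mem_gr
  | zero => intro n ht; rw [mk_zero, map_zero, map_zero]; exact zero_mem _
  | add s t hs ht =>
    intro n h
    rw [mk_add h.1 h.2, map_add, map_add]
    exact add_mem (hs h.1) (ht h.2)
  | smul c t ht =>
    intro n h
    have h' : WF a n t := h
    rw [mk_smul c h', map_smul, map_smul]
    exact Submodule.smul_mem _ _ (ht h')
  | bracket i l s t hs ht =>
    intro n h
    obtain ⟨rfl, h1, h2⟩ := h
    have e := Env.ι_mul_ι (mk_mem h1) (mk_mem h2)
    have e' : Env.ι (cellular a) ((cellular a).bracket (mk h1) (mk h2)) =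
        Env.ι (cellular a) (mk h1) * Env.ι (cellular a) (mk h2) -
          (-1 : k) ^ (i * l) • (Env.ι (cellular a) (mk h2) * Env.ι (cellular a) (mk h1)) := by
      rw [e, add_sub_cancel_left]
    have key : ∀ {i l : ℤ} {x y : Env (cellular a)}, x ∈ Env.gr (cellular a) i →
        y ∈ Env.gr (cellular a) l → contraction₀ a x ∈ Bar.gr (U (cellular a)) (i + 1) →
        contraction₀ a y ∈ Bar.gr (U (cellular a)) (l + 1) →
        contraction₀ a (x * y) ∈ Bar.gr (U (cellular a)) (i + l + 1) := by
      intro i l x y hx hy hx' hy'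
      rw [contraction₀_mul]
      refine add_mem ?_ ?_
      · rw [add_right_comm]; exact Bar.mul_mem_gr hx' (Bar.j_mem_gr hy)
      · rw [add_assoc]
        exact Bar.mul_mem_gr (Bar.j_mem_gr (DGA.sign_mem (A := U (cellular a)) hx)) hy'
    rw [mk_bracket rfl h1 h2, e', map_sub, map_smul]
    refine sub_mem (key (Env.ι_mem_gr (mk_mem h1)) (Env.ι_mem_gr (mk_mem h2)) (hs h1) (ht h2))
      (Submodule.smul_mem _ _ ?_)
    rw [add_comm i l]
    exact key (Env.ι_mem_gr (mk_mem h2)) (Env.ι_mem_gr (mk_mem h1)) (ht h2) (hs h1)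

theorem contraction₀_mem_gr {n : ℤ} {u : Env (cellular a)} (hu : u ∈ Env.gr (cellular a) n) :
    contraction₀ a u ∈ Bar.gr (U (cellular a)) (n + 1) := by
  induction hu using Submodule.span_induction with
  | zero => rw [map_zero]; exact zero_mem _
  | add x y _ _ hx hy => rw [map_add]; exact add_mem hx hy
  | smul c x _ hx => rw [map_smul]; exact Submodule.smul_mem _ _ hx
  | mem x hx =>
    obtain ⟨l, rfl, rfl⟩ := hx
    induction l with
    | nil =>
      have : contraction₀ a 1 = 0 := (isOddDerivation_contraction₀ a).map_one
      simp only [List.map_nil, List.prod_nil, this]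
      exact zero_mem _
    | cons p l ih =>
      obtain ⟨t, ht, e⟩ := exists_mk p.2.2
      obtain ⟨h, -⟩ := Env.decomposeHom_prod l
      simp only [List.map_cons, List.prod_cons, List.sum_cons]
      rw [contraction₀_mul]
      refine add_mem ?_ ?_
      · rw [add_right_comm, e]
        exact Bar.mul_mem_gr (contraction₀_mk_mem_gr ht) (Bar.j_mem_gr h)
      · rw [add_assoc]
        exact Bar.mul_mem_gr (Bar.j_mem_gr (DGA.sign_mem (A := U (cellular a))
          (Env.ι_mem_gr p.2.2))) ih

/-- The contraction of the algebra obtained by adjoining `ε` to the enveloping algebra. -/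
def contraction (a : DGLA k) : Bar (U (cellular a)) →ₗ[k] Bar (U (cellular a)) :=
  Bar.derivation (isOddDerivation_contraction₀ a) 0

theorem contraction_j (u : Env (cellular a)) :
    contraction a (Bar.j (U (cellular a)) u) = contraction₀ a u := Bar.derivation_j _ _ _

theorem contraction_ε : contraction a (Bar.ε (U (cellular a))) = 0 := Bar.derivation_ε _ _

theorem contraction_mul (u v : Bar (U (cellular a))) : contraction a (u * v) =
    contraction a u * v + Bar.sign (U (cellular a)) u * contraction a v :=
  Bar.derivation_mul _ _ _ _

theorem contraction_sign (u : Bar (U (cellular a))) :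
    contraction a (Bar.sign (U (cellular a)) u) =
      -Bar.sign (U (cellular a)) (contraction a u) := by
  refine Bar.derivation_sign _ _ (fun u => ?_) (map_zero _) u
  refine LinearMap.congr_fun (hom_ext_of_homogeneous (Env.gr (cellular a))
    (f := contraction₀ a ∘ₗ (U (cellular a)).sign.toLinearMap)
    (g := -((Bar.sign (U (cellular a))).toLinearMap ∘ₗ contraction₀ a)) fun i u hu => ?_) u
  have e1 : (U (cellular a)).sign u = (-1 : k) ^ i • u := DGA.sign_of_mem (A := U (cellular a)) hu
  simp only [LinearMap.comp_apply, AlgHom.toLinearMap_apply, LinearMap.neg_apply]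
  rw [Bar.sign_of_mem (contraction₀_mem_gr hu)]
  refine (congrArg _ e1).trans ?_
  rw [map_smul, zpow_add₀ (neg_ne_zero.mpr (one_ne_zero' k)), zpow_one, mul_neg_one, neg_smul,
    neg_neg]

theorem contraction_mem_gr {n : ℤ} {u : Bar (U (cellular a))}
    (hu : u ∈ Bar.gr (U (cellular a)) n) : contraction a u ∈ Bar.gr (U (cellular a)) (n + 1) :=
  Bar.derivation_mem_gr _ contraction₀_mem_gr (zero_mem _) hu

theorem contraction_mem_rel [CharZero k] {u : Bar (U (cellular a))}
    (hu : u ∈ Bar.rel (U (cellular a))) : contraction a u ∈ Bar.rel (U (cellular a)) :=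
  Bar.derivation_mem_rel _ (zero_mem _) (by simp) contraction_sign hu

/-- The graded commutator of the differential and the contraction. -/
def euler (a : DGLA k) : Bar (U (cellular a)) →ₗ[k] Bar (U (cellular a)) :=
  Bar.d (U (cellular a)) ∘ₗ contraction a + contraction a ∘ₗ Bar.d (U (cellular a))

theorem euler_apply (u : Bar (U (cellular a))) : euler a u =
    Bar.d (U (cellular a)) (contraction a u) + contraction a (Bar.d (U (cellular a)) u) := rfl

theorem euler_mul (u v : Bar (U (cellular a))) : euler a (u * v) =
    euler a u * v + u * euler a v := by
  simp only [euler_apply, contraction_mul, Bar.d_mul, map_add, contraction_sign, Bar.d_sign,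
    Bar.sign_sign, mul_add, add_mul, neg_mul]
  abel

theorem euler_ε : euler a (Bar.ε (U (cellular a))) = 0 := by
  have : contraction a 1 = 0 := Bar.derivation_one _ _
  rw [euler_apply, contraction_ε, map_zero, Bar.d_ε, this, add_zero]

theorem isPositive_sign {u : Bar (U (cellular a))} (hu : IsPositive (euler a) u) :
    IsPositive (euler a) (Bar.sign (U (cellular a)) u) := by
  refine IsPositive.map_of_commute (f := (Bar.sign (U (cellular a))).toLinearMap) (fun u => ?_) hu
  simp only [AlgHom.toLinearMap_apply, euler_apply, map_add, contraction_sign, Bar.d_sign, map_neg]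
  simp

theorem isPositive_mul_ε {u : Bar (U (cellular a))} (hu : IsPositive (euler a) u) :
    IsPositive (euler a) (u * Bar.ε (U (cellular a))) :=
  IsPositive.map_of_commute (f := LinearMap.mulRight k (Bar.ε (U (cellular a))))
    (fun u => by simp [euler_mul, euler_ε]) hu

theorem isPositive_ε_mul {u : Bar (U (cellular a))} (hu : IsPositive (euler a) u) :
    IsPositive (euler a) (Bar.ε (U (cellular a)) * u) :=
  IsPositive.map_of_commute (f := LinearMap.mulLeft k (Bar.ε (U (cellular a))))
    (fun u => by simp [euler_mul, euler_ε]) hu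

/-- Up to terms that involve the boundary, cells are eigenvectors of the Euler operator with
eigenvalue `1`. -/
theorem euler_cell {n : ℤ} {z : CellTerm k a.carrier} {w : a.carrier} (h : WF a n (cell n z w)) :
    euler a (Bar.j (U (cellular a)) (Env.ι (cellular a) (mk h))) =
      Bar.j (U (cellular a)) (Env.ι (cellular a) (mk h)) +
      (contraction₀ a (Env.ι (cellular a) (mk h.2.1)) -
        Bar.sign (U (cellular a)) (Bar.j (U (cellular a)) (Env.ι (cellular a) (mk h.2.1))) *
          Bar.ε (U (cellular a))) := by
  have e1 : (U (cellular a)).d (Env.ι (cellular a) (mk h)) = Env.ι (cellular a) (mk h.2.1) :=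
    (Env.d_ι _).trans (congrArg _ (mk_d h h.2.1 (diff_cell _ _ _)))
  rw [euler_apply, contraction_j, contraction₀_cell, Bar.d_mul, Bar.d_ε, Bar.d_j, Bar.d_j,
    ← Bar.sign_j, Bar.sign_sign, mul_one, e1, contraction_j]
  have e2 : (U (cellular a)).d ((U (cellular a)).sign (Env.ι (cellular a) (mk h))) =
      -(U (cellular a)).sign (Env.ι (cellular a) (mk h.2.1)) := by
    rw [← e1, DGA.sign_d, neg_neg]
  rw [e2, map_neg, neg_mul, Bar.sign_j]
  abel

theorem isPositive_mk {t : CellTerm k a.carrier} : ∀ {n : ℤ} (ht : WF a n t),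
    IsPositive (euler a) (Bar.j (U (cellular a)) (Env.ι (cellular a) (mk ht))) ∧
      IsPositive (euler a) (contraction₀ a (Env.ι (cellular a) (mk ht))) := by
  induction t with
  | cell m z w hz =>
    intro n ht
    obtain rfl : m = n := ht.1
    have h1 : IsPositive (euler a) (Bar.j (U (cellular a)) (Env.ι (cellular a) (mk ht))) := by
      -- the operator `euler - 1` maps a cell to terms in its boundary, where induction applies
      refine IsPositive.step 0 ?_
      rw [euler_cell, Nat.cast_zero, zero_add, one_smul, add_sub_cancel_left, sub_eq_add_neg]
      exact (hz ht.2.1).2.add (isPositive_mul_ε (isPositive_sign (hz ht.2.1).1)).neg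
    refine ⟨h1, ?_⟩
    rw [contraction₀_cell, ← Bar.sign_j]
    exact isPositive_mul_ε (isPositive_sign h1)
  | zero =>
    intro n ht
    rw [mk_zero, map_zero, map_zero, map_zero]
    exact ⟨IsPositive.zero, IsPositive.zero⟩
  | add s t hs ht =>
    intro n h
    rw [mk_add h.1 h.2, map_add, map_add, map_add]
    exact ⟨(hs h.1).1.add (ht h.2).1, (hs h.1).2.add (ht h.2).2⟩
  | smul c t ht =>
    intro n h
    have h' : WF a n t := h
    rw [mk_smul c h', map_smul, map_smul, map_smul]
    exact ⟨(ht h').1.smul c, (ht h').2.smul c⟩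
  | bracket i l s t hs ht =>
    intro n h
    obtain ⟨rfl, h1, h2⟩ := h
    have e := Env.ι_mul_ι (mk_mem h1) (mk_mem h2)
    have e' : Env.ι (cellular a) ((cellular a).bracket (mk h1) (mk h2)) =
        Env.ι (cellular a) (mk h1) * Env.ι (cellular a) (mk h2) +
          (-(-1 : k) ^ (i * l)) • (Env.ι (cellular a) (mk h2) * Env.ι (cellular a) (mk h1)) := by
      rw [e, neg_smul, ← sub_eq_add_neg, add_sub_cancel_left]
    rw [mk_bracket rfl h1 h2, e']
    constructor
    · rw [map_add, map_smul, map_mul, map_mul]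
      exact ((hs h1).1.mul euler_mul (ht h2).1).add
        (((ht h2).1.mul euler_mul (hs h1).1).smul _)
    · rw [map_add, map_smul, contraction₀_mul, contraction₀_mul, ← Bar.sign_j, ← Bar.sign_j]
      exact (((hs h1).2.mul euler_mul (ht h2).1).add
        ((isPositive_sign (hs h1).1).mul euler_mul (ht h2).2)).add
        ((((ht h2).2.mul euler_mul (hs h1).1).add
        ((isPositive_sign (ht h2).1).mul euler_mul (hs h1).2)).smul _)

/-- Every element is, up to a linear combination of `1`, `ε` and a multiple of `ε²`, a sum of
generalized eigenvectors of the Euler operator with positive eigenvalues. -/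
theorem exists_isPositive (b : Bar (U (cellular a))) : ∃ (c c' : k) (x p : Bar (U (cellular a))),
    IsPositive (euler a) p ∧ b = c • (1 : Bar (U (cellular a))) + c' • Bar.ε (U (cellular a)) +
      x * (Bar.ε (U (cellular a)) * Bar.ε (U (cellular a))) + p := by
  have hadd : ∀ b b' : Bar (U (cellular a)),
    (∃ (c c' : k) (x p : Bar (U (cellular a))),
      IsPositive (euler a) p ∧ b = c • (1 : Bar (U (cellular a))) + c' • Bar.ε (U (cellular a)) +
      x * (Bar.ε (U (cellular a)) * Bar.ε (U (cellular a))) + p) →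
    (∃ (c c' : k) (x p : Bar (U (cellular a))),
      IsPositive (euler a) p ∧ b' = c • (1 : Bar (U (cellular a))) + c' • Bar.ε (U (cellular a)) +
      x * (Bar.ε (U (cellular a)) * Bar.ε (U (cellular a))) + p) →
    (∃ (c c' : k) (x p : Bar (U (cellular a))),
      IsPositive (euler a) p ∧ b + b' = c • (1 : Bar (U (cellular a))) +
      c' • Bar.ε (U (cellular a)) +
      x * (Bar.ε (U (cellular a)) * Bar.ε (U (cellular a))) + p) := by
    rintro _ _ ⟨c, c', x, p, hp, rfl⟩ ⟨d, d', y, q, hq, rfl⟩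
    refine ⟨c + d, c' + d', x + y, p + q, hp.add hq, ?_⟩
    rw [add_smul, add_smul, add_mul]
    abel
  have hsmul : ∀ (r : k) (b : Bar (U (cellular a))),
    (∃ (c c' : k) (x p : Bar (U (cellular a))),
      IsPositive (euler a) p ∧ b = c • (1 : Bar (U (cellular a))) + c' • Bar.ε (U (cellular a)) +
      x * (Bar.ε (U (cellular a)) * Bar.ε (U (cellular a))) + p) →
    (∃ (c c' : k) (x p : Bar (U (cellular a))),
      IsPositive (euler a) p ∧ r • b = c • (1 : Bar (U (cellular a))) +
      c' • Bar.ε (U (cellular a)) +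
      x * (Bar.ε (U (cellular a)) * Bar.ε (U (cellular a))) + p) := by
    rintro r _ ⟨c, c', x, p, hp, rfl⟩
    refine ⟨r * c, r * c', r • x, r • p, hp.smul r, ?_⟩
    rw [smul_add, smul_add, smul_add, smul_smul, smul_smul, smul_mul_assoc]
  induction b using Bar.induction_left with
  | h1 => exact ⟨1, 0, 0, 0, IsPositive.zero, by simp⟩
  | hadd u v hu hv => exact hadd u v hu hv
  | hsmul r u hu => exact hsmul r u hu
  | hε u hu =>
    obtain ⟨c, c', x, p, hp, rfl⟩ := hu
    refine ⟨0, c, c' • 1 + Bar.ε (U (cellular a)) * x, Bar.ε (U (cellular a)) * p,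
      isPositive_ε_mul hp, ?_⟩
    rw [mul_add, mul_add, mul_add, mul_smul_comm, mul_smul_comm, zero_smul, zero_add, add_mul,
      smul_mul_assoc, one_mul, mul_one, mul_assoc]
    abel
  | hj v u hu =>
    have h0 : ∀ n t (ht : WF a n t) (u : Bar (U (cellular a))),
        (∃ (c c' : k) (x p : Bar (U (cellular a))),
          IsPositive (euler a) p ∧ u = c • (1 : Bar (U (cellular a))) +
          c' • Bar.ε (U (cellular a)) +
          x * (Bar.ε (U (cellular a)) * Bar.ε (U (cellular a))) + p) →
        (∃ (c c' : k) (x p : Bar (U (cellular a))),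
          IsPositive (euler a) p ∧ Bar.j (U (cellular a)) (Env.ι (cellular a) (mk ht)) * u =
          c • (1 : Bar (U (cellular a))) + c' • Bar.ε (U (cellular a)) +
          x * (Bar.ε (U (cellular a)) * Bar.ε (U (cellular a))) + p) := by
      rintro n t ht _ ⟨c, c', x, p, hp, rfl⟩
      have h1 := (isPositive_mk ht).1
      refine ⟨0, 0, Bar.j (U (cellular a)) (Env.ι (cellular a) (mk ht)) * x, _,
        ((h1.smul c).add ((isPositive_mul_ε h1).smul c')).add (h1.mul euler_mul hp), ?_⟩
      rw [mul_add, mul_add, mul_add, mul_smul_comm, mul_smul_comm, mul_one, zero_smul, zero_smul,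
        zero_add, zero_add, mul_assoc]
      abel
    have h2 : ∀ (v : Env (cellular a)) (u : Bar (U (cellular a))),
        (∃ (c c' : k) (x p : Bar (U (cellular a))),
          IsPositive (euler a) p ∧ u = c • (1 : Bar (U (cellular a))) +
          c' • Bar.ε (U (cellular a)) +
          x * (Bar.ε (U (cellular a)) * Bar.ε (U (cellular a))) + p) →
        (∃ (c c' : k) (x p : Bar (U (cellular a))),
          IsPositive (euler a) p ∧ Bar.j (U (cellular a)) v * u =
          c • (1 : Bar (U (cellular a))) + c' • Bar.ε (U (cellular a)) +
          x * (Bar.ε (U (cellular a)) * Bar.ε (U (cellular a))) + p) := by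
      intro v
      induction v using Env.induction_left with
      | h1 => intro u hu; rwa [map_one, one_mul]
      | hadd x y hx hy => intro u hu; rw [map_add, add_mul]; exact hadd _ _ (hx u hu) (hy u hu)
      | hsmul r x hx => intro u hu; rw [map_smul, smul_mul_assoc]; exact hsmul _ _ (hx u hu)
      | hmul hx v hv =>
        intro u hu
        obtain ⟨t, ht, rfl⟩ := exists_mk hx
        rw [map_mul, mul_assoc]
        exact h0 _ t ht _ (hv u hu)
    exact h2 v u hu

/-- Cycles on which the Euler operator is invertible are boundaries. -/
theorem exists_sub_d_mem_rel [CharZero k] {p : Bar (U (cellular a))}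
    (hp : IsPositive (euler a) p) : ∀ {m : ℤ} {b : Bar (U (cellular a))},
    b ∈ Bar.gr (U (cellular a)) m → b - p ∈ Bar.rel (U (cellular a)) →
    Bar.d (U (cellular a)) b ∈ Bar.rel (U (cellular a)) →
    ∃ c ∈ Bar.gr (U (cellular a)) (m + 1),
      b - Bar.d (U (cellular a)) c ∈ Bar.rel (U (cellular a)) := by
  induction hp with
  | zero =>
    intro m b _ hb _
    exact ⟨0, zero_mem _, by rwa [map_zero]⟩
  | @step p l _ ih =>
    intro m b hb hbp hdb
    have h0 : ((l : k) + 1) ≠ 0 := Nat.cast_add_one_ne_zero l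
    have hE : ∀ x ∈ Bar.rel (U (cellular a)), euler a x ∈ Bar.rel (U (cellular a)) := fun x hx =>
      add_mem (Bar.d_mem_rel (contraction_mem_rel hx)) (contraction_mem_rel (Bar.d_mem_rel hx))
    have hσ := contraction_mem_rel hdb
    have hgr : euler a b ∈ Bar.gr (U (cellular a)) m := by
      refine add_mem ?_ ?_
      · have := Bar.d_mem_gr (contraction_mem_gr hb)
        rwa [add_sub_cancel_right] at this
      · have := contraction_mem_gr (Bar.d_mem_gr hb)
        rwa [sub_add_cancel] at this
    -- as `b` is a cycle, `euler b` is a boundary, so it suffices to treat `euler b - (l + 1) b`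
    obtain ⟨c, hc, h⟩ := ih (b := euler a b - ((l : k) + 1) • b)
      (sub_mem hgr (Submodule.smul_mem _ _ hb)) (by
        have := sub_mem (hE _ hbp) (Submodule.smul_mem _ ((l : k) + 1) hbp)
        convert this using 1
        rw [map_sub, smul_sub]
        abel) (by
        rw [map_sub, map_smul, euler_apply, map_add, Bar.d_d, zero_add]
        exact sub_mem (Bar.d_mem_rel hσ) (Submodule.smul_mem _ _ hdb))
    refine ⟨((l : k) + 1)⁻¹ • (contraction a b - c),
      Submodule.smul_mem _ _ (sub_mem (contraction_mem_gr hb) hc), ?_⟩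
    have := Submodule.smul_mem _ ((l : k) + 1)⁻¹ (sub_mem hσ h)
    convert this using 1
    rw [map_smul, euler_apply, map_sub, smul_sub, smul_sub, smul_sub, smul_sub, smul_add,
      inv_smul_smul₀ h0]
    abel

theorem toCyc_cellular_bijective [CharZero k] (a : DGLA k) (n : ℤ) :
    Function.Bijective (toCyc (cellular a) n) := by
  refine Bar.connesToCyc_bijective (fun m b hb hdb => ?_) n
  obtain ⟨c, c', x, p, hp, e⟩ := exists_isPositive b
  refine exists_sub_d_mem_rel hp hb ?_ hdb
  rw [e, add_sub_cancel_right]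
  exact add_mem (add_mem (Submodule.smul_mem _ _ Bar.one_mem_rel)
    (Submodule.smul_mem _ _ Bar.ε_mem_rel)) (Bar.mul_ε_ε_mem_rel x)

end CellTerm

end Acyclic

/-! ### Chain homotopies over a field -/

section Homotopy

variable {k : Type u} [Field k]

/-- Homogeneous linear maps have homogeneous generalized inverses. -/
theorem exists_generalized_inverse {M N : Type u} [AddCommGroup M] [Module k M] [AddCommGroup N]
    [Module k N] {gr : ℤ → Submodule k M} [DirectSum.Decomposition gr] {gr' : ℤ → Submodule k N}
    [DirectSum.Decomposition gr'] {f : M →ₗ[k] N} {e : ℤ}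
    (hf : ∀ {i x}, x ∈ gr i → f x ∈ gr' (i + e)) :
    ∃ g : N →ₗ[k] M, (∀ {i x}, x ∈ gr' i → g x ∈ gr (i - e)) ∧ ∀ x, f (g (f x)) = f x := by
  obtain ⟨r, hr⟩ := LinearMap.exists_rightInverse_of_surjective f.rangeRestrict
    f.range_rangeRestrict
  obtain ⟨g₀, hg₀⟩ := LinearMap.exists_extend r
  have h0 : ∀ x, f (g₀ (f x)) = f x := fun x => by
    have h1 : g₀ (f x) = r (f.rangeRestrict x) := LinearMap.congr_fun hg₀ (f.rangeRestrict x)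
    rw [h1]
    exact congrArg Subtype.val (LinearMap.congr_fun hr (f.rangeRestrict x))
  let π : ℤ → M →ₗ[k] M := fun i => (gr i).subtype ∘ₗ
    DirectSum.component k ℤ (fun i => gr i) i ∘ₗ (DirectSum.decomposeLinearEquiv gr).toLinearMap
  let π' : ℤ → N →ₗ[k] N := fun i => (gr' i).subtype ∘ₗ
    DirectSum.component k ℤ (fun i => gr' i) i ∘ₗ (DirectSum.decomposeLinearEquiv gr').toLinearMap
  have hπ : ∀ i x, x ∈ gr i → π i x = x := fun i x hx => DirectSum.decompose_of_mem_same gr hx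
  have hπ' : ∀ i x, x ∈ gr' i → π' i x = x := fun i x hx => DirectSum.decompose_of_mem_same gr' hx
  have hc : ∀ i x, f (π i x) = π' (i + e) (f x) := fun i x => by
    refine LinearMap.congr_fun (hom_ext_of_homogeneous gr (f := f ∘ₗ π i) (g := π' (i + e) ∘ₗ f)
      fun j y hy => ?_) x
    change f (π i y) = π' (i + e) (f y)
    rcases eq_or_ne j i with rfl | h
    · rw [hπ _ _ hy, hπ' _ _ (hf hy)]
    · have e1 : π i y = 0 := DirectSum.decompose_of_mem_ne gr hy h
      have e2 : π' (i + e) (f y) = 0 := DirectSum.decompose_of_mem_ne gr' (hf hy) (by simpa using h)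
      rw [e1, e2, map_zero]
  let g : N →ₗ[k] M := (DirectSum.toModule k ℤ M fun i => π (i - e) ∘ₗ g₀ ∘ₗ (gr' i).subtype) ∘ₗ
    (DirectSum.decomposeLinearEquiv gr').toLinearMap
  have hg : ∀ {i x}, x ∈ gr' i → g x = π (i - e) (g₀ x) := by
    intro i x hx
    simp only [g, LinearMap.comp_apply, LinearEquiv.coe_coe,
      DirectSum.decomposeLinearEquiv_apply, DirectSum.decompose_of_mem gr' hx]
    rw [← DirectSum.lof_eq_of k, DirectSum.toModule_lof]
    rfl
  refine ⟨g, fun {i x} hx => ?_, fun x => ?_⟩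
  · rw [hg hx]
    exact Subtype.prop _
  · refine LinearMap.congr_fun (hom_ext_of_homogeneous gr (f := f ∘ₗ g ∘ₗ f) (g := f)
      fun i x hx => ?_) x
    rw [LinearMap.comp_apply, LinearMap.comp_apply, hg (hf hx), hc, h0, sub_add_cancel,
      hπ' _ _ (hf hx)]

/-- A complex of vector spaces, as a graded vector space with a differential of degree `-1`. -/
structure GradedComplex (k : Type u) [Field k] where
  carrier : Type u
  [addCommGroup : AddCommGroup carrier]
  [module : Module k carrier]
  gr : ℤ → Submodule k carrier
  [dec : DirectSum.Decomposition gr]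
  d : carrier →ₗ[k] carrier
  d_mem : ∀ {i x}, x ∈ gr i → d x ∈ gr (i - 1)
  d_d : ∀ x, d (d x) = 0

attribute [instance] GradedComplex.addCommGroup GradedComplex.module GradedComplex.dec

/-- The complex underlying a DG Lie algebra. -/
abbrev DGLA.toComplex (L : DGLA k) : GradedComplex k where
  carrier := L.carrier
  gr := L.gr
  d := L.d
  d_mem := L.d_mem
  d_d := L.d_d

/-- The complex underlying a DG algebra. -/
abbrev DGA.toComplex (A : DGA k) : GradedComplex k where
  carrier := A.carrier
  gr := A.gr
  d := A.d
  d_mem := A.d_mem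
  d_d := A.d_d

namespace GradedComplex

variable {V W : GradedComplex k}

/-- `f` is a chain map. -/
structure IsChainMap (V W : GradedComplex k) (f : V.carrier →ₗ[k] W.carrier) : Prop where
  mem : ∀ {i x}, x ∈ V.gr i → f x ∈ W.gr i
  map_d : ∀ x, f (V.d x) = W.d (f x)

/-- The chain map `f` is injective and surjective on homology. -/
structure IsQuasiIso (V W : GradedComplex k) (f : V.carrier →ₗ[k] W.carrier) : Prop
    extends IsChainMap V W f where
  inj : ∀ {n x y}, x ∈ V.gr n → V.d x = 0 → y ∈ W.gr (n + 1) → f x = W.d y →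
    ∃ z ∈ V.gr (n + 1), x = V.d z
  surj : ∀ {n y}, y ∈ W.gr n → W.d y = 0 →
    ∃ x ∈ V.gr n, V.d x = 0 ∧ ∃ z ∈ W.gr (n + 1), y = f x + W.d z

/-- `s` is a homotopy between the identity and a projection to a subspace that represents the
homology. -/
structure IsSplitting (V : GradedComplex k) (s : V.carrier →ₗ[k] V.carrier) : Prop where
  mem : ∀ {i x}, x ∈ V.gr i → s x ∈ V.gr (i + 1)
  d_s_d : ∀ x, V.d (s (V.d x)) = V.d x
  s_s_d : ∀ x, s (s (V.d x)) = 0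

variable (V) in
theorem exists_isSplitting : ∃ s, IsSplitting V s := by
  obtain ⟨s, hs, h⟩ := exists_generalized_inverse (f := V.d) (gr := V.gr) (gr' := V.gr) (e := -1)
    (fun hx => V.d_mem hx)
  have hs' : ∀ {i x}, x ∈ V.gr i → s x ∈ V.gr (i + 1) := fun hx => by
    simpa using hs hx
  -- a generalized inverse of `d`, corrected to satisfy `s s d = 0`
  refine ⟨s - s ∘ₗ s ∘ₗ V.d, ⟨fun {i x} hx => sub_mem (hs' hx) ?_, fun x => ?_, fun x => ?_⟩⟩
  · have := hs' (hs' (V.d_mem hx))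
    rwa [sub_add_cancel] at this
  · simp [V.d_d, h]
  · simp [V.d_d, h]

namespace IsSplitting

variable {s : V.carrier →ₗ[k] V.carrier}

variable (V s) in
/-- The projection defined by a splitting. -/
def proj : V.carrier →ₗ[k] V.carrier := LinearMap.id - V.d ∘ₗ s - s ∘ₗ V.d

theorem proj_apply (x : V.carrier) : proj V s x = x - V.d (s x) - s (V.d x) := rfl

theorem d_proj (hs : IsSplitting V s) (x : V.carrier) : V.d (proj V s x) = 0 := by
  simp [proj_apply, V.d_d, hs.d_s_d]

theorem proj_d (hs : IsSplitting V s) (x : V.carrier) : proj V s (V.d x) = 0 := by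
  simp [proj_apply, V.d_d, hs.d_s_d]

theorem proj_proj (hs : IsSplitting V s) (x : V.carrier) : proj V s (proj V s x) = proj V s x := by
  have : proj V s (s (V.d x)) = 0 := by simp [proj_apply, hs.d_s_d, hs.s_s_d]
  rw [proj_apply x, map_sub, map_sub, hs.proj_d, this, sub_zero, sub_zero, proj_apply]

theorem proj_mem (hs : IsSplitting V s) {i : ℤ} {x : V.carrier} (hx : x ∈ V.gr i) :
    proj V s x ∈ V.gr i := by
  have h1 := V.d_mem (hs.mem hx)
  have h2 := hs.mem (V.d_mem hx)
  rw [add_sub_cancel_right] at h1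
  rw [sub_add_cancel] at h2
  exact sub_mem (sub_mem hx h1) h2

theorem isChainMap (hs : IsSplitting V s) : IsChainMap V V (proj V s) where
  mem := hs.proj_mem
  map_d x := by rw [hs.proj_d, hs.d_proj]

end IsSplitting

/-- A quasi-isomorphism has a homotopy inverse `g` that is inverse to it on the subspaces that
represent the homology. -/
theorem IsQuasiIso.exists_inverse {f : V.carrier →ₗ[k] W.carrier} (hf : IsQuasiIso V W f)
    {s : V.carrier →ₗ[k] V.carrier} (hs : IsSplitting V s) {t : W.carrier →ₗ[k] W.carrier}
    (ht : IsSplitting W t) : ∃ g, IsChainMap W V g ∧ (∀ y, g (W.d y) = 0) ∧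
      (∀ x, g (f (IsSplitting.proj V s x)) = IsSplitting.proj V s x) ∧
      ∀ y, IsSplitting.proj W t (f (g y)) = IsSplitting.proj W t y := by
  set P := IsSplitting.proj V s with hP
  set Q := IsSplitting.proj W t with hQ
  -- `Q f P` is an isomorphism between the subspaces that represent the homology
  obtain ⟨g, hg, hg'⟩ := exists_generalized_inverse (f := Q ∘ₗ f ∘ₗ P) (gr := V.gr) (gr' := W.gr)
    (e := 0) (fun {i x} hx => by rw [add_zero]; exact ht.proj_mem (hf.mem (hs.proj_mem hx)))
  simp only [LinearMap.comp_apply] at hg'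
  have hgm : ∀ {i x}, x ∈ W.gr i → g x ∈ V.gr i := fun hx => by simpa using hg hx
  have hinj : ∀ i, ∀ x ∈ V.gr i, Q (f (P x)) = 0 → P x = 0 := by
    intro i x hx h
    have h1 : f (P x) = W.d (t (f (P x))) := by
      have := IsSplitting.proj_apply (V := W) (s := t) (f (P x))
      rw [← hf.map_d, hs.d_proj, map_zero, map_zero, sub_zero] at this
      exact sub_eq_zero.1 (this.symm.trans h)
    obtain ⟨z, -, hz⟩ := hf.inj (hs.proj_mem hx) (hs.d_proj x) (ht.mem (hf.mem (hs.proj_mem hx))) h1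
    rw [← hs.proj_proj x]
    exact (congrArg P hz).trans (hs.proj_d z)
  refine ⟨P ∘ₗ g ∘ₗ Q, ⟨fun hx => hs.proj_mem (hgm (ht.proj_mem hx)), fun x => ?_⟩, fun y => ?_,
    fun x => ?_, fun y => ?_⟩
  · exact ((congrArg (fun y => P (g y)) (ht.proj_d x)).trans (by rw [map_zero, map_zero])).trans
      (hs.d_proj _).symm
  · exact (congrArg (fun y => P (g y)) (ht.proj_d y)).trans (by rw [map_zero, map_zero])
  · refine LinearMap.congr_fun (hom_ext_of_homogeneous V.gr (f := (P ∘ₗ g ∘ₗ Q) ∘ₗ f ∘ₗ P) (g := P)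
      fun i x hx => ?_) x
    simp only [LinearMap.comp_apply]
    rw [← sub_eq_zero, ← map_sub]
    refine hinj i _ (sub_mem (hgm (ht.proj_mem (hf.mem (hs.proj_mem hx)))) hx) ?_
    rw [map_sub, map_sub, map_sub, hg', sub_self]
  · refine LinearMap.congr_fun (hom_ext_of_homogeneous W.gr (f := Q ∘ₗ f ∘ₗ P ∘ₗ g ∘ₗ Q) (g := Q)
      fun i y hy => ?_) y
    obtain ⟨x, -, hdx, z, -, hz⟩ := hf.surj (ht.proj_mem hy) (ht.d_proj y)
    have h1 : x = P x + V.d (s x) := by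
      rw [hP, IsSplitting.proj_apply, hdx, map_zero, sub_zero, sub_add_cancel]
    have h2 : Q y = Q (f (P x)) := by
      rw [← ht.proj_proj y]
      refine (congrArg Q hz).trans ?_
      rw [map_add, ht.proj_d, add_zero, h1, map_add, map_add, hf.map_d, ht.proj_d, add_zero,
        ← h1]
    simp only [LinearMap.comp_apply]
    rw [h2, hg']

/-- A quasi-isomorphism of complexes of vector spaces is a homotopy equivalence. -/
theorem IsQuasiIso.exists_homotopy_inverse {f : V.carrier →ₗ[k] W.carrier}
    (hf : IsQuasiIso V W f) : ∃ (g : W.carrier →ₗ[k] V.carrier) (h : V.carrier →ₗ[k] V.carrier)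
      (h' : W.carrier →ₗ[k] W.carrier), IsChainMap W V g ∧
      (∀ {i x}, x ∈ V.gr i → h x ∈ V.gr (i + 1)) ∧ (∀ {i x}, x ∈ W.gr i → h' x ∈ W.gr (i + 1)) ∧
      (∀ x, V.d (h x) + h (V.d x) = x - g (f x)) ∧
      ∀ y, W.d (h' y) + h' (W.d y) = y - f (g y) := by
  obtain ⟨s, hs⟩ := exists_isSplitting V
  obtain ⟨t, ht⟩ := exists_isSplitting W
  obtain ⟨g, hg, hgd, h1, h2⟩ := hf.exists_inverse hs ht
  refine ⟨g, s - g ∘ₗ f ∘ₗ s, t - t ∘ₗ f ∘ₗ g, hg,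
    fun hx => sub_mem (hs.mem hx) (hg.mem (hf.mem (hs.mem hx))),
    fun hx => sub_mem (ht.mem hx) (ht.mem (hf.mem (hg.mem hx))), fun x => ?_, fun y => ?_⟩
  · have e := h1 x
    have hdg : ∀ y, V.d (g y) = 0 := fun y => (hg.map_d y).symm.trans (hgd y)
    simp only [IsSplitting.proj_apply, map_sub, hf.map_d, hgd] at e
    simp only [LinearMap.sub_apply, LinearMap.comp_apply, map_sub, hdg]
    rw [sub_zero] at e
    rw [sub_eq_iff_eq_add.1 e]
    abel
  · have e := h2 y
    have hdg : ∀ y, V.d (g y) = 0 := fun y => (hg.map_d y).symm.trans (hgd y)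
    simp only [IsSplitting.proj_apply, ← hf.map_d, hdg, map_zero, sub_zero] at e
    simp only [LinearMap.sub_apply, LinearMap.comp_apply, map_sub, hgd, map_zero, sub_zero]
    rw [sub_eq_iff_eq_add] at e
    conv_rhs => rw [e]
    abel

end GradedComplex

end Homotopy

/-! ### Quasi-isomorphisms of enveloping algebras -/

section Enveloping

variable {k : Type u} [Field k]

open GradedComplex

theorem DGLA.Hom.isQuasiIso_toComplex {L L' : DGLA k} {f : DGLA.Hom L L'} (hf : f.IsQuasiIso) :
    GradedComplex.IsQuasiIso L.toComplex L'.toComplex f.toLin where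
  mem := f.map_gr
  map_d := f.map_d
  inj {n x y} hx hdx hy h := by
    have h1 : x ∈ L.cx.cycles n := ⟨hx, hdx⟩
    have h2 : f.toLin x ∈ L'.cx.boundaries n :=
      Submodule.mem_sup_left ⟨y, hy, h.symm⟩
    have := PresentedComplex.Hom.mem_boundaries_of_injective (f := f.cx) (hf n).1 h1 h2
    obtain ⟨_, ⟨z, hz, rfl⟩, w, hw, e⟩ := Submodule.mem_sup.1 this
    obtain rfl : w = 0 := hw
    exact ⟨z, hz, by rw [← e, add_zero]⟩
  surj {n y} hy hdy := by
    have h1 : y ∈ L'.cx.cycles n := ⟨hy, hdy⟩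
    obtain ⟨x, hx, h⟩ := PresentedComplex.Hom.exists_of_surjective (f := f.cx) (hf n).2 h1
    obtain ⟨_, ⟨z, hz, rfl⟩, w, hw, e⟩ := Submodule.mem_sup.1 h
    obtain rfl : w = 0 := hw
    refine ⟨x, hx.1, hx.2, -z, neg_mem hz, ?_⟩
    rw [add_zero] at e
    rw [map_neg, e, neg_sub]
    exact (add_sub_cancel _ _).symm

namespace Env

variable {L L' : DGLA k}

/-- A chain map of complexes that underlie DG Lie algebras, as a morphism of abelian DG Lie
algebras. -/
abbrev abelianHom {f : L.carrier →ₗ[k] L'.carrier}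
    (hf : IsChainMap L.toComplex L'.toComplex f) : DGLA.Hom L.abelian L'.abelian where
  toLin := f
  map_gr := hf.mem
  map_d := hf.map_d
  map_bracket _ _ := map_zero f

theorem isDerivation_of_abelian {m : ℤ} {s : L.carrier →ₗ[k] L.carrier}
    (hs : ∀ {i x}, x ∈ L.gr i → s x ∈ L.gr (i + m)) : IsDerivation (L := L.abelian) m s where
  mem := hs
  map_bracket _ _ _ _ := by simp

variable {s : L.carrier →ₗ[k] L.carrier} (hs : IsSplitting L.toComplex s)

/-- The graded commutator of the differential of `Sym(L)` and the derivation that extends a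
splitting of `L`. -/
def symEuler : Env L.abelian →ₗ[k] Env L.abelian :=
  d L.abelian ∘ₗ derivation (isDerivation_of_abelian hs.mem) +
    derivation (isDerivation_of_abelian hs.mem) ∘ₗ d L.abelian

theorem symEuler_apply (u : Env L.abelian) : symEuler hs u =
    d L.abelian (derivation (isDerivation_of_abelian hs.mem) u) +
      derivation (isDerivation_of_abelian hs.mem) (d L.abelian u) := rfl

theorem symEuler_mul (u v : Env L.abelian) :
    symEuler hs (u * v) = symEuler hs u * v + u * symEuler hs v := by
  have h1 : ∀ u, twist L.abelian (-1) u = twist L.abelian 1 u := fun u => by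
    refine LinearMap.congr_fun (hom_ext_of_homogeneous (gr L.abelian)
      (f := (twist L.abelian (-1)).toLinearMap) (g := (twist L.abelian 1).toLinearMap)
      fun i u hu => ?_) u
    simp only [AlgHom.toLinearMap_apply, twist_of_mem hu, neg_one_mul, one_mul, zpow_neg]
    rcases Int.even_or_odd i with h | h <;> simp [h.neg_one_zpow]
  simp only [symEuler_apply, derivation_mul, d_mul, map_add, derivation_twist]
  have h2 : d L.abelian (twist L.abelian 1 u) = -twist L.abelian 1 (d L.abelian u) := by
    rw [← h1, ← h1, twist_d, neg_neg]
  have h3 : twist L.abelian (-1) (twist L.abelian 1 u) = u := by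
    rw [twist_twist, neg_add_cancel, twist_zero]
  have h4 : twist L.abelian 1 (twist L.abelian (-1) u) = u := by
    rw [twist_twist, add_neg_cancel, twist_zero]
  rw [h2, h3, h4, h1]
  simp only [one_mul, zpow_neg, zpow_one, inv_neg, inv_one, neg_smul, one_smul, neg_mul,
    add_mul, mul_add]
  abel

theorem symEuler_ι (x : L.carrier) : symEuler hs (ι L.abelian x) =
    ι L.abelian (x - IsSplitting.proj L.toComplex s x) := by
  rw [symEuler_apply]
  have e1 : derivation (isDerivation_of_abelian hs.mem) (ι L.abelian x) = ι L.abelian (s x) :=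
    derivation_ι _ _
  have e2 : derivation (isDerivation_of_abelian hs.mem) (ι L.abelian (L.d x)) =
      ι L.abelian (s (L.d x)) := derivation_ι _ _
  have e3 : d L.abelian (ι L.abelian x) = ι L.abelian (L.d x) := d_ι _
  have e4 : d L.abelian (ι L.abelian (s x)) = ι L.abelian (L.d (s x)) := d_ι _
  rw [e1, e3, e2, e4, IsSplitting.proj_apply, ← map_add]
  congr 1
  abel

theorem symEuler_ι_proj (x : L.carrier) :
    symEuler hs (ι L.abelian (IsSplitting.proj L.toComplex s x)) = 0 := by
  rw [symEuler_ι, hs.proj_proj, sub_self, map_zero]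

theorem symEuler_map_proj (u : Env L.abelian) :
    symEuler hs (Env.map (abelianHom hs.isChainMap) u) = 0 := by
  induction u using induction_left with
  | h1 => simp [symEuler_apply, derivation_one, d]
  | hadd a b ha hb => rw [map_add, map_add, ha, hb, add_zero]
  | hsmul c a ha => rw [map_smul, map_smul, ha, smul_zero]
  | hmul _ u hu =>
    rw [map_mul, symEuler_mul, hu, mul_zero, add_zero, Env.map_ι]
    exact (congrArg (· * _) (symEuler_ι_proj hs _)).trans (zero_mul _)

/-- The difference of an element of `Sym(L)` and its image under the projection defined by a
splitting of `L` is a sum of eigenvectors with positive eigenvalues. -/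
theorem isPositive_sub_map_proj (u : Env L.abelian) :
    IsPositive (symEuler hs) (u - Env.map (abelianHom hs.isChainMap) u) := by
  induction u using induction_left with
  | h1 => rw [map_one, sub_self]; exact IsPositive.zero
  | hadd a b ha hb => rw [map_add, add_sub_add_comm]; exact ha.add hb
  | hsmul c a ha => rw [map_smul, ← smul_sub]; exact ha.smul c
  | @hmul i x hx u hu =>
    set P := IsSplitting.proj L.toComplex s
    set v := Env.map (abelianHom hs.isChainMap) u
    have hx1 : IsPositive (symEuler hs) (ι L.abelian (x - P x)) := by
      refine IsPositive.step 0 ?_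
      rw [symEuler_ι, map_sub P, hs.proj_proj, sub_self, sub_zero, Nat.cast_zero, zero_add,
        one_smul, sub_self]
      exact IsPositive.zero
    have h1 : IsPositive (symEuler hs) (ι L.abelian (x - P x) * v) :=
      IsPositive.map_of_commute (f := LinearMap.mulRight k v) (fun y => by
        simp only [LinearMap.mulRight_apply, symEuler_mul]
        rw [symEuler_map_proj, mul_zero, add_zero]) hx1
    have h2 : IsPositive (symEuler hs) (ι L.abelian (P x) * (u - v)) :=
      IsPositive.map_of_commute (f := LinearMap.mulLeft k (ι L.abelian (P x))) (fun y => by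
        simp only [LinearMap.mulLeft_apply, symEuler_mul]
        rw [symEuler_ι_proj, zero_mul, zero_add]) hu
    have h3 := hx1.mul (symEuler_mul hs) hu
    have e : ι L.abelian x * u - Env.map (abelianHom hs.isChainMap) (ι L.abelian x * u) =
        ι L.abelian (x - P x) * v + ι L.abelian (P x) * (u - v) +
          ι L.abelian (x - P x) * (u - v) := by
      have e1 : Env.map (abelianHom hs.isChainMap) (ι L.abelian x * u) =
        ι L.abelian (P x) * v := (map_mul _ _ _).trans (congrArg (· * v) (Env.map_ι _ _))
      rw [e1]
      simp only [map_sub, sub_mul, mul_sub]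
      abel
    rw [e]
    exact (h1.add h2).add h3

/-- Cycles on which the operator `symEuler` is invertible are boundaries. -/
theorem exists_d_eq_of_isPositive [CharZero k] {z : Env L.abelian}
    (hz : IsPositive (symEuler hs) z) : ∀ {n : ℤ}, z ∈ gr L.abelian n → d L.abelian z = 0 →
      ∃ w ∈ gr L.abelian (n + 1), z = d L.abelian w := by
  induction hz with
  | zero => intro n _ _; exact ⟨0, zero_mem _, (map_zero _).symm⟩
  | @step z l _ ih =>
    intro n hz hdz
    have h0 : ((l : k) + 1) ≠ 0 := Nat.cast_add_one_ne_zero l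
    have e : symEuler hs z = d L.abelian (derivation (isDerivation_of_abelian hs.mem) z) := by
      rw [symEuler_apply, hdz, map_zero, add_zero]
    have hs1 := derivation_mem (isDerivation_of_abelian hs.mem) hz
    have hgr : symEuler hs z ∈ gr L.abelian n := by
      have := d_mem hs1
      rwa [add_sub_cancel_right, ← e] at this
    obtain ⟨w, hw, h⟩ := ih (sub_mem hgr (Submodule.smul_mem _ _ hz)) (by
      rw [map_sub, map_smul, hdz, e, d_d, smul_zero, sub_zero])
    refine ⟨((l : k) + 1)⁻¹ • (derivation (isDerivation_of_abelian hs.mem) z - w),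
      Submodule.smul_mem _ _ (sub_mem hs1 hw), ?_⟩
    rw [map_smul, map_sub, ← h, ← e, sub_sub_cancel, inv_smul_smul₀ h0]

theorem exists_sub_map_proj [CharZero k] {n : ℤ} {z : Env L.abelian} (hz : z ∈ gr L.abelian n)
    (hdz : d L.abelian z = 0) : ∃ w ∈ gr L.abelian (n + 1),
      z - Env.map (abelianHom hs.isChainMap) z = d L.abelian w := by
  refine exists_d_eq_of_isPositive hs (isPositive_sub_map_proj hs z)
    (sub_mem hz (Env.map_mem _ hz)) ?_
  rw [map_sub, hdz, zero_sub, neg_eq_zero]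
  exact ((U.map (abelianHom hs.isChainMap)).map_d z).symm.trans
    ((congrArg _ hdz).trans (map_zero _))

/-- The symmetric algebra functor preserves quasi-isomorphisms. -/
theorem isQuasiIso_map_abelian [CharZero k] {f : DGLA.Hom L L'} (hf : f.IsQuasiIso) :
    GradedComplex.IsQuasiIso (Sym L).toComplex (Sym L').toComplex
      (Env.map f.abelian).toLinearMap := by
  obtain ⟨s, hs⟩ := exists_isSplitting L.toComplex
  obtain ⟨t, ht⟩ := exists_isSplitting L'.toComplex
  obtain ⟨g, hg, -, h1, h2⟩ := (f.isQuasiIso_toComplex hf).exists_inverse hs ht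
  have h1' : ∀ u, Env.map (abelianHom hg) (Env.map f.abelian
      (Env.map (abelianHom hs.isChainMap) u)) = Env.map (abelianHom hs.isChainMap) u := fun u =>
    AlgHom.congr_fun (algHom_ext (f := ((Env.map (abelianHom hg)).comp (Env.map f.abelian)).comp
      (Env.map (abelianHom hs.isChainMap))) (g := Env.map (abelianHom hs.isChainMap)) fun x => by
        simp only [AlgHom.comp_apply, Env.map_ι]
        exact congrArg _ (h1 x)) u
  have h2' : ∀ u, Env.map (abelianHom ht.isChainMap) (Env.map f.abelian
      (Env.map (abelianHom hg) u)) = Env.map (abelianHom ht.isChainMap) u := fun u =>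
    AlgHom.congr_fun (algHom_ext (f := ((Env.map (abelianHom ht.isChainMap)).comp
      (Env.map f.abelian)).comp (Env.map (abelianHom hg)))
      (g := Env.map (abelianHom ht.isChainMap)) fun x => by
        simp only [AlgHom.comp_apply, Env.map_ι]
        exact congrArg _ (h2 x)) u
  refine ⟨⟨Env.map_mem f.abelian, (U.map f.abelian).map_d⟩, fun {n x y} hx hdx hy h => ?_,
    fun {n y} hy hdy => ?_⟩
  · obtain ⟨w, hw, e⟩ := exists_sub_map_proj hs hx hdx
    refine ⟨Env.map (abelianHom hg) (y - Env.map f.abelian w) + w,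
      add_mem (Env.map_mem _ (sub_mem hy (Env.map_mem _ hw))) hw, ?_⟩
    have e1 : d L.abelian (Env.map (abelianHom hg) (y - Env.map f.abelian w)) =
        Env.map (abelianHom hg) (d L'.abelian y - Env.map f.abelian (d L.abelian w)) := by
      refine ((U.map (abelianHom hg)).map_d _).symm.trans (congrArg _ ?_)
      refine (map_sub _ _ _).trans (congrArg _ ?_)
      exact ((U.map f.abelian).map_d w).symm
    have e2 : Env.map f.abelian x = d L'.abelian y := h
    refine Eq.symm ((map_add _ _ _).trans ?_)
    refine (congrArg (· + _) e1).trans ?_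
    rw [← e2, ← e, ← map_sub, sub_sub_cancel, h1']
    abel
  · obtain ⟨w, hw, e⟩ := exists_sub_map_proj ht hy hdy
    set x := Env.map (abelianHom hg) y with hx
    have hxm : x ∈ gr L.abelian n := Env.map_mem (abelianHom hg) hy
    have hdx : d L.abelian x = 0 :=
      ((U.map (abelianHom hg)).map_d y).symm.trans ((congrArg _ hdy).trans (map_zero _))
    have hdfx : d L'.abelian (Env.map f.abelian x) = 0 :=
      ((U.map f.abelian).map_d x).symm.trans ((congrArg _ hdx).trans (map_zero _))
    obtain ⟨w', hw', e'⟩ := exists_sub_map_proj ht (Env.map_mem f.abelian hxm) hdfx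
    refine ⟨x, hxm, hdx, w - w', sub_mem hw hw', ?_⟩
    have e3 := h2' y
    refine Eq.symm ((congrArg (_ + ·) (map_sub (d L'.abelian) w w')).trans ?_)
    rw [← e, ← e', e3]
    change Env.map f.abelian x + _ = y
    abel

theorem pbw_mem_gr {n : ℤ} [CharZero k] {u : Env L.abelian} (hu : u ∈ gr L.abelian n) :
    pbw L u ∈ gr L n := by
  rw [mem_gr_iff] at hu ⊢
  have := pbw_derivation (L := L) (isDerivation_degree L.abelian) (isDerivation_degree L) u
  refine this.symm.trans ?_
  rw [← map_smul]
  exact congrArg _ hu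

theorem pbwEquiv_symm_mem_gr {n : ℤ} [CharZero k] {u : Env L} (hu : u ∈ gr L n) :
    (pbwEquiv L).symm u ∈ gr L.abelian n := by
  obtain ⟨v, rfl⟩ := pbw_surjective u
  have e : (pbwEquiv L).symm (pbw L v) = v := (pbwEquiv L).symm_apply_apply v
  rw [e]
  rw [mem_gr_iff] at hu ⊢
  have := pbw_derivation (L := L) (isDerivation_degree L.abelian) (isDerivation_degree L) v
  refine (pbw_bijective L).1 (this.trans (hu.trans ?_))
  rw [map_smul]

/-- The enveloping algebra functor preserves quasi-isomorphisms. -/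
theorem isQuasiIso_map [CharZero k] {f : DGLA.Hom L L'} (hf : f.IsQuasiIso) :
    GradedComplex.IsQuasiIso (U L).toComplex (U L').toComplex (Env.map f).toLinearMap := by
  have key := isQuasiIso_map_abelian hf
  have hd : ∀ (L : DGLA k) (u : Env L.abelian), pbw L (d L.abelian u) = d L (pbw L u) := fun L u =>
    pbw_derivation (L := L) (isDerivation_d L.abelian) (isDerivation_d L) u
  refine ⟨⟨Env.map_mem f, (U.map f).map_d⟩, fun {n x y} hx hdx hy h => ?_, fun {n y} hy hdy => ?_⟩
  · obtain ⟨x', rfl⟩ := pbw_surjective x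
    obtain ⟨y', rfl⟩ := pbw_surjective y
    have hx' := pbwEquiv_symm_mem_gr hx
    have hy' := pbwEquiv_symm_mem_gr hy
    have ex : (pbwEquiv L).symm (pbw L x') = x' := (pbwEquiv L).symm_apply_apply x'
    have ey : (pbwEquiv L').symm (pbw L' y') = y' := (pbwEquiv L').symm_apply_apply y'
    rw [ex] at hx'
    rw [ey] at hy'
    obtain ⟨z, hz, e⟩ := key.inj (n := n) (x := x') (y := y') hx'
      ((pbw_bijective L).1 ((hd L x').trans (hdx.trans (map_zero _).symm))) hy'
      ((pbw_bijective L').1 ((pbw_map f x').trans (h.trans (hd L' y').symm)))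
    exact ⟨pbw L z, pbw_mem_gr hz, (congrArg (pbw L) e).trans (hd L z)⟩
  · obtain ⟨y', rfl⟩ := pbw_surjective y
    have hy' := pbwEquiv_symm_mem_gr hy
    have ey : (pbwEquiv L').symm (pbw L' y') = y' := (pbwEquiv L').symm_apply_apply y'
    rw [ey] at hy'
    obtain ⟨x, hx, hdx, z, hz, e⟩ := key.surj (n := n) (y := y') hy'
      ((pbw_bijective L').1 ((hd L' y').trans (hdy.trans (map_zero _).symm)))
    refine ⟨pbw L x, pbw_mem_gr hx, (hd L x).symm.trans ((congrArg _ hdx).trans (map_zero _)),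
      pbw L' z, pbw_mem_gr hz, ?_⟩
    refine (congrArg (pbw L') e).trans ((map_add _ _ _).trans ?_)
    exact congrArg₂ (· + ·) (pbw_map f x) (hd L' z)

end Env

end Enveloping

/-! ### Homotopies on tensor powers -/

section TensorPower

open PiTensorProduct

variable {k : Type u} [Field k]

section Module

variable {V W : Type u} [AddCommGroup V] [Module k V] [AddCommGroup W] [Module k W]

theorem map_add_map_eq_zero {ι : Type*} [DecidableEq ι] {F G : ι → V →ₗ[k] W} (m : ι)
    (hm : G m = -F m) (h : ∀ j, j ≠ m → G j = F j) :
    PiTensorProduct.map F + PiTensorProduct.map G = 0 := by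
  have e : G = Function.update F m ((-1 : k) • F m) := by
    funext j
    rcases eq_or_ne j m with rfl | hj
    · rw [Function.update_self, hm, neg_one_smul]
    · rw [Function.update_of_ne hj, h j hj]
  rw [e, PiTensorProduct.map_update_smul, Function.update_eq_self]
  exact (congrArg (_ + ·) (neg_one_smul k _)).trans (add_neg_cancel _)

theorem map_eq_map_of_neg {ι : Type*} [DecidableEq ι] {F G : ι → V →ₗ[k] W} (m m' : ι)
    (hmm : m ≠ m') (hm : G m = -F m) (hm' : G m' = -F m') (h : ∀ j, j ≠ m → j ≠ m' → G j = F j) :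
    PiTensorProduct.map F = PiTensorProduct.map G := by
  have h1 := map_add_map_eq_zero (k := k) (F := F) (G := Function.update F m (-F m)) m
    (Function.update_self _ _ _) fun j hj => Function.update_of_ne hj _ _
  have h2 := map_add_map_eq_zero (k := k) (F := Function.update F m (-F m)) (G := G) m'
    (by rw [Function.update_of_ne hmm.symm, hm']) fun j hj => by
      rcases eq_or_ne j m with rfl | hj'
      · rw [Function.update_self, hm]
      · rw [Function.update_of_ne hj', h j hj' hj]
  exact (eq_neg_of_add_eq_zero_left h1).trans (eq_neg_of_add_eq_zero_right h2).symm

/-- The operator `∑ᵢ σ ⊗ ⋯ ⊗ σ ⊗ s ⊗ p ⊗ ⋯ ⊗ p` on a tensor power, where `s` is in position `i`. -/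
def koszulSum (σ s p : V →ₗ[k] V) (n : ℕ) :
    (⨂[k] _ : Fin n, V) →ₗ[k] ⨂[k] _ : Fin n, V :=
  ∑ i : Fin n, PiTensorProduct.map fun j => if j < i then σ else if j = i then s else p

/-- The telescoping sum that expresses `1 - p ⊗ ⋯ ⊗ p`. -/
theorem koszulSum_id_id_sub (p : V →ₗ[k] V) (n : ℕ) :
    koszulSum LinearMap.id (LinearMap.id - p) p n =
      LinearMap.id - PiTensorProduct.map fun _ => p := by
  let T : ℕ → (⨂[k] _ : Fin n, V) →ₗ[k] ⨂[k] _ : Fin n, V := fun c =>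
    PiTensorProduct.map fun j => if (j : ℕ) < c then LinearMap.id else p
  have h : ∀ i : Fin n, (PiTensorProduct.map fun j => if j < i then (LinearMap.id : V →ₗ[k] V)
      else if j = i then LinearMap.id - p else p) = T (i + 1) - T i := by
    intro i
    have e1 : (fun j => if j < i then (LinearMap.id : V →ₗ[k] V)
        else if j = i then LinearMap.id - p else p) = Function.update
          (fun j : Fin n => if (j : ℕ) < i then LinearMap.id else p) i
            (LinearMap.id + (-1 : k) • p) := by
      funext j
      rcases eq_or_ne j i with rfl | hj
      · rw [Function.update_self, if_neg (lt_irrefl _), if_pos rfl, neg_one_smul, sub_eq_add_neg]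
      · rw [Function.update_of_ne hj, if_neg hj]; rfl
    have e2 : Function.update (fun j : Fin n => if (j : ℕ) < i then LinearMap.id else p) i
        LinearMap.id = fun j : Fin n => if (j : ℕ) < i + 1 then LinearMap.id else p := by
      funext j
      rcases eq_or_ne j i with rfl | hj
      · rw [Function.update_self, if_pos (Nat.lt_succ_self _)]
      · rw [Function.update_of_ne hj]
        have : (j : ℕ) ≠ i := fun h => hj (Fin.ext h)
        exact if_congr (by omega) rfl rfl
    have e3 : Function.update (fun j : Fin n => if (j : ℕ) < i then LinearMap.id else p) i p =
        fun j : Fin n => if (j : ℕ) < i then LinearMap.id else p := by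
      funext j
      rcases eq_or_ne j i with rfl | hj
      · rw [Function.update_self, if_neg (lt_irrefl _)]
      · rw [Function.update_of_ne hj]
    rw [e1, PiTensorProduct.map_update_add, PiTensorProduct.map_update_smul, e2, e3]
    exact (congrArg (_ + ·) (neg_one_smul k _)).trans (sub_eq_add_neg _ _).symm
  rw [koszulSum, Finset.sum_congr rfl fun i _ => h i,
    Fin.sum_univ_eq_sum_range (fun c => T (c + 1) - T c), Finset.sum_range_sub]
  have e1 : T n = LinearMap.id := by
    have : (fun j : Fin n => if (j : ℕ) < n then LinearMap.id else p) = fun _ => LinearMap.id :=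
      funext fun j => if_pos j.2
    exact (congrArg PiTensorProduct.map this).trans PiTensorProduct.map_id
  have e2 : T 0 = PiTensorProduct.map fun _ => p :=
    congrArg PiTensorProduct.map (funext fun j => if_neg (Nat.not_lt_zero _))
  rw [e1, e2]

/-- A homotopy `s` between the identity and `p` extends to tensor powers. -/
theorem koszulSum_homotopy {σ d s p : V →ₗ[k] V} (hσ : σ ∘ₗ σ = LinearMap.id)
    (hd : d ∘ₗ σ = -(σ ∘ₗ d)) (hs : s ∘ₗ σ = -(σ ∘ₗ s)) (hp : p ∘ₗ σ = σ ∘ₗ p)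
    (hdp : p ∘ₗ d = d ∘ₗ p)
    (h : d ∘ₗ s + s ∘ₗ d = LinearMap.id - p) (n : ℕ) :
    koszulSum σ d LinearMap.id n ∘ₗ koszulSum σ s p n +
      koszulSum σ s p n ∘ₗ koszulSum σ d LinearMap.id n =
        LinearMap.id - PiTensorProduct.map fun _ => p := by
  let F : Fin n → Fin n → V →ₗ[k] V := fun i j =>
    if j < i then σ else if j = i then d else LinearMap.id
  let G : Fin n → Fin n → V →ₗ[k] V := fun i j => if j < i then σ else if j = i then s else p
  have key : ∀ i l, PiTensorProduct.map (F i) ∘ₗ PiTensorProduct.map (G l) +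
      PiTensorProduct.map (G l) ∘ₗ PiTensorProduct.map (F i) =
        if i = l then (PiTensorProduct.map fun j => if j < i then (LinearMap.id : V →ₗ[k] V)
          else if j = i then LinearMap.id - p else p) else 0 := by
    intro i l
    rw [← PiTensorProduct.map_comp, ← PiTensorProduct.map_comp]
    rcases lt_trichotomy i l with hil | rfl | hil
    · rw [if_neg hil.ne]
      refine map_add_map_eq_zero i ?_ fun j hj => ?_
      · simp only [F, G, if_pos hil, if_neg (lt_irrefl i), if_true, hd, neg_neg]
      · rcases lt_or_gt_of_ne hj with hj' | hj'
        · simp only [F, G, if_pos hj', if_pos (hj'.trans hil)]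
        · simp only [F, if_neg hj'.le.not_gt, if_neg hj, LinearMap.comp_id, LinearMap.id_comp]
    · rw [if_pos rfl]
      let K : (V →ₗ[k] V) → Fin n → V →ₗ[k] V := fun x j =>
        if j < i then LinearMap.id else if j = i then x else p
      have e : ∀ (x y z : V →ₗ[k] V), x + y = z →
          PiTensorProduct.map (K x) + PiTensorProduct.map (K y) = PiTensorProduct.map (K z) := by
        rintro x y _ rfl
        have hK : ∀ x, K x = Function.update (K 0) i x := fun x => by
          funext j
          rcases eq_or_ne j i with rfl | hj
          · simp [K]
          · simp [K, hj]
        rw [hK x, hK y, hK (x + y), PiTensorProduct.map_update_add]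
      rw [← e _ _ _ h]
      refine congrArg₂ (· + ·) (congrArg _ (funext fun j => ?_)) (congrArg _ (funext fun j => ?_))
      all_goals
        simp only [F, G, K]
        split_ifs
        · exact hσ
        · rfl
        · rfl
    · rw [if_neg hil.ne', add_comm]
      refine map_add_map_eq_zero l ?_ fun j hj => ?_
      · simp only [F, G, if_pos hil, if_neg (lt_irrefl l), if_true, hs, neg_neg]
      · rcases lt_or_gt_of_ne hj with hj' | hj'
        · simp only [F, G, if_pos hj', if_pos (hj'.trans hil)]
        · simp only [F, G, if_neg hj'.le.not_gt, if_neg hj]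
          split_ifs
          · exact hp.symm
          · exact hdp.symm
          · rfl
  have e1 : koszulSum σ d LinearMap.id n = ∑ i, PiTensorProduct.map (F i) := rfl
  have e2 : koszulSum σ s p n = ∑ i, PiTensorProduct.map (G i) := rfl
  rw [e1, e2, ← koszulSum_id_id_sub p n, koszulSum]
  have e3 : (∑ i, PiTensorProduct.map (F i)) ∘ₗ (∑ i, PiTensorProduct.map (G i)) +
      (∑ i, PiTensorProduct.map (G i)) ∘ₗ (∑ i, PiTensorProduct.map (F i)) =
      ∑ i, ∑ l, (PiTensorProduct.map (F i) ∘ₗ PiTensorProduct.map (G l) +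
        PiTensorProduct.map (G l) ∘ₗ PiTensorProduct.map (F i)) := by
    simp only [Finset.sum_add_distrib]
    congr 1
    · refine LinearMap.ext fun x => ?_
      simp only [LinearMap.comp_apply, LinearMap.sum_apply, map_sum]
      exact Finset.sum_comm
    · refine LinearMap.ext fun x => ?_
      simp only [LinearMap.comp_apply, LinearMap.sum_apply, map_sum]
  rw [e3]
  refine Finset.sum_congr rfl fun i _ => ?_
  rw [Finset.sum_congr rfl fun l _ => key i l, Finset.sum_ite_eq, if_pos (Finset.mem_univ _)]

end Module

namespace DGA

variable (A B : DGA k)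

/-- The tensors of degree `m` in `A^{⊗n}`. -/
def tensorGr (n : ℕ) (m : ℤ) : Submodule k (⨂[k] _ : Fin n, A.carrier) :=
  Submodule.span k {z | ∃ (e : Fin n → ℤ) (a : Fin n → A.carrier),
    (∀ i, a i ∈ A.gr (e i)) ∧ ∑ i, e i = m ∧ z = tprod k a}

/-- The relations on `A^{⊗(n+1)}` that define the column of index `n` of the reduced Connes
complex. -/
def columnRel (n : ℕ) : Submodule k (⨂[k] _ : Fin (n + 1), A.carrier) :=
  Submodule.span k ({z | ∃ x, z = x - (-1 : k) ^ n • A.rotate n x} ∪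
    {z | ∃ a : Fin (n + 1) → A.carrier, (∃ i, a i = 1) ∧ z = tprod k a})

variable {A B}

theorem map_mem_tensorGr {n : ℕ} {m : ℤ} {F : Fin n → A.carrier →ₗ[k] B.carrier} {s : Fin n → ℤ}
    (hF : ∀ {j i x}, x ∈ A.gr i → F j x ∈ B.gr (i + s j)) {x : ⨂[k] _ : Fin n, A.carrier}
    (hx : x ∈ A.tensorGr n m) : PiTensorProduct.map F x ∈ B.tensorGr n (m + ∑ j, s j) := by
  induction hx using Submodule.span_induction with
  | zero => rw [map_zero]; exact zero_mem _
  | add x y _ _ hx hy => rw [map_add]; exact add_mem hx hy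
  | smul c x _ hx => rw [map_smul]; exact Submodule.smul_mem _ _ hx
  | mem x hx =>
    obtain ⟨e, a, ha, rfl, rfl⟩ := hx
    rw [map_tprod]
    exact Submodule.subset_span ⟨fun j => e j + s j, _, fun j => hF (ha j),
      Finset.sum_add_distrib, rfl⟩

theorem map_mem_tensorGr' {n : ℕ} {m : ℤ} {f : A.carrier →ₗ[k] B.carrier}
    (hf : ∀ {i x}, x ∈ A.gr i → f x ∈ B.gr i) {x : ⨂[k] _ : Fin n, A.carrier}
    (hx : x ∈ A.tensorGr n m) : PiTensorProduct.map (fun _ => f) x ∈ B.tensorGr n m := by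
  have := map_mem_tensorGr (F := fun _ => f) (s := 0) (fun hx => by simpa using hf hx) hx
  simpa using this

theorem koszulSum_mem_tensorGr {n : ℕ} {m l : ℤ} {σ s p : A.carrier →ₗ[k] A.carrier}
    (hσ : ∀ {i x}, x ∈ A.gr i → σ x ∈ A.gr i) (hs : ∀ {i x}, x ∈ A.gr i → s x ∈ A.gr (i + l))
    (hp : ∀ {i x}, x ∈ A.gr i → p x ∈ A.gr i) {x : ⨂[k] _ : Fin n, A.carrier}
    (hx : x ∈ A.tensorGr n m) : koszulSum σ s p n x ∈ A.tensorGr n (m + l) := by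
  rw [koszulSum, LinearMap.sum_apply]
  refine sum_mem fun i _ => ?_
  have := map_mem_tensorGr (F := fun j => if j < i then σ else if j = i then s else p)
    (s := Pi.single i l) (fun {j r x} hx => by
      split_ifs with h1 h2
      · rw [Pi.single_eq_of_ne h1.ne, add_zero]; exact hσ hx
      · subst h2; rw [Pi.single_eq_same]; exact hs hx
      · rw [Pi.single_eq_of_ne h2, add_zero]; exact hp hx) hx
  rwa [Finset.sum_pi_single' , if_pos (Finset.mem_univ _)] at this

theorem internalD_eq (n : ℕ) :
    A.internalD n = koszulSum A.sign.toLinearMap A.d LinearMap.id (n + 1) := rfl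

theorem sign_comp_sign : A.sign.toLinearMap ∘ₗ A.sign.toLinearMap = LinearMap.id :=
  LinearMap.ext A.sign_sign

theorem comp_sign_of_even {f : A.carrier →ₗ[k] B.carrier}
    (hf : ∀ {i x}, x ∈ A.gr i → f x ∈ B.gr i) :
    f ∘ₗ A.sign.toLinearMap = B.sign.toLinearMap ∘ₗ f :=
  degreewise_comm _ _ hf

theorem comp_sign_of_odd {f : A.carrier →ₗ[k] B.carrier}
    (hf : ∀ {i x}, x ∈ A.gr i → f x ∈ B.gr (i + 1)) :
    f ∘ₗ A.sign.toLinearMap = -(B.sign.toLinearMap ∘ₗ f) :=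
  hom_ext_of_homogeneous A.gr fun i x hx => by
    simp only [LinearMap.comp_apply, LinearMap.neg_apply, AlgHom.toLinearMap_apply]
    rw [sign_of_mem hx, sign_of_mem (hf hx), map_smul,
      zpow_add₀ (neg_ne_zero.mpr (one_ne_zero' k)), zpow_one, mul_neg_one, neg_smul, neg_neg]

theorem d_comp_sign : A.d ∘ₗ A.sign.toLinearMap = -(A.sign.toLinearMap ∘ₗ A.d) :=
  LinearMap.ext fun x => by
    simp only [LinearMap.comp_apply, LinearMap.neg_apply, AlgHom.toLinearMap_apply]
    rw [sign_d, neg_neg]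

/-- Chain maps induce chain maps of tensor powers. -/
theorem map_internalD {f : A.carrier →ₗ[k] B.carrier}
    (hf : GradedComplex.IsChainMap A.toComplex B.toComplex f) (n : ℕ)
    (x : ⨂[k] _ : Fin (n + 1), A.carrier) :
    PiTensorProduct.map (fun _ => f) (A.internalD n x) =
      B.internalD n (PiTensorProduct.map (fun _ => f) x) := by
  simp only [internalD_eq, koszulSum, LinearMap.sum_apply, map_sum]
  refine Finset.sum_congr rfl fun i _ => ?_
  rw [← LinearMap.comp_apply, ← LinearMap.comp_apply, ← PiTensorProduct.map_comp,
    ← PiTensorProduct.map_comp]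
  refine LinearMap.congr_fun (congrArg _ (funext fun j => ?_)) x
  split_ifs
  · exact comp_sign_of_even hf.mem
  · exact LinearMap.ext hf.map_d
  · rfl

theorem map_reindex_finRotate (n : ℕ) (F : Fin (n + 1) → A.carrier →ₗ[k] A.carrier)
    (x : ⨂[k] _ : Fin (n + 1), A.carrier) :
    PiTensorProduct.map F (PiTensorProduct.reindex k (fun _ => A.carrier) (finRotate (n + 1)) x) =
      PiTensorProduct.reindex k (fun _ => A.carrier) (finRotate (n + 1))
        (PiTensorProduct.map (fun j => F (finRotate (n + 1) j)) x) := by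
  rw [← PiTensorProduct.map_reindex (fun j => F (finRotate (n + 1) j)) (finRotate (n + 1)) x]
  refine LinearMap.congr_fun (congrArg _ (funext fun j => ?_)) _
  rw [Equiv.apply_symm_apply]

theorem map_rotate {f : A.carrier →ₗ[k] A.carrier}
    (hf : ∀ {i x}, x ∈ A.gr i → f x ∈ A.gr i) (n : ℕ) (x : ⨂[k] _ : Fin (n + 1), A.carrier) :
    PiTensorProduct.map (fun _ => f) (A.rotate n x) =
      A.rotate n (PiTensorProduct.map (fun _ => f) x) := by
  simp only [rotate, LinearMap.comp_apply, LinearEquiv.coe_coe]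
  rw [map_reindex_finRotate]
  refine congrArg _ ?_
  simp only [LinearMap.add_apply, map_add]
  simp only [← LinearMap.comp_apply, ← PiTensorProduct.map_comp]
  refine congrArg₂ (· + ·) ?_ ?_
  all_goals
    refine LinearMap.congr_fun (congrArg _ (funext fun j => ?_)) x
    split_ifs
    · exact degreewise_comm _ _ hf
    · first | rfl | exact degreewise_comm _ _ hf

theorem internalD_rotate (n : ℕ) (x : ⨂[k] _ : Fin (n + 1), A.carrier) :
    A.internalD n (A.rotate n x) = A.rotate n (A.internalD n x) := by
  set p₀ := degreewise A.gr (fun m => if Even m then (1 : k) else 0) with hp₀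
  set p₁ := degreewise A.gr (fun m => if Even m then (0 : k) else 1) with hp₁
  set σ := A.sign.toLinearMap with hσ
  have h0 : σ ∘ₗ p₀ = p₀ := hom_ext_of_homogeneous A.gr fun i x hx => by
    simp only [hσ, hp₀, LinearMap.comp_apply, degreewise_of_mem A.gr _ hx, map_smul,
      AlgHom.toLinearMap_apply, sign_of_mem hx]
    split_ifs with h
    · simp [h.neg_one_zpow]
    · simp
  have h1 : σ ∘ₗ p₁ = -p₁ := hom_ext_of_homogeneous A.gr fun i x hx => by
    simp only [hσ, hp₁, LinearMap.comp_apply, LinearMap.neg_apply, degreewise_of_mem A.gr _ hx,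
      map_smul, AlgHom.toLinearMap_apply, sign_of_mem hx]
    split_ifs with h
    · simp
    · simp [(Int.not_even_iff_odd.1 h).neg_one_zpow]
  have h2 : A.d ∘ₗ p₀ = p₁ ∘ₗ A.d := hom_ext_of_homogeneous A.gr fun i x hx => by
    simp only [hp₀, hp₁, LinearMap.comp_apply, degreewise_of_mem A.gr _ hx,
      degreewise_of_mem A.gr _ (A.d_mem hx), map_smul]
    congr 1
    split_ifs with h h' h' <;> first | rfl | (exfalso; revert h h'; simp [parity_simps])
  have h3 : A.d ∘ₗ p₁ = p₀ ∘ₗ A.d := hom_ext_of_homogeneous A.gr fun i x hx => by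
    simp only [hp₀, hp₁, LinearMap.comp_apply, degreewise_of_mem A.gr _ hx,
      degreewise_of_mem A.gr _ (A.d_mem hx), map_smul]
    congr 1
    split_ifs with h h' h' <;> first | rfl | (exfalso; revert h h'; simp [parity_simps])
  have h4 : σ ∘ₗ σ = LinearMap.id := sign_comp_sign
  have h5 : A.d ∘ₗ σ = -(σ ∘ₗ A.d) := d_comp_sign
  let D : Fin (n + 1) → Fin (n + 1) → A.carrier →ₗ[k] A.carrier := fun i j =>
    if j < i then σ else if j = i then A.d else LinearMap.id
  let R₀ : Fin (n + 1) → A.carrier →ₗ[k] A.carrier := fun i =>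
    if i = Fin.last n then p₀ else LinearMap.id
  let R₁ : Fin (n + 1) → A.carrier →ₗ[k] A.carrier := fun i => if i = Fin.last n then p₁ else σ
  have eD : A.internalD n = ∑ i, PiTensorProduct.map (D i) := rfl
  have eR : ∀ x, A.rotate n x = PiTensorProduct.reindex k (fun _ => A.carrier) (finRotate (n + 1))
      ((PiTensorProduct.map R₀ + PiTensorProduct.map R₁) x) := fun x => rfl
  have e0 : (fun j => D 0 (finRotate (n + 1) j)) =
      fun j => if j = Fin.last n then A.d else LinearMap.id := by
    funext j
    refine Fin.lastCases ?_ (fun j => ?_) j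
    · rw [finRotate_last, if_pos rfl]
      simp [D]
    · rw [if_neg (Fin.castSucc_lt_last j).ne]
      have : finRotate (n + 1) j.castSucc = j.succ := by
        rw [← finRotate_symm_succ, Equiv.apply_symm_apply]
      rw [this]
      simp [D, Fin.succ_ne_zero]
  have eS : ∀ l : Fin n, (fun j => D l.succ (finRotate (n + 1) j)) =
      fun j => if j = Fin.last n then σ else D l.castSucc j := by
    intro l
    funext j
    refine Fin.lastCases ?_ (fun j => ?_) j
    · rw [finRotate_last, if_pos rfl]
      simp [D]
    · rw [if_neg (Fin.castSucc_lt_last j).ne]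
      have : finRotate (n + 1) j.castSucc = j.succ := by
        rw [← finRotate_symm_succ, Equiv.apply_symm_apply]
      rw [this]
      simp [D]
  have k0 : PiTensorProduct.map (fun j => D 0 (finRotate (n + 1) j)) ∘ₗ
      (PiTensorProduct.map R₀ + PiTensorProduct.map R₁) =
      (PiTensorProduct.map R₀ + PiTensorProduct.map R₁) ∘ₗ
        PiTensorProduct.map (D (Fin.last n)) := by
    rw [e0, LinearMap.comp_add, LinearMap.add_comp, ← PiTensorProduct.map_comp,
      ← PiTensorProduct.map_comp, ← PiTensorProduct.map_comp, ← PiTensorProduct.map_comp]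
    refine (add_comm _ _).trans ?_
    refine congrArg₂ (· + ·) (congrArg _ (funext fun j => ?_)) (congrArg _ (funext fun j => ?_))
    · refine Fin.lastCases ?_ (fun j => ?_) j
      · simp [D, R₀, R₁, h3]
      · simp [D, R₀, R₁, (Fin.castSucc_lt_last j).ne, Fin.castSucc_lt_last j]
    · refine Fin.lastCases ?_ (fun j => ?_) j
      · simp [D, R₀, R₁, h2]
      · simp [D, R₀, R₁, (Fin.castSucc_lt_last j).ne, Fin.castSucc_lt_last j, h4]
  have kS : ∀ l : Fin n, PiTensorProduct.map (fun j => D l.succ (finRotate (n + 1) j)) ∘ₗ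
      (PiTensorProduct.map R₀ + PiTensorProduct.map R₁) =
      (PiTensorProduct.map R₀ + PiTensorProduct.map R₁) ∘ₗ PiTensorProduct.map (D l.castSucc) := by
    intro l
    have hD : D l.castSucc (Fin.last n) = LinearMap.id := by
      simp [D, (Fin.castSucc_lt_last l).not_gt, (Fin.castSucc_lt_last l).ne']
    rw [eS, LinearMap.comp_add, LinearMap.add_comp, ← PiTensorProduct.map_comp,
      ← PiTensorProduct.map_comp, ← PiTensorProduct.map_comp, ← PiTensorProduct.map_comp]
    refine congrArg₂ (· + ·) (congrArg _ (funext fun j => ?_)) ?_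
    · refine Fin.lastCases ?_ (fun j => ?_) j
      · simp [R₀, hD, h0]
      · simp [R₀, (Fin.castSucc_lt_last j).ne]
    · refine map_eq_map_of_neg (Fin.last n) l.castSucc (Fin.castSucc_lt_last l).ne' ?_ ?_
        fun j hj hj' => ?_
      · simp [R₁, hD, h1]
      · simp [R₁, D, (Fin.castSucc_lt_last l).ne, h5]
      · simp only [R₁, if_neg hj, D, if_neg hj']
        split_ifs
        · rfl
        · rfl
  rw [eD, eR, eR]
  simp only [LinearMap.sum_apply, map_reindex_finRotate]
  rw [← map_sum]
  refine congrArg _ ?_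
  rw [map_sum, Fin.sum_univ_succ, Fin.sum_univ_castSucc]
  refine (add_comm _ _).trans ?_
  refine congrArg₂ (· + ·) (Finset.sum_congr rfl fun l _ => ?_) ?_
  · exact LinearMap.congr_fun (kS l) x
  · exact LinearMap.congr_fun k0 x

end DGA

end TensorPower

/-! ### The columns of the reduced Connes complex -/

section Columns

open PiTensorProduct

variable {k : Type u} [Field k]

namespace DGA

/-- `ε` is a homogeneous linear functional on `A` with `ε 1 = 1` that vanishes on boundaries. -/
structure IsAugmentation (A : DGA k) (ε : A.carrier →ₗ[k] k) : Prop where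
  map_one : ε 1 = 1
  map_d : ∀ x, ε (A.d x) = 0
  map_of_ne : ∀ {i x}, x ∈ A.gr i → i ≠ 0 → ε x = 0

variable {A B : DGA k}

/-- The projection of `A` to the kernel of `ε`. -/
def reduced (ε : A.carrier →ₗ[k] k) : A.carrier →ₗ[k] A.carrier :=
  LinearMap.id - Algebra.linearMap k A.carrier ∘ₗ ε

theorem reduced_apply (ε : A.carrier →ₗ[k] k) (x : A.carrier) :
    reduced ε x = x - algebraMap k A.carrier (ε x) := rfl

theorem d_algebraMap (r : k) : A.d (algebraMap k A.carrier r) = 0 := by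
  have h := A.leibniz (SetLike.GradedOne.one_mem (A := A.gr)) 1
  rw [mul_one, mul_one, one_mul, zpow_zero, one_smul, left_eq_add] at h
  rw [Algebra.algebraMap_eq_smul_one, map_smul, h, smul_zero]

theorem IsAugmentation.reduced_mem {ε : A.carrier →ₗ[k] k} (hε : A.IsAugmentation ε) {i : ℤ}
    {x : A.carrier} (hx : x ∈ A.gr i) : reduced ε x ∈ A.gr i := by
  rw [reduced_apply]
  refine sub_mem hx ?_
  rcases eq_or_ne i 0 with rfl | hi
  · exact SetLike.algebraMap_mem_graded A.gr _
  · rw [hε.map_of_ne hx hi, map_zero]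
    exact zero_mem _

theorem IsAugmentation.isChainMap_reduced {ε : A.carrier →ₗ[k] k} (hε : A.IsAugmentation ε) :
    GradedComplex.IsChainMap A.toComplex A.toComplex (reduced ε) where
  mem := hε.reduced_mem
  map_d x := by
    rw [reduced_apply, reduced_apply, hε.map_d, map_zero, sub_zero, map_sub, d_algebraMap,
      sub_zero]

/-- Up to a sign that depends only on degrees, the rotation permutes the factors of pure
tensors. -/
theorem exists_rotate_tprod [CharZero k] {n : ℕ} (e : Fin (n + 1) → ℤ) :
    ∃ c : k, c * c = 1 ∧ ∀ a : Fin (n + 1) → A.carrier, (∀ i, a i ∈ A.gr (e i)) →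
      A.rotate n (tprod k a) = c • tprod k fun i => a ((finRotate (n + 1)).symm i) := by
  obtain ⟨p, hp⟩ := exists_neg_one_pow (k := k) (e (Fin.last n))
  refine ⟨∏ i : Fin n, ((-1 : k) ^ e i.castSucc) ^ p, ?_, fun a ha => ?_⟩
  · rw [← Finset.prod_mul_distrib]
    refine Finset.prod_eq_one fun i _ => ?_
    rw [← mul_pow, neg_one_zpow_mul_self, one_pow]
  · have h1 : A.sign (a (Fin.last n)) = (-1 : k) ^ p • a (Fin.last n) := by
      rw [← hp, sign_of_mem (ha _)]
    rw [rotate_tprod h1]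
    have h2 : (Fin.cons (a (Fin.last n)) (fun i => (A.sign ^ p) (Fin.init a i)) :
        Fin (n + 1) → A.carrier) = fun i =>
          (Fin.cons 1 (fun i : Fin n => ((-1 : k) ^ e i.castSucc) ^ p) : Fin (n + 1) → k) i •
            a ((finRotate (n + 1)).symm i) := by
      funext i
      refine Fin.cases ?_ (fun i => ?_) i
      · rw [Fin.cons_zero, Fin.cons_zero, finRotate_symm_zero, one_smul]
      · rw [Fin.cons_succ, Fin.cons_succ, finRotate_symm_succ]
        exact pow_apply_of_eigen _ (sign_of_mem (ha _)) p
    rw [h2, MultilinearMap.map_smul_univ, Fin.prod_univ_succ, Fin.cons_zero, one_mul]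
    simp only [Fin.cons_succ]

theorem rotate_mem_tensorGr [CharZero k] {n : ℕ} {m : ℤ} {x : ⨂[k] _ : Fin (n + 1), A.carrier}
    (hx : x ∈ A.tensorGr (n + 1) m) : A.rotate n x ∈ A.tensorGr (n + 1) m := by
  induction hx using Submodule.span_induction with
  | zero => rw [map_zero]; exact zero_mem _
  | add x y _ _ hx hy => rw [map_add]; exact add_mem hx hy
  | smul c x _ hx => rw [map_smul]; exact Submodule.smul_mem _ _ hx
  | mem x hx =>
    obtain ⟨e, a, ha, rfl, rfl⟩ := hx
    obtain ⟨c, -, hc⟩ := exists_rotate_tprod (A := A) e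
    rw [hc a ha]
    exact Submodule.smul_mem _ _ (Submodule.subset_span ⟨fun i => e ((finRotate (n + 1)).symm i), _,
      fun i => ha _, Equiv.sum_comp _ e, rfl⟩)

/-- Linear maps on tensor powers are equal if they agree on tensors of homogeneous elements. -/
theorem tensor_ext_homogeneous {N : Type*} [AddCommGroup N] [Module k N] {n : ℕ}
    {f g : (⨂[k] _ : Fin n, A.carrier) →ₗ[k] N}
    (h : ∀ (e : Fin n → ℤ) (a : Fin n → A.carrier), (∀ i, a i ∈ A.gr (e i)) →
      f (tprod k a) = g (tprod k a)) : f = g := by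
  refine PiTensorProduct.ext (MultilinearMap.ext fun a => ?_)
  change f (tprod k a) = g (tprod k a)
  have key : ∀ (S : Finset (Fin n)) (a : Fin n → A.carrier),
      (∀ i ∉ S, ∃ e, a i ∈ A.gr e) → f (tprod k a) = g (tprod k a) := by
    intro S
    induction S using Finset.induction_on with
    | empty =>
      intro a ha
      choose e he using fun i => ha i (Finset.notMem_empty i)
      exact h e a he
    | insert i S _ ih =>
      intro a ha
      have h1 : ∀ x, f (tprod k (Function.update a i x)) = g (tprod k (Function.update a i x)) := by
        intro x
        induction x using DirectSum.Decomposition.inductionOn A.gr with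
        | zero => rw [MultilinearMap.map_update_zero, map_zero, map_zero]
        | add x y hx hy => rw [MultilinearMap.map_update_add, map_add, map_add, hx, hy]
        | @homogeneous e x =>
          refine ih _ fun j hj => ?_
          rcases eq_or_ne j i with rfl | hji
          · exact ⟨e, by rw [Function.update_self]; exact x.2⟩
          · rw [Function.update_of_ne hji]
            exact ha j (by simp [hji, hj])
      simpa using h1 (a i)
  exact key Finset.univ a fun i hi => absurd (Finset.mem_univ i) hi

/-- The generator of the cyclic action on the column of index `n`. -/
def cyclic (A : DGA k) (n : ℕ) : Module.End k (⨂[k] _ : Fin (n + 1), A.carrier) :=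
  (-1 : k) ^ n • A.rotate n

theorem exists_cyclic_pow [CharZero k] (A : DGA k) (n : ℕ) :
    ∃ K : ℕ, 0 < K ∧ cyclic A n ^ K = 1 := by
  set τ : Equiv.Perm (Fin (n + 1)) := (finRotate (n + 1)).symm with hτ
  have h1 : ∀ (j : ℕ) (e : Fin (n + 1) → ℤ), ∃ c : k, c * c = 1 ∧
      ∀ a : Fin (n + 1) → A.carrier, (∀ i, a i ∈ A.gr (e i)) →
        (cyclic A n ^ j) (tprod k a) = c • tprod k fun i => a ((τ ^ j) i) := by
    intro j
    induction j with
    | zero => exact fun e => ⟨1, one_mul 1, fun a _ => by simp⟩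
    | succ j ih =>
      intro e
      obtain ⟨c, hc, h⟩ := exists_rotate_tprod (A := A) e
      obtain ⟨c', hc', h'⟩ := ih fun i => e (τ i)
      refine ⟨(-1) ^ n * (c * c'), ?_, fun a ha => ?_⟩
      · have := neg_one_pow_mul_self (k := k) n
        calc _ = ((-1 : k) ^ n * (-1) ^ n) * ((c * c) * (c' * c')) := by ring
          _ = 1 := by rw [this, hc, hc']; ring
      · rw [pow_succ, Module.End.mul_apply, cyclic, LinearMap.smul_apply, h a ha, map_smul,
          map_smul]
        rw [← cyclic, h' _ fun i => ha (τ i), smul_smul, smul_smul, pow_succ', mul_assoc]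
        rfl
  refine ⟨orderOf τ + orderOf τ, by have := orderOf_pos τ; omega, ?_⟩
  refine tensor_ext_homogeneous fun e a ha => ?_
  obtain ⟨c, hc, h⟩ := h1 (orderOf τ) e
  simp only [pow_orderOf_eq_one, Equiv.Perm.one_apply] at h
  rw [pow_add, Module.End.mul_apply, h a ha, map_smul, h a ha, smul_smul, hc, one_smul]
  rfl

theorem sub_cyclic_mem_columnRel (n : ℕ) (x : ⨂[k] _ : Fin (n + 1), A.carrier) :
    x - cyclic A n x ∈ A.columnRel n :=
  Submodule.subset_span (Or.inl ⟨x, rfl⟩)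

theorem tprod_mem_columnRel {n : ℕ} {a : Fin (n + 1) → A.carrier} {i : Fin (n + 1)} (h : a i = 1) :
    tprod k a ∈ A.columnRel n :=
  Submodule.subset_span (Or.inr ⟨a, ⟨i, h⟩, rfl⟩)

theorem sub_map_reduced_mem_columnRel (ε : A.carrier →ₗ[k] k) (n : ℕ)
    (x : ⨂[k] _ : Fin (n + 1), A.carrier) :
    x - PiTensorProduct.map (fun _ => reduced ε) x ∈ A.columnRel n := by
  have e := LinearMap.congr_fun (koszulSum_id_id_sub (reduced ε) (n + 1)) x
  rw [LinearMap.sub_apply, LinearMap.id_apply] at e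
  rw [← e]
  induction x using PiTensorProduct.induction_on with
  | add x y hx hy =>
    rw [map_add]
    exact add_mem (hx (LinearMap.congr_fun (koszulSum_id_id_sub (reduced ε) (n + 1)) x))
      (hy (LinearMap.congr_fun (koszulSum_id_id_sub (reduced ε) (n + 1)) y))
  | smul_tprod r a =>
    rw [map_smul]
    refine Submodule.smul_mem _ _ ?_
    rw [koszulSum, LinearMap.sum_apply]
    refine sum_mem fun i _ => ?_
    rw [map_tprod]
    set b : Fin (n + 1) → A.carrier := fun j => (if j < i then LinearMap.id else
      if j = i then LinearMap.id - reduced ε else reduced ε) (a j) with hb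
    have h1 : b i = ε (a i) • (1 : A.carrier) := by
      simp [hb, reduced_apply, Algebra.algebraMap_eq_smul_one]
    have h2 : b = Function.update b i (ε (a i) • (1 : A.carrier)) := by
      rw [← h1, Function.update_eq_self]
    rw [h2, MultilinearMap.map_update_smul]
    exact Submodule.smul_mem _ _ (tprod_mem_columnRel (Function.update_self i 1 b))

/-- The average over the cyclic group of order `K`. -/
def average (A : DGA k) (n K : ℕ) : Module.End k (⨂[k] _ : Fin (n + 1), A.carrier) :=
  (K : k)⁻¹ • ∑ j ∈ Finset.range K, cyclic A n ^ j

theorem average_cyclic {n K : ℕ} (hK : cyclic A n ^ K = 1)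
    (x : ⨂[k] _ : Fin (n + 1), A.carrier) : average A n K (x - cyclic A n x) = 0 := by
  have h : (∑ j ∈ Finset.range K, cyclic A n ^ j) * (1 - cyclic A n) = 0 := by
    rw [geom_sum_mul_neg, hK, sub_self]
  have h1 := LinearMap.congr_fun h x
  rw [average, LinearMap.smul_apply]
  exact (congrArg _ h1).trans (smul_zero _)

theorem sub_cyclic_pow_mem_columnRel (n j : ℕ) (x : ⨂[k] _ : Fin (n + 1), A.carrier) :
    x - (cyclic A n ^ j) x ∈ A.columnRel n := by
  induction j with
  | zero => simp
  | succ j ih =>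
    have := add_mem ih (sub_cyclic_mem_columnRel n ((cyclic A n ^ j) x))
    rwa [sub_add_sub_cancel, ← Module.End.mul_apply, ← pow_succ'] at this

theorem sub_average_mem_columnRel [CharZero k] {n K : ℕ} (hK : 0 < K)
    (x : ⨂[k] _ : Fin (n + 1), A.carrier) : x - average A n K x ∈ A.columnRel n := by
  have h0 : (K : k) ≠ 0 := Nat.cast_ne_zero.2 hK.ne'
  have e : x - average A n K x =
      (K : k)⁻¹ • ∑ j ∈ Finset.range K, (x - (cyclic A n ^ j) x) := by
    rw [Finset.sum_sub_distrib, Finset.sum_const, Finset.card_range, smul_sub,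
      ← Nat.cast_smul_eq_nsmul k, inv_smul_smul₀ h0, average, LinearMap.smul_apply,
      LinearMap.sum_apply]
  rw [e]
  exact Submodule.smul_mem _ _ (sum_mem fun j _ => sub_cyclic_pow_mem_columnRel n j x)

/-- Operators that commute with the rotation commute with the average. -/
theorem average_comm {n K : ℕ} {T : (⨂[k] _ : Fin (n + 1), A.carrier) →ₗ[k]
    ⨂[k] _ : Fin (n + 1), B.carrier} (hT : ∀ x, T (A.rotate n x) = B.rotate n (T x))
    (x : ⨂[k] _ : Fin (n + 1), A.carrier) : T (average A n K x) = average B n K (T x) := by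
  have h : ∀ (j : ℕ) x, T ((cyclic A n ^ j) x) = (cyclic B n ^ j) (T x) := by
    intro j
    induction j with
    | zero => intro x; rfl
    | succ j ih =>
      intro x
      rw [pow_succ', pow_succ', Module.End.mul_apply, Module.End.mul_apply, ← ih, cyclic, cyclic,
        LinearMap.smul_apply, LinearMap.smul_apply, map_smul, hT]
  simp only [average, LinearMap.smul_apply, LinearMap.sum_apply, map_smul, map_sum, h]

/-- A projection of the column of index `n` with kernel the relations. -/
def columnProj (ε : A.carrier →ₗ[k] k) (n K : ℕ) :
    Module.End k (⨂[k] _ : Fin (n + 1), A.carrier) :=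
  average A n K ∘ₗ PiTensorProduct.map fun _ => reduced ε

theorem columnProj_apply (ε : A.carrier →ₗ[k] k) (n K : ℕ) (x : ⨂[k] _ : Fin (n + 1), A.carrier) :
    columnProj ε n K x = average A n K (PiTensorProduct.map (fun _ => reduced ε) x) := rfl

variable {ε : A.carrier →ₗ[k] k} (hε : A.IsAugmentation ε) {n K : ℕ}

theorem sub_columnProj_mem_columnRel [CharZero k] (hK : 0 < K)
    (x : ⨂[k] _ : Fin (n + 1), A.carrier) : x - columnProj ε n K x ∈ A.columnRel n := by
  have := add_mem (sub_map_reduced_mem_columnRel ε n x) (sub_average_mem_columnRel hK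
    (PiTensorProduct.map (fun _ => reduced ε) x))
  rwa [sub_add_sub_cancel] at this

theorem columnProj_of_mem (hε : A.IsAugmentation ε) (hK : cyclic A n ^ K = 1)
    {x : ⨂[k] _ : Fin (n + 1), A.carrier} (hx : x ∈ A.columnRel n) : columnProj ε n K x = 0 := by
  have h : A.columnRel n ≤ LinearMap.ker (columnProj ε n K) := by
    refine Submodule.span_le.2 ?_
    rintro _ (⟨x, rfl⟩ | ⟨a, ⟨i, hi⟩, rfl⟩)
    · change columnProj ε n K (x - cyclic A n x) = 0
      rw [columnProj_apply, map_sub, cyclic, LinearMap.smul_apply, map_smul,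
        map_rotate hε.reduced_mem, ← LinearMap.smul_apply, ← cyclic, average_cyclic hK]
    · change columnProj ε n K (tprod k a) = 0
      rw [columnProj_apply, map_tprod, MultilinearMap.map_coord_zero _ i, map_zero]
      rw [reduced_apply, hi, hε.map_one, map_one, sub_self]
  exact h hx

theorem columnProj_mem_tensorGr [CharZero k] (hε : A.IsAugmentation ε) {m : ℤ}
    {x : ⨂[k] _ : Fin (n + 1), A.carrier} (hx : x ∈ A.tensorGr (n + 1) m) :
    columnProj ε n K x ∈ A.tensorGr (n + 1) m := by
  have h1 := map_mem_tensorGr' (A := A) (B := A) hε.reduced_mem hx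
  rw [columnProj_apply, average, LinearMap.smul_apply, LinearMap.sum_apply]
  refine Submodule.smul_mem _ _ (sum_mem fun j hj => ?_)
  clear hj
  induction j with
  | zero => exact h1
  | succ j ih =>
    rw [pow_succ', Module.End.mul_apply]
    exact Submodule.smul_mem _ _ (rotate_mem_tensorGr ih)

theorem columnProj_internalD (hε : A.IsAugmentation ε) (x : ⨂[k] _ : Fin (n + 1), A.carrier) :
    columnProj ε n K (A.internalD n x) = A.internalD n (columnProj ε n K x) := by
  rw [columnProj_apply, columnProj_apply, map_internalD hε.isChainMap_reduced,
    average_comm (internalD_rotate n)]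

theorem columnProj_map (f : DGA.Hom A B) {ε' : B.carrier →ₗ[k] k}
    (hf : ∀ x, ε' (f.toAlgHom x) = ε x) (x : ⨂[k] _ : Fin (n + 1), A.carrier) :
    PiTensorProduct.map (fun _ => f.toAlgHom.toLinearMap) (columnProj ε n K x) =
      columnProj ε' n K (PiTensorProduct.map (fun _ => f.toAlgHom.toLinearMap) x) := by
  rw [columnProj_apply, columnProj_apply,
    average_comm fun x => LinearMap.congr_fun (rotate_comp f n) x]
  refine congrArg _ ?_
  rw [← LinearMap.comp_apply, ← LinearMap.comp_apply, ← PiTensorProduct.map_comp,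
    ← PiTensorProduct.map_comp]
  refine LinearMap.congr_fun (congrArg _ (funext fun _ => LinearMap.ext fun x => ?_)) x
  simp [reduced_apply, hf]

/-- The mapping cone of the map of columns induced by a quasi-isomorphism is acyclic. -/
theorem exists_column_homotopy [CharZero k] (f : DGA.Hom A B)
    (hf : GradedComplex.IsQuasiIso A.toComplex B.toComplex f.toAlgHom.toLinearMap)
    (hε : A.IsAugmentation ε) {ε' : B.carrier →ₗ[k] k} (hε' : B.IsAugmentation ε')
    (hfε : ∀ x, ε' (f.toAlgHom x) = ε x) {n : ℕ} {m : ℤ} {x : ⨂[k] _ : Fin (n + 1), A.carrier}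
    {y : ⨂[k] _ : Fin (n + 1), B.carrier} (hx : x ∈ A.tensorGr (n + 1) m)
    (hy : y ∈ B.tensorGr (n + 1) (m + 1)) (hdx : A.internalD n x ∈ A.columnRel n)
    (h : PiTensorProduct.map (fun _ => f.toAlgHom.toLinearMap) x - B.internalD n y ∈
      B.columnRel n) :
    ∃ x' ∈ A.tensorGr (n + 1) (m + 1), ∃ y' ∈ B.tensorGr (n + 1) (m + 1 + 1),
      x - A.internalD n x' ∈ A.columnRel n ∧
      y - PiTensorProduct.map (fun _ => f.toAlgHom.toLinearMap) x' - B.internalD n y' ∈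
        B.columnRel n := by
  obtain ⟨g, s, t, hg, hs, ht, hgf, hfg⟩ := hf.exists_homotopy_inverse
  obtain ⟨K₁, hK₁, hA₁⟩ := exists_cyclic_pow A n
  obtain ⟨K₂, hK₂, hB₂⟩ := exists_cyclic_pow B n
  set K := K₁ * K₂ with hKdef
  have hK : 0 < K := Nat.mul_pos hK₁ hK₂
  have hA : cyclic A n ^ K = 1 := by rw [hKdef, pow_mul, hA₁, one_pow]
  have hB : cyclic B n ^ K = 1 := by rw [hKdef, mul_comm, pow_mul, hB₂, one_pow]
  let F := PiTensorProduct.map (R := k) (fun _ : Fin (n + 1) => f.toAlgHom.toLinearMap)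
  let G := PiTensorProduct.map (R := k) (fun _ : Fin (n + 1) => g)
  have hP : GradedComplex.IsChainMap A.toComplex A.toComplex (g ∘ₗ f.toAlgHom.toLinearMap) :=
    ⟨fun hx => hg.mem (hf.mem hx), fun x => (congrArg g (hf.map_d x)).trans (hg.map_d _)⟩
  have hQ : GradedComplex.IsChainMap B.toComplex B.toComplex (f.toAlgHom.toLinearMap ∘ₗ g) :=
    ⟨fun hx => hf.mem (hg.mem hx),
      fun x => (congrArg f.toAlgHom.toLinearMap (hg.map_d x)).trans (hf.map_d _)⟩
  have hS := koszulSum_homotopy (σ := A.sign.toLinearMap) (d := A.d) (s := s) sign_comp_sign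
    d_comp_sign (comp_sign_of_odd hs) (comp_sign_of_even hP.mem) (LinearMap.ext hP.map_d)
    (LinearMap.ext hgf) (n + 1)
  have hT := koszulSum_homotopy (σ := B.sign.toLinearMap) (d := B.d) (s := t) sign_comp_sign
    d_comp_sign (comp_sign_of_odd ht) (comp_sign_of_even hQ.mem) (LinearMap.ext hQ.map_d)
    (LinearMap.ext hfg) (n + 1)
  rw [← internalD_eq, PiTensorProduct.map_comp] at hS hT
  set S := koszulSum A.sign.toLinearMap s (g ∘ₗ f.toAlgHom.toLinearMap) (n + 1)
  set T := koszulSum B.sign.toLinearMap t (f.toAlgHom.toLinearMap ∘ₗ g) (n + 1)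
  have hS' : ∀ z, A.internalD n (S z) + S (A.internalD n z) = z - G (F z) :=
    fun z => LinearMap.congr_fun hS z
  have hT' : ∀ z, B.internalD n (T z) + T (B.internalD n z) = z - F (G z) :=
    fun z => LinearMap.congr_fun hT z
  have hSm : ∀ {l z}, z ∈ A.tensorGr (n + 1) l → S z ∈ A.tensorGr (n + 1) (l + 1) := fun hz =>
    koszulSum_mem_tensorGr sign_mem hs hP.mem hz
  have hTm : ∀ {l z}, z ∈ B.tensorGr (n + 1) l → T z ∈ B.tensorGr (n + 1) (l + 1) := fun hz =>
    koszulSum_mem_tensorGr sign_mem ht hQ.mem hz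
  have hFm : ∀ {l z}, z ∈ A.tensorGr (n + 1) l → F z ∈ B.tensorGr (n + 1) l := fun hz =>
    map_mem_tensorGr' hf.mem hz
  have hGm : ∀ {l z}, z ∈ B.tensorGr (n + 1) l → G z ∈ A.tensorGr (n + 1) l := fun hz =>
    map_mem_tensorGr' hg.mem hz
  have hFd : ∀ z, F (A.internalD n z) = B.internalD n (F z) :=
    map_internalD hf.toIsChainMap n
  have hGd : ∀ z, G (B.internalD n z) = A.internalD n (G z) := map_internalD hg n
  -- representatives in the images of the projections are cycles of the mapping cone, not only
  -- modulo relations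
  set x₁ := columnProj ε n K x
  set y₁ := columnProj ε' n K y
  have hx₁ : x₁ ∈ A.tensorGr (n + 1) m := columnProj_mem_tensorGr hε hx
  have hy₁ : y₁ ∈ B.tensorGr (n + 1) (m + 1) := columnProj_mem_tensorGr hε' hy
  have hdx₁ : A.internalD n x₁ = 0 :=
    (columnProj_internalD hε x).symm.trans (columnProj_of_mem hε hA hdx)
  have h₁ : F x₁ = B.internalD n y₁ := by
    have := columnProj_of_mem hε' hB h
    rw [map_sub, columnProj_internalD hε', ← columnProj_map f hfε] at this
    exact sub_eq_zero.1 this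
  have e1 := hS' x₁
  rw [hdx₁, map_zero, add_zero] at e1
  -- the homotopy inverse `G` and the homotopies `S` and `T` contract the mapping cone
  set z := G y₁ + S x₁
  have hz : z ∈ A.tensorGr (n + 1) (m + 1) := add_mem (hGm hy₁) (hSm hx₁)
  have hdz : A.internalD n z = x₁ := by
    rw [map_add, e1, ← hGd, ← h₁, add_sub_cancel]
  have hw : B.internalD n (y₁ - F z) = 0 := by
    rw [map_sub, ← hFd, hdz, h₁, sub_self]
  have e2 := hT' (y₁ - F z)
  rw [hw, map_zero, add_zero] at e2
  refine ⟨z + G (y₁ - F z), add_mem hz (hGm (sub_mem hy₁ (hFm hz))), T (y₁ - F z),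
    hTm (sub_mem hy₁ (hFm hz)), ?_, ?_⟩
  · rw [map_add, hdz, ← hGd, hw, map_zero, add_zero]
    exact sub_columnProj_mem_columnRel hK x
  · have e3 : y - F (z + G (y₁ - F z)) - B.internalD n (T (y₁ - F z)) = y - y₁ := by
      rw [e2, map_add]
      abel
    exact e3 ▸ sub_columnProj_mem_columnRel hK y

end DGA

end Columns

/-! ### Invariance of reduced cyclic homology under quasi-isomorphisms -/

section Invariance

open PiTensorProduct

variable {k : Type u} [Field k]

namespace DGA

variable {A B : DGA k}

theorem sum_contractNth {n : ℕ} (j : Fin (n + 1)) (e : Fin (n + 2) → ℤ) :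
    ∑ i, Fin.contractNth j.castSucc (· + ·) e i = ∑ i, e i := by
  have h := congrFun (Fin.partialSum_contractNth e j.castSucc) (Fin.last (n + 1))
  have hj : j.castSucc.succ.succAbove (Fin.last (n + 1)) = Fin.last (n + 2) :=
    Fin.succAbove_ne_last_last (by
      rw [Ne, Fin.ext_iff, Fin.val_succ, Fin.val_castSucc, Fin.val_last]
      omega)
  have hl : ∀ (m : ℕ) (f : Fin m → ℤ), Fin.partialSum f (Fin.last m) = ∑ i, f i := fun m f => by
    rw [Fin.partialSum, Fin.val_last, List.take_of_length_le (List.length_ofFn).le, List.sum_ofFn]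
  rwa [Function.comp_apply, hj, hl, hl] at h

theorem face_mem_tensorGr {n : ℕ} (j : Fin (n + 1)) {m : ℤ} {x : ⨂[k] _ : Fin (n + 2), A.carrier}
    (hx : x ∈ A.tensorGr (n + 2) m) : face A.carrier j x ∈ A.tensorGr (n + 1) m := by
  induction hx using Submodule.span_induction with
  | zero => rw [map_zero]; exact zero_mem _
  | add x y _ _ hx hy => rw [map_add]; exact add_mem hx hy
  | smul c x _ hx => rw [map_smul]; exact Submodule.smul_mem _ _ hx
  | mem x hx =>
    obtain ⟨e, a, ha, rfl, rfl⟩ := hx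
    refine Submodule.subset_span ⟨Fin.contractNth j.castSucc (· + ·) e,
      Fin.contractNth j.castSucc (· * ·) a, fun i => ?_, sum_contractNth j e, ?_⟩
    · simp only [Fin.contractNth]
      split_ifs
      · exact ha _
      · exact SetLike.mul_mem_graded (ha _) (ha _)
      · exact ha _
    · rw [face, lift.tprod]; rfl

theorem hochschildB_mem_tensorGr [CharZero k] {n : ℕ} {m : ℤ} {x : ⨂[k] _ : Fin (n + 2), A.carrier}
    (hx : x ∈ A.tensorGr (n + 2) m) : A.hochschildB n x ∈ A.tensorGr (n + 1) m := by
  rw [hochschildB, LinearMap.add_apply, LinearMap.sum_apply]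
  exact add_mem (sum_mem fun j _ => Submodule.smul_mem _ _ (face_mem_tensorGr j hx))
    (Submodule.smul_mem _ _ (face_mem_tensorGr 0 (rotate_mem_tensorGr hx)))

theorem internalD_mem_tensorGr {n : ℕ} {m : ℤ} {x : ⨂[k] _ : Fin (n + 1), A.carrier}
    (hx : x ∈ A.tensorGr (n + 1) m) : A.internalD n x ∈ A.tensorGr (n + 1) (m - 1) :=
  koszulSum_mem_tensorGr sign_mem A.d_mem (fun h => h) hx

/-- The inclusion of the tensor power of index `n` in the Hochschild chains. -/
def column (A : DGA k) (n : ℕ) : (⨂[k] _ : Fin (n + 1), A.carrier) →ₗ[k] A.connes.M :=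
  DirectSum.lof k ℕ (fun n => ⨂[k] _ : Fin (n + 1), A.carrier) n

/-- The component of a Hochschild chain in the tensor power of index `n`. -/
def component (A : DGA k) (n : ℕ) : A.connes.M →ₗ[k] ⨂[k] _ : Fin (n + 1), A.carrier :=
  DirectSum.component k ℕ (fun n => ⨂[k] _ : Fin (n + 1), A.carrier) n

theorem component_column_self (n : ℕ) (x : ⨂[k] _ : Fin (n + 1), A.carrier) :
    A.component n (A.column n x) = x :=
  DirectSum.component.lof_self k (M := fun n => ⨂[k] _ : Fin (n + 1), A.carrier) n x

theorem component_column_of_ne {n l : ℕ} (h : n ≠ l) (x : ⨂[k] _ : Fin (n + 1), A.carrier) :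
    A.component l (A.column n x) = 0 :=
  DirectSum.of_eq_of_ne (β := fun n => ⨂[k] _ : Fin (n + 1), A.carrier) n l x h.symm

theorem hom_ext_column {N : Type*} [AddCommGroup N] [Module k N] {f g : A.connes.M →ₗ[k] N}
    (h : ∀ n x, f (A.column n x) = g (A.column n x)) (x : A.connes.M) : f x = g x :=
  LinearMap.congr_fun (DirectSum.linearMap_ext k fun n => LinearMap.ext fun x => h n x) x

theorem column_mem_gr {n : ℕ} {m : ℤ} {x : ⨂[k] _ : Fin (n + 1), A.carrier}
    (hx : x ∈ A.tensorGr (n + 1) m) : A.column n x ∈ A.connes.gr (m + n) := by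
  induction hx using Submodule.span_induction with
  | zero => rw [map_zero]; exact zero_mem _
  | add x y _ _ hx hy => rw [map_add]; exact add_mem hx hy
  | smul c x _ hx => rw [map_smul]; exact Submodule.smul_mem _ _ hx
  | mem x hx =>
    obtain ⟨e, a, ha, rfl, rfl⟩ := hx
    exact Submodule.subset_span ⟨n, e, a, ha, rfl, rfl⟩

theorem component_mem_tensorGr {m : ℤ} {x : A.connes.M} (hx : x ∈ A.connes.gr m) (n : ℕ) :
    A.component n x ∈ A.tensorGr (n + 1) (m - n) := by
  induction hx using Submodule.span_induction with
  | zero => rw [map_zero]; exact zero_mem _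
  | add x y _ _ hx hy => rw [map_add]; exact add_mem hx hy
  | smul c x _ hx => rw [map_smul]; exact Submodule.smul_mem _ _ hx
  | mem x hx =>
    obtain ⟨l, e, a, ha, rfl, rfl⟩ := hx
    change A.component n (A.column l _) ∈ _
    rcases eq_or_ne l n with rfl | h
    · rw [component_column_self, add_sub_cancel_right]
      exact Submodule.subset_span ⟨e, a, ha, rfl, rfl⟩
    · rw [component_column_of_ne h]
      exact zero_mem _

theorem column_mem_rel {n : ℕ} {x : ⨂[k] _ : Fin (n + 1), A.carrier} (hx : x ∈ A.columnRel n) :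
    A.column n x ∈ A.connes.rel := by
  induction hx using Submodule.span_induction with
  | zero => rw [map_zero]; exact zero_mem _
  | add x y _ _ hx hy => rw [map_add]; exact add_mem hx hy
  | smul c x _ hx => rw [map_smul]; exact Submodule.smul_mem _ _ hx
  | mem x hx =>
    rcases hx with ⟨x, rfl⟩ | ⟨a, h, rfl⟩
    · exact Submodule.subset_span (Or.inl ⟨n, x, rfl⟩)
    · exact Submodule.subset_span (Or.inr ⟨n, a, h, rfl⟩)

theorem component_mem_columnRel {x : A.connes.M} (hx : x ∈ A.connes.rel) (n : ℕ) :
    A.component n x ∈ A.columnRel n := by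
  induction hx using Submodule.span_induction with
  | zero => rw [map_zero]; exact zero_mem _
  | add x y _ _ hx hy => rw [map_add]; exact add_mem hx hy
  | smul c x _ hx => rw [map_smul]; exact Submodule.smul_mem _ _ hx
  | mem x hx =>
    rcases hx with ⟨l, x, rfl⟩ | ⟨l, a, h, rfl⟩
    · change A.component n (A.column l _) ∈ _
      rcases eq_or_ne l n with rfl | hl
      · rw [component_column_self]
        exact Submodule.subset_span (Or.inl ⟨x, rfl⟩)
      · rw [component_column_of_ne hl]
        exact zero_mem _
    · change A.component n (A.column l _) ∈ _
      rcases eq_or_ne l n with rfl | hl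
      · rw [component_column_self]
        exact Submodule.subset_span (Or.inr ⟨a, h, rfl⟩)
      · rw [component_column_of_ne hl]
        exact zero_mem _

theorem connes_d_column_zero (x : ⨂[k] _ : Fin (0 + 1), A.carrier) :
    A.connes.d (A.column 0 x) = A.column 0 (A.internalD 0 x) :=
  DirectSum.toModule_lof (M := fun n : ℕ => ⨂[k] _ : Fin (n + 1), A.carrier) k 0 x

theorem connes_d_column_succ (n : ℕ) (x : ⨂[k] _ : Fin (n + 1 + 1), A.carrier) :
    A.connes.d (A.column (n + 1) x) = A.column n (A.hochschildB n x) +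
      (-1 : k) ^ (n + 1) • A.column (n + 1) (A.internalD (n + 1) x) :=
  hochschildD_succ n x

theorem component_d (n : ℕ) (x : A.connes.M) : A.component n (A.connes.d x) =
    A.hochschildB n (A.component (n + 1) x) +
      (-1 : k) ^ n • A.internalD n (A.component n x) := by
  refine hom_ext_column (f := A.component n ∘ₗ A.connes.d) (g := A.hochschildB n ∘ₗ
    A.component (n + 1) + (-1 : k) ^ n • A.internalD n ∘ₗ A.component n) (fun l x => ?_) x
  simp only [LinearMap.comp_apply, LinearMap.add_apply, LinearMap.smul_apply]
  cases l with
  | zero =>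
    rw [connes_d_column_zero, component_column_of_ne (Nat.succ_ne_zero n).symm, map_zero]
    refine Eq.trans ?_ (zero_add _).symm
    cases n with
    | zero => rw [component_column_self, component_column_self, pow_zero, one_smul]
    | succ n =>
      rw [component_column_of_ne (Nat.succ_ne_zero n).symm,
        component_column_of_ne (Nat.succ_ne_zero n).symm, map_zero, smul_zero]
  | succ l =>
    rw [connes_d_column_succ, map_add, map_smul]
    refine congrArg₂ (· + ·) ?_ ?_
    · rcases eq_or_ne l n with rfl | h
      · rw [component_column_self, component_column_self]
      · rw [component_column_of_ne h, component_column_of_ne (by omega), map_zero]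
    · rcases eq_or_ne (l + 1) n with rfl | h
      · rw [component_column_self, component_column_self]
      · rw [component_column_of_ne h, component_column_of_ne h, map_zero, smul_zero, smul_zero]

theorem connes_d_mem_gr [CharZero k] {m : ℤ} {x : A.connes.M} (hx : x ∈ A.connes.gr m) :
    A.connes.d x ∈ A.connes.gr (m - 1) := by
  induction hx using Submodule.span_induction with
  | zero => rw [map_zero]; exact zero_mem _
  | add x y _ _ hx hy => rw [map_add]; exact add_mem hx hy
  | smul c x _ hx => rw [map_smul]; exact Submodule.smul_mem _ _ hx
  | mem x hx =>
    obtain ⟨n, e, a, ha, rfl, rfl⟩ := hx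
    have h : tprod k a ∈ A.tensorGr (n + 1) (∑ i, e i) :=
      Submodule.subset_span ⟨e, a, ha, rfl, rfl⟩
    change A.connes.d (A.column n (tprod k a)) ∈ _
    cases n with
    | zero =>
      rw [connes_d_column_zero, add_sub_right_comm]
      exact column_mem_gr (internalD_mem_tensorGr h)
    | succ n =>
      rw [connes_d_column_succ]
      refine add_mem ?_ (Submodule.smul_mem _ _ ?_)
      · have := column_mem_gr (hochschildB_mem_tensorGr h)
        convert this using 1
        push_cast
        ring_nf
      · rw [add_sub_right_comm]
        exact column_mem_gr (internalD_mem_tensorGr h)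

theorem chainMap_column (f : DGA.Hom A B) (n : ℕ) (x : ⨂[k] _ : Fin (n + 1), A.carrier) :
    chainMap f (A.column n x) =
      B.column n (PiTensorProduct.map (fun _ => f.toAlgHom.toLinearMap) x) :=
  chainMap_lof f n x

theorem component_chainMap (f : DGA.Hom A B) (n : ℕ) (x : A.connes.M) :
    B.component n (chainMap f x) =
      PiTensorProduct.map (fun _ => f.toAlgHom.toLinearMap) (A.component n x) := rfl

theorem chainMap_d (f : DGA.Hom A B) (x : A.connes.M) :
    chainMap f (A.connes.d x) = B.connes.d (chainMap f x) :=
  LinearMap.congr_fun (chainMap_hochschildD f) x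

theorem eq_zero_of_component {x : A.connes.M} (h : ∀ n, A.component n x = 0) : x = 0 :=
  DFinsupp.ext h

theorem exists_component_eq_zero (x : A.connes.M) : ∃ N, ∀ n, N ≤ n → A.component n x = 0 := by
  classical
  refine ⟨(DFinsupp.support x).sup id + 1, fun n hn => ?_⟩
  by_contra h
  have h1 : n ∈ DFinsupp.support x := DFinsupp.mem_support_iff.2 h
  have h2 : n ≤ (DFinsupp.support x).sup id := Finset.le_sup (f := id) h1
  omega

/-- The mapping cone of the map of reduced Connes complexes induced by a quasi-isomorphism is
acyclic. -/
theorem exists_connes_homotopy [CharZero k] (f : DGA.Hom A B)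
    (hf : GradedComplex.IsQuasiIso A.toComplex B.toComplex f.toAlgHom.toLinearMap)
    {ε : A.carrier →ₗ[k] k} (hε : A.IsAugmentation ε) {ε' : B.carrier →ₗ[k] k}
    (hε' : B.IsAugmentation ε') (hfε : ∀ x, ε' (f.toAlgHom x) = ε x) (N : ℕ) :
    ∀ {m : ℤ} {x : A.connes.M} {y : B.connes.M}, x ∈ A.connes.gr m → y ∈ B.connes.gr (m + 1) →
      (∀ n, N ≤ n → A.component n x = 0) → (∀ n, N ≤ n → B.component n y = 0) →
      A.connes.d x ∈ A.connes.rel → chainMap f x - B.connes.d y ∈ B.connes.rel →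
      ∃ x' ∈ A.connes.gr (m + 1), ∃ y' ∈ B.connes.gr (m + 1 + 1),
        x - A.connes.d x' ∈ A.connes.rel ∧
        y - chainMap f x' - B.connes.d y' ∈ B.connes.rel := by
  induction N with
  | zero =>
    intro m x y _ _ hx hy _ _
    refine ⟨0, zero_mem _, 0, zero_mem _, ?_, ?_⟩
    · rw [eq_zero_of_component fun n => hx n n.zero_le, map_zero, sub_zero]
      exact zero_mem _
    · rw [eq_zero_of_component fun n => hy n n.zero_le, map_zero, map_zero, sub_zero, sub_zero]
      exact zero_mem _
  | succ N ih =>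
    intro m x y hxm hym hx hy hdx h
    have hN : (-1 : k) ^ N * (-1 : k) ^ N = 1 := neg_one_pow_mul_self N
    have h1 : A.internalD N (A.component N x) ∈ A.columnRel N := by
      have := component_mem_columnRel hdx N
      rw [component_d, hx (N + 1) le_rfl, map_zero, zero_add] at this
      have := Submodule.smul_mem _ ((-1 : k) ^ N) this
      rwa [smul_smul, hN, one_smul] at this
    have h2 : PiTensorProduct.map (fun _ => f.toAlgHom.toLinearMap) (A.component N x) -
        B.internalD N ((-1 : k) ^ N • B.component N y) ∈ B.columnRel N := by
      have := component_mem_columnRel h N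
      rwa [map_sub, component_d, hy (N + 1) le_rfl, map_zero, zero_add, component_chainMap,
        ← map_smul] at this
    have hym' := Submodule.smul_mem _ ((-1 : k) ^ N) (component_mem_tensorGr hym N)
    rw [add_sub_right_comm] at hym'
    obtain ⟨u, hu, v, hv, e1, e2⟩ := exists_column_homotopy f hf hε hε' hfε
      (component_mem_tensorGr hxm N) hym' h1 h2
    have hu' : (-1 : k) ^ N • A.column N u ∈ A.connes.gr (m + 1) := by
      have := column_mem_gr hu
      rw [show m - N + 1 + N = m + 1 by ring] at this
      exact Submodule.smul_mem _ _ this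
    have hv' : B.column N v ∈ B.connes.gr (m + 1 + 1) := by
      have := column_mem_gr hv
      rwa [show m - N + 1 + 1 + N = m + 1 + 1 by ring] at this
    -- subtracting the boundary of `(x₁, y₁)` leaves relations in the column of index `N`; these
    -- do not affect the problem, and induction applies to the columns of smaller index
    set x₁ := (-1 : k) ^ N • A.column N u with hx₁
    set y₁ := B.column N v with hy₁
    have cx : ∀ n, N ≤ n → A.component n (x - A.connes.d x₁) =
        A.component n (A.column N (A.component N x - A.internalD N u)) := by
      intro n hn
      rw [map_sub, component_d, hx₁, map_smul, map_smul, map_smul, map_smul,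
        component_column_of_ne (by omega), map_zero, smul_zero, zero_add, smul_smul]
      rcases eq_or_ne N n with rfl | h
      · rw [component_column_self, component_column_self, hN, one_smul]
      · rw [component_column_of_ne h, component_column_of_ne h, map_zero, smul_zero, sub_zero,
          hx n (by omega)]
    have cy : ∀ n, N ≤ n → B.component n (y - chainMap f x₁ - B.connes.d y₁) =
        B.component n (B.column N ((-1 : k) ^ N • ((-1 : k) ^ N • B.component N y -
          PiTensorProduct.map (fun _ => f.toAlgHom.toLinearMap) u - B.internalD N v))) := by
      intro n hn
      rw [map_sub, map_sub, component_d, hx₁, hy₁, component_chainMap, map_smul, map_smul,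
        component_column_of_ne (n := N) (l := n + 1) (by omega), map_zero, zero_add]
      rcases eq_or_ne N n with rfl | h
      · rw [component_column_self, component_column_self, component_column_self, smul_sub, smul_sub,
          smul_smul, hN, one_smul]
      · rw [component_column_of_ne h, component_column_of_ne h, component_column_of_ne h, map_zero,
          map_zero, smul_zero, smul_zero, sub_zero, sub_zero, hy n (by omega)]
    set r := A.component N x - A.internalD N u
    set r' := (-1 : k) ^ N • ((-1 : k) ^ N • B.component N y -
          PiTensorProduct.map (fun _ => f.toAlgHom.toLinearMap) u - B.internalD N v)
    have hr : A.column N r ∈ A.connes.rel := column_mem_rel e1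
    have hr' : B.column N r' ∈ B.connes.rel := column_mem_rel (Submodule.smul_mem _ _ e2)
    have gx : x - A.connes.d x₁ ∈ A.connes.gr m := by
      have := connes_d_mem_gr hu'
      rw [add_sub_cancel_right] at this
      exact sub_mem hxm this
    have gy : y - chainMap f x₁ - B.connes.d y₁ ∈ B.connes.gr (m + 1) := by
      have := connes_d_mem_gr hv'
      rw [add_sub_cancel_right] at this
      exact sub_mem (sub_mem hym ((connesMap f).map_gr hu')) this
    have gr : A.column N r ∈ A.connes.gr m := by
      have := column_mem_gr (component_mem_tensorGr gx N)
      rwa [cx N le_rfl, component_column_self, sub_add_cancel] at this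
    have gr' : B.column N r' ∈ B.connes.gr (m + 1) := by
      have := column_mem_gr (component_mem_tensorGr gy N)
      rwa [cy N le_rfl, component_column_self, sub_add_cancel] at this
    obtain ⟨x₂, hx₂, y₂, hy₂, e3, e4⟩ := ih (m := m)
      (x := x - A.connes.d x₁ - A.column N r)
      (y := y - chainMap f x₁ - B.connes.d y₁ - B.column N r') (sub_mem gx gr) (sub_mem gy gr')
      (fun n hn => by rw [map_sub, cx n hn, sub_self])
      (fun n hn => by rw [map_sub, cy n hn, sub_self])
      (by
        rw [map_sub, map_sub]
        exact sub_mem (sub_mem hdx (d_d_mem_connes_rel x₁)) (d_mem_connes_rel hr))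
      (by
        have := add_mem (sub_mem (add_mem h (d_d_mem_connes_rel y₁))
          ((connesMap f).map_rel hr)) (d_mem_connes_rel hr')
        have e5 : chainMap f (x - A.connes.d x₁ - A.column N r) =
            chainMap f x - B.connes.d (chainMap f x₁) - chainMap f (A.column N r) := by
          rw [map_sub, map_sub, chainMap_d]
        have e6 : B.connes.d (y - chainMap f x₁ - B.connes.d y₁ - B.column N r') = B.connes.d y -
            B.connes.d (chainMap f x₁) - B.connes.d (B.connes.d y₁) -
              B.connes.d (B.column N r') := by
          rw [map_sub, map_sub, map_sub]
        rw [e5, e6]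
        convert this using 1
        change _ = chainMap f x - B.connes.d y + B.connes.d (B.connes.d y₁) -
          chainMap f (A.column N r) + B.connes.d (B.column N r')
        abel)
    refine ⟨x₁ + x₂, add_mem hu' hx₂, y₁ + y₂, add_mem hv' hy₂, ?_, ?_⟩
    · have := add_mem e3 hr
      convert this using 1
      rw [map_add]
      abel
    · have := add_mem e4 hr'
      convert this using 1
      rw [map_add, map_add]
      abel

/-- Reduced cyclic homology is invariant under quasi-isomorphisms of augmented DG algebras. -/
theorem HC.map_bijective [CharZero k] (f : DGA.Hom A B)
    (hf : GradedComplex.IsQuasiIso A.toComplex B.toComplex f.toAlgHom.toLinearMap)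
    {ε : A.carrier →ₗ[k] k} (hε : A.IsAugmentation ε) {ε' : B.carrier →ₗ[k] k}
    (hε' : B.IsAugmentation ε') (hfε : ∀ x, ε' (f.toAlgHom x) = ε x) (n : ℤ) :
    Function.Bijective (HC.map f n) := by
  refine PresentedComplex.Hom.mapH_bijective (fun x hx hb => ?_) (fun y hy => ?_)
  · obtain ⟨_, ⟨y, hy, rfl⟩, r, hr, e⟩ := Submodule.mem_sup.1 hb
    obtain ⟨N₁, h₁⟩ := exists_component_eq_zero x
    obtain ⟨N₂, h₂⟩ := exists_component_eq_zero y
    obtain ⟨x', hx', -, -, h, -⟩ := exists_connes_homotopy f hf hε hε' hfε (N₁ + N₂) hx.1 hy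
      (fun n hn => h₁ n (by omega)) (fun n hn => h₂ n (by omega)) hx.2 (by
        have e' : chainMap f x = B.connes.d y + r := e.symm
        rwa [e', add_sub_cancel_left])
    exact Submodule.mem_sup.2 ⟨_, ⟨x', hx', rfl⟩, _, h, add_sub_cancel _ _⟩
  · obtain ⟨N, hN⟩ := exists_component_eq_zero y
    obtain ⟨x', hx', y', hy', h, h'⟩ := exists_connes_homotopy f hf hε hε' hfε N
      (m := n - 1) (x := 0) (y := y) (zero_mem _) (by rw [sub_add_cancel]; exact hy.1)
      (fun n hn => map_zero _) hN (by rw [map_zero]; exact zero_mem _)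
      (by rw [map_zero, zero_sub]; exact neg_mem hy.2)
    rw [sub_add_cancel] at hx' hy'
    refine ⟨x', ⟨hx', ?_⟩, ?_⟩
    · rw [zero_sub] at h
      exact (neg_mem_iff (H := A.connes.rel)).1 h
    · refine Submodule.mem_sup.2 ⟨_, ⟨-y', neg_mem hy', rfl⟩, _, neg_mem h', ?_⟩
      change B.connes.d (-y') + _ = chainMap f x' - y
      rw [map_neg]
      abel

end DGA

theorem isAugmentation_counit [CharZero k] (L : DGLA k) :
    (U L).IsAugmentation (counit L).toLinearMap := by
  have h : ∀ {i x}, x ∈ Env.gr L i → i ≠ 0 → counit L x = 0 := by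
    intro i x hx hi
    induction hx using Submodule.span_induction with
    | zero => rw [map_zero]
    | add x y _ _ hx hy => rw [map_add, hx, hy, add_zero]
    | smul c x _ hx => rw [map_smul, hx, smul_zero]
    | mem x hx =>
      obtain ⟨l, hl, rfl⟩ := hx
      cases l with
      | nil => exact absurd hl.symm (by simpa using hi)
      | cons p l =>
        have : counit L (Env.ι L (p.2 : L.carrier)) = 0 := Env.lift_ι _ _ _
        rw [List.map_cons, List.prod_cons, map_mul, this, zero_mul]
  refine ⟨map_one (counit L), fun x => ?_, h⟩
  refine LinearMap.congr_fun (Env.hom_ext_left (L := L)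
    (F := (counit L).toLinearMap ∘ₗ Env.d L) (G := 0) ?_ fun {i y} hy u hu => ?_) x
  · have : Env.d L 1 = 0 := Env.derivation_one _
    rw [LinearMap.comp_apply, this, map_zero]; rfl
  · have h0 : ∀ y, counit L (Env.ι L y) = 0 := fun y => Env.lift_ι _ _ _
    simp only [LinearMap.comp_apply, AlgHom.toLinearMap_apply, Env.d_mul, map_add, map_mul,
      Env.d_ι, Env.twist_ι hy, map_smul, h0, zero_mul, smul_zero, add_zero]
    rfl

/-- Cofibrant resolutions induce isomorphisms on reduced cyclic homology of enveloping algebras. -/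
theorem fromResolution_bijective [CharZero k] {a : DGLA k} (R : a.CofibrantResolution) (n : ℤ) :
    Function.Bijective (fromResolution R n) :=
  DGA.HC.map_bijective (U.map R.q) (Env.isQuasiIso_map R.quasiIso) (isAugmentation_counit R.L)
    (isAugmentation_counit a) (Env.counit_map R.q) n

end Invariance

/-! ### The Hodge decomposition and the Adams operations -/

section Assembly

variable {k : Type u} [Field k]

namespace DGA

variable {A B C : DGA k}

/-- The chain map `A / (k + [A, A]) → B / (k + [B, B])` induced by a morphism. -/
def cycMap (f : DGA.Hom A B) : PresentedComplex.Hom A.cyc B.cyc where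
  toLin := f.toAlgHom.toLinearMap
  map_gr := f.map_gr
  map_rel {x} hx := by
    have h : A.commutators ≤ B.commutators.comap f.toAlgHom.toLinearMap := by
      refine Submodule.span_le.2 ?_
      rintro _ (rfl | ⟨i, j, x, hx, y, hy, rfl⟩)
      · exact Submodule.subset_span (Or.inl (map_one f.toAlgHom))
      · refine Submodule.subset_span (Or.inr ⟨i, j, _, f.map_gr hx, _, f.map_gr hy, ?_⟩)
        simp
    exact h hx
  map_d x := B.cyc.sub_mem_rel (f.map_d x)

theorem proj₀_chainMap (f : DGA.Hom A B) (x : A.connes.M) :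
    B.proj₀ (chainMap f x) = f.toAlgHom (A.proj₀ x) := by
  refine hom_ext_column (f := B.proj₀ ∘ₗ chainMap f) (g := f.toAlgHom.toLinearMap ∘ₗ A.proj₀)
    (fun n x => ?_) x
  rw [LinearMap.comp_apply, LinearMap.comp_apply, chainMap_column]
  cases n with
  | zero =>
    induction x using PiTensorProduct.induction_on with
    | smul_tprod r a =>
      simp only [map_smul, PiTensorProduct.map_tprod]
      exact congrArg _ ((B.proj₀_zero _).trans (congrArg f.toAlgHom (A.proj₀_zero a)).symm)
    | add x y hx hy => simp only [map_add, hx, hy]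
  | succ n =>
    exact (B.proj₀_succ n _).trans ((congrArg f.toAlgHom (A.proj₀_succ n x)).trans
      (map_zero _)).symm

theorem connesToCyc_natural (f : DGA.Hom A B) (n : ℤ) (z : A.HC n) :
    (connesToCyc B).mapH n (HC.map f n z) = (cycMap f).mapH n ((connesToCyc A).mapH n z) := by
  obtain ⟨x, rfl⟩ := PresentedComplex.mkH_surjective n z
  exact congrArg (B.cyc.mkH n) (Subtype.ext (proj₀_chainMap f (x : A.connes.M)))

theorem HC.map_map {f : DGA.Hom A B} {g : DGA.Hom B C} {h : DGA.Hom A C}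
    (e : ∀ x, g.toAlgHom (f.toAlgHom x) = h.toAlgHom x) (n : ℤ) (z : A.HC n) :
    HC.map g n (HC.map f n z) = HC.map h n z := by
  obtain ⟨x, rfl⟩ := PresentedComplex.mkH_surjective n z
  refine congrArg (C.connes.mkH n) (Subtype.ext ?_)
  change chainMap g (chainMap f (x : A.connes.M)) = chainMap h (x : A.connes.M)
  refine LinearMap.congr_fun (chain_ext (f := chainMap g ∘ₗ chainMap f) (g := chainMap h)
    fun n a => ?_) _
  rw [LinearMap.comp_apply, chain_apply, chainMap_lof, chainMap_lof, chainMap_lof,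
    PiTensorProduct.map_tprod, PiTensorProduct.map_tprod, PiTensorProduct.map_tprod]
  simp [e]

theorem HC.map_eq_self {f : DGA.Hom A A} (e : ∀ x, f.toAlgHom x = x) (n : ℤ) (z : A.HC n) :
    HC.map f n z = z := by
  refine PresentedComplex.Hom.mapH_eq_self (f := connesMap f) (fun x _ => ?_) z
  have : chainMap f x = x := by
    refine LinearMap.congr_fun (chain_ext (f := chainMap f) (g := LinearMap.id) fun n a => ?_) _
    rw [chain_apply, chainMap_lof, PiTensorProduct.map_tprod]
    simp [e]
  exact (sub_eq_zero.2 this).symm ▸ zero_mem _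

theorem cycMap_cycMap {f : DGA.Hom A B} {g : DGA.Hom B C} {h : DGA.Hom A C}
    (e : ∀ x, g.toAlgHom (f.toAlgHom x) = h.toAlgHom x) (n : ℤ) (z : A.cyc.H n) :
    (cycMap g).mapH n ((cycMap f).mapH n z) = (cycMap h).mapH n z := by
  obtain ⟨x, rfl⟩ := PresentedComplex.mkH_surjective n z
  exact congrArg (C.cyc.mkH n) (Subtype.ext (e (x : A.carrier)))

theorem cycMap_eq_self {f : DGA.Hom A A} (e : ∀ x, f.toAlgHom x = x) (n : ℤ) (z : A.cyc.H n) :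
    (cycMap f).mapH n z = z := by
  obtain ⟨x, rfl⟩ := PresentedComplex.mkH_surjective n z
  exact congrArg (A.cyc.mkH n) (Subtype.ext (e (x : A.carrier)))

end DGA

variable {L L' L'' : DGLA k}

theorem Env.map_map {f : DGLA.Hom L L'} {g : DGLA.Hom L' L''} {h : DGLA.Hom L L''}
    (e : g.toLin ∘ₗ f.toLin = h.toLin) (u : Env L) : Env.map g (Env.map f u) = Env.map h u := by
  refine AlgHom.congr_fun (Env.algHom_ext (f := (Env.map g).comp (Env.map f)) (g := Env.map h)
    fun x => ?_) u
  rw [AlgHom.comp_apply, Env.map_ι, Env.map_ι, Env.map_ι]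
  exact congrArg _ (LinearMap.congr_fun e x)

theorem Env.map_eq_self {f : DGLA.Hom L L} (e : f.toLin = LinearMap.id) (u : Env L) :
    Env.map f u = u := by
  refine AlgHom.congr_fun (Env.algHom_ext (f := Env.map f) (g := AlgHom.id k _) fun x => ?_) u
  rw [Env.map_ι, e]; rfl

/-- The identity morphism. -/
def DGLA.Hom.id (L : DGLA k) : DGLA.Hom L L := ⟨LinearMap.id, fun h => h, fun _ => rfl,
  fun _ _ => rfl⟩

variable [CharZero k]

/-- For cofibrant `L`, the reduced cyclic homology of `U(L)` is the homology of
`U(L) / (k + [U(L), U(L)])`: this holds for the cellular resolution of `L`, of which `L` is a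
retract. -/
theorem toCyc_bijective (hL : L.IsCofibrant) (n : ℤ) : Function.Bijective (toCyc L n) := by
  obtain ⟨i, hi⟩ := hL _ _ (CellTerm.proj L) (CellTerm.proj_surjective L)
    (CellTerm.proj_isQuasiIso L) (DGLA.Hom.id L)
  have key := CellTerm.toCyc_cellular_bijective L n
  have e : ∀ u, Env.map (CellTerm.proj L) (Env.map i u) = u := fun u =>
    (Env.map_map hi u).trans (Env.map_eq_self rfl u)
  have h1 : ∀ z, toCyc _ n (DGA.HC.map (U.map i) n z) =
    (DGA.cycMap (U.map i)).mapH n (toCyc L n z) := DGA.connesToCyc_natural (U.map i) n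
  have h2 : ∀ z, toCyc L n (DGA.HC.map (U.map (CellTerm.proj L)) n z) =
    (DGA.cycMap (U.map (CellTerm.proj L))).mapH n (toCyc _ n z) :=
      DGA.connesToCyc_natural (U.map (CellTerm.proj L)) n
  have h3 : ∀ z, DGA.HC.map (U.map (CellTerm.proj L)) n (DGA.HC.map (U.map i) n z) = z := fun z =>
    (DGA.HC.map_map (h := U.map (DGLA.Hom.id L)) (fun u => Env.map_map hi u) n z).trans
      (DGA.HC.map_eq_self (Env.map_eq_self rfl) n z)
  have h4 : ∀ z, (DGA.cycMap (U.map (CellTerm.proj L))).mapH n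
      ((DGA.cycMap (U.map i)).mapH n z) = z := fun z =>
    (DGA.cycMap_cycMap (h := U.map (DGLA.Hom.id L)) (fun u => Env.map_map hi u) n z).trans
      (DGA.cycMap_eq_self (Env.map_eq_self rfl) n z)
  constructor
  · intro z w h
    rw [← h3 z, ← h3 w]
    refine congrArg _ (key.1 ?_)
    rw [h1, h1, h]
  · intro w
    obtain ⟨z, hz⟩ := key.2 ((DGA.cycMap (U.map i)).mapH n w)
    exact ⟨DGA.HC.map (U.map (CellTerm.proj L)) n z, by rw [h2, hz, h4]⟩

theorem adams_map (f : DGLA.Hom L L') (p : ℕ) (u : Env L) :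
    adams L' p (Env.map f u) = Env.map f (adams L p u) := by
  obtain ⟨s, rfl⟩ := Env.pbw_surjective u
  refine LinearMap.congr_fun (Env.hom_ext_of_symPow
    (F := adams L' p ∘ₗ (Env.map f).toLinearMap ∘ₗ Env.pbw L)
    (G := (Env.map f).toLinearMap ∘ₗ adams L p ∘ₗ Env.pbw L) fun n s hs => ?_) s
  simp only [LinearMap.comp_apply, AlgHom.toLinearMap_apply]
  rw [Env.pbw_of_mem hs, ← Env.symm_map, Env.adams_symm, Env.adams_symm, map_smul, Env.symm_map]

theorem adamsCyc_natural (f : DGLA.Hom L L') (p : ℕ) (n : ℤ) (z : (U L).cyc.H n) :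
    (adamsCyc p L').mapH n ((DGA.cycMap (U.map f)).mapH n z) =
      (DGA.cycMap (U.map f)).mapH n ((adamsCyc p L).mapH n z) := by
  obtain ⟨x, rfl⟩ := PresentedComplex.mkH_surjective n z
  exact congrArg ((U L').cyc.mkH n) (Subtype.ext (adams_map f p (x : Env L)))

theorem hodgeMap_natural (f : DGLA.Hom L L') (n : ℤ) (x : ⨁ d : ℕ+, (lam (d : ℕ) L).H n) :
    (DGA.cycMap (U.map f)).mapH n (hodgeMap L n x) =
      hodgeMap L' n (DirectSum.lmap (fun d : ℕ+ => (lam.map (d : ℕ) f).mapH n) x) := by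
  refine LinearMap.congr_fun (DirectSum.linearMap_ext k
    (ψ := (DGA.cycMap (U.map f)).mapH n ∘ₗ hodgeMap L n) (ψ' := hodgeMap L' n ∘ₗ
      DirectSum.lmap (fun d : ℕ+ => (lam.map (d : ℕ) f).mapH n))
    fun d => LinearMap.ext fun y => ?_) x
  simp only [LinearMap.comp_apply]
  rw [hodgeMap_lof, DirectSum.lmap_lof, hodgeMap_lof]
  obtain ⟨y, rfl⟩ := PresentedComplex.mkH_surjective n y
  exact congrArg ((U L').cyc.mkH n) (Subtype.ext (lamToCyc_natural f d (y : Env L.abelian)).symm)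

/-- The Adams operations act on the summands of the decomposition by powers of `p`. -/
theorem adamsCyc_hodgeMap (p : ℕ) (n : ℤ) (x : ⨁ d : ℕ+, (lam (d : ℕ) L).H n) :
    (adamsCyc p L).mapH n (hodgeMap L n x) =
      hodgeMap L n (DirectSum.lmap (fun d : ℕ+ =>
        ((p : k) ^ (d : ℕ) • LinearMap.id : (lam (d : ℕ) L).H n →ₗ[k] (lam (d : ℕ) L).H n)) x) := by
  refine LinearMap.congr_fun (DirectSum.linearMap_ext k
    (ψ := (adamsCyc p L).mapH n ∘ₗ hodgeMap L n) (ψ' := hodgeMap L n ∘ₗ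
      DirectSum.lmap (fun d : ℕ+ =>
        ((p : k) ^ (d : ℕ) • LinearMap.id : (lam (d : ℕ) L).H n →ₗ[k] (lam (d : ℕ) L).H n)))
    fun d => LinearMap.ext fun y => ?_) x
  simp only [LinearMap.comp_apply]
  rw [hodgeMap_lof, DirectSum.lmap_lof, hodgeMap_lof, adamsCyc_lamToCyc, LinearMap.smul_apply,
    map_smul]
  rfl

variable {a b : DGLA k}

/-- The isomorphism of the reduced cyclic homology of `U(a)` with the homology of
`U(R) / (k + [U(R), U(R)])` for a cofibrant resolution `R → a`. -/
def cycEquiv (R : a.CofibrantResolution) (n : ℤ) : (U a).HC n ≃ₗ[k] (U R.L).cyc.H n :=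
  (LinearEquiv.ofBijective (fromResolution R n) (fromResolution_bijective R n)).symm.trans
    (LinearEquiv.ofBijective (toCyc R.L n) (toCyc_bijective R.cofibrant n))

theorem cycEquiv_fromResolution (R : a.CofibrantResolution) (n : ℤ) (z : (U R.L).HC n) :
    cycEquiv R n (fromResolution R n z) = toCyc R.L n z := by
  refine congrArg (toCyc R.L n) ?_
  exact LinearEquiv.symm_apply_apply
    (LinearEquiv.ofBijective (fromResolution R n) (fromResolution_bijective R n)) z

theorem cycEquiv_natural (φ : DGLA.Hom a b) (R : a.CofibrantResolution)
    (S : b.CofibrantResolution) (f : DGLA.Hom R.L S.L)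
    (h : S.q.toLin ∘ₗ f.toLin = φ.toLin ∘ₗ R.q.toLin) (n : ℤ) (v : (U a).HC n) :
    cycEquiv S n (DGA.HC.map (U.map φ) n v) = (DGA.cycMap (U.map f)).mapH n (cycEquiv R n v) := by
  obtain ⟨z, rfl⟩ := (fromResolution_bijective R n).2 v
  let χ : DGLA.Hom R.L b := ⟨φ.toLin ∘ₗ R.q.toLin, fun hx => φ.map_gr (R.q.map_gr hx),
    fun x => (congrArg φ.toLin (R.q.map_d x)).trans (φ.map_d _),
    fun x y => (congrArg φ.toLin (R.q.map_bracket x y)).trans (φ.map_bracket _ _)⟩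
  have e1 : DGA.HC.map (U.map φ) n (fromResolution R n z) = DGA.HC.map (U.map χ) n z :=
    DGA.HC.map_map (fun u => Env.map_map rfl u) n z
  have e2 : fromResolution S n (DGA.HC.map (U.map f) n z) = DGA.HC.map (U.map χ) n z :=
    DGA.HC.map_map (fun u => Env.map_map h u) n z
  rw [e1, ← e2, cycEquiv_fromResolution, cycEquiv_fromResolution]
  exact DGA.connesToCyc_natural (U.map f) n z

/-- The `p`-th Adams operation on the reduced cyclic homology of `U(a)`. -/
def adamsHC (p : ℕ) (a : DGLA k) (n : ℤ) : Module.End k ((U a).HC n) :=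
  (cycEquiv (cellularResolution a) n).symm.toLinearMap ∘ₗ
    (adamsCyc p (cellularResolution a).L).mapH n ∘ₗ
      (cycEquiv (cellularResolution a) n).toLinearMap

/-- The Adams operations can be computed with every cofibrant resolution. -/
theorem cycEquiv_adamsHC (p : ℕ) (R : a.CofibrantResolution) (n : ℤ) (v : (U a).HC n) :
    cycEquiv R n (adamsHC p a n v) = (adamsCyc p R.L).mapH n (cycEquiv R n v) := by
  obtain ⟨f, hf⟩ := R.cofibrant _ _ (CellTerm.proj a) (CellTerm.proj_surjective a)
    (CellTerm.proj_isQuasiIso a) R.q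
  have h1 : ∀ v, cycEquiv (cellularResolution a) n v =
      (DGA.cycMap (U.map f)).mapH n (cycEquiv R n v) := fun v =>
    (congrArg _ (DGA.HC.map_eq_self (Env.map_eq_self rfl) n v).symm).trans
      (cycEquiv_natural (DGLA.Hom.id a) R (cellularResolution a) f hf n v)
  -- the map induced by `f` is injective because both resolutions compute the same homology
  have hinj : Function.Injective ((DGA.cycMap (U.map f)).mapH n) := by
    intro x y h
    obtain ⟨v, rfl⟩ := (cycEquiv R n).surjective x
    obtain ⟨w, rfl⟩ := (cycEquiv R n).surjective y
    rw [← h1, ← h1] at h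
    rw [(cycEquiv (cellularResolution a) n).injective h]
  refine hinj ?_
  rw [← h1, ← adamsCyc_natural, ← h1]
  exact LinearEquiv.apply_symm_apply _ _

/-- The Hodge decomposition of the reduced cyclic homology of `U(a)`. -/
def hodgeEquiv (R : a.CofibrantResolution) (n : ℤ) :
    (⨁ d : ℕ+, drinfeldHomology (d : ℕ) R n) ≃ₗ[k] (U a).HC n :=
  (LinearEquiv.ofBijective (hodgeMap R.L n) (hodgeMap_bijective R.L n)).trans (cycEquiv R n).symm

theorem cycEquiv_hodgeEquiv (R : a.CofibrantResolution) (n : ℤ)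
    (x : ⨁ d : ℕ+, drinfeldHomology (d : ℕ) R n) :
    cycEquiv R n (hodgeEquiv R n x) = hodgeMap R.L n x :=
  LinearEquiv.apply_symm_apply _ _

theorem adamsHC_hodgeEquiv (p : ℕ) (R : a.CofibrantResolution) (n : ℤ)
    (x : ⨁ d : ℕ+, drinfeldHomology (d : ℕ) R n) :
    adamsHC p a n (hodgeEquiv R n x) = hodgeEquiv R n
      (DirectSum.lmap (fun d : ℕ+ => ((p : k) ^ (d : ℕ) • LinearMap.id :
        drinfeldHomology (d : ℕ) R n →ₗ[k] drinfeldHomology (d : ℕ) R n)) x) := by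
  refine (cycEquiv R n).injective ?_
  rw [cycEquiv_adamsHC, cycEquiv_hodgeEquiv, cycEquiv_hodgeEquiv, adamsCyc_hodgeMap]

theorem hodgeEquiv_natural (φ : DGLA.Hom a b) (R : a.CofibrantResolution)
    (S : b.CofibrantResolution) (f : DGLA.Hom R.L S.L)
    (h : S.q.toLin ∘ₗ f.toLin = φ.toLin ∘ₗ R.q.toLin) (n : ℤ)
    (x : ⨁ d : ℕ+, drinfeldHomology (d : ℕ) R n) :
    DGA.HC.map (U.map φ) n (hodgeEquiv R n x) =
      hodgeEquiv S n (DirectSum.lmap (fun d : ℕ+ => drinfeldHomology.map (d : ℕ) f n) x) := by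
  refine (cycEquiv S n).injective ?_
  rw [cycEquiv_natural φ R S f h, cycEquiv_hodgeEquiv, cycEquiv_hodgeEquiv, hodgeMap_natural]
  rfl

theorem range_hodgeEquiv_lof {p : ℕ} (hp : 2 ≤ p) (R : a.CofibrantResolution) (n : ℤ) (d : ℕ+) :
    LinearMap.range ((hodgeEquiv R n).toLinearMap ∘ₗ
      DirectSum.lof k ℕ+ (fun d : ℕ+ => drinfeldHomology (d : ℕ) R n) d) =
        Module.End.eigenspace (adamsHC p a n) ((p : k) ^ (d : ℕ)) := by
  ext v
  rw [Module.End.mem_eigenspace_iff]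
  constructor
  · rintro ⟨x, rfl⟩
    rw [LinearMap.comp_apply, LinearEquiv.coe_coe, adamsHC_hodgeEquiv, DirectSum.lmap_lof,
      LinearMap.smul_apply, map_smul, map_smul]
    rfl
  · intro hv
    obtain ⟨x, rfl⟩ := (hodgeEquiv R n).surjective v
    rw [adamsHC_hodgeEquiv, ← map_smul] at hv
    have hx := (hodgeEquiv R n).injective hv
    refine ⟨x d, congrArg (hodgeEquiv R n) (DFinsupp.ext fun e => ?_)⟩
    rcases eq_or_ne d e with rfl | hde
    · exact DirectSum.of_eq_same d _
    · refine (DirectSum.of_eq_of_ne _ _ _ hde.symm).trans ?_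
      have h1 : (p : k) ^ (e : ℕ) • x e = (p : k) ^ (d : ℕ) • x e := DFunLike.congr_fun hx e
      rw [← sub_eq_zero, ← sub_smul] at h1
      refine ((smul_eq_zero.1 h1).resolve_left (sub_ne_zero.2 fun h2 => hde ?_)).symm
      have h3 : p ^ (e : ℕ) = p ^ (d : ℕ) := by exact_mod_cast h2
      exact PNat.coe_injective (Nat.pow_right_injective hp h3).symm

end Assembly

end DrinfeldHodge

end

theorem theorem7p4 {k : Type u} [Field k] [CharZero k] :
    -- cofibrant resolutions exist
    (∀ a : DGLA k, Nonempty a.CofibrantResolution) ∧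
    -- reduced cyclic homology of `U(a)` is the homology of `U(R) / (k + [U(R), U(R)])` for each
    -- cofibrant resolution `R → a`
    (∀ (a : DGLA k) (R : a.CofibrantResolution) (n : ℤ),
      Function.Bijective (fromResolution R n) ∧ Function.Bijective (toCyc R.L n)) ∧
    -- the Adams operations of `U(L)` descend to chain maps of `U(L) / (k + [U(L), U(L)])`
    (∀ (p : ℕ) (L : DGLA k), ∃ h : PresentedComplex.Hom (U L).cyc (U L).cyc,
      h.toLin = adams L p) ∧
    ∃ (Ψ : ∀ (_ : ℕ) (a : DGLA k) (n : ℤ), Module.End k ((U a).HC n))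
      (Φ : ∀ {a : DGLA k} (R : a.CofibrantResolution) (n : ℤ),
        (⨁ d : ℕ+, drinfeldHomology d R n) ≃ₗ[k] (U a).HC n),
      -- `Ψ p` is the `p`-th Adams operation on the reduced cyclic homology of `U(a)`
      (∀ (p : ℕ) {a : DGLA k} (R : a.CofibrantResolution) (n : ℤ)
        (h : PresentedComplex.Hom (U R.L).cyc (U R.L).cyc), h.toLin = adams R.L p →
        ∀ z w : (U R.L).HC n, toCyc R.L n w = h.mapH n (toCyc R.L n z) →
          Ψ p a n (fromResolution R n z) = fromResolution R n w) ∧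
      -- the decomposition `Φ` is natural
      (∀ {a b : DGLA k} (φ : DGLA.Hom a b) (R : a.CofibrantResolution)
        (S : b.CofibrantResolution) (f : DGLA.Hom R.L S.L),
        S.q.toLin ∘ₗ f.toLin = φ.toLin ∘ₗ R.q.toLin →
        ∀ (n : ℤ) (x : ⨁ d : ℕ+, drinfeldHomology d R n),
          DGA.HC.map (U.map φ) n (Φ R n x) =
            Φ S n (DirectSum.lmap (fun d : ℕ+ => drinfeldHomology.map (d : ℕ) f n) x)) ∧
      -- the `d`-th summand is the eigenspace of `Ψ p` with eigenvalue `p ^ d`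
      (∀ (p : ℕ), 2 ≤ p → ∀ {a : DGLA k} (R : a.CofibrantResolution) (n : ℤ) (d : ℕ+),
        LinearMap.range ((Φ R n).toLinearMap ∘ₗ
            DirectSum.lof k ℕ+ (fun d : ℕ+ => drinfeldHomology d R n) d) =
          Module.End.eigenspace (Ψ p a n) ((p : k) ^ (d : ℕ))) := by
  refine ⟨fun a => ⟨cellularResolution a⟩,
    fun a R n => ⟨fromResolution_bijective R n, toCyc_bijective R.cofibrant n⟩,
    fun p L => ⟨adamsCyc p L, rfl⟩, fun p a n => adamsHC p a n, fun R n => hodgeEquiv R n, ?_,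
    fun φ R S f h n x => hodgeEquiv_natural φ R S f h n x,
    fun p hp _ R n d => range_hodgeEquiv_lof hp R n d⟩
  intro p a R n h hh z w hw
  -- a chain map is determined by its underlying linear map
  obtain rfl : h = adamsCyc p R.L := by
    obtain ⟨t, _, _, _⟩ := h
    obtain rfl : t = adams R.L p := hh
    rfl
  refine (cycEquiv R n).injective ?_
  rw [cycEquiv_adamsHC, cycEquiv_fromResolution, cycEquiv_fromResolution, hw]
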